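/- Let $n\ge 3$, $\lambda=\frac{n-2}{2}$, and let $V\in C^1(\mathbb R^n\setminus\{0\})$ be real valued. Put $\tilde V(x)=-\partial_r(rV)(x)$, where $r=|x|$, and let $\not\!\nabla$ be the spherical gradient on the unit sphere (so that $|\not\!\nabla\varphi(x)|^2=|x|^2(|\nabla\varphi(x)|^2-|\partial_r\varphi(x)|^2)$). Assume that (A1) $\sup_x |x|^2V_+(x)<\infty$ and $\sup_x|x|^2V_-(x)<\infty$, where $V_\pm=\max\{\pm V,0\}$, and that there is a $\delta>0$ such that for every $r>0$ and every smooth $\varphi:\mathbb R^n\to\mathbb C$ (A2) $\displaystyle\int_{|x|=r}|\not\!\nabla \varphi|^2+(\lambda^2+|x|^2V)|\varphi|^2\,d\sigma\ \ge\ \delta^2\int_{|x|=r}|\varphi|^2\,d\sigma$, (A3) the same inequality holds with $\tilde V$ in place of $V$. Let $P$ be the Friedrichs extension of $-\Delta+V$ on $C_c^\infty(\mathbb R^n\setminus\{0\})$. (i) If $u\in C(\mathbb R;L^2)$ is the solution of $i\partial_tu=Pu$, $u(0)=f\in L^2(\mathbb R^n)$ (that is, $\frac{d}{dt}\langle\psi,u(t)\rangle=-i\langle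 P\psi,u(t)\rangle$ for all $\psi\in D(P)$ and $t\in\mathbb R$), then $$\big\||x|^{-1}u\big\|_{L^2_tL^2_x(\mathbb R\times\mathbb R^n)}\le C_\delta\,\|f\|_{L^2},\qquad C_\delta=\begin{cases}\sqrt2\,\delta^{-1}, & \delta^2\le\frac12,\\ \sqrt2\,(\delta^2-\frac14)^{-1/4}, & \delta^2>\frac12.\end{cases}$$ (ii) There is a constant $C>0$ (depending on $n$ and $V$) such that, for all $f\in\dot H^{1/2}(\mathbb R^n)$ and $g\in\dot H^{-1/2}(\mathbb R^n)$, the solution $u$ of $\partial_t^2u=-Pu$, $u(0)=f$, $\partial_tu(0)=g$ satisfies $$\big\||x|^{-1}u\big\|_{L^2_tL^2_x(\mathbb R\times\mathbb R^n)}\le C\big(\|f\|_{\dot H^{1/2}}+\|g\|_{\dot H^{-1/2}}\big).$$ Here, for $f,g\in L^2$, the solution is the $u\in C(\mathbb R;L^2)$ with $u(0)=f$ such that, for every $\psi\in D(P)$, $\langle\psi,u(t)\rangle$ is twice differentiable in $t$ with second derivative $-\langle P\psi,u(t)\rangle$ and first derivative $\langle\psi,g\rangle$ at $t=0$; for general data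 it is the extension by continuity: $u(t)$ is, for every $t$, the $\dot H^{1/2}$-limit of $u_k(t)$, where the $u_k$ are the solutions for $L^2$ data converging to $(f,g)$ in $\dot H^{1/2}\times\dot H^{-1/2}$. -/

import Mathlib

open MeasureTheory Filter Topology Set
open scoped ENNReal NNReal ContDiff SchwartzMap FourierTransform InnerProductSpace Laplacian

noncomputable section

namespace CriticalDecay

/-- Euclidean space `ℝⁿ`. -/
abbrev E (n : ℕ) : Type := EuclideanSpace ℝ (Fin n)

/-- The Hilbert space `L²(ℝⁿ; ℂ)`. -/
abbrev L2 (n : ℕ) : Type := Lp ℂ 2 (volume : Measure (E n))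

/-! ### The potential and the assumptions on it -/

/-- `|∇φ(x)|² = ∑ⱼ |∂ⱼφ(x)|²` for a complex valued function `φ`. -/
def gradSq {n : ℕ} (φ : E n → ℂ) (x : E n) : ℝ :=
  ∑ j : Fin n, ‖fderiv ℝ φ x (EuclideanSpace.single j 1)‖ ^ 2

/-- The radial derivative `∂ᵣφ(x)`, for `x ≠ 0`. -/
def radialDeriv {n : ℕ} (φ : E n → ℂ) (x : E n) : ℂ :=
  fderiv ℝ φ x (‖x‖⁻¹ • x)

/-- The square of the spherical gradient of `φ` at `x`. This is the gradient on the *unit* sphere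
of `θ ↦ φ(|x|θ)`, so its square is `|x|²` times that of the tangential part of `∇φ(x)`. -/
def sphGradSq {n : ℕ} (φ : E n → ℂ) (x : E n) : ℝ :=
  ‖x‖ ^ 2 * (gradSq φ x - ‖radialDeriv φ x‖ ^ 2)

/-- The integral of `F` over the sphere `|x| = r`: `∫ F dσ = r^(n-1) ∫_{|θ|=1} F(rθ) dθ`. -/
def sphereIntegral {n : ℕ} (r : ℝ) (F : E n → ℝ) : ℝ :=
  r ^ (n - 1) *
    ∫ θ : Metric.sphere (0 : E n) 1, F (r • (θ : E n)) ∂((volume : Measure (E n)).toSphere)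

/-- `λ = (n - 2) / 2`. -/
def lam (n : ℕ) : ℝ := ((n : ℝ) - 2) / 2

/-- `Ṽ(x) = -∂ᵣ(r V)(x)`. -/
def tildeV {n : ℕ} (V : E n → ℝ) (x : E n) : ℝ :=
  -deriv (fun s : ℝ => s * V (s • (‖x‖⁻¹ • x))) ‖x‖

/-- `sup |x|² V₊ < ∞` and `sup |x|² V₋ < ∞`. -/
def CriticalBound {n : ℕ} (V : E n → ℝ) : Prop :=
  BddAbove (range fun x : E n => ‖x‖ ^ 2 * max (V x) 0) ∧
    BddAbove (range fun x : E n => ‖x‖ ^ 2 * max (-V x) 0)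

/-- On every sphere centred at the origin,
`∫ |∇̸φ|² + (λ² + |x|² W) |φ|² dσ ≥ δ² ∫ |φ|² dσ` for every smooth `φ`. -/
def PositiveOnSpheres {n : ℕ} (W : E n → ℝ) (δ : ℝ) : Prop :=
  ∀ r : ℝ, 0 < r → ∀ φ : E n → ℂ, ContDiff ℝ ∞ φ →
    δ ^ 2 * sphereIntegral r (fun x => ‖φ x‖ ^ 2) ≤
      sphereIntegral r (fun x =>
        sphGradSq φ x + (lam n ^ 2 + ‖x‖ ^ 2 * W x) * ‖φ x‖ ^ 2)

/-! ### The Friedrichs extension of `-Δ + V` -/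

/-- `φ ∈ C_c^∞(ℝⁿ ∖ {0})`. -/
def IsTest {n : ℕ} (φ : E n → ℂ) : Prop :=
  ContDiff ℝ ∞ φ ∧ HasCompactSupport φ ∧ (0 : E n) ∉ tsupport φ

/-- The quadratic form `Q(φ) = ∫ |∇φ|² + V|φ|²`, for test functions `φ`. -/
def formQ {n : ℕ} (V : E n → ℝ) (φ : E n → ℂ) : ℝ :=
  ∫ x : E n, (gradSq φ x + V x * ‖φ x‖ ^ 2)

/-- `ψ` is in the form domain: the completion of the test functions for the form norm, i.e. `ψ` is
the `L²` limit of a sequence of test functions that is Cauchy with respect to `Q`. -/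
def InFormDomain {n : ℕ} (V : E n → ℝ) (ψ : L2 n) : Prop :=
  ∃ φ : ℕ → E n → ℂ, (∀ k, IsTest (φ k)) ∧
    Tendsto (fun k => eLpNorm (fun x => φ k x - ψ x) 2 volume) atTop (𝓝 0) ∧
    ∀ ε : ℝ, 0 < ε → ∃ N : ℕ, ∀ k ≥ N, ∀ l ≥ N, formQ V (fun x => φ k x - φ l x) < ε

/-- The graph of the Friedrichs extension `P` of the operator `-Δ + V` on `C_c^∞(ℝⁿ ∖ {0})`:
`ψ ∈ D(P)` and `Pψ = h`. The Friedrichs extension is the restriction of the adjoint to the form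
domain. -/
def FriedrichsGraph {n : ℕ} (V : E n → ℝ) (ψ h : L2 n) : Prop :=
  InFormDomain V ψ ∧
    ∀ φ : E n → ℂ, IsTest φ →
      ∫ x : E n, (starRingEnd ℂ) (-(Δ φ) x + (V x : ℂ) * φ x) * ψ x =
        ∫ x : E n, (starRingEnd ℂ) (φ x) * h x

/-! ### Solutions with data in `L²` -/

/-- `u ∈ C(ℝ; L²)` is the solution `e^{-itP} f` of `i∂ₜu = Pu`, `u(0) = f`: for every `ψ ∈ D(P)`,
`d/dt ⟨ψ, u(t)⟩ = -i ⟨Pψ, u(t)⟩`. -/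
structure IsSchrodingerSolution {n : ℕ} (V : E n → ℝ) (f : L2 n) (u : ℝ → L2 n) : Prop where
  cont : Continuous u
  init : u 0 = f
  eqn : ∀ ψ h : L2 n, FriedrichsGraph V ψ h → ∀ t : ℝ,
    HasDerivAt (fun s : ℝ => ⟪ψ, u s⟫_ℂ) (-Complex.I * ⟪h, u t⟫_ℂ) t

/-- `u ∈ C(ℝ; L²)` is the solution `cos(t√P) f + P^{-1/2} sin(t√P) g` of `∂ₜ²u = -Pu`, `u(0) = f`,
`∂ₜu(0) = g`, for data `f, g ∈ L²`: for every `ψ ∈ D(P)`, `⟨ψ, u(t)⟩` is twice differentiable in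
`t`, its second derivative is `-⟨Pψ, u(t)⟩`, and its first derivative at `0` is `⟨ψ, g⟩`. -/
structure IsWaveSolutionL2 {n : ℕ} (V : E n → ℝ) (f g : L2 n) (u : ℝ → L2 n) : Prop where
  cont : Continuous u
  init : u 0 = f
  eqn : ∀ ψ h : L2 n, FriedrichsGraph V ψ h →
    ∃ d : ℝ → ℂ, d 0 = ⟪ψ, g⟫_ℂ ∧ ∀ t : ℝ,
      HasDerivAt (fun s : ℝ => ⟪ψ, u s⟫_ℂ) (d t) t ∧ HasDerivAt d (-⟪h, u t⟫_ℂ) t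

/-! ### Homogeneous Sobolev spaces and solutions with data in `Ḣ^{1/2} × Ḣ^{-1/2}` -/

/-- The norm of a tempered distribution `T` in `Ḣˢ(ℝⁿ)` (used for `|s| < n/2`), with value `∞` if
`T ∉ Ḣˢ`: `T̂ = (2π|ξ|)⁻ˢ F` for some `F ∈ L²`, which is then unique, and the norm is `‖F‖`.
The factor `2π` belongs to the normalisation `e^{-2πi⟨x,ξ⟩}` of the Fourier transform. -/
def hsNorm {n : ℕ} (s : ℝ) (T : 𝓢'(E n, ℂ)) : ℝ≥0∞ :=
  ⨅ (F : L2 n) (_ : ∀ φ : 𝓢(E n, ℂ), (𝓕 T) φ =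
    ∫ ξ : E n, φ ξ * ((((2 * Real.pi * ‖ξ‖) ^ (-s) : ℝ) : ℂ) * F ξ)), ‖F‖ₑ

/-- The function `v` is (integrable against Schwartz functions and) the tempered distribution `T`. -/
def Represents {n : ℕ} (v : E n → ℂ) (T : 𝓢'(E n, ℂ)) : Prop :=
  ∀ φ : 𝓢(E n, ℂ), Integrable (fun x => φ x * v x) ∧ T φ = ∫ x : E n, φ x * v x

/-- `u` is the solution of `∂ₜ²u = -Pu`, `u(0) = f`, `∂ₜu(0) = g` for data `f ∈ Ḣ^{1/2}`,
`g ∈ Ḣ^{-1/2}`, that is, the value at `(f, g)` of the continuous extension of the solution operator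
from the `L²` data: `u(t)` is, for every `t`, the `Ḣ^{1/2}` limit of `uₖ(t)`, where `uₖ` are the
solutions for a sequence of `L²` data that converges to `(f, g)` in `Ḣ^{1/2} × Ḣ^{-1/2}`. -/
def IsWaveSolution {n : ℕ} (V : E n → ℝ) (f g : 𝓢'(E n, ℂ)) (u : ℝ → E n → ℂ) : Prop :=
  ∃ (U : ℝ → 𝓢'(E n, ℂ)) (fk gk : ℕ → L2 n) (uk : ℕ → ℝ → L2 n),
    (∀ t, Represents (u t) (U t)) ∧
    (∀ k, IsWaveSolutionL2 V (fk k) (gk k) (uk k)) ∧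
    Tendsto (fun k => hsNorm (1 / 2) ((fk k : 𝓢'(E n, ℂ)) - f)) atTop (𝓝 0) ∧
    Tendsto (fun k => hsNorm (-1 / 2) ((gk k : 𝓢'(E n, ℂ)) - g)) atTop (𝓝 0) ∧
    ∀ t, Tendsto (fun k => hsNorm (1 / 2) ((uk k t : 𝓢'(E n, ℂ)) - U t)) atTop (𝓝 0)

/-! ### The estimates -/

/-- `‖ |x|⁻¹ u ‖` in `L²_t L²_x`, over `ℝ × ℝⁿ`. -/
def weightedNorm {n : ℕ} (u : ℝ → E n → ℂ) : ℝ≥0∞ :=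
  (∫⁻ t : ℝ, ∫⁻ x : E n, (‖u t x‖ₑ / ‖x‖ₑ) ^ 2) ^ (1 / 2 : ℝ)

/-- The constant in the smoothing estimate for the Schrödinger equation: `√2 / δ` if `δ² ≤ 1/2`,
and `√2 (δ² - 1/4)^(-1/4)` otherwise. -/
def smoothingConst (δ : ℝ) : ℝ :=
  if δ ^ 2 ≤ 1 / 2 then √2 / δ else √2 / (δ ^ 2 - 1 / 4) ^ (1 / 4 : ℝ)

end CriticalDecay

end

/-! The theorem is an instance of Kato smoothing: a bound on the resolvent of `P` between two
weights `|x|⁻¹`, uniform up to the real axis, yields a space-time `L²` bound for the flow.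

The resolvent bound comes from a multiplier argument. For a test function `u` and `Im z = ε ≥ 0` put
`v = e^{-izr}u`. Conjugation turns `-Δ + V - z²` into `-Δ + V` plus the first order term `-2iz
r⁻¹Zv`, where `Zv = x·∇v + (n-1)/2 v`. Pairing with `e^{-2εr}Zv` and taking real parts leaves only
`ε` of that term: the real part of `z` drops out, and the estimate is uniform in frequency. What
remains is a Morawetz identity, in which `V` and `Ṽ` occur exactly in the combinations that the
positivity assumptions bound from below on spheres, and a Hardy inequality with constant `1/4`. The
outcome, `apriori`, is `‖|x|⁻¹u‖² ≤ aprioriSq δ * ‖|x|(-Δ + V - z²)u‖²`. Mollification and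
logarithmic cutoffs at `0` and `∞` carry it over to the domain of `P` (`apriori_cutoff`,
`IsFriedrichsInverse.norm_invN_le`).

With `A = min(|x|⁻¹, N)`, `R(ζ) = (P - ζ)⁻¹` and `c = √(aprioriSq δ)` this says `‖A R(ζ) A‖ ≤ c`.
The resolvent identity and duality give `‖A R(ζ)‖² ≤ c/|Im ζ|` (`IsFriedrichsInverse.katoBound`).
Plancherel's theorem in time then bounds `∫ ‖A e^{-itP}f‖² dt` by `2c‖f‖²`, and `2c` is the square
of `smoothingConst δ`. Fatou's lemma removes all regularisations, including `N`.

The wave flow splits into `e^{±it√P}`. Passing from the variable `√p` to `p` costs a factor `√p`, so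
the bound involves `P^{1/4}f` and `P^{-1/4}g`. The form of `P` is comparable with the Dirichlet
integral, and `∫ (p + τ²)⁻¹ dτ = π/√p` reduces square roots to resolvents, which can be compared by
a variational principle; this produces the norms of `Ḣ^{±1/2}`. General data follow by weak lower
semicontinuity.

Throughout, `P` is represented by `T = (P + 1)⁻¹`, with `0 ≤ T ≤ 1`. The spectral variable is `s =
1/(1 + p)`, and functions of `P` are continuous functions of `T`, cut off near `s = 0` (`p = ∞`) and
`s = 1` (`p = 0`). -/

namespace CriticalDecay

/-! ### Functional calculus and scalar spectral measures of a positive contraction. -/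

section FunctionalCalculus

variable {H : Type*} [NormedAddCommGroup H] [InnerProductSpace ℂ H] [CompleteSpace H]

/-- A self-adjoint operator with `0 ≤ T ≤ 1`. -/
structure IsPosContraction (T : H →L[ℂ] H) : Prop where
  selfAdj : IsSelfAdjoint T
  nonneg : ∀ x, 0 ≤ (⟪x, T x⟫_ℂ).re
  le_one : ∀ x, (⟪x, T x⟫_ℂ).re ≤ ‖x‖ ^ 2

/-- The continuous functional calculus of `T` for functions of a real variable. -/
noncomputable def fc (T : H →L[ℂ] H) (f : ℝ → ℂ) : H →L[ℂ] H := cfc (fun z : ℂ => f z.re) T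

variable {T : H →L[ℂ] H}

-- Both `T` and `1 - T` are positive operators, so their spectra lie in `[0, ∞)`, and the spectrum
-- of `1 - T` is the reflection of that of `T`.
open scoped ComplexOrder in
lemma IsPosContraction.spectrum_subset (hT : IsPosContraction T) {z : ℂ}
    (hz : z ∈ spectrum ℂ T) : z.re ∈ Icc (0 : ℝ) 1 ∧ z = (z.re : ℂ) := by
  have hre := hT.selfAdj.mem_spectrum_eq_re hz
  have h0 : (0 : H →L[ℂ] H) ≤ T := by
    rw [ContinuousLinearMap.nonneg_iff_isPositive]
    refine ⟨hT.selfAdj.isSymmetric, fun x => ?_⟩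
    have := hT.nonneg x
    rw [ContinuousLinearMap.reApplyInnerSelf_apply, inner_re_symm]
    exact this
  have h1 : (0 : H →L[ℂ] H) ≤ 1 - T := by
    rw [ContinuousLinearMap.nonneg_iff_isPositive]
    refine ⟨((IsSelfAdjoint.one _).sub hT.selfAdj).isSymmetric, fun x => ?_⟩
    have := hT.le_one x
    rw [ContinuousLinearMap.reApplyInnerSelf_apply, inner_re_symm]
    simp [inner_sub_right, inner_self_eq_norm_sq_to_K]
    norm_cast
  have e0 := spectrum_nonneg_of_nonneg h0 hz
  have e1 : (1 - z) ∈ spectrum ℂ (1 - T) := by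
    have h2 := spectrum.neg_eq (R := ℂ) T
    have h3 := spectrum.singleton_add_eq (R := ℂ) (-T) 1
    rw [map_one, ← sub_eq_add_neg, ← h2] at h3
    rw [← h3]
    refine ⟨1, rfl, -z, by simpa using hz, by simp [sub_eq_add_neg]⟩
  have e2 := spectrum_nonneg_of_nonneg h1 e1
  rw [Complex.le_def] at e0 e2
  refine ⟨⟨by simpa using e0.1, by simpa using e2.1⟩, by simpa using hre⟩

lemma fc_continuousOn (hT : IsPosContraction T) {f : ℝ → ℂ} (hf : ContinuousOn f (Icc 0 1)) :
    ContinuousOn (fun z : ℂ => f z.re) (spectrum ℂ T) :=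
  hf.comp Complex.continuous_re.continuousOn fun _ hz => (hT.spectrum_subset hz).1

lemma fc_congr (hT : IsPosContraction T) {f g : ℝ → ℂ} (h : EqOn f g (Icc 0 1)) :
    fc T f = fc T g :=
  cfc_congr fun _ hz => h (hT.spectrum_subset hz).1

lemma fc_mul (hT : IsPosContraction T) {f g : ℝ → ℂ} (hf : ContinuousOn f (Icc 0 1))
    (hg : ContinuousOn g (Icc 0 1)) : fc T (fun s => f s * g s) = fc T f * fc T g :=
  cfc_mul _ _ T (fc_continuousOn hT hf) (fc_continuousOn hT hg)

lemma fc_mul_apply (hT : IsPosContraction T) {f g : ℝ → ℂ} (hf : ContinuousOn f (Icc 0 1))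
    (hg : ContinuousOn g (Icc 0 1)) (x : H) :
    fc T f (fc T g x) = fc T (fun s => f s * g s) x := by
  rw [fc_mul hT hf hg]; rfl

lemma fc_add (hT : IsPosContraction T) {f g : ℝ → ℂ} (hf : ContinuousOn f (Icc 0 1))
    (hg : ContinuousOn g (Icc 0 1)) : fc T (fun s => f s + g s) = fc T f + fc T g :=
  cfc_add T _ _ (fc_continuousOn hT hf) (fc_continuousOn hT hg)

lemma fc_sub (hT : IsPosContraction T) {f g : ℝ → ℂ} (hf : ContinuousOn f (Icc 0 1))
    (hg : ContinuousOn g (Icc 0 1)) : fc T (fun s => f s - g s) = fc T f - fc T g :=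
  cfc_sub _ _ T (fc_continuousOn hT hf) (fc_continuousOn hT hg)

lemma fc_const_mul (hT : IsPosContraction T) (c : ℂ) {f : ℝ → ℂ}
    (hf : ContinuousOn f (Icc 0 1)) : fc T (fun s => c * f s) = c • fc T f :=
  cfc_const_mul c _ T (fc_continuousOn hT hf)

lemma fc_one (hT : IsPosContraction T) : fc T (fun _ => 1) = 1 :=
  cfc_const_one ℂ T hT.selfAdj.isStarNormal

lemma fc_id (hT : IsPosContraction T) : fc T (fun s => (s : ℂ)) = T := by
  refine (cfc_congr fun z hz => ?_).trans (cfc_id' ℂ T hT.selfAdj.isStarNormal)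
  exact (hT.spectrum_subset hz).2.symm

lemma fc_adjoint (f : ℝ → ℂ) :
    ContinuousLinearMap.adjoint (fc T f) = fc T (fun s => starRingEnd ℂ (f s)) := by
  rw [← ContinuousLinearMap.star_eq_adjoint]
  exact (cfc_star _ T).symm

lemma inner_fc_left (f : ℝ → ℂ) (x y : H) :
    ⟪fc T f x, y⟫_ℂ = ⟪x, fc T (fun s => starRingEnd ℂ (f s)) y⟫_ℂ := by
  rw [← fc_adjoint, ContinuousLinearMap.adjoint_inner_right]

lemma norm_fc_le (hT : IsPosContraction T) {f : ℝ → ℂ} {c : ℝ} (hc : 0 ≤ c)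
    (h : ∀ s ∈ Icc (0 : ℝ) 1, ‖f s‖ ≤ c) : ‖fc T f‖ ≤ c :=
  norm_cfc_le hc fun _ hz => h _ (hT.spectrum_subset hz).1

/-- Factor `f = √f · √f` and move one factor across the inner product. This positivity makes the
functional in `exists_spectralMeasure` a positive one. -/
lemma inner_fc_self_nonneg (hT : IsPosContraction T) {f : ℝ → ℝ}
    (hf : ContinuousOn f (Icc 0 1)) (h0 : ∀ s ∈ Icc (0 : ℝ) 1, 0 ≤ f s) (x : H) :
    ⟪x, fc T (fun s => (f s : ℂ)) x⟫_ℂ =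
      ((‖fc T (fun s => ((√(f s) : ℝ) : ℂ)) x‖ ^ 2 : ℝ) : ℂ) := by
  have hc : ContinuousOn (fun s => ((√(f s) : ℝ) : ℂ)) (Icc 0 1) :=
    Complex.continuous_ofReal.comp_continuousOn hf.sqrt
  have : fc T (fun s => (f s : ℂ)) =
      fc T (fun s => ((√(f s) : ℝ) : ℂ) * ((√(f s) : ℝ) : ℂ)) := by
    refine fc_congr hT fun s hs => ?_
    rw [← Complex.ofReal_mul, Real.mul_self_sqrt (h0 s hs)]
  rw [this, ← fc_mul_apply hT hc hc]
  have h2 := inner_fc_left (T := T) (fun s => ((√(f s) : ℝ) : ℂ)) x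
    (fc T (fun s => ((√(f s) : ℝ) : ℂ)) x)
  simp only [Complex.conj_ofReal] at h2
  rw [← h2, inner_self_eq_norm_sq_to_K]
  simp

open scoped CompactlySupported in
/-- Existence of the scalar spectral measure of `T` at `x`. -/
theorem exists_spectralMeasure (hT : IsPosContraction T) (x : H) :
    ∃ μ : Measure (Icc (0 : ℝ) 1), IsFiniteMeasure μ ∧
      ∀ f : ℝ → ℝ, ContinuousOn f (Icc 0 1) →
        (⟪x, fc T (fun s => (f s : ℂ)) x⟫_ℂ).re = ∫ s, f s ∂μ := by
  -- `fc` takes functions on the line, so a function on `[0,1]` is extended by its boundary values;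
  -- only the values on `[0,1]` matter, by `fc_congr`.
  let ext : C_c(Icc (0 : ℝ) 1, ℝ) → ℝ → ℝ := fun f s => f (projIcc 0 1 zero_le_one s)
  have hext : ∀ f, Continuous (ext f) := fun f => f.continuous.comp continuous_projIcc
  have hextc : ∀ f, ContinuousOn (fun s => ((ext f s : ℝ) : ℂ)) (Icc 0 1) := fun f =>
    (Complex.continuous_ofReal.comp (hext f)).continuousOn
  let Λ₀ : C_c(Icc (0 : ℝ) 1, ℝ) →ₗ[ℝ] ℝ :=
    { toFun := fun f => (⟪x, fc T (fun s => (ext f s : ℂ)) x⟫_ℂ).re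
      map_add' := fun f g => by
        have : (fun s => ((ext (f + g) s : ℝ) : ℂ)) = fun s => (ext f s : ℂ) + (ext g s : ℂ) := by
          funext s; simp [ext]
        rw [this, fc_add hT (hextc f) (hextc g)]
        simp
      map_smul' := fun c f => by
        have : (fun s => ((ext (c • f) s : ℝ) : ℂ)) = fun s => (c : ℂ) * (ext f s : ℂ) := by
          funext s; simp [ext]
        rw [this, fc_const_mul hT _ (hextc f)]
        simp }
  let Λ : C_c(Icc (0 : ℝ) 1, ℝ) →ₚ[ℝ] ℝ := PositiveLinearMap.mk₀ Λ₀ (by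
    intro f hf
    change 0 ≤ (⟪x, fc T (fun s => (ext f s : ℂ)) x⟫_ℂ).re
    rw [inner_fc_self_nonneg hT (hext f).continuousOn (fun s _ => hf _)]
    rw [Complex.ofReal_re]
    positivity)
  refine ⟨RealRMK.rieszMeasure Λ, inferInstance, fun f hf => ?_⟩
  let F : C_c(Icc (0 : ℝ) 1, ℝ) :=
    { toFun := fun s => f s
      continuous_toFun := hf.domRestrict
      hasCompactSupport' := HasCompactSupport.of_compactSpace _ }
  have h := RealRMK.integral_rieszMeasure Λ F
  change _ = (⟪x, fc T (fun s => (ext F s : ℂ)) x⟫_ℂ).re at h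
  rw [← show (∫ s, F s ∂(RealRMK.rieszMeasure Λ)) = ∫ s, f s ∂(RealRMK.rieszMeasure Λ) from rfl, h]
  congr 3
  refine fc_congr hT fun s hs => ?_
  simp only [ext, F, projIcc_of_mem zero_le_one hs]
  rfl

/-- The scalar spectral measure of `T` at `x`. -/
noncomputable def specMeas (hT : IsPosContraction T) (x : H) : Measure (Icc (0 : ℝ) 1) :=
  (exists_spectralMeasure hT x).choose

instance (hT : IsPosContraction T) (x : H) : IsFiniteMeasure (specMeas hT x) :=
  (exists_spectralMeasure hT x).choose_spec.1

lemma inner_fc_eq_integral (hT : IsPosContraction T) (x : H) {f : ℝ → ℝ}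
    (hf : ContinuousOn f (Icc 0 1)) :
    (⟪x, fc T (fun s => (f s : ℂ)) x⟫_ℂ).re = ∫ s, f s ∂(specMeas hT x) :=
  (exists_spectralMeasure hT x).choose_spec.2 f hf

lemma norm_fc_sq (hT : IsPosContraction T) (x : H) {f : ℝ → ℂ} (hf : ContinuousOn f (Icc 0 1)) :
    ‖fc T f x‖ ^ 2 = (⟪x, fc T (fun s => ((‖f s‖ ^ 2 : ℝ) : ℂ)) x⟫_ℂ).re := by
  have hf' : ContinuousOn (fun s => starRingEnd ℂ (f s)) (Icc 0 1) :=
    Complex.continuous_conj.comp_continuousOn hf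
  have h : ⟪fc T f x, fc T f x⟫_ℂ = ⟪x, fc T (fun s => ((‖f s‖ ^ 2 : ℝ) : ℂ)) x⟫_ℂ := by
    rw [inner_fc_left, fc_mul_apply hT hf' hf]
    congr 2
    refine congrArg (fc T) (funext fun s => ?_)
    rw [mul_comm, Complex.mul_conj, Complex.normSq_eq_norm_sq]
  rw [← h, inner_self_eq_norm_sq_to_K]
  norm_cast

/-- Norms of vectors become integrals over the spectral variable here, so that Tonelli's theorem can
exchange them with integrals over time or frequency. -/
lemma enorm_fc_sq (hT : IsPosContraction T) (x : H) {f : ℝ → ℂ} (hf : ContinuousOn f (Icc 0 1)) :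
    ‖fc T f x‖ₑ ^ 2 = ∫⁻ s, ‖f s‖ₑ ^ 2 ∂(specMeas hT x) := by
  have hc : ContinuousOn (fun s => ‖f s‖ ^ 2) (Icc 0 1) := hf.norm.pow 2
  have hc' : Continuous (fun s : Icc (0 : ℝ) 1 => ‖f s‖ ^ 2) := hc.domRestrict
  rw [← ofReal_norm, ← ENNReal.ofReal_pow (norm_nonneg _), norm_fc_sq hT x hf,
    inner_fc_eq_integral hT x hc, ofReal_integral_eq_lintegral_ofReal
      (hc'.integrable_of_hasCompactSupport (HasCompactSupport.of_compactSpace _))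
      (Eventually.of_forall fun s => by positivity)]
  refine lintegral_congr fun s => ?_
  rw [ENNReal.ofReal_pow (norm_nonneg _), ofReal_norm]

end FunctionalCalculus

end CriticalDecay

namespace CriticalDecay

/-! ### The Friedrichs extension of an abstract symmetric operator. -/

section Friedrichs

variable {H : Type*} [NormedAddCommGroup H] [InnerProductSpace ℂ H] [CompleteSpace H]

/-- The inverse `T` of the Friedrichs extension of a symmetric operator `S ≥ 1`, given on the
domain `D` (embedded into `H` by `J`). -/
theorem exists_friedrichs_inverse {D : Type*} [AddCommGroup D] [Module ℂ D]
    (J S : D →ₗ[ℂ] H) (hsymm : ∀ φ ψ, ⟪J φ, S ψ⟫_ℂ = ⟪S φ, J ψ⟫_ℂ)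
    (hone : ∀ φ, ‖J φ‖ ^ 2 ≤ (⟪J φ, S φ⟫_ℂ).re) :
    ∃ T : H →L[ℂ] H, IsPosContraction T ∧ (∀ φ, T (S φ) = J φ) ∧
      (∀ φ h, ⟪S φ, T h⟫_ℂ = ⟪J φ, h⟫_ℂ) ∧
      ∀ h, ∃ φ : ℕ → D, Tendsto (fun k => J (φ k)) atTop (𝓝 (T h)) ∧
        Tendsto (fun k => (⟪J (φ k), S (φ k)⟫_ℂ).re) atTop (𝓝 (⟪T h, h⟫_ℂ).re) ∧
        ∀ ε : ℝ, 0 < ε → ∃ N : ℕ, ∀ k ≥ N, ∀ l ≥ N,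
          (⟪J (φ k - φ l), S (φ k - φ l)⟫_ℂ).re < ε := by
  -- The form `⟨Jφ, Sψ⟩` serves as inner product on `D`. A seminorm is enough, since the completion
  -- identifies null vectors with zero.
  let core : PreInnerProductSpace.Core ℂ D :=
    { inner := fun φ ψ => ⟪J φ, S ψ⟫_ℂ
      conj_inner_symm := fun φ ψ => by
        change starRingEnd ℂ ⟪J ψ, S φ⟫_ℂ = ⟪J φ, S ψ⟫_ℂ
        rw [inner_conj_symm, hsymm]
      re_inner_nonneg := fun φ => (sq_nonneg _).trans (hone φ)
      add_left := fun a b c => by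
        change ⟪J (a + b), S c⟫_ℂ = ⟪J a, S c⟫_ℂ + ⟪J b, S c⟫_ℂ
        rw [map_add, inner_add_left]
      smul_left := fun a b c => by
        change ⟪J (c • a), S b⟫_ℂ = starRingEnd ℂ c * ⟪J a, S b⟫_ℂ
        rw [map_smul, inner_smul_left] }
  let _ : SeminormedAddCommGroup D :=
    @InnerProductSpace.Core.toSeminormedAddCommGroup ℂ D _ _ _ core
  let _ : InnerProductSpace ℂ D := InnerProductSpace.ofCore core
  have hin : ∀ φ ψ : D, ⟪φ, ψ⟫_ℂ = ⟪J φ, S ψ⟫_ℂ := fun _ _ => rfl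
  have hnorm : ∀ φ : D, ‖φ‖ ^ 2 = (⟪J φ, S φ⟫_ℂ).re := fun φ => by
    rw [← hin, inner_self_eq_norm_sq_to_K]; norm_cast
  have hJ : ∀ φ : D, ‖J φ‖ ≤ 1 * ‖φ‖ := fun φ => by
    rw [one_mul]
    exact le_of_sq_le_sq ((hone φ).trans (hnorm φ).ge) (norm_nonneg _)
  let J₁ : D →L[ℂ] H := J.mkContinuous 1 hJ
  let j : UniformSpace.Completion D →L[ℂ] H :=
    J₁.extend (UniformSpace.Completion.toComplL (𝕜 := ℂ) (E := D))
  have hj : ∀ φ : D, j (φ : UniformSpace.Completion D) = J φ := fun φ =>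
    J₁.extend_eq UniformSpace.Completion.denseRange_coe
      (UniformSpace.Completion.isUniformInducing_coe D) φ
  have hj1 : ‖j‖ ≤ 1 := by
    refine ContinuousLinearMap.opNorm_le_bound _ zero_le_one fun x => ?_
    refine UniformSpace.Completion.induction_on x
      (isClosed_le (by fun_prop) (by fun_prop)) fun φ => ?_
    rw [hj, UniformSpace.Completion.norm_coe]
    exact hJ φ
  -- If `j` maps the completed form domain to `H`, the equation `⟨φ, η⟩ = ⟨Jφ, h⟩` for all `φ` is
  -- solved by `η = j* h`. The inverse of the extension is therefore `j j*`, and its positivity and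
  -- contractivity are automatic.
  let T : H →L[ℂ] H := j ∘L ContinuousLinearMap.adjoint j
  have hadj : ∀ (φ : D) (h : H),
      ⟪(φ : UniformSpace.Completion D), ContinuousLinearMap.adjoint j h⟫_ℂ = ⟪J φ, h⟫_ℂ :=
    fun φ h => by rw [ContinuousLinearMap.adjoint_inner_right, hj]
  -- Reading the form with `S` on the left gives `j* S φ = φ`, hence `T S = J`.
  have hS : ∀ (φ : D) (η : UniformSpace.Completion D),
      ⟪(φ : UniformSpace.Completion D), η⟫_ℂ = ⟪S φ, j η⟫_ℂ := by
    intro φ η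
    refine UniformSpace.Completion.induction_on η
      (isClosed_eq (by fun_prop) (by fun_prop)) fun ψ => ?_
    rw [UniformSpace.Completion.inner_coe, hin, hj, hsymm]
  have hTS : ∀ φ, ContinuousLinearMap.adjoint j (S φ) = (φ : UniformSpace.Completion D) := by
    intro φ
    refine ext_inner_left ℂ fun η => ?_
    rw [ContinuousLinearMap.adjoint_inner_right, ← inner_conj_symm, ← hS, inner_conj_symm]
  have hTT : ∀ x, ⟪x, T x⟫_ℂ = ((‖ContinuousLinearMap.adjoint j x‖ ^ 2 : ℝ) : ℂ) := by
    intro x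
    change ⟪x, j (ContinuousLinearMap.adjoint j x)⟫_ℂ = _
    rw [← ContinuousLinearMap.adjoint_inner_left, inner_self_eq_norm_sq_to_K]
    simp
  refine ⟨T, ⟨?_, fun x => ?_, fun x => ?_⟩, fun φ => ?_, fun φ h => ?_, fun h => ?_⟩
  · rw [ContinuousLinearMap.isSelfAdjoint_iff', ContinuousLinearMap.adjoint_comp,
      ContinuousLinearMap.adjoint_adjoint]
  · rw [hTT, Complex.ofReal_re]; positivity
  · rw [hTT, Complex.ofReal_re]
    have h1 : ‖ContinuousLinearMap.adjoint j x‖ ≤ ‖x‖ := by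
      refine (ContinuousLinearMap.le_opNorm _ _).trans ?_
      rw [LinearIsometryEquiv.norm_map]
      exact mul_le_of_le_one_left (norm_nonneg _) hj1
    gcongr
  · change j (ContinuousLinearMap.adjoint j (S φ)) = _
    rw [hTS, hj]
  · change ⟪S φ, j (ContinuousLinearMap.adjoint j h)⟫_ℂ = _
    rw [← hS, hadj]
  · have hd : ContinuousLinearMap.adjoint j h ∈
        closure (range ((↑) : D → UniformSpace.Completion D)) :=
      UniformSpace.Completion.denseRange_coe _
    obtain ⟨s, hs, hlim⟩ := mem_closure_iff_seq_limit.1 hd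
    choose φ hφ using hs
    have hlim' : Tendsto (fun k => (φ k : UniformSpace.Completion D)) atTop
        (𝓝 (ContinuousLinearMap.adjoint j h)) := by simpa only [hφ] using hlim
    refine ⟨φ, ?_, ?_, fun ε hε => ?_⟩
    · change Tendsto _ _ (𝓝 (j (ContinuousLinearMap.adjoint j h)))
      have := (j.continuous.tendsto _).comp hlim'
      simpa only [Function.comp_def, hj] using this
    -- The form along the approximants tends to `‖j* h‖²`, which is `⟨T h, h⟩`.
    · have h1 := (hlim'.norm).pow 2
      have h2 : (⟪T h, h⟫_ℂ).re = ‖ContinuousLinearMap.adjoint j h‖ ^ 2 := by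
        rw [← inner_conj_symm, hTT, Complex.conj_ofReal, Complex.ofReal_re]
      rw [h2]
      simpa only [UniformSpace.Completion.norm_coe, hnorm] using h1
    · obtain ⟨N, hN⟩ := Metric.cauchySeq_iff.1 hlim'.cauchySeq (√ε) (Real.sqrt_pos.2 hε)
      refine ⟨N, fun k hk l hl => ?_⟩
      have h1 := hN k hk l hl
      rw [dist_eq_norm, ← UniformSpace.Completion.coe_sub, UniformSpace.Completion.norm_coe] at h1
      rw [← hnorm]
      exact (Real.lt_sqrt (norm_nonneg _)).1 h1

end Friedrichs

end CriticalDecay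

namespace CriticalDecay

/-! ### Spectral cutoffs away from `p = 0` and `p = ∞`. -/

section Cutoff

/-- Truncation of `s` to `[1/(m+3), 1 - 1/(m+3)]`. -/
noncomputable def clampC (m : ℕ) (s : ℝ) : ℝ := max (1 / (m + 3)) (min s (1 - 1 / (m + 3)))

/-- The function `1/s - 1`, truncated near `s = 0` and `s = 1`. -/
noncomputable def pm (m : ℕ) (s : ℝ) : ℝ := 1 / clampC m s - 1

/-- A cutoff function supported in `[1/(m+3), 1 - 1/(m+3)]`. -/
noncomputable def chi (m : ℕ) (s : ℝ) : ℝ :=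
  max 0 (min 1 ((m + 3) * s - 1)) * max 0 (min 1 ((m + 3) * (1 - s) - 1))

lemma clampC_pos (m : ℕ) (s : ℝ) : 0 < clampC m s :=
  lt_max_of_lt_left (by positivity)

lemma clampC_lt_one (m : ℕ) (s : ℝ) : clampC m s < 1 := by
  have h : (0 : ℝ) < 1 / (m + 3) := by positivity
  refine max_lt ?_ (min_lt_of_right_lt (by linarith))
  rw [div_lt_one (by positivity)]
  have : (0 : ℝ) ≤ m := by positivity
  linarith

/-- On the support of `chi` the truncation does nothing, so there `pm m s` is the true `p = 1/s -
1`. Elsewhere its value is irrelevant, because a factor `chi` is always present. -/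
lemma clampC_of_chi_ne {m : ℕ} {s : ℝ} (h : chi m s ≠ 0) : clampC m s = s := by
  have h1 : (0 : ℝ) < m + 3 := by positivity
  rw [chi, mul_ne_zero_iff] at h
  have a : 0 < (m + 3) * s - 1 := by
    by_contra! h'
    exact h.1 (max_eq_left ((min_le_right _ _).trans h'))
  have b : 0 < (m + 3) * (1 - s) - 1 := by
    by_contra! h'
    exact h.2 (max_eq_left ((min_le_right _ _).trans h'))
  have a' : 1 / ((m : ℝ) + 3) ≤ s := by rw [div_le_iff₀ h1]; linarith
  have b' : 1 / ((m : ℝ) + 3) ≤ 1 - s := by rw [div_le_iff₀ h1]; linarith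
  rw [clampC, min_eq_left (by linarith), max_eq_right a']

lemma pm_pos (m : ℕ) (s : ℝ) : 0 < pm m s := by
  rw [pm, sub_pos, lt_div_iff₀ (clampC_pos m s), one_mul]
  exact clampC_lt_one m s

lemma continuous_clampC (m : ℕ) : Continuous (clampC m) := by
  unfold clampC; fun_prop

lemma continuous_pm (m : ℕ) : Continuous (pm m) := by
  unfold pm
  exact (continuous_const.div (continuous_clampC m) fun s => (clampC_pos m s).ne').sub
    continuous_const

lemma continuous_chi (m : ℕ) : Continuous (chi m) := by
  unfold chi; fun_prop

lemma chi_nonneg (m : ℕ) (s : ℝ) : 0 ≤ chi m s :=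
  mul_nonneg (le_max_left _ _) (le_max_left _ _)

lemma chi_le_one (m : ℕ) (s : ℝ) : chi m s ≤ 1 :=
  mul_le_one₀ (max_le zero_le_one (min_le_left _ _)) (le_max_left _ _)
    (max_le zero_le_one (min_le_left _ _))

/-- `chi` differs from `1` only within `2/(m+3)` of an endpoint, and there `s (1 - s)` is that
small. -/
lemma abs_chi_sub_one_mul_le (m : ℕ) {s : ℝ} (hs : s ∈ Icc (0 : ℝ) 1) :
    |chi m s - 1| * (s * (1 - s)) ≤ 2 / (m + 3) := by
  have h3 : (0 : ℝ) < m + 3 := by positivity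
  have h1 : |chi m s - 1| ≤ 1 := by
    rw [abs_le]; constructor <;> linarith [chi_nonneg m s, chi_le_one m s]
  have hs0 : 0 ≤ s * (1 - s) := mul_nonneg hs.1 (by linarith [hs.2])
  by_cases ha : s ≤ 2 / (m + 3)
  · calc |chi m s - 1| * (s * (1 - s)) ≤ 1 * (s * 1) := by
          gcongr
          · exact hs.1
          · linarith [hs.1]
      _ ≤ _ := by linarith
  by_cases hb : 1 - s ≤ 2 / (m + 3)
  · calc |chi m s - 1| * (s * (1 - s)) ≤ 1 * (1 * (1 - s)) := by
          gcongr
          · linarith [hs.2]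
          · exact hs.2
      _ ≤ _ := by linarith
  push Not at ha hb
  rw [div_lt_iff₀ h3] at ha hb
  have : chi m s = 1 := by
    rw [chi, min_eq_left (by linarith), min_eq_left (by linarith)]
    norm_num
  rw [this]
  simp only [sub_self, abs_zero, zero_mul]
  positivity

end Cutoff

/-! ### Spectrally truncated Schrödinger and wave evolutions. -/

section Evolution

variable {H : Type*} [NormedAddCommGroup H] [InnerProductSpace ℂ H] [CompleteSpace H]
variable {T : H →L[ℂ] H}

lemma norm_fc_apply_le (hT : IsPosContraction T) {f : ℝ → ℂ} {c : ℝ} (hc : 0 ≤ c)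
    (h : ∀ s ∈ Icc (0 : ℝ) 1, ‖f s‖ ≤ c) (x : H) : ‖fc T f x‖ ≤ c * ‖x‖ :=
  (ContinuousLinearMap.le_opNorm _ _).trans (by gcongr; exact norm_fc_le hT hc h)

lemma ofReal_continuousOn {f : ℝ → ℝ} (hf : Continuous f) :
    ContinuousOn (fun s => (f s : ℂ)) (Icc 0 1) :=
  (Complex.continuous_ofReal.comp hf).continuousOn

/-- Since `T` and `1 - T` are injective, the self-adjoint operator `U = T(1 - T)` is injective and
has dense range. On that range `abs_chi_sub_one_mul_le` gives convergence, and the uniform bound by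
`1` extends it to all vectors. -/
lemma tendsto_fc_chi (hT : IsPosContraction T) (h0 : ∀ x, T x = 0 → x = 0)
    (h1 : ∀ x, T x = x → x = 0) (x : H) :
    Tendsto (fun m => fc T (fun s => (chi m s : ℂ)) x) atTop (𝓝 x) := by
  set U : H →L[ℂ] H := fc T (fun s => ((s * (1 - s) : ℝ) : ℂ)) with hU
  have hUc : ContinuousOn (fun s : ℝ => ((s * (1 - s) : ℝ) : ℂ)) (Icc 0 1) :=
    ofReal_continuousOn (by fun_prop)
  have hUT : ∀ y, U y = T (y - T y) := by
    intro y
    have e : U = fc T (fun s => (s : ℂ) * (1 - (s : ℂ))) := by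
      rw [hU]; congr 1; funext s; push_cast; ring
    have hid : ContinuousOn (fun s : ℝ => (s : ℂ)) (Icc 0 1) := by fun_prop
    have hone : ContinuousOn (fun _ : ℝ => (1 : ℂ)) (Icc 0 1) := by fun_prop
    have hsub : ContinuousOn (fun s : ℝ => (1 : ℂ) - (s : ℂ)) (Icc 0 1) := hone.sub hid
    rw [e, fc_mul hT hid hsub, fc_sub hT hone hid, fc_id hT, fc_one hT]
    rfl
  have hUadj : ContinuousLinearMap.adjoint U = U := by
    rw [hU, fc_adjoint]; simp only [Complex.conj_ofReal]
  have hker : ∀ y, U y = 0 → y = 0 := by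
    intro y hy
    rw [hUT] at hy
    exact h1 y (sub_eq_zero.1 (h0 _ hy)).symm
  have hdense : DenseRange U := by
    have h2 : (LinearMap.range (U : H →ₗ[ℂ] H)).topologicalClosure = ⊤ := by
      rw [Submodule.topologicalClosure_eq_top_iff, Submodule.eq_bot_iff]
      intro y hy
      refine hker y (ext_inner_left ℂ fun z => ?_)
      rw [Submodule.mem_orthogonal] at hy
      rw [inner_zero_right, ← ContinuousLinearMap.adjoint_inner_left, hUadj]
      exact hy _ ⟨z, rfl⟩
    have h3 := congrArg (fun S : Submodule ℂ H => (S : Set H)) h2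
    simp only [Submodule.topologicalClosure_coe, Submodule.top_coe] at h3
    rw [DenseRange, dense_iff_closure_eq, ← h3]
    rfl
  rw [Metric.tendsto_atTop]
  intro ε hε
  obtain ⟨z, hz⟩ := hdense.exists_dist_lt x (show 0 < ε / 4 by positivity)
  have hlim : Tendsto (fun m : ℕ => 2 / ((m : ℝ) + 3) * ‖z‖) atTop (𝓝 0) := by
    have : Tendsto (fun m : ℕ => 2 / ((m : ℝ) + 3)) atTop (𝓝 0) :=
      tendsto_const_nhds.div_atTop
        (tendsto_atTop_add_const_right _ _ tendsto_natCast_atTop_atTop)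
    simpa using this.mul_const ‖z‖
  obtain ⟨N, hN⟩ := eventually_atTop.1 (hlim.eventually_lt_const (show 0 < ε / 4 by positivity))
  refine ⟨N, fun m hm => ?_⟩
  have hcc : ContinuousOn (fun s => (chi m s : ℂ)) (Icc 0 1) :=
    ofReal_continuousOn (continuous_chi m)
  have hone : ContinuousOn (fun _ : ℝ => (1 : ℂ)) (Icc 0 1) := by fun_prop
  have e1 : ‖fc T (fun s => (chi m s : ℂ)) (x - U z)‖ ≤ 1 * ‖x - U z‖ := by
    refine norm_fc_apply_le hT zero_le_one (fun s _ => ?_) _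
    rw [Complex.norm_real, Real.norm_of_nonneg (chi_nonneg m s)]
    exact chi_le_one m s
  have e2 : ‖fc T (fun s => (chi m s : ℂ)) (U z) - U z‖ ≤ 2 / ((m : ℝ) + 3) * ‖z‖ := by
    have : fc T (fun s => (chi m s : ℂ)) (U z) - U z
        = fc T (fun s => ((chi m s : ℂ) - 1) * ((s * (1 - s) : ℝ) : ℂ)) z := by
      have hsub : ContinuousOn (fun s : ℝ => (chi m s : ℂ) - 1) (Icc 0 1) := hcc.sub hone
      rw [fc_mul hT hsub hUc, fc_sub hT hcc hone, fc_one hT]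
      rfl
    rw [this]
    refine norm_fc_apply_le hT (by positivity) (fun s hs => ?_) _
    have h := abs_chi_sub_one_mul_le m hs
    rw [norm_mul, ← Complex.ofReal_one, ← Complex.ofReal_sub, Complex.norm_real, Complex.norm_real,
      Real.norm_eq_abs, Real.norm_of_nonneg (mul_nonneg hs.1 (by linarith [hs.2]))]
    exact h
  rw [dist_eq_norm] at hz ⊢
  have e3 := hN m hm
  calc ‖fc T (fun s => (chi m s : ℂ)) x - x‖
      = ‖fc T (fun s => (chi m s : ℂ)) (x - U z) +
          (fc T (fun s => (chi m s : ℂ)) (U z) - U z) - (x - U z)‖ := by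
        congr 1; rw [map_sub]; abel
    _ ≤ ‖fc T (fun s => (chi m s : ℂ)) (x - U z)‖ +
          ‖fc T (fun s => (chi m s : ℂ)) (U z) - U z‖ + ‖x - U z‖ :=
        (norm_sub_le _ _).trans (by gcongr; exact norm_add_le _ _)
    _ < ε := by linarith

/-- A weak derivative that is continuous is a strong derivative. -/
lemma hasDerivAt_of_weak {y g : ℝ → H} (hg : Continuous g)
    (h : ∀ η t, HasDerivAt (fun s => ⟪η, y s⟫_ℂ) ⟪η, g t⟫_ℂ t) (t : ℝ) :
    HasDerivAt y (g t) t := by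
  have hF : ∀ t, HasDerivAt (fun t => ∫ s in (0 : ℝ)..t, g s) (g t) t := fun t =>
    intervalIntegral.integral_hasDerivAt_right (hg.intervalIntegrable _ _)
      (hg.stronglyMeasurableAtFilter _ _) hg.continuousAt
  -- The strong integral of `g` has the same weak derivative as `y`, so the two differ by a
  -- constant.
  have hy : ∀ t, y t = y 0 + ∫ s in (0 : ℝ)..t, g s := by
    intro t
    refine ext_inner_left ℂ fun η => ?_
    have hd : ∀ s, HasDerivAt (fun s => ⟪η, y s⟫_ℂ - ⟪η, y 0 + ∫ r in (0 : ℝ)..s, g r⟫_ℂ) 0 s := by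
      intro s
      have h2 := ((hF s).const_add (y 0))
      have h3 := ((innerSL ℂ η).restrictScalars ℝ).hasFDerivAt.comp_hasDerivAt s h2
      have h4 := (h η s).sub h3
      simp only [ContinuousLinearMap.coe_restrictScalars', innerSL_apply_apply, sub_self] at h4
      exact h4
    have hc := is_const_of_deriv_eq_zero (fun s => (hd s).differentiableAt)
      (fun s => (hd s).deriv) t 0
    simp only [intervalIntegral.integral_same, add_zero, sub_self] at hc
    exact sub_eq_zero.1 hc
  rw [funext hy]
  exact (hF t).const_add _

lemma fc_exp_eq (hT : IsPosContraction T) {q : ℝ → ℝ} (hq : Continuous q) (t : ℝ) :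
    fc T (fun s => Complex.exp (t * (Complex.I * q s))) =
      NormedSpace.exp (t • fc T (fun s => Complex.I * q s)) := by
  have hc : ContinuousOn (fun s => Complex.I * (q s : ℂ)) (Icc 0 1) :=
    continuousOn_const.mul (ofReal_continuousOn hq)
  have hc2 : ContinuousOn (fun s => (t : ℂ) * (Complex.I * (q s : ℂ))) (Icc 0 1) :=
    continuousOn_const.mul hc
  have e : t • fc T (fun s => Complex.I * q s) = fc T (fun s => (t : ℂ) * (Complex.I * q s)) := by
    rw [fc_const_mul hT _ hc]; rfl
  have hn : IsStarNormal T := hT.selfAdj.isStarNormal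
  rw [e, ← CFC.complex_exp_eq_normedSpace_exp (a := fc T _) (cfc_predicate _ T)]
  exact cfc_comp' Complex.exp (fun z : ℂ => (t : ℂ) * (Complex.I * q z.re)) T
    (Complex.continuous_exp.continuousOn) (fc_continuousOn hT hc2)

/-- The solution of `z' = i q(T) z`. -/
lemma eq_fc_exp_of_hasDerivAt (hT : IsPosContraction T) {q : ℝ → ℝ} (hq : Continuous q)
    {z : ℝ → H} (hz : ∀ t, HasDerivAt z (fc T (fun s => Complex.I * q s) (z t)) t) (t : ℝ) :
    z t = fc T (fun s => Complex.exp (t * (Complex.I * q s))) (z 0) := by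
  set B := fc T (fun s => Complex.I * q s) with hB
  have hadj : ContinuousLinearMap.adjoint B = -B := by
    have hc : ContinuousOn (fun s => Complex.I * (q s : ℂ)) (Icc 0 1) :=
      continuousOn_const.mul (ofReal_continuousOn hq)
    rw [hB, fc_adjoint, ← neg_one_smul ℂ, ← fc_const_mul hT _ hc]
    congr 1; funext s; simp
  have hE : ∀ t : ℝ, HasDerivAt (fun t : ℝ => fc T (fun s => Complex.exp (t * (Complex.I * q s))) (z 0))
      (B (fc T (fun s => Complex.exp (t * (Complex.I * q s))) (z 0))) t := by
    intro t
    simp only [fc_exp_eq hT hq]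
    have h1 := hasDerivAt_exp_smul_const' (𝕂 := ℝ) B t
    exact (((ContinuousLinearMap.apply ℂ H (z 0)).restrictScalars ℝ).hasFDerivAt).comp_hasDerivAt
      t h1
  -- Uniqueness: the difference `w` of two solutions satisfies `w' = B w` with `B` skew-adjoint, so
  -- `‖w‖` is constant, and it vanishes at `0`.
  set w := fun t : ℝ => z t - fc T (fun s => Complex.exp (t * (Complex.I * q s))) (z 0) with hw
  have hw' : ∀ t, HasDerivAt w (B (w t)) t := fun t => by
    have := (hz t).sub (hE t)
    rw [← map_sub] at this
    exact this
  have hn : ∀ t, HasDerivAt (fun t => ⟪w t, w t⟫_ℂ) 0 t := fun t => by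
    have h1 := (hw' t).inner ℂ (hw' t)
    rw [← ContinuousLinearMap.adjoint_inner_left, hadj] at h1
    simpa using h1
  have hcst := is_const_of_deriv_eq_zero (fun s => (hn s).differentiableAt)
    (fun s => (hn s).deriv) t 0
  have hw0 : w 0 = 0 := by
    have h1 := fc_one hT
    simp [hw, h1]
  simp only [hw0, inner_zero_left, inner_self_eq_zero] at hcst
  exact sub_eq_zero.1 hcst

/-- `χ(T) (1/s)` applied to `T x` gives `χ(T) x`. -/
lemma fc_chi_div_T (hT : IsPosContraction T) (m : ℕ) (x : H) :
    fc T (fun s => ((chi m s / clampC m s : ℝ) : ℂ)) (T x) = fc T (fun s => (chi m s : ℂ)) x := by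
  have hc : Continuous fun s => chi m s / clampC m s :=
    (continuous_chi m).div (continuous_clampC m) fun s => (clampC_pos m s).ne'
  have hid : ContinuousOn (fun s : ℝ => (s : ℂ)) (Icc 0 1) := by fun_prop
  have h := fc_mul_apply hT (ofReal_continuousOn hc) hid x
  rw [fc_id hT] at h
  rw [h]
  refine congrArg (fun L : H →L[ℂ] H => L x) (congrArg (fc T) (funext fun s => ?_))
  by_cases h0 : chi m s = 0
  · simp [h0]
  · have h1 := clampC_pos m s
    rw [clampC_of_chi_ne h0] at h1 ⊢
    rw [← Complex.ofReal_mul, div_mul_cancel₀ _ h1.ne']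

lemma fc_chi_div_sub (hT : IsPosContraction T) (m : ℕ) (x : H) :
    fc T (fun s => ((chi m s / clampC m s : ℝ) : ℂ)) (x - T x) =
      fc T (fun s => (pm m s : ℂ)) (fc T (fun s => (chi m s : ℂ)) x) := by
  have hc : Continuous fun s => chi m s / clampC m s :=
    (continuous_chi m).div (continuous_clampC m) fun s => (clampC_pos m s).ne'
  have hχ := ofReal_continuousOn (continuous_chi m)
  rw [map_sub, fc_chi_div_T hT, fc_mul_apply hT (ofReal_continuousOn (continuous_pm m)) hχ,
    ← sub_apply, ← fc_sub hT (ofReal_continuousOn hc) hχ]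
  refine congrArg (fun L : H →L[ℂ] H => L x) (congrArg (fc T) (funext fun s => ?_))
  rw [← Complex.ofReal_sub, ← Complex.ofReal_mul, pm]
  congr 1; ring

/-- The spectrally truncated solution of the Schrödinger equation. -/
lemma schrodinger_truncated (hT : IsPosContraction T) {u : ℝ → H} (hu : Continuous u)
    (h : ∀ η t, HasDerivAt (fun s => ⟪T η, u s⟫_ℂ) (-Complex.I * ⟪η - T η, u t⟫_ℂ) t)
    (m : ℕ) (t : ℝ) :
    fc T (fun s => (chi m s : ℂ)) (u t) =
      fc T (fun s => Complex.exp (t * (Complex.I * ((-pm m s : ℝ) : ℂ))))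
        (fc T (fun s => (chi m s : ℂ)) (u 0)) := by
  have hsymm : ∀ x y, ⟪T x, y⟫_ℂ = ⟪x, T y⟫_ℂ := hT.selfAdj.isSymmetric
  -- `u` need not be differentiable, but `T u` is: testing against `T η`, for which `P T η = η - T
  -- η`, exhibits a continuous weak derivative.
  have hy : ∀ t, HasDerivAt (fun t => T (u t)) (-Complex.I • (u t - T (u t))) t := by
    refine hasDerivAt_of_weak (by fun_prop) fun η t => ?_
    have h1 := h η t
    simp only [hsymm, inner_sub_left] at h1
    rw [inner_smul_right, inner_sub_right]
    exact h1
  have hq : Continuous fun s => -pm m s := (continuous_pm m).neg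
  refine eq_fc_exp_of_hasDerivAt hT hq (z := fun t => fc T (fun s => (chi m s : ℂ)) (u t))
    (fun t => ?_) t
  -- The bounded operator `(χ/s)(T)` undoes `T` on the support of the cutoff and leaves an equation
  -- with the bounded generator `-i pm(T)`.
  have h2 := ((fc T (fun s => ((chi m s / clampC m s : ℝ) : ℂ))).restrictScalars
    ℝ).hasFDerivAt.comp_hasDerivAt t (hy t)
  simp only [Function.comp_def, ContinuousLinearMap.coe_restrictScalars', fc_chi_div_T hT,
    map_smul, fc_chi_div_sub hT] at h2
  convert h2 using 1
  have e : fc T (fun s => Complex.I * ((-pm m s : ℝ) : ℂ)) =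
      (-Complex.I) • fc T (fun s => (pm m s : ℂ)) := by
    rw [← fc_const_mul hT _ (ofReal_continuousOn (continuous_pm m))]
    congr 1; funext s; simp
  rw [e]; rfl

/-- The spectrally truncated solution of the wave equation is a sum of two half waves. -/
lemma wave_truncated (hT : IsPosContraction T) {u : ℝ → H} {g : H} (hu : Continuous u)
    (h : ∀ η, ∃ d : ℝ → ℂ, d 0 = ⟪T η, g⟫_ℂ ∧ ∀ t : ℝ,
      HasDerivAt (fun s : ℝ => ⟪T η, u s⟫_ℂ) (d t) t ∧ HasDerivAt d (-⟪η - T η, u t⟫_ℂ) t)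
    (m : ℕ) (t : ℝ) :
    fc T (fun s => (chi m s : ℂ)) (u t) =
      fc T (fun s => Complex.exp (t * (Complex.I * ((√(pm m s) : ℝ) : ℂ))))
        (fc T (fun s => (chi m s : ℂ)) ((2⁻¹ : ℂ) •
          (u 0 - Complex.I • fc T (fun s => ((1 / √(pm m s) : ℝ) : ℂ)) g))) +
      fc T (fun s => Complex.exp (t * (Complex.I * ((-√(pm m s) : ℝ) : ℂ))))
        (fc T (fun s => (chi m s : ℂ)) ((2⁻¹ : ℂ) •
          (u 0 + Complex.I • fc T (fun s => ((1 / √(pm m s) : ℝ) : ℂ)) g))) := by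
  have hsymm : ∀ x y, ⟪T x, y⟫_ℂ = ⟪x, T y⟫_ℂ := hT.selfAdj.isSymmetric
  -- `w` stands for `T ∂ₜu`, written without `∂ₜu`: it starts at `T g` and has derivative `-P T u =
  -- -(u - T u)`.
  set w : ℝ → H := fun t => T g - ∫ s in (0 : ℝ)..t, (u s - T (u s)) with hw
  have hcont : Continuous fun s => u s - T (u s) := by fun_prop
  have hw' : ∀ t, HasDerivAt w (-(u t - T (u t))) t := fun t =>
    (intervalIntegral.integral_hasDerivAt_right (hcont.intervalIntegrable _ _)
      (hcont.stronglyMeasurableAtFilter _ _) hcont.continuousAt).const_sub _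
  have hwc : Continuous w :=
    continuous_iff_continuousAt.2 fun t => (hw' t).continuousAt
  have hy : ∀ t, HasDerivAt (fun t => T (u t)) (w t) t := by
    refine hasDerivAt_of_weak hwc fun η t => ?_
    obtain ⟨d, hd0, hd⟩ := h η
    have hd' : ∀ t, HasDerivAt (fun t => d t - ⟪η, w t⟫_ℂ) 0 t := fun t => by
      have h1 := ((innerSL ℂ η).restrictScalars ℝ).hasFDerivAt.comp_hasDerivAt t (hw' t)
      have h2 := (hd t).2.sub h1
      simp only [ContinuousLinearMap.coe_restrictScalars', innerSL_apply_apply, inner_sub_left,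
        inner_sub_right, inner_neg_right, hsymm, sub_self] at h2
      exact h2
    have hc := is_const_of_deriv_eq_zero (fun s => (hd' s).differentiableAt)
      (fun s => (hd' s).deriv) t 0
    simp only [hw, intervalIntegral.integral_same, sub_zero, hd0, hsymm, sub_self] at hc
    have h3 := (hd t).1
    simp only [hsymm] at h3
    rw [sub_eq_zero.1 hc] at h3
    exact h3
  set C := fc T (fun s => ((chi m s / clampC m s : ℝ) : ℂ)) with hC
  set X := fc T (fun s => (chi m s : ℂ)) with hX
  set J := fc T (fun s => ((1 / √(pm m s) : ℝ) : ℂ)) with hJ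
  set Ω := fc T (fun s => ((√(pm m s) : ℝ) : ℂ)) with hΩ
  have hsq : Continuous fun s => √(pm m s) := (continuous_pm m).sqrt
  have hsqpos : ∀ s, √(pm m s) ≠ 0 := fun s => (Real.sqrt_pos.2 (pm_pos m s)).ne'
  have hsqn : Continuous fun s => -√(pm m s) := hsq.neg
  have hinv : Continuous fun s => 1 / √(pm m s) := continuous_const.div hsq hsqpos
  have hsqc := ofReal_continuousOn hsq
  have hinvc := ofReal_continuousOn hinv
  have hχ := ofReal_continuousOn (continuous_chi m)
  have hCc := ofReal_continuousOn ((continuous_chi m).div (continuous_clampC m)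
    fun s => (clampC_pos m s).ne')
  have hz' : ∀ t, HasDerivAt (fun t => X (u t)) (C (w t)) t := fun t => by
    have h2 := (C.restrictScalars ℝ).hasFDerivAt.comp_hasDerivAt t (hy t)
    simpa only [Function.comp_def, ContinuousLinearMap.coe_restrictScalars', hC,
      fc_chi_div_T hT] using h2
  have hy' : ∀ t, HasDerivAt (fun t => J (C (w t))) (-Ω (X (u t))) t := fun t => by
    have h2 := ((J ∘L C).restrictScalars ℝ).hasFDerivAt.comp_hasDerivAt t (hw' t)
    simp only [Function.comp_def, ContinuousLinearMap.coe_restrictScalars', 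
      ContinuousLinearMap.comp_apply, map_neg] at h2
    rw [hC, fc_chi_div_sub hT, hJ, fc_mul_apply hT hinvc
      (ofReal_continuousOn (continuous_pm m))] at h2
    convert h2 using 1
    refine congrArg Neg.neg ?_
    refine congrArg (fun L : H →L[ℂ] H => L (X (u t))) (congrArg (fc T) (funext fun s => ?_))
    rw [← Complex.ofReal_mul]
    congr 1
    nth_rw 3 [← Real.mul_self_sqrt (pm_pos m s).le]
    field_simp [hsqpos s]
  have hΩJ : ∀ x, Ω (J x) = x := fun x => by
    rw [hΩ, hJ, fc_mul_apply hT hsqc hinvc]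
    have : (fun s => ((√(pm m s) : ℝ) : ℂ) * ((1 / √(pm m s) : ℝ) : ℂ)) = fun _ => 1 := by
      funext s
      rw [← Complex.ofReal_mul, mul_one_div_cancel (hsqpos s), Complex.ofReal_one]
    rw [this, fc_one hT]; rfl
  have hw0 : J (C (w 0)) = X (J g) := by
    simp only [hw, intervalIntegral.integral_same, sub_zero]
    rw [hC, fc_chi_div_T hT, ← hX, hJ, hX, fc_mul_apply hT hinvc hχ, fc_mul_apply hT hχ hinvc]
    simp only [mul_comm]
  -- For `a = ±i` the factorisation `∂ₜ² + Ω² = (∂ₜ - aΩ)(∂ₜ + aΩ)` shows that `z - aΩ⁻¹∂ₜz`, with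
  -- `z = X u`, solves a first order equation.
  have hcomb : ∀ a : ℂ, a * a = -1 → ∀ t, HasDerivAt
      (fun t => (2⁻¹ : ℂ) • (X (u t) - a • J (C (w t))))
      (a • Ω ((2⁻¹ : ℂ) • (X (u t) - a • J (C (w t))))) t := fun a ha t => by
    have h1 := ((hz' t).sub ((hy' t).const_smul a)).const_smul (2⁻¹ : ℂ)
    refine h1.congr_deriv ?_
    rw [map_smul, map_sub Ω, map_smul Ω, hΩJ, smul_comm a, smul_sub a, smul_smul, ha]
    congr 1
    simp only [smul_neg, neg_smul, one_smul]
    abel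
  have hmain : ∀ t, X (u t) = (2⁻¹ : ℂ) • (X (u t) - Complex.I • J (C (w t))) +
      (2⁻¹ : ℂ) • (X (u t) - (-Complex.I) • J (C (w t))) := fun t => by
    rw [← smul_add]
    have : X (u t) - Complex.I • J (C (w t)) + (X (u t) - (-Complex.I) • J (C (w t))) =
      (2 : ℂ) • X (u t) := by rw [two_smul, neg_smul]; abel
    rw [this, smul_smul]; norm_num
  have ep := eq_fc_exp_of_hasDerivAt hT hsq (z := fun t =>
    (2⁻¹ : ℂ) • (X (u t) - Complex.I • J (C (w t)))) (fun t => by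
      rw [fc_const_mul hT _ hsqc]
      exact hcomb Complex.I (by simp) t) t
  have em := eq_fc_exp_of_hasDerivAt hT hsqn (z := fun t =>
    (2⁻¹ : ℂ) • (X (u t) - (-Complex.I) • J (C (w t)))) (fun t => by
      have : fc T (fun s => Complex.I * ((-√(pm m s) : ℝ) : ℂ)) = (-Complex.I) • Ω := by
        rw [hΩ, ← fc_const_mul hT _ hsqc]
        congr 1; funext s; simp
      rw [this]
      exact hcomb (-Complex.I) (by simp) t) t
  rw [hmain t]
  simp only [hw0] at ep em
  rw [ep, em]
  simp only [map_smul, map_sub, map_add, neg_smul, sub_neg_eq_add]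

end Evolution

end CriticalDecay

namespace CriticalDecay

/-! ### Plancherel's theorem for functions with values in a Hilbert space. -/

section Plancherel

variable {F : Type*} [NormedAddCommGroup F] [InnerProductSpace ℂ F] [CompleteSpace F]
variable {V : Type*} [NormedAddCommGroup V] [InnerProductSpace ℝ V] [FiniteDimensional ℝ V]
  [MeasurableSpace V] [BorelSpace V]

lemma enorm_sq_eq_lintegral {X : Type*} {_ : MeasurableSpace X} {ν : Measure X} (f : Lp F 2 ν) :
    ‖f‖ₑ ^ 2 = ∫⁻ x, ‖f x‖ₑ ^ 2 ∂ν := by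
  rw [Lp.enorm_def, eLpNorm_eq_lintegral_rpow_enorm_toReal (by norm_num) (by norm_num)]
  rw [← ENNReal.rpow_natCast, ← ENNReal.rpow_mul]
  simp

/-- The `L²` Fourier transform of an integrable function is the Fourier integral. -/
lemma fourier_toLp_ae_eq {f : V → F} (hf : Integrable f) (hf2 : MemLp f 2) :
    ((𝓕 (hf2.toLp f) : Lp F 2 (volume : Measure V)) : V → F) =ᵐ[volume] 𝓕 f := by
  have hc : Continuous (𝓕 f) :=
    VectorFourier.fourierIntegral_continuous Real.continuous_fourierChar
      (by exact continuous_inner) hf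
  -- The two sides are compared as distributions: the `L²` transform agrees with the transform by
  -- duality, and for integrable `f` Fubini's theorem moves the Fourier integral onto the test
  -- function.
  refine ae_eq_of_integral_contDiff_smul_eq ((Lp.memLp _).locallyIntegrable one_le_two)
    hc.locallyIntegrable fun φ hφ hφc => ?_
  have hg₁ : HasCompactSupport (Complex.ofRealCLM ∘ φ) := hφc.comp_left rfl
  have hg₂ : ContDiff ℝ ∞ (Complex.ofRealCLM ∘ φ) := by fun_prop
  set Φ : 𝓢(V, ℂ) := hg₁.toSchwartzMap hg₂ with hΦ
  have hΦa : ∀ x, Φ x = (φ x : ℂ) := fun x => rfl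
  have h1 := congrArg (fun D : 𝓢'(V, F) => D Φ) (Lp.fourier_toTemperedDistribution_eq (hf2.toLp f))
  simp only [TemperedDistribution.fourier_apply, Lp.toTemperedDistribution_apply] at h1
  have h2 : ∫ x, (𝓕 Φ) x • (hf2.toLp f) x = ∫ x, (𝓕 Φ) x • f x := by
    refine integral_congr_ae ?_
    filter_upwards [hf2.coeFn_toLp] with x hx
    rw [hx]
  have h3 : ∫ x, (𝓕 (Φ : V → ℂ)) x • f x = ∫ x, Φ x • (𝓕 f) x :=
    VectorFourier.integral_fourierIntegral_smul_eq_flip (L := innerₗ V)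
      Real.continuous_fourierChar continuous_inner Φ.integrable hf |>.trans (by
        rw [flip_innerₗ]; rfl)
  rw [h2, SchwartzMap.fourier_coe, h3] at h1
  simp only [hΦa] at h1
  rw [show (∫ x, φ x • (𝓕 (hf2.toLp f) : Lp F 2 (volume : Measure V)) x) =
    ∫ x, (φ x : ℂ) • (𝓕 (hf2.toLp f) : Lp F 2 (volume : Measure V)) x from rfl, ← h1]
  rfl

lemma lintegral_enorm_fourier_sq {f : V → F} (hf : Integrable f) (hf2 : MemLp f 2) :
    ∫⁻ x, ‖𝓕 f x‖ₑ ^ 2 = ∫⁻ x, ‖f x‖ₑ ^ 2 := by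
  have h1 := enorm_sq_eq_lintegral (𝓕 (hf2.toLp f) : Lp F 2 (volume : Measure V))
  have h2 := enorm_sq_eq_lintegral (hf2.toLp f)
  have h3 : ‖(𝓕 (hf2.toLp f) : Lp F 2 (volume : Measure V))‖ₑ = ‖hf2.toLp f‖ₑ := by
    rw [← ofReal_norm, ← ofReal_norm, Lp.norm_fourier_eq]
  rw [h3, h2] at h1
  calc _ = ∫⁻ x, ‖(𝓕 (hf2.toLp f) : Lp F 2 (volume : Measure V)) x‖ₑ ^ 2 := by
        refine lintegral_congr_ae ?_
        filter_upwards [fourier_toLp_ae_eq hf hf2] with x hx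
        rw [hx]
    _ = _ := by
        rw [← h1]
        refine lintegral_congr_ae ?_
        filter_upwards [hf2.coeFn_toLp] with x hx
        rw [hx]

end Plancherel

/-! ### Resolvents, the Kato bound and two explicit integrals. -/

section Kato

variable {H : Type*} [NormedAddCommGroup H] [InnerProductSpace ℂ H] [CompleteSpace H]
variable {T : H →L[ℂ] H}

/-- If `T = (1 + P)⁻¹`, then `resf ζ` of `T` is `(P - ζ)⁻¹`. -/
noncomputable def resf (ζ : ℂ) (s : ℝ) : ℂ := s / (1 - s - ζ * s)

lemma resf_denom_ne {ζ : ℂ} (hζ : ζ.im ≠ 0) (s : ℝ) : (1 - s - ζ * s : ℂ) ≠ 0 := by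
  intro h
  have him := congrArg Complex.im h
  have hre := congrArg Complex.re h
  simp at him hre
  rcases him with h1 | h1
  · exact hζ h1
  · simp [h1] at hre

lemma continuous_resf {ζ : ℂ} (hζ : ζ.im ≠ 0) : Continuous (resf ζ) := by
  unfold resf
  exact Complex.continuous_ofReal.div (by fun_prop) (resf_denom_ne hζ)

/-- The integrand is bounded by `b` uniformly on the spectrum, so the functional calculus commutes
with the integral over `t`. The transform in time is thus computed on scalars. -/
lemma fourier_fc (hT : IsPosContraction T) (A : H →L[ℂ] H) {g : ℝ → ℝ → ℂ} {b : ℝ → ℝ}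
    (hg : Continuous (Function.uncurry g)) (hb : Integrable b)
    (hgb : ∀ t, ∀ s ∈ Icc (0 : ℝ) 1, ‖g t s‖ ≤ b t) (x : H) (τ : ℝ) :
    𝓕 (fun t => A (fc T (g t) x)) τ = A (fc T (fun s => 𝓕 (fun t => g t s) τ) x) := by
  set g' : ℝ → ℂ → ℂ := fun t z => Real.fourierChar (-(t * τ)) • g t z.re with hg'
  have hn : IsStarNormal T := hT.selfAdj.isStarNormal
  have hc : ContinuousOn (Function.uncurry g') (univ ×ˢ spectrum ℂ T) := by
    refine Continuous.continuousOn ?_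
    simp only [hg', Function.uncurry_def, Circle.smul_def]
    refine Continuous.smul (continuous_subtype_val.comp
      (Real.continuous_fourierChar.comp (by fun_prop))) ?_
    exact hg.comp (continuous_fst.prodMk (Complex.continuous_re.comp continuous_snd))
  have hbd : ∀ᵐ t : ℝ, ∀ z ∈ spectrum ℂ T, ‖g' t z‖ ≤ b t := Eventually.of_forall fun t z hz => by
    rw [hg', Circle.norm_smul]
    exact hgb t _ (hT.spectrum_subset hz).1
  have h1 := cfc_integral g' b T hc hbd hb.2 hn
  have h2 := integrable_cfc g' b T hc hbd hb.2 hn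
  let Λ : (H →L[ℂ] H) →L[ℂ] H := A ∘L ContinuousLinearMap.apply ℂ H x
  have h3 := Λ.integral_comp_comm h2
  rw [← h1] at h3
  simp only [Real.fourier_real_eq]
  refine Eq.trans (integral_congr_ae (Eventually.of_forall fun t => ?_)) h3
  have hcz : ContinuousOn (fun z : ℂ => g t z.re) (spectrum ℂ T) :=
    (hg.comp (continuous_const.prodMk Complex.continuous_re)).continuousOn
  change _ = A (cfc (g' t) T x)
  have : cfc (g' t) T = (Real.fourierChar (-(t * τ)) : ℂ) • fc T (g t) :=
    cfc_smul (Real.fourierChar (-(t * τ)) : ℂ) (fun z : ℂ => g t z.re) T hcz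
  rw [this, smul_apply, map_smul]
  rfl

/-- `‖A (P - ζ)⁻¹‖² ≤ c / |Im ζ|`. -/
def KatoBound (T A : H →L[ℂ] H) (c : ℝ) : Prop :=
  ∀ ζ : ℂ, ζ.im ≠ 0 → ∀ h, ‖A (fc T (resf ζ) h)‖ ^ 2 ≤ c / |ζ.im| * ‖h‖ ^ 2

/-- Insert `(P - ζ)⁻¹(P - ζ)` in front of `k(T)`. The Kato bound absorbs `A (P - ζ)⁻¹`, and the
other factor becomes an integral against the spectral measure. The support condition on `k` makes
the truncated `pm` the true `p`. -/
lemma KatoBound.enorm_le {A : H →L[ℂ] H} {c : ℝ} (hA : KatoBound T A c) (hc : 0 ≤ c)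
    (hT : IsPosContraction T) (m : ℕ) {k : ℝ → ℂ} (hk : Continuous k)
    (hkm : ∀ s, chi m s = 0 → k s = 0) {ζ : ℂ} (hζ : ζ.im ≠ 0) (x : H) :
    ‖A (fc T k x)‖ₑ ^ 2 ≤
      ENNReal.ofReal (c / |ζ.im|) * ∫⁻ s, ‖(pm m s - ζ) * k s‖ₑ ^ 2 ∂(specMeas hT x) := by
  have hk' : Continuous fun s => (pm m s - ζ) * k s :=
    ((Complex.continuous_ofReal.comp (continuous_pm m)).sub continuous_const).mul hk
  rw [← enorm_fc_sq hT x hk'.continuousOn]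
  have e : fc T k x = fc T (resf ζ) (fc T (fun s => (pm m s - ζ) * k s) x) := by
    rw [fc_mul_apply hT (continuous_resf hζ).continuousOn hk'.continuousOn]
    refine congrArg (fun L : H →L[ℂ] H => L x) (congrArg (fc T) (funext fun s => ?_))
    by_cases h0 : chi m s = 0
    · simp [hkm s h0]
    · have h1 := clampC_pos m s
      rw [clampC_of_chi_ne h0] at h1
      have h2 := resf_denom_ne hζ s
      have h3 : (s : ℂ) ≠ 0 := by exact_mod_cast h1.ne'
      rw [resf, pm, clampC_of_chi_ne h0]
      push_cast
      field_simp
      rw [mul_div_assoc, div_self (by rwa [mul_comm] at h2), mul_one]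
  rw [e, ← ofReal_norm, ← ofReal_norm, ← ENNReal.ofReal_pow (norm_nonneg _),
    ← ENNReal.ofReal_pow (norm_nonneg _), ← ENNReal.ofReal_mul (by positivity)]
  exact ENNReal.ofReal_le_ofReal (hA ζ hζ _)

/-- A Poisson kernel in the variable `a + 2πτ`. Its mass is independent of `a`, which makes the
smoothing bound uniform over the spectrum. -/
lemma lintegral_lorentz {ε : ℝ} (hε : 0 < ε) (a : ℝ) :
    ∫⁻ τ : ℝ, ENNReal.ofReal (4 * ε ^ 2 / ((a + 2 * Real.pi * τ) ^ 2 + ε ^ 2)) =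
      ENNReal.ofReal (2 * ε) := by
  have hpi := Real.pi_pos
  have e : ∀ τ : ℝ, 4 * ε ^ 2 / ((a + 2 * Real.pi * τ) ^ 2 + ε ^ 2) =
      4 * (1 + (a / ε + (2 * Real.pi / ε) * τ) ^ 2)⁻¹ := fun τ => by
    field_simp; ring
  have hpos : (2 * Real.pi / ε) ≠ 0 := by positivity
  have hint : Integrable fun τ : ℝ => 4 * (1 + (a / ε + (2 * Real.pi / ε) * τ) ^ 2)⁻¹ :=
    ((integrable_inv_one_add_sq.comp_add_left (a / ε)).comp_mul_left' hpos).const_mul 4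
  simp_rw [e]
  rw [← ofReal_integral_eq_lintegral_ofReal hint (Eventually.of_forall fun τ => by positivity)]
  congr 1
  rw [integral_const_mul]
  have h1 := Measure.integral_comp_mul_left (fun y => (1 + (a / ε + y) ^ 2)⁻¹) (2 * Real.pi / ε)
  rw [h1, integral_add_left_eq_self (fun y => (1 + y ^ 2)⁻¹), integral_univ_inv_one_add_sq,
    smul_eq_mul, abs_of_pos (by positivity)]
  field_simp; ring

lemma integral_exp_neg_abs_mul {ε : ℝ} (hε : 0 < ε) (y : ℝ) :
    ∫ t : ℝ, (Real.exp (-ε * |t|) : ℂ) * Complex.exp (-(t * y * Complex.I)) =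
      2 * ε / (ε ^ 2 + y ^ 2) ∧
    Integrable fun t : ℝ => Real.exp (-ε * |t|) := by
  set a : ℂ := -ε - y * Complex.I
  set b : ℂ := ε - y * Complex.I
  have ha : a.re < 0 := by simp [a, hε]
  have hb : 0 < b.re := by simp [b, hε]
  set f : ℝ → ℂ := fun t => (Real.exp (-ε * |t|) : ℂ) * Complex.exp (-(t * y * Complex.I))
  have h1 : EqOn f (fun t : ℝ => Complex.exp (a * t)) (Ioi 0) := fun t ht => by
    simp only [f, a, abs_of_pos (mem_Ioi.1 ht), Complex.ofReal_exp, ← Complex.exp_add]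
    congr 1; push_cast; ring
  have h2 : EqOn f (fun t : ℝ => Complex.exp (b * t)) (Iic 0) := fun t ht => by
    simp only [f, b, abs_of_nonpos (mem_Iic.1 ht), Complex.ofReal_exp, ← Complex.exp_add]
    congr 1; push_cast; ring
  have i1 : IntegrableOn f (Ioi 0) :=
    (integrableOn_exp_mul_complex_Ioi ha 0).congr_fun h1.symm measurableSet_Ioi
  have i2 : IntegrableOn f (Iic 0) :=
    (integrableOn_exp_mul_complex_Iic hb 0).congr_fun h2.symm measurableSet_Iic
  have hi : Integrable f := by
    rw [← integrableOn_univ, ← Iic_union_Ioi (a := (0 : ℝ))]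
    exact i2.union i1
  constructor
  · rw [← setIntegral_univ, ← Iic_union_Ioi (a := (0 : ℝ)),
      setIntegral_union (by simp) measurableSet_Ioi i2 i1,
      setIntegral_congr_fun measurableSet_Iic h2, setIntegral_congr_fun measurableSet_Ioi h1,
      integral_exp_mul_complex_Ioi ha, integral_exp_mul_complex_Iic hb]
    have ha0 : a ≠ 0 := fun h => by simp [h] at ha
    have hb0 : b ≠ 0 := fun h => by simp [h] at hb
    have hab : (ε ^ 2 + y ^ 2 : ℂ) = -(a * b) := by
      simp only [a, b]; ring_nf; simp [Complex.I_sq]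
    rw [hab]
    have : (2 * ε : ℂ) = b - a := by simp only [a, b]; ring
    rw [this]
    field_simp
    simp; ring
  · refine hi.norm.congr (Eventually.of_forall fun t => ?_)
    simp only [f, norm_mul, Complex.norm_real, Complex.norm_exp]
    simp [abs_of_pos (Real.exp_pos _)]

end Kato

end CriticalDecay

namespace CriticalDecay

/-! ### Kato smoothing for the Schrödinger flow. -/

section KatoSmoothing

variable {H : Type*} [NormedAddCommGroup H] [InnerProductSpace ℂ H] [CompleteSpace H]
variable {T : H →L[ℂ] H}

/-- A jointly continuous family varies continuously in the supremum norm of the compact interval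
`[0,1]`, and this norm dominates the operator norm. -/
lemma continuous_fc_apply (hT : IsPosContraction T) {g : ℝ → ℝ → ℂ}
    (hg : Continuous (Function.uncurry g)) (x : H) : Continuous fun t => fc T (g t) x := by
  have hn : IsStarNormal T := hT.selfAdj.isStarNormal
  have hg' : ∀ t, Continuous (g t) := fun t => hg.comp (continuous_const.prodMk continuous_id)
  let G : ℝ → C(Icc (0 : ℝ) 1, ℂ) := fun t => ⟨fun s => g t s, (hg' t).comp continuous_subtype_val⟩
  have hG : Continuous G := ContinuousMap.continuous_of_continuous_uncurry _
    (hg.comp (continuous_fst.prodMk (continuous_subtype_val.comp continuous_snd)))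
  rw [continuous_iff_continuousAt]
  intro t₀
  have h1 : Tendsto (fun t => ‖G t - G t₀‖ * ‖x‖) (𝓝 t₀) (𝓝 0) := by
    have := ((hG.tendsto t₀).sub_const (G t₀)).norm.mul_const ‖x‖
    simpa using this
  rw [ContinuousAt, tendsto_iff_norm_sub_tendsto_zero]
  refine squeeze_zero (fun _ => norm_nonneg _) (fun t => ?_) h1
  rw [← sub_apply, ← fc_sub hT (hg' t).continuousOn (hg' t₀).continuousOn]
  exact norm_fc_apply_le hT (norm_nonneg _)
    (fun s hs => (G t - G t₀).norm_coe_le_norm ⟨s, hs⟩) x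

/-- Plancherel's theorem for `t ↦ A g(t, T) x`. -/
lemma lintegral_fourier_fc (hT : IsPosContraction T) (A : H →L[ℂ] H) {g : ℝ → ℝ → ℂ} {b : ℝ → ℝ}
    (hg : Continuous (Function.uncurry g)) (hb : Integrable b) {M : ℝ} (hbM : ∀ t, b t ≤ M)
    (hgb : ∀ t, ∀ s ∈ Icc (0 : ℝ) 1, ‖g t s‖ ≤ b t) (x : H) :
    ∫⁻ τ, ‖A (fc T (fun s => 𝓕 (fun t => g t s) τ) x)‖ₑ ^ 2 =
      ∫⁻ t, ‖A (fc T (g t) x)‖ₑ ^ 2 := by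
  have hb0 : ∀ t, 0 ≤ b t := fun t => (norm_nonneg _).trans (hgb t 0 (by simp))
  have hcont : Continuous fun t => A (fc T (g t) x) := A.continuous.comp (continuous_fc_apply hT hg x)
  have hbound : ∀ t, ‖A (fc T (g t) x)‖ ≤ b t * (‖A‖ * ‖x‖) := fun t => by
    refine (A.le_opNorm _).trans ?_
    calc ‖A‖ * ‖fc T (g t) x‖ ≤ ‖A‖ * (b t * ‖x‖) := by
          gcongr; exact norm_fc_apply_le hT (hb0 t) (hgb t) x
      _ = _ := by ring
  have hi : Integrable fun t => A (fc T (g t) x) :=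
    (hb.mul_const _).mono' hcont.aestronglyMeasurable (Eventually.of_forall hbound)
  have h2 : MemLp (fun t => A (fc T (g t) x)) 2 := by
    rw [memLp_two_iff_integrable_sq_norm hcont.aestronglyMeasurable]
    refine (((hb.mul_const (‖A‖ * ‖x‖)).mul_const (M * (‖A‖ * ‖x‖)))).mono'
      (hcont.norm.pow 2).aestronglyMeasurable (Eventually.of_forall fun t => ?_)
    rw [Real.norm_of_nonneg (by positivity), sq]
    have : ‖A (fc T (g t) x)‖ ≤ M * (‖A‖ * ‖x‖) :=
      (hbound t).trans (by gcongr; exact hbM t)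
    exact mul_le_mul (hbound t) this (norm_nonneg _) (mul_nonneg (hb0 t) (by positivity))
  rw [← lintegral_enorm_fourier_sq hi h2]
  refine lintegral_congr fun τ => ?_
  rw [fourier_fc hT A hg hb hgb]

/-- At time frequency `τ` the damped flow is a Poisson kernel of `P` at height `ε`. For `ζ = -2πτ +
iε` one has `|p - ζ|² = (p + 2πτ)² + ε²`, so the factor `|p - ζ|²` coming from `KatoBound.enorm_le`
cancels one of the two kernels in the square. The other one has mass `2ε` in `τ`, against the factor
`c/ε`; the product `2c` depends neither on `ε` nor on `m`. -/
lemma schrodinger_step (hT : IsPosContraction T) {A : H →L[ℂ] H} {c : ℝ} (hc : 0 ≤ c)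
    (hA : KatoBound T A c) (m : ℕ) {ε : ℝ} (hε : 0 < ε) (x : H) :
    ∫⁻ t : ℝ, ‖(Real.exp (-ε * |t|) : ℂ) •
        A (fc T (fun s => Complex.exp (t * (Complex.I * ((-pm m s : ℝ) : ℂ))))
          (fc T (fun s => (chi m s : ℂ)) x))‖ₑ ^ 2 ≤ ENNReal.ofReal (2 * c) * ‖x‖ₑ ^ 2 := by
  have hpm := continuous_pm m
  have hχ := continuous_chi m
  set g : ℝ → ℝ → ℂ := fun t s => (chi m s : ℂ) * ((Real.exp (-ε * |t|) : ℂ) *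
    Complex.exp (t * (Complex.I * ((-pm m s : ℝ) : ℂ)))) with hg
  have hgc : Continuous (Function.uncurry g) := by
    simp only [hg, Function.uncurry_def]
    have h1 : Continuous fun p : ℝ × ℝ => (chi m p.2 : ℂ) :=
      Complex.continuous_ofReal.comp (hχ.comp continuous_snd)
    have h2 : Continuous fun p : ℝ × ℝ => ((-pm m p.2 : ℝ) : ℂ) :=
      Complex.continuous_ofReal.comp (hpm.comp continuous_snd).neg
    fun_prop
  have hgn : ∀ t s, ‖g t s‖ ≤ Real.exp (-ε * |t|) := fun t s => by
    rw [hg]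
    simp only [norm_mul, Complex.norm_exp, Complex.norm_real, Real.norm_eq_abs,
      abs_of_nonneg (chi_nonneg m s), abs_of_pos (Real.exp_pos _)]
    have : (t * (Complex.I * ((-pm m s : ℝ) : ℂ)) : ℂ).re = 0 := by simp
    rw [this, Real.exp_zero, mul_one]
    exact mul_le_of_le_one_left (Real.exp_pos _).le (chi_le_one m s)
  have hfour : ∀ τ s, 𝓕 (fun t => g t s) τ =
      ((chi m s * (2 * ε / (ε ^ 2 + (pm m s + 2 * Real.pi * τ) ^ 2)) : ℝ) : ℂ) := fun τ s => by
    have h1 := (integral_exp_neg_abs_mul hε (pm m s + 2 * Real.pi * τ)).1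
    rw [Real.fourier_real_eq_integral_exp_smul]
    push_cast
    push_cast at h1
    rw [← h1, ← integral_const_mul]
    refine integral_congr_ae (Eventually.of_forall fun t => ?_)
    simp only [hg, smul_eq_mul]
    rw [show (-(t * (pm m s + 2 * Real.pi * τ) * Complex.I) : ℂ) =
      (↑(-2 * Real.pi * t * τ) * Complex.I) + (t * (Complex.I * ((-pm m s : ℝ) : ℂ))) by
        push_cast; ring, Complex.exp_add]
    push_cast
    ring
  have hP := lintegral_fourier_fc hT A hgc (integral_exp_neg_abs_mul hε 0).2 (M := 1)
    (fun t => Real.exp_le_one_iff.2 (by nlinarith [abs_nonneg t])) (fun t s _ => hgn t s) x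
  have hL : ∀ t : ℝ, (Real.exp (-ε * |t|) : ℂ) •
        A (fc T (fun s => Complex.exp (t * (Complex.I * ((-pm m s : ℝ) : ℂ))))
          (fc T (fun s => (chi m s : ℂ)) x)) = A (fc T (g t) x) := fun t => by
    have hec : Continuous fun s => Complex.exp (t * (Complex.I * ((-pm m s : ℝ) : ℂ))) := by
      have h2 : Continuous fun s : ℝ => ((-pm m s : ℝ) : ℂ) :=
        Complex.continuous_ofReal.comp hpm.neg
      fun_prop
    have hm : ContinuousOn (fun s => Complex.exp (t * (Complex.I * ((-pm m s : ℝ) : ℂ))) *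
        (chi m s : ℂ)) (Icc 0 1) := hec.continuousOn.mul (ofReal_continuousOn hχ)
    rw [fc_mul_apply hT hec.continuousOn (ofReal_continuousOn hχ), ← map_smul,
      ← smul_apply, ← fc_const_mul hT _ hm]
    congr 1
    refine congrArg (fun L : H →L[ℂ] H => L x) (congrArg (fc T) (funext fun s => ?_))
    simp only [hg]; ring
  simp_rw [hL]
  rw [← hP]
  simp_rw [hfour]
  have hk : ∀ τ, Continuous fun s : ℝ => 
      chi m s * (2 * ε / (ε ^ 2 + (pm m s + 2 * Real.pi * τ) ^ 2)) := fun τ => by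
    refine hχ.mul (continuous_const.div (by fun_prop) fun s => ?_)
    positivity
  have hmeas : Measurable (Function.uncurry fun (τ : ℝ) (s : Icc (0 : ℝ) 1) =>
      ENNReal.ofReal (chi m s ^ 2) *
        ENNReal.ofReal (4 * ε ^ 2 / ((pm m s + 2 * Real.pi * τ) ^ 2 + ε ^ 2))) := by
    have h1 : Measurable fun p : ℝ × Icc (0 : ℝ) 1 => chi m p.2 :=
      (hχ.comp (continuous_subtype_val.comp continuous_snd)).measurable
    have h2 : Measurable fun p : ℝ × Icc (0 : ℝ) 1 => pm m p.2 :=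
      (hpm.comp (continuous_subtype_val.comp continuous_snd)).measurable
    simp only [Function.uncurry_def]
    fun_prop
  calc ∫⁻ τ, ‖A (fc T (fun s => ((chi m s * (2 * ε / (ε ^ 2 + (pm m s + 2 * Real.pi * τ) ^ 2)) :
          ℝ) : ℂ)) x)‖ₑ ^ 2
      ≤ ∫⁻ τ, ENNReal.ofReal (c / ε) * ∫⁻ s, ENNReal.ofReal (chi m s ^ 2) * ENNReal.ofReal
          (4 * ε ^ 2 / ((pm m s + 2 * Real.pi * τ) ^ 2 + ε ^ 2)) ∂(specMeas hT x) := by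
        refine lintegral_mono fun τ => ?_
        set ζ : ℂ := ((-(2 * Real.pi * τ) : ℝ) : ℂ) + ε * Complex.I with hζ
        have him : ζ.im = ε := by simp [hζ]
        have h := hA.enorm_le hc hT m (Complex.continuous_ofReal.comp (hk τ))
          (fun s hs => by simp [hs]) (ζ := ζ) (by rw [him]; exact hε.ne') x
        rw [him, abs_of_pos hε] at h
        refine h.trans (le_of_eq ?_)
        congr 1
        refine lintegral_congr fun s => ?_
        rw [← ENNReal.ofReal_mul (by positivity), ← ofReal_norm,
          ← ENNReal.ofReal_pow (norm_nonneg _), norm_mul, mul_pow]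
        congr 1
        have e1 : ‖(pm m s - ζ : ℂ)‖ ^ 2 = (pm m s + 2 * Real.pi * τ) ^ 2 + ε ^ 2 := by
          rw [← Complex.normSq_eq_norm_sq, Complex.normSq_apply]
          simp [hζ]; ring
        rw [e1, Function.comp_apply, Complex.norm_real, Real.norm_eq_abs, sq_abs]
        have : (pm m s + 2 * Real.pi * τ) ^ 2 + ε ^ 2 ≠ 0 := by positivity
        rw [add_comm (ε ^ 2)]
        field_simp
        ring
    _ = ENNReal.ofReal (c / ε) * ∫⁻ s, (∫⁻ τ, ENNReal.ofReal (chi m s ^ 2) * ENNReal.ofReal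
          (4 * ε ^ 2 / ((pm m s + 2 * Real.pi * τ) ^ 2 + ε ^ 2))) ∂(specMeas hT x) := by
        rw [lintegral_const_mul' _ _ ENNReal.ofReal_ne_top, lintegral_lintegral_swap
          hmeas.aemeasurable]
    _ = ENNReal.ofReal (c / ε) * ∫⁻ s, ENNReal.ofReal (chi m s ^ 2) * ENNReal.ofReal (2 * ε)
          ∂(specMeas hT x) := by
        congr 1
        refine lintegral_congr fun s => ?_
        rw [lintegral_const_mul' _ _ ENNReal.ofReal_ne_top, lintegral_lorentz hε]
    _ ≤ ENNReal.ofReal (c / ε) * ((∫⁻ s, ‖(1 : ℂ)‖ₑ ^ 2 ∂(specMeas hT x)) *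
          ENNReal.ofReal (2 * ε)) := by
        rw [lintegral_mul_const' _ _ ENNReal.ofReal_ne_top]
        gcongr with s
        rw [enorm_one, one_pow]
        exact ENNReal.ofReal_le_one.2 (pow_le_one₀ (chi_nonneg m s) (chi_le_one m s))
    _ = ENNReal.ofReal (2 * c) * ‖x‖ₑ ^ 2 := by
        rw [← enorm_fc_sq hT x (f := fun _ => 1) continuousOn_const, fc_one hT, mul_comm (_ ^ 2),
          ← mul_assoc, ← ENNReal.ofReal_mul (by positivity)]
        congr 2
        field_simp

/-- Kato smoothing for the Schrödinger equation. -/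
theorem lintegral_schrodinger_le (hT : IsPosContraction T) (h0 : ∀ x, T x = 0 → x = 0)
    (h1 : ∀ x, T x = x → x = 0) {A : H →L[ℂ] H} {c : ℝ} (hc : 0 ≤ c) (hA : KatoBound T A c)
    {u : ℝ → H} (hu : Continuous u)
    (h : ∀ η t, HasDerivAt (fun s => ⟪T η, u s⟫_ℂ) (-Complex.I * ⟪η - T η, u t⟫_ℂ) t) :
    ∫⁻ t, ‖A (u t)‖ₑ ^ 2 ≤ ENNReal.ofReal (2 * c) * ‖u 0‖ₑ ^ 2 := by
  -- The damping and the spectral cutoff are removed together by Fatou's lemma.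
  set ε : ℕ → ℝ := fun m => 1 / (m + 1) with hε
  have hεlim : Tendsto ε atTop (𝓝 0) := tendsto_one_div_add_atTop_nhds_zero_nat
  set G : ℕ → ℝ → H := fun m t => (Real.exp (-ε m * |t|) : ℂ) •
    A (fc T (fun s => (chi m s : ℂ)) (u t)) with hG
  have hlim : ∀ t, Tendsto (fun m => ‖G m t‖ₑ ^ 2) atTop (𝓝 (‖A (u t)‖ₑ ^ 2)) := fun t => by
    have e1 : Tendsto (fun m => (Real.exp (-ε m * |t|) : ℂ)) atTop (𝓝 1) := by
      have : Tendsto (fun m => Real.exp (-ε m * |t|)) atTop (𝓝 (Real.exp (-0 * |t|))) :=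
        (Real.continuous_exp.tendsto _).comp ((hεlim.neg).mul_const _)
      simp only [neg_zero, zero_mul, Real.exp_zero] at this
      exact_mod_cast (Complex.continuous_ofReal.tendsto _).comp this
    have e2 := e1.smul ((A.continuous.tendsto _).comp (tendsto_fc_chi hT h0 h1 (u t)))
    rw [one_smul] at e2
    exact (ENNReal.continuous_pow 2).tendsto _ |>.comp e2.enorm
  calc ∫⁻ t, ‖A (u t)‖ₑ ^ 2 = ∫⁻ t, liminf (fun m => ‖G m t‖ₑ ^ 2) atTop :=
        lintegral_congr fun t => (hlim t).liminf_eq.symm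
    _ ≤ liminf (fun m => ∫⁻ t, ‖G m t‖ₑ ^ 2) atTop := by
        refine lintegral_liminf_le fun m => ?_
        have : Continuous (G m) := by simp only [hG]; fun_prop
        exact this.enorm.measurable.pow_const 2
    _ ≤ ENNReal.ofReal (2 * c) * ‖u 0‖ₑ ^ 2 := by
        refine liminf_le_of_le (by isBoundedDefault) fun b hb => ?_
        obtain ⟨m, hm⟩ := hb.exists
        refine hm.trans ?_
        refine (le_of_eq (lintegral_congr fun t => ?_)).trans
          (schrodinger_step hT hc hA m (ε := ε m) (by positivity) (u 0))
        rw [hG, ← schrodinger_truncated hT hu h m t]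

end KatoSmoothing

end CriticalDecay

namespace CriticalDecay

/-! ### The tent function as an approximate identity. -/

section Tent

/-- The tent function. -/
noncomputable def tent (y : ℝ) : ℝ := max 0 (1 - |y|)

lemma continuous_tent : Continuous tent := by unfold tent; fun_prop

lemma tent_nonneg (y : ℝ) : 0 ≤ tent y := le_max_left _ _

lemma tent_le_one (y : ℝ) : tent y ≤ 1 := max_le zero_le_one (by linarith [abs_nonneg y])

lemma tent_eq_zero {y : ℝ} (h : 1 ≤ |y|) : tent y = 0 := max_eq_left (by linarith)

lemma hasCompactSupport_tent : HasCompactSupport tent :=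
  HasCompactSupport.intro (isCompact_Icc (a := -1) (b := 1)) fun y hy => tent_eq_zero <| by
    by_contra! h
    exact hy (abs_le.1 h.le)

lemma integrable_tent : Integrable tent :=
  continuous_tent.integrable_of_hasCompactSupport hasCompactSupport_tent

lemma integral_tent : ∫ y, tent y = 1 := by
  have h1 : ∫ y, tent y = ∫ y in (-1 : ℝ)..1, tent y := by
    rw [intervalIntegral.integral_of_le (by norm_num), setIntegral_eq_integral_of_forall_compl_eq_zero]
    intro y hy
    refine tent_eq_zero ?_
    by_contra! h
    exact hy ⟨(abs_lt.1 h).1, (abs_lt.1 h).2.le⟩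
  have hi : ∀ a b, IntervalIntegrable tent volume a b := fun a b =>
    continuous_tent.intervalIntegrable a b
  have h2 : ∫ y in (-1 : ℝ)..0, tent y = ∫ y in (-1 : ℝ)..0, (1 + y) := by
    refine intervalIntegral.integral_congr fun y hy => ?_
    rw [uIcc_of_le (by norm_num)] at hy
    simp only [tent, abs_of_nonpos hy.2]
    rw [max_eq_right (by linarith [hy.1])]; ring
  have h3 : ∫ y in (0 : ℝ)..1, tent y = ∫ y in (0 : ℝ)..1, (1 - y) := by
    refine intervalIntegral.integral_congr fun y hy => ?_
    rw [uIcc_of_le (by norm_num)] at hy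
    simp only [tent, abs_of_nonneg hy.1]
    rw [max_eq_right (by linarith [hy.2])]
  rw [h1, ← intervalIntegral.integral_add_adjacent_intervals (hi (-1) 0) (hi 0 1), h2, h3,
    intervalIntegral.integral_add (by simp) (by simp),
    intervalIntegral.integral_sub (by simp) (by simp)]
  simp
  norm_num

end Tent

/-! ### Kato smoothing for the wave flow. -/

section HalfWave

variable {H : Type*} [NormedAddCommGroup H] [InnerProductSpace ℂ H] [CompleteSpace H]
variable {T : H →L[ℂ] H}

lemma integral_comp_add_div (F : ℝ → ℂ) (a : ℝ) {ε : ℝ} (hε : 0 < ε) :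
    ∫ τ, F ((τ + a) / ε) = ε * ∫ y, F y := by
  rw [integral_add_right_eq_self (fun τ => F (τ / ε)), Measure.integral_comp_div, abs_of_pos hε]
  simp

lemma lintegral_tent_comp (a : ℝ) {ε : ℝ} (hε : 0 < ε) :
    ∫⁻ τ, ENNReal.ofReal (tent ((τ + a) / ε)) = ENNReal.ofReal ε := by
  have hi : Integrable fun τ => tent ((τ + a) / ε) :=
    (integrable_tent.comp_div hε.ne').comp_add_right a
  rw [← ofReal_integral_eq_lintegral_ofReal hi (Eventually.of_forall fun τ => tent_nonneg _),
    integral_add_right_eq_self (fun τ => tent (τ / ε)), Measure.integral_comp_div, abs_of_pos hε,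
    integral_tent, smul_eq_mul, mul_one]

/-- The regularisation is made in frequency: `g(τ, ·)` is a tent of width `ε` about `τ = -√p/(2π)`,
and its Fourier transform is the half wave times `𝓕 tent (εt)`. Compact support in `τ` keeps `p`
close to `4π²τ²`, and the Kato bound is used at a point whose imaginary part has the size of this
uncertainty. That size is about `4πε√p`, which is the source of the weight `√p`. -/
lemma halfWave_step (hT : IsPosContraction T) {A : H →L[ℂ] H} {c : ℝ} (hc : 0 ≤ c)
    (hA : KatoBound T A c) (m : ℕ) {ε : ℝ} (hε : 0 < ε) (x : H) :
    ∫⁻ t : ℝ, ‖𝓕 (fun y => (tent y : ℂ)) (ε * t) •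
        A (fc T (fun s => Complex.exp (t * (Complex.I * ((√(pm m s) : ℝ) : ℂ))))
          (fc T (fun s => (chi m s : ℂ)) x))‖ₑ ^ 2 ≤
      ∫⁻ s, ENNReal.ofReal (8 * Real.pi ^ 2 * c * (√(pm m s) / Real.pi + 3 * ε) * chi m s ^ 2)
        ∂(specMeas hT x) := by
  have hpi := Real.pi_pos
  have hsq : Continuous fun s => √(pm m s) := (continuous_pm m).sqrt
  have hχ := continuous_chi m
  set w : ℝ → ℝ := fun s => √(pm m s) / (2 * Real.pi) with hwdef
  have hwc : Continuous w := hsq.div_const _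
  have hw0 : ∀ s, 0 ≤ w s := fun s => by positivity
  obtain ⟨W, hW⟩ : ∃ W, ∀ s ∈ Icc (0 : ℝ) 1, w s ≤ W := by
    obtain ⟨W, hW⟩ := (isCompact_Icc (a := (0 : ℝ)) (b := 1)).bddAbove_image hwc.continuousOn
    exact ⟨W, fun s hs => hW ⟨s, hs, rfl⟩⟩
  set g : ℝ → ℝ → ℂ := fun τ s => ((chi m s * (tent ((τ + w s) / ε) / ε) : ℝ) : ℂ) with hg
  have hgr : Continuous fun p : ℝ × ℝ => chi m p.2 * (tent ((p.1 + w p.2) / ε) / ε) := by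
    have h1 : Continuous fun p : ℝ × ℝ => tent ((p.1 + w p.2) / ε) :=
      continuous_tent.comp (by fun_prop)
    have h2 : Continuous fun p : ℝ × ℝ => chi m p.2 := hχ.comp continuous_snd
    fun_prop
  have hgc : Continuous (Function.uncurry g) := Complex.continuous_ofReal.comp hgr
  -- As `w ≤ W` on `[0,1]`, the tents for all spectral parameters have their supports in one compact
  -- interval.
  set b : ℝ → ℝ := (Icc (-(ε + W)) (ε + W)).indicator fun _ => ε⁻¹ with hb
  have hbi : Integrable b := by
    rw [hb, integrable_indicator_iff measurableSet_Icc]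
    exact integrableOn_const (by simp)
  have hbM : ∀ t, b t ≤ ε⁻¹ := fun t => indicator_le_self' (fun _ _ => by positivity) t
  have hgn : ∀ τ s, ‖g τ s‖ = chi m s * (tent ((τ + w s) / ε) / ε) := fun τ s => by
    rw [hg, Complex.norm_real, Real.norm_of_nonneg]
    exact mul_nonneg (chi_nonneg m s) (div_nonneg (tent_nonneg _) hε.le)
  have hgb : ∀ t, ∀ s ∈ Icc (0 : ℝ) 1, ‖g t s‖ ≤ b t := fun t s hs => by
    rw [hgn]
    by_cases ht : t ∈ Icc (-(ε + W)) (ε + W)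
    · rw [hb, indicator_of_mem ht, ← one_mul ε⁻¹, div_eq_mul_inv]
      exact mul_le_mul (chi_le_one m s) (mul_le_of_le_one_left (by positivity) (tent_le_one _))
        (mul_nonneg (tent_nonneg _) (by positivity)) zero_le_one
    · rw [hb, indicator_of_notMem ht, tent_eq_zero]
      · simp
      · rw [abs_div, abs_of_pos hε, le_div_iff₀ hε, one_mul]
        by_contra! h
        rw [abs_lt] at h
        exact ht ⟨by linarith [hW s hs], by linarith [hw0 s, hW s hs]⟩
  have hfour : ∀ t s, 𝓕 (fun τ => g τ s) t = 𝓕 (fun y => (tent y : ℂ)) (ε * t) *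
      (Complex.exp (t * (Complex.I * ((√(pm m s) : ℝ) : ℂ))) * (chi m s : ℂ)) := fun t s => by
    simp only [Real.fourier_real_eq_integral_exp_smul]
    have h1 := integral_comp_add_div (fun y : ℝ => Complex.exp (↑(-2 * Real.pi * (ε * y - w s) * t) *
      Complex.I) • ((chi m s * (tent y / ε) : ℝ) : ℂ)) (w s) hε
    have h2 : ∀ τ, ε * ((τ + w s) / ε) - w s = τ := fun τ => by field_simp; ring
    simp only [h2] at h1
    rw [hg, h1, ← integral_const_mul, ← integral_mul_const]
    refine integral_congr_ae (Eventually.of_forall fun y => ?_)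
    simp only [smul_eq_mul]
    have h3 : (↑(-2 * Real.pi * (ε * y - w s) * t) * Complex.I : ℂ) =
        ↑(-2 * Real.pi * y * (ε * t)) * Complex.I +
          t * (Complex.I * ((√(pm m s) : ℝ) : ℂ)) := by
      simp only [hwdef]
      have : (Real.pi : ℂ) ≠ 0 := by exact_mod_cast hpi.ne'
      push_cast
      field_simp
      ring
    rw [h3, Complex.exp_add]
    have : (ε : ℂ) ≠ 0 := by exact_mod_cast hε.ne'
    push_cast
    field_simp
  have hP := lintegral_fourier_fc hT A hgc hbi hbM hgb x
  have hL : ∀ t : ℝ, 𝓕 (fun y => (tent y : ℂ)) (ε * t) •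
        A (fc T (fun s => Complex.exp (t * (Complex.I * ((√(pm m s) : ℝ) : ℂ))))
          (fc T (fun s => (chi m s : ℂ)) x)) = A (fc T (fun s => 𝓕 (fun τ => g τ s) t) x) :=
    fun t => by
    have hec : Continuous fun s => Complex.exp (t * (Complex.I * ((√(pm m s) : ℝ) : ℂ))) := by
      have h2 : Continuous fun s : ℝ => ((√(pm m s) : ℝ) : ℂ) :=
        Complex.continuous_ofReal.comp hsq
      fun_prop
    have hm : ContinuousOn (fun s => Complex.exp (t * (Complex.I * ((√(pm m s) : ℝ) : ℂ))) *
        (chi m s : ℂ)) (Icc 0 1) := hec.continuousOn.mul (ofReal_continuousOn hχ)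
    simp only [hfour]
    rw [fc_mul_apply hT hec.continuousOn (ofReal_continuousOn hχ), ← map_smul,
      ← smul_apply, ← fc_const_mul hT _ hm]
  simp_rw [hL]
  rw [hP]
  have hmeas : Measurable (Function.uncurry fun (τ : ℝ) (s : Icc (0 : ℝ) 1) =>
      ENNReal.ofReal (8 * Real.pi ^ 2 * c * (√(pm m s) / Real.pi + 3 * ε) * chi m s ^ 2 / ε) *
        ENNReal.ofReal (tent ((τ + w s) / ε))) := by
    have h1 : Measurable fun p : ℝ × Icc (0 : ℝ) 1 => chi m p.2 :=
      (hχ.comp (continuous_subtype_val.comp continuous_snd)).measurable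
    have h2 : Measurable fun p : ℝ × Icc (0 : ℝ) 1 => √(pm m p.2) :=
      (hsq.comp (continuous_subtype_val.comp continuous_snd)).measurable
    have h3 : Measurable fun p : ℝ × Icc (0 : ℝ) 1 => tent ((p.1 + w p.2) / ε) :=
      (continuous_tent.comp ((continuous_fst.add
        (hwc.comp (continuous_subtype_val.comp continuous_snd))).div_const ε)).measurable
    simp only [Function.uncurry_def]
    fun_prop
  calc ∫⁻ τ, ‖A (fc T (g τ) x)‖ₑ ^ 2
      ≤ ∫⁻ τ, ∫⁻ s, ENNReal.ofReal
          (8 * Real.pi ^ 2 * c * (√(pm m s) / Real.pi + 3 * ε) * chi m s ^ 2 / ε) *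
            ENNReal.ofReal (tent ((τ + w s) / ε)) ∂(specMeas hT x) := by
        refine lintegral_mono fun τ => ?_
        -- On the support of the tent `√p/(2π)` and `|τ|` differ by at most `ε`, whence `|p - 4π²τ²|
        -- ≤ l`. With imaginary part `l` this gives `|p - ζ|² ≤ 2l²`, while the Kato factor is
        -- `c/l`.
        set l : ℝ := 4 * Real.pi ^ 2 * ε * (2 * |τ| + ε) with hl
        have hlpos : 0 < l := by positivity
        set ζ : ℂ := ((4 * Real.pi ^ 2 * |τ| ^ 2 : ℝ) : ℂ) + l * Complex.I with hζ
        have him : ζ.im = l := by simp [hζ, -Complex.ofReal_mul, -Complex.ofReal_pow]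
        have h := hA.enorm_le hc hT m (k := g τ)
          (hgc.comp (continuous_const.prodMk continuous_id))
          (fun s hs => by simp [hg, hs]) (ζ := ζ) (by rw [him]; exact hlpos.ne') x
        rw [him, abs_of_pos hlpos, ← lintegral_const_mul' _ _ ENNReal.ofReal_ne_top] at h
        refine h.trans (lintegral_mono fun s => ?_)
        rw [← ENNReal.ofReal_mul (by have := chi_nonneg m s; positivity), ← ofReal_norm,
          ← ENNReal.ofReal_pow (norm_nonneg _), ← ENNReal.ofReal_mul (by positivity)]
        refine ENNReal.ofReal_le_ofReal ?_
        rw [norm_mul, mul_pow, hgn]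
        set y := (τ + w s) / ε with hy
        by_cases hy1 : 1 ≤ |y|
        · rw [tent_eq_zero hy1]; simp
        push Not at hy1
        rw [hy, abs_div, abs_of_pos hε, div_lt_one hε] at hy1
        have e0 : w s = √(pm m s) / (2 * Real.pi) := rfl
        have e1 : pm m s = 4 * Real.pi ^ 2 * w s ^ 2 := by
          rw [e0, div_pow, Real.sq_sqrt (pm_pos m s).le]; field_simp; ring
        have e2 : abs (w s - |τ|) ≤ ε := by
          have := abs_abs_sub_abs_le_abs_sub (w s) (-τ)
          rw [abs_of_nonneg (hw0 s), abs_neg, sub_neg_eq_add, add_comm] at this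
          exact this.trans hy1.le
        have e3 : |pm m s - 4 * Real.pi ^ 2 * |τ| ^ 2| ≤ l := by
          have : pm m s - 4 * Real.pi ^ 2 * |τ| ^ 2 =
            4 * Real.pi ^ 2 * ((w s - |τ|) * (w s + |τ|)) := by rw [e1]; ring
          rw [this, abs_mul, abs_of_pos (by positivity), abs_mul,
            abs_of_nonneg (by have := hw0 s; positivity : 0 ≤ w s + |τ|), hl]
          have e4 : w s + |τ| ≤ 2 * |τ| + ε := by linarith [(abs_le.1 e2).2]
          have h5 := mul_le_mul e2 e4 (by have := hw0 s; positivity) hε.le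
          calc 4 * Real.pi ^ 2 * (abs (w s - |τ|) * (w s + |τ|))
              ≤ 4 * Real.pi ^ 2 * (ε * (2 * |τ| + ε)) := by gcongr
            _ = _ := by ring
        have e5 : ‖(pm m s - ζ : ℂ)‖ ^ 2 ≤ 2 * l ^ 2 := by
          have : ‖(pm m s - ζ : ℂ)‖ ^ 2 = (pm m s - 4 * Real.pi ^ 2 * |τ| ^ 2) ^ 2 + l ^ 2 := by
            rw [← Complex.normSq_eq_norm_sq, Complex.normSq_apply]
            simp [hζ, -Complex.ofReal_mul, -Complex.ofReal_pow]; ring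
          rw [this]
          have := sq_le_sq' (abs_le.1 e3).1 (abs_le.1 e3).2
          linarith
        have e6 : l ≤ 4 * Real.pi ^ 2 * ε * (√(pm m s) / Real.pi + 3 * ε) := by
          have : √(pm m s) / Real.pi = 2 * w s := by rw [e0]; field_simp
          rw [this, hl]
          have := (abs_le.1 e2).1
          gcongr 4 * Real.pi ^ 2 * ε * ?_
          linarith
        have e7 : tent y ^ 2 ≤ tent y := by
          rw [sq]; exact mul_le_of_le_one_left (tent_nonneg _) (tent_le_one _)
        calc c / l * (‖(pm m s - ζ : ℂ)‖ ^ 2 * (chi m s * (tent y / ε)) ^ 2)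
            ≤ c / l * (2 * l ^ 2 * (chi m s * (tent y / ε)) ^ 2) := by gcongr
          _ = 2 * c * l * chi m s ^ 2 * tent y ^ 2 / ε ^ 2 := by field_simp
          _ ≤ 2 * c * (4 * Real.pi ^ 2 * ε * (√(pm m s) / Real.pi + 3 * ε)) * chi m s ^ 2 *
                tent y / ε ^ 2 := by gcongr
          _ = _ := by field_simp; ring
    _ = ∫⁻ s, (∫⁻ τ, ENNReal.ofReal
          (8 * Real.pi ^ 2 * c * (√(pm m s) / Real.pi + 3 * ε) * chi m s ^ 2 / ε) *
            ENNReal.ofReal (tent ((τ + w s) / ε))) ∂(specMeas hT x) :=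
        lintegral_lintegral_swap hmeas.aemeasurable
    _ = _ := by
        refine lintegral_congr fun s => ?_
        rw [lintegral_const_mul' _ _ ENNReal.ofReal_ne_top, lintegral_tent_comp _ hε,
          ← ENNReal.ofReal_mul (by have := chi_nonneg m s; positivity)]
        congr 1
        field_simp

/-- Fatou's lemma as the tent shrinks: `𝓕 tent (εt) → 1` because the tent has integral `1`, and the
error `3ε` of `halfWave_step` disappears because the spectral measure is finite. -/
lemma lintegral_halfWave_le (hT : IsPosContraction T) {A : H →L[ℂ] H} {c : ℝ} (hc : 0 ≤ c)
    (hA : KatoBound T A c) (m : ℕ) (x : H) :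
    ∫⁻ t : ℝ, ‖A (fc T (fun s => Complex.exp (t * (Complex.I * ((√(pm m s) : ℝ) : ℂ))))
          (fc T (fun s => (chi m s : ℂ)) x))‖ₑ ^ 2 ≤
      ENNReal.ofReal (8 * Real.pi * c) *
        ‖fc T (fun s => ((chi m s * √√(pm m s) : ℝ) : ℂ)) x‖ₑ ^ 2 := by
  have hpi := Real.pi_pos
  have hsq : Continuous fun s => √(pm m s) := (continuous_pm m).sqrt
  have hχ := continuous_chi m
  set ε : ℕ → ℝ := fun k => 1 / (k + 1) with hε
  have hεlim : Tendsto ε atTop (𝓝 0) := tendsto_one_div_add_atTop_nhds_zero_nat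
  have hεpos : ∀ k, 0 < ε k := fun k => by positivity
  set y : ℝ → H := fun t => A (fc T (fun s => Complex.exp (t * (Complex.I * ((√(pm m s) : ℝ) : ℂ))))
          (fc T (fun s => (chi m s : ℂ)) x)) with hy
  have hyc : Continuous y := by
    refine A.continuous.comp (continuous_fc_apply hT ?_ _)
    have h2 : Continuous fun p : ℝ × ℝ => ((√(pm m p.2) : ℝ) : ℂ) :=
      Complex.continuous_ofReal.comp (hsq.comp continuous_snd)
    simp only [Function.uncurry_def]
    fun_prop
  set κ : ℝ → ℂ := 𝓕 (fun y => (tent y : ℂ)) with hκ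
  have hκc : Continuous κ :=
    VectorFourier.fourierIntegral_continuous Real.continuous_fourierChar
      (by exact continuous_inner) integrable_tent.ofReal
  have hκ0 : κ 0 = 1 := by
    rw [hκ, Real.fourier_real_eq_integral_exp_smul]
    simp only [mul_zero, Complex.ofReal_zero, zero_mul, Complex.exp_zero, one_smul]
    rw [integral_complex_ofReal, integral_tent, Complex.ofReal_one]
  have hlim : ∀ t, Tendsto (fun k => ‖κ (ε k * t) • y t‖ₑ ^ 2) atTop (𝓝 (‖y t‖ₑ ^ 2)) := fun t => by
    have e1 : Tendsto (fun k => κ (ε k * t)) atTop (𝓝 1) := by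
      have h1 := hεlim.mul_const t
      rw [zero_mul] at h1
      rw [← hκ0]
      exact (hκc.tendsto 0).comp h1
    have e2 := e1.smul_const (y t)
    rw [one_smul] at e2
    exact (ENNReal.continuous_pow 2).tendsto _ |>.comp e2.enorm
  set X : ℝ≥0∞ := ENNReal.ofReal (8 * Real.pi * c) *
        ‖fc T (fun s => ((chi m s * √√(pm m s) : ℝ) : ℂ)) x‖ₑ ^ 2 with hX
  have hq4 : Continuous fun s => chi m s * √√(pm m s) := hχ.mul hsq.sqrt
  have hXe : X = ∫⁻ s, ENNReal.ofReal (8 * Real.pi * c) *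
      ENNReal.ofReal (√(pm m s) * chi m s ^ 2) ∂(specMeas hT x) := by
    rw [hX, enorm_fc_sq hT x (ofReal_continuousOn hq4),
      ← lintegral_const_mul' _ _ ENNReal.ofReal_ne_top]
    refine lintegral_congr fun s => ?_
    rw [← ofReal_norm, ← ENNReal.ofReal_pow (norm_nonneg _), Complex.norm_real, Real.norm_eq_abs,
      sq_abs, mul_pow, Real.sq_sqrt (Real.sqrt_nonneg _), mul_comm (chi m s ^ 2)]
  have hstep : ∀ k, ∫⁻ t, ‖κ (ε k * t) • y t‖ₑ ^ 2 ≤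
      X + ENNReal.ofReal (24 * Real.pi ^ 2 * c * ε k) * specMeas hT x univ := fun k => by
    refine (halfWave_step hT hc hA m (hεpos k) x).trans ?_
    have hk := hεpos k
    rw [hXe, ← lintegral_const, ← lintegral_add_right _ measurable_const]
    refine lintegral_mono fun s => ?_
    have h0 := chi_nonneg m s
    have h1 : chi m s ^ 2 ≤ 1 := pow_le_one₀ h0 (chi_le_one m s)
    rw [← ENNReal.ofReal_mul (by positivity), ← ENNReal.ofReal_add (by positivity) (by positivity)]
    refine ENNReal.ofReal_le_ofReal ?_
    calc 8 * Real.pi ^ 2 * c * (√(pm m s) / Real.pi + 3 * ε k) * chi m s ^ 2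
        = 8 * Real.pi * c * (√(pm m s) * chi m s ^ 2) +
          24 * Real.pi ^ 2 * c * ε k * chi m s ^ 2 := by field_simp; ring
      _ ≤ 8 * Real.pi * c * (√(pm m s) * chi m s ^ 2) + 24 * Real.pi ^ 2 * c * ε k * 1 := by gcongr
      _ = _ := by ring
  have hlim2 : Tendsto (fun k => X + ENNReal.ofReal (24 * Real.pi ^ 2 * c * ε k) *
      specMeas hT x univ) atTop (𝓝 X) := by
    have h1 : Tendsto (fun k => ENNReal.ofReal (24 * Real.pi ^ 2 * c * ε k)) atTop (𝓝 0) := by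
      have := ENNReal.tendsto_ofReal (hεlim.const_mul (24 * Real.pi ^ 2 * c))
      simpa using this
    have h2 := ENNReal.Tendsto.mul_const h1 (b := specMeas hT x univ)
      (Or.inr (measure_ne_top _ _))
    rw [zero_mul] at h2
    simpa using h2.const_add X
  calc ∫⁻ t, ‖y t‖ₑ ^ 2 = ∫⁻ t, liminf (fun k => ‖κ (ε k * t) • y t‖ₑ ^ 2) atTop :=
        lintegral_congr fun t => (hlim t).liminf_eq.symm
    _ ≤ liminf (fun k => ∫⁻ t, ‖κ (ε k * t) • y t‖ₑ ^ 2) atTop := by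
        refine lintegral_liminf_le fun k => ?_
        have : Continuous fun t => κ (ε k * t) • y t := by fun_prop
        exact this.enorm.measurable.pow_const 2
    _ ≤ liminf (fun k => X + ENNReal.ofReal (24 * Real.pi ^ 2 * c * ε k) *
      specMeas hT x univ) atTop := liminf_le_liminf (Eventually.of_forall hstep)
    _ = X := hlim2.liminf_eq

lemma ENNReal_add_sq_le (x y : ℝ≥0∞) : (x + y) ^ 2 ≤ 4 * (x ^ 2 + y ^ 2) := by
  have key : ∀ x y : ℝ≥0∞, x ≤ y → (x + y) ^ 2 ≤ 4 * (x ^ 2 + y ^ 2) := fun x y h => by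
    calc (x + y) ^ 2 ≤ (2 * y) ^ 2 := by rw [two_mul]; gcongr
      _ = 4 * y ^ 2 := by rw [mul_pow]; norm_num
      _ ≤ _ := by gcongr; exact le_add_self
  rcases le_total x y with h | h
  · exact key x y h
  · rw [add_comm x, add_comm (x ^ 2)]; exact key y x h

/-- Kato smoothing for the wave equation. -/
theorem lintegral_wave_le (hT : IsPosContraction T) (h0 : ∀ x, T x = 0 → x = 0)
    (h1 : ∀ x, T x = x → x = 0) {A : H →L[ℂ] H} {c : ℝ} (hc : 0 ≤ c) (hA : KatoBound T A c)
    {u : ℝ → H} {g : H} (hu : Continuous u)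
    (h : ∀ η, ∃ d : ℝ → ℂ, d 0 = ⟪T η, g⟫_ℂ ∧ ∀ t : ℝ,
      HasDerivAt (fun s : ℝ => ⟪T η, u s⟫_ℂ) (d t) t ∧ HasDerivAt d (-⟪η - T η, u t⟫_ℂ) t)
    {α β : ℝ≥0∞} (hα : ∀ m, ‖fc T (fun s => ((chi m s * √√(pm m s) : ℝ) : ℂ)) (u 0)‖ₑ ≤ α)
    (hβ : ∀ m, ‖fc T (fun s => ((chi m s * (1 / √√(pm m s)) : ℝ) : ℂ)) g‖ₑ ≤ β) :
    ∫⁻ t, ‖A (u t)‖ₑ ^ 2 ≤ ENNReal.ofReal (64 * Real.pi * c) * (α + β) ^ 2 := by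
  have hpi := Real.pi_pos
  set G : ℕ → ℝ → H := fun m t => A (fc T (fun s => (chi m s : ℂ)) (u t)) with hG
  have hlim : ∀ t, Tendsto (fun m => ‖G m t‖ₑ ^ 2) atTop (𝓝 (‖A (u t)‖ₑ ^ 2)) := fun t =>
    (ENNReal.continuous_pow 2).tendsto _ |>.comp
      ((A.continuous.tendsto _).comp (tendsto_fc_chi hT h0 h1 (u t))).enorm
  have hm : ∀ m, ∫⁻ t, ‖G m t‖ₑ ^ 2 ≤ ENNReal.ofReal (64 * Real.pi * c) * (α + β) ^ 2 := fun m => by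
    have hsq : Continuous fun s => √(pm m s) := (continuous_pm m).sqrt
    have hχ := continuous_chi m
    have hsqpos : ∀ s, 0 < √(pm m s) := fun s => Real.sqrt_pos.2 (pm_pos m s)
    have hinv : Continuous fun s => 1 / √(pm m s) :=
      continuous_const.div hsq fun s => (hsqpos s).ne'
    set J := fc T (fun s => ((1 / √(pm m s) : ℝ) : ℂ)) with hJ
    set hp := (2⁻¹ : ℂ) • (u 0 - Complex.I • J g) with hhp
    set hn := (2⁻¹ : ℂ) • (u 0 + Complex.I • J g) with hhn
    set yp : ℝ → H := fun t => A (fc T (fun s => Complex.exp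
      (t * (Complex.I * ((√(pm m s) : ℝ) : ℂ)))) (fc T (fun s => (chi m s : ℂ)) hp)) with hyp
    set yn : ℝ → H := fun t => A (fc T (fun s => Complex.exp
      (t * (Complex.I * ((√(pm m s) : ℝ) : ℂ)))) (fc T (fun s => (chi m s : ℂ)) hn)) with hyn
    -- The half wave with frequency `-√p` is the other one run backwards in time, so a single
    -- estimate serves both.
    have hGe : ∀ t, G m t = yp t + yn (-t) := fun t => by
      simp only [hG, hyp, hyn]
      rw [wave_truncated hT hu h m t, map_add]
      congr 3
      refine congrArg (fc T) (funext fun s => ?_)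
      push_cast; ring_nf
    -- `√√p · (1/√p) = 1/√√p`: the velocity enters with the weight `P^{-1/4}`.
    have hB : ‖fc T (fun s => ((chi m s * √√(pm m s) : ℝ) : ℂ)) (J g)‖ₑ ≤ β := by
      have hq4 : Continuous fun s => chi m s * √√(pm m s) := hχ.mul hsq.sqrt
      rw [hJ, fc_mul_apply hT (ofReal_continuousOn hq4) (ofReal_continuousOn hinv)]
      refine (le_of_eq ?_).trans (hβ m)
      congr 2
      refine congrArg (fc T) (funext fun s => ?_)
      rw [← Complex.ofReal_mul]
      congr 1
      have h2 := Real.sqrt_pos.2 (hsqpos s)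
      nth_rw 2 [← Real.mul_self_sqrt (hsqpos s).le]
      field_simp
    have hhalf : ∀ v : H, ‖(2⁻¹ : ℂ) • v‖ₑ ≤ ‖v‖ₑ := fun v => by
      rw [enorm_smul]
      refine mul_le_of_le_one_left zero_le ?_
      rw [← ofReal_norm]
      refine ENNReal.ofReal_le_one.2 ?_
      norm_num
    have hI : ∀ v : H, ‖Complex.I • v‖ₑ = ‖v‖ₑ := fun v => by
      rw [enorm_smul, ← ofReal_norm Complex.I]; simp
    have hP : ‖fc T (fun s => ((chi m s * √√(pm m s) : ℝ) : ℂ)) hp‖ₑ ≤ α + β := by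
      rw [hhp, map_smul, map_sub, map_smul]
      refine (hhalf _).trans ((enorm_sub_le).trans ?_)
      rw [hI]
      exact add_le_add (hα m) hB
    have hN : ‖fc T (fun s => ((chi m s * √√(pm m s) : ℝ) : ℂ)) hn‖ₑ ≤ α + β := by
      rw [hhn, map_smul, map_add, map_smul]
      refine (hhalf _).trans ((enorm_add_le _ _).trans ?_)
      rw [hI]
      exact add_le_add (hα m) hB
    have hcont : ∀ v, Continuous fun t : ℝ => A (fc T (fun s => Complex.exp
      (t * (Complex.I * ((√(pm m s) : ℝ) : ℂ)))) v) := fun v => by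
      refine A.continuous.comp (continuous_fc_apply hT ?_ _)
      have h2 : Continuous fun p : ℝ × ℝ => ((√(pm m p.2) : ℝ) : ℂ) :=
        Complex.continuous_ofReal.comp (hsq.comp continuous_snd)
      simp only [Function.uncurry_def]
      fun_prop
    calc ∫⁻ t, ‖G m t‖ₑ ^ 2 ≤ ∫⁻ t, 4 * (‖yp t‖ₑ ^ 2 + ‖yn (-t)‖ₑ ^ 2) := by
          refine lintegral_mono fun t => ?_
          rw [hGe]
          refine le_trans ?_ (ENNReal_add_sq_le _ _)
          gcongr
          exact enorm_add_le _ _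
      _ = 4 * ((∫⁻ t, ‖yp t‖ₑ ^ 2) + ∫⁻ t, ‖yn t‖ₑ ^ 2) := by
          rw [lintegral_const_mul' _ _ (by norm_num),
            lintegral_add_left ((hcont _).enorm.measurable.pow_const 2)]
          congr 2
          have := lintegral_sub_left_eq_self (μ := (volume : Measure ℝ)) (fun t => ‖yn t‖ₑ ^ 2) 0
          simpa using this
      _ ≤ 4 * (ENNReal.ofReal (8 * Real.pi * c) * (α + β) ^ 2 +
            ENNReal.ofReal (8 * Real.pi * c) * (α + β) ^ 2) := by
          gcongr
          · exact (lintegral_halfWave_le hT hc hA m hp).trans (by gcongr)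
          · exact (lintegral_halfWave_le hT hc hA m hn).trans (by gcongr)
      _ = ENNReal.ofReal (64 * Real.pi * c) * (α + β) ^ 2 := by
          rw [← two_mul, ← mul_assoc, ← mul_assoc]
          congr 1
          rw [show (4 * 2 : ℝ≥0∞) = ENNReal.ofReal 8 by norm_num,
            ← ENNReal.ofReal_mul (by norm_num)]
          congr 1; ring
  calc ∫⁻ t, ‖A (u t)‖ₑ ^ 2 = ∫⁻ t, liminf (fun m => ‖G m t‖ₑ ^ 2) atTop :=
        lintegral_congr fun t => (hlim t).liminf_eq.symm
    _ ≤ liminf (fun m => ∫⁻ t, ‖G m t‖ₑ ^ 2) atTop := by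
        refine lintegral_liminf_le fun m => ?_
        have : Continuous (G m) := by simp only [hG]; fun_prop
        exact this.enorm.measurable.pow_const 2
    _ ≤ _ := by
        refine liminf_le_of_le (by isBoundedDefault) fun b hb => ?_
        obtain ⟨m, hm'⟩ := hb.exists
        exact hm'.trans (hm m)

end HalfWave

end CriticalDecay

namespace CriticalDecay

/-! ### Partial derivatives and the divergence theorem off the origin. -/

section PartialDerivatives

variable {n : ℕ}

/-- The partial derivative `∂ⱼf(x)`. -/
noncomputable def pd {G : Type*} [NormedAddCommGroup G] [NormedSpace ℝ G]
    (j : Fin n) (f : E n → G) (x : E n) : G :=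
  fderiv ℝ f x (EuclideanSpace.single j 1)

section Rules

variable {G : Type*} [NormedAddCommGroup G] [NormedSpace ℝ G] {j : Fin n} {x : E n}

lemma pd_add {f g : E n → G} (hf : DifferentiableAt ℝ f x) (hg : DifferentiableAt ℝ g x) :
    pd j (fun y => f y + g y) x = pd j f x + pd j g x := by
  simp [pd, fderiv_fun_add hf hg]

lemma pd_sub {f g : E n → G} (hf : DifferentiableAt ℝ f x) (hg : DifferentiableAt ℝ g x) :
    pd j (fun y => f y - g y) x = pd j f x - pd j g x := by
  simp [pd, fderiv_fun_sub hf hg]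

lemma pd_sum {ι : Type*} {s : Finset ι} {f : ι → E n → G}
    (hf : ∀ i ∈ s, DifferentiableAt ℝ (f i) x) :
    pd j (fun y => ∑ i ∈ s, f i y) x = ∑ i ∈ s, pd j (f i) x := by
  simp [pd, fderiv_fun_sum hf]

lemma pd_const (c : G) : pd j (fun _ : E n => c) x = 0 := by simp [pd]

lemma pd_mul {A : Type*} [NormedCommRing A] [NormedAlgebra ℝ A] {f g : E n → A}
    (hf : DifferentiableAt ℝ f x) (hg : DifferentiableAt ℝ g x) :
    pd j (fun y => f y * g y) x = pd j f x * g x + f x * pd j g x := by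
  simp [pd, fderiv_fun_mul hf hg, mul_comm, add_comm]

lemma pd_const_mul {A : Type*} [NormedCommRing A] [NormedAlgebra ℝ A] {f : E n → A} (c : A)
    (hf : DifferentiableAt ℝ f x) :
    pd j (fun y => c * f y) x = c * pd j f x := by
  rw [pd_mul (differentiableAt_const c) hf, pd_const, zero_mul, zero_add]

lemma pd_clm {G' : Type*} [NormedAddCommGroup G'] [NormedSpace ℝ G'] (l : G →L[ℝ] G')
    {f : E n → G} (hf : DifferentiableAt ℝ f x) :
    pd j (fun y => l (f y)) x = l (pd j f x) := by
  have := (l.hasFDerivAt.comp x hf.hasFDerivAt).fderiv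
  simp only [pd]
  rw [show (fun y => l (f y)) = l ∘ f from rfl, this]; rfl

lemma pd_congr {f g : E n → G} (h : f =ᶠ[𝓝 x] g) : pd j f x = pd j g x := by
  simp [pd, h.fderiv_eq]

lemma pd_comp_real {f : ℝ → G} {f' : G} {g : E n → ℝ} (hf : HasDerivAt f f' (g x))
    (hg : DifferentiableAt ℝ g x) : pd j (fun y => f (g y)) x = pd j g x • f' := by
  have := (hf.hasFDerivAt.comp x hg.hasFDerivAt).fderiv
  simp only [pd]
  rw [show (fun y => f (g y)) = f ∘ g from rfl, this]; simp

lemma pd_coord (k : Fin n) : pd j (fun y : E n => y k) x = if k = j then 1 else 0 := by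
  have : (fun y : E n => y k) = (EuclideanSpace.proj k : E n →L[ℝ] ℝ) := rfl
  rw [pd, this, ContinuousLinearMap.fderiv]
  simp [EuclideanSpace.proj]

lemma pd_norm (hx : x ≠ 0) : pd j (fun y : E n => ‖y‖) x = x j / ‖x‖ := by
  have h1 : HasFDerivAt (fun y : E n => ‖y‖ ^ 2) (2 • innerSL ℝ x) x :=
    (hasStrictFDerivAt_norm_sq x).hasFDerivAt
  have hd : DifferentiableAt ℝ (fun y : E n => ‖y‖) x :=
    (contDiffAt_norm ℝ hx (n := 1)).differentiableAt (by norm_num)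
  have h2 : pd j (fun y : E n => ‖y‖ * ‖y‖) x = 2 * x j := by
    have : (fun y : E n => ‖y‖ * ‖y‖) = fun y => ‖y‖ ^ 2 := by ext y; ring
    rw [this, pd, h1.fderiv]
    simp [EuclideanSpace.inner_single_right]
  rw [pd_mul hd hd] at h2
  have := norm_pos_iff.2 hx
  field_simp
  linarith

lemma norm_sq_eq_sum (x : E n) : ‖x‖ ^ 2 = ∑ j, x j ^ 2 := by
  simp [EuclideanSpace.norm_sq_eq]

lemma sum_coord_mul_pd (f : E n → G) (x : E n) :
    ∑ j, x j • pd j f x = fderiv ℝ f x x := by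
  have h : x = ∑ j, x j • (EuclideanSpace.single j (1 : ℝ) : E n) := by
    ext k
    simp [Finset.sum_apply, Pi.single_apply]
  conv_rhs => rw [h, map_sum]
  simp only [map_smul, pd]
  rw [← h]

lemma laplacian_eq_sum_pd {f : E n → G} (hf : ContDiffAt ℝ 2 f x) :
    (Δ f) x = ∑ j, pd j (pd j f) x := by
  rw [InnerProductSpace.laplacian_eq_iteratedFDeriv_orthonormalBasis f
    (EuclideanSpace.basisFun (Fin n) ℝ)]
  refine Finset.sum_congr rfl fun j _ => ?_
  rw [iteratedFDeriv_two_apply]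
  have h1 : DifferentiableAt ℝ (fderiv ℝ f) x :=
    (hf.fderiv_right (m := 1) (by norm_num)).differentiableAt (by norm_num)
  unfold pd
  rw [fderiv_clm_apply h1 (differentiableAt_const _)]
  simp

lemma pd_comm {f : E n → G} (hf : ContDiffAt ℝ 2 f x) (j k : Fin n) :
    pd j (pd k f) x = pd k (pd j f) x := by
  have h1 : DifferentiableAt ℝ (fderiv ℝ f) x :=
    (hf.fderiv_right (m := 1) (by norm_num)).differentiableAt (by norm_num)
  unfold pd
  rw [fderiv_clm_apply h1 (differentiableAt_const _), fderiv_clm_apply h1 (differentiableAt_const _)]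
  simpa using (hf.isSymmSndFDerivAt (by simp)).eq _ _

lemma contDiff_pd {f : E n → G} {m k : WithTop ℕ∞} (hf : ContDiff ℝ k f) (h : m + 1 ≤ k) (j : Fin n) :
    ContDiff ℝ m (pd j f) :=
  (hf.fderiv_right h).clm_apply contDiff_const

lemma contDiffOn_pd {f : E n → G} {m k : WithTop ℕ∞} (hf : ContDiffOn ℝ k f {0}ᶜ) (h : m + 1 ≤ k)
    (j : Fin n) : ContDiffOn ℝ m (pd j f) {0}ᶜ :=
  (hf.fderiv_of_isOpen isOpen_compl_singleton h).clm_apply contDiffOn_const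

lemma pd_eq_zero_of_notMem {f : E n → G} {K : Set (E n)} (hK : IsClosed K)
    (hf : ∀ y ∉ K, f y = 0) (hx : x ∉ K) : pd j f x = 0 := by
  have : f =ᶠ[𝓝 x] fun _ => 0 := by
    filter_upwards [hK.isOpen_compl.mem_nhds hx] with y hy using hf y hy
  rw [pd_congr this, pd_const]

end Rules

lemma volume_singleton_zero_compl (hn : n ≠ 0) : ∀ᵐ x : E n, x ≠ 0 := by
  have : NeZero n := ⟨hn⟩
  have : Nontrivial (E n) := inferInstance
  exact (measure_eq_zero_iff_ae_notMem.1 (measure_singleton (0 : E n))).mono fun x hx => by simpa using hx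

lemma integrable_of_continuousOn_compl {G : Type*} [NormedAddCommGroup G]
    {K : Set (E n)} (hK : IsCompact K) (h0 : (0 : E n) ∉ K) {f : E n → G}
    (hf : ContinuousOn f {0}ᶜ) (hz : ∀ x ∉ K, f x = 0) : Integrable f := by
  have h1 : ContinuousOn f K := hf.mono fun x hx h => h0 (by rw [← mem_singleton_iff.1 h]; exact hx)
  refine (integrableOn_iff_integrable_of_support_subset ?_).1 (h1.integrableOn_compact hK)
  intro x hx
  by_contra h
  exact hx (hz x h)

/-- Near the origin the function vanishes, since `K` is closed and misses it. Singular radial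
factors are harmless for this reason. -/
lemma contDiff_of_contDiffOn_compl {G : Type*} [NormedAddCommGroup G] [NormedSpace ℝ G]
    {K : Set (E n)} (hK : IsClosed K) (h0 : (0 : E n) ∉ K) {f : E n → G} {m : WithTop ℕ∞}
    (hf : ContDiffOn ℝ m f {0}ᶜ) (hz : ∀ x ∉ K, f x = 0) : ContDiff ℝ m f := by
  rw [contDiff_iff_contDiffAt]
  intro x
  by_cases hx : x = 0
  · have : f =ᶠ[𝓝 x] fun _ => 0 := by
      filter_upwards [hK.isOpen_compl.mem_nhds (by rw [hx]; exact h0)] with y hy using hz y hy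
    exact contDiffAt_const.congr_of_eventuallyEq this
  · exact hf.contDiffAt (isOpen_compl_singleton.mem_nhds hx)

/-- Integration by parts for functions on `ℝⁿ ∖ {0}`. -/
lemma integral_mul_pd_eq_neg {𝕜 : Type*} [RCLike 𝕜]
    {K : Set (E n)} (hK : IsCompact K) (h0 : (0 : E n) ∉ K) {f g : E n → 𝕜}
    (hf : ContDiff ℝ 1 f) (hg : ContDiff ℝ 1 g) (hz : ∀ x ∉ K, g x = 0) (j : Fin n) :
    ∫ x, f x * pd j g x = - ∫ x, pd j f x * g x := by
  have hf' : Continuous (pd j f) := (contDiff_pd (m := 0) hf (by norm_num) j).continuous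
  have hg' : Continuous (pd j g) := (contDiff_pd (m := 0) hg (by norm_num) j).continuous
  refine integral_mul_fderiv_eq_neg_fderiv_mul_of_integrable ?_ ?_ ?_
    (fun x _ => hf.differentiable (by norm_num) x)
    (fun x _ => hg.differentiable (by norm_num) x)
  · exact integrable_of_continuousOn_compl hK h0 (hf'.mul hg.continuous).continuousOn
      fun x hx => by simp [hz x hx]
  · refine integrable_of_continuousOn_compl hK h0 (hf.continuous.mul hg').continuousOn
      fun x hx => ?_
    change f x * pd j g x = 0
    rw [pd_eq_zero_of_notMem hK.isClosed hz hx, mul_zero]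
  · exact integrable_of_continuousOn_compl hK h0 (hf.continuous.mul hg.continuous).continuousOn
      fun x hx => by simp [hz x hx]

lemma integral_pd_eq_zero
    {K : Set (E n)} (hK : IsCompact K) (h0 : (0 : E n) ∉ K) {f : E n → ℝ}
    (hf : ContDiffOn ℝ 1 f {0}ᶜ) (hz : ∀ x ∉ K, f x = 0) (j : Fin n) :
    ∫ x, pd j f x = 0 := by
  have h := integral_mul_pd_eq_neg (f := fun _ => (1 : ℝ)) hK h0 contDiff_const
    (contDiff_of_contDiffOn_compl hK.isClosed h0 hf hz) hz j
  simpa [pd_const] using h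

/-- The divergence theorem for vector fields compactly supported in `ℝⁿ ∖ {0}`. -/
lemma integral_div_eq_zero (hn : n ≠ 0)
    {K : Set (E n)} (hK : IsCompact K) (h0 : (0 : E n) ∉ K) {F : Fin n → E n → ℝ}
    (hF : ∀ j, ContDiffOn ℝ 1 (F j) {0}ᶜ) (hz : ∀ j, ∀ x ∉ K, F j x = 0) {D : E n → ℝ}
    (hD : ∀ x, x ≠ 0 → ∑ j, pd j (F j) x = D x) :
    Integrable D ∧ ∫ x, D x = 0 := by
  have hi : ∀ j, Integrable (pd j (F j)) := fun j =>
    integrable_of_continuousOn_compl hK h0 (contDiffOn_pd (m := 0) (hF j) (by norm_num) j).continuousOn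
      fun x hx => pd_eq_zero_of_notMem hK.isClosed (hz j) hx
  have hae : (fun x => ∑ j, pd j (F j) x) =ᵐ[volume] D :=
    (volume_singleton_zero_compl hn).mono hD
  refine ⟨(integrable_finsetSum _ fun j _ => hi j).congr hae, ?_⟩
  rw [← integral_congr_ae hae, integral_finsetSum _ fun j _ => hi j]
  exact Finset.sum_eq_zero fun j _ => integral_pd_eq_zero hK h0 (hF j) (hz j) j

end PartialDerivatives

end CriticalDecay

namespace CriticalDecay

/-! ### Divergence identities for the multiplier method. -/

section Multiplier

variable {n : ℕ} {K : Set (E n)} {v : E n → ℝ}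

lemma sum_pd_mul_coord (x : E n) {g : E n → ℝ} (hg : DifferentiableAt ℝ g x) :
    ∑ j, pd j (fun y => g y * y j) x = n * g x + ∑ j, x j * pd j g x := by
  have : ∀ j, pd j (fun y : E n => g y * y j) x = g x + x j * pd j g x := fun j => by
    rw [pd_mul hg (by fun_prop), pd_coord, if_pos rfl]; ring
  simp [this, Finset.sum_add_distrib]

/-- `∫ div(W v² x) = 0`. -/
lemma integral_virial (hn : n ≠ 0) (hK : IsCompact K) (h0 : (0 : E n) ∉ K)
    (hv : ContDiff ℝ 1 v) (hz : ∀ x ∉ K, v x = 0)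
    {W D : E n → ℝ} (hW : ContDiffOn ℝ 1 W {0}ᶜ) (hD : ∀ x, x ≠ 0 → ∑ j, x j * pd j W x = D x) :
    Integrable (fun x => 2 * W x * v x * (∑ j, x j * pd j v x) + (n * W x + D x) * v x ^ 2) ∧
    ∫ x, (2 * W x * v x * (∑ j, x j * pd j v x) + (n * W x + D x) * v x ^ 2) = 0 := by
  refine integral_div_eq_zero hn hK h0 (F := fun j x => (W x * (v x * v x)) * x j)
    (fun j => ?_) (fun j x hx => by simp [hz x hx]) fun x hx => ?_
  · exact (hW.mul (hv.contDiffOn.mul hv.contDiffOn)).mul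
      (EuclideanSpace.proj j : E n →L[ℝ] ℝ).contDiff.contDiffOn
  · have hWx : DifferentiableAt ℝ W x :=
      (hW.contDiffAt (isOpen_compl_singleton.mem_nhds hx)).differentiableAt (by norm_num)
    have hvx : DifferentiableAt ℝ v x := hv.differentiable (by norm_num) x
    rw [sum_pd_mul_coord x (hWx.fun_mul (hvx.fun_mul hvx)), ← hD x hx]
    have : ∀ j, x j * pd j (fun y => W y * (v y * v y)) x =
        (x j * pd j W x) * v x ^ 2 + 2 * W x * v x * (x j * pd j v x) := fun j => by
      rw [pd_mul hWx (hvx.fun_mul hvx), pd_mul hvx hvx]; ring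
    simp only [this, Finset.sum_add_distrib, ← Finset.sum_mul, ← Finset.mul_sum]
    ring

/-- `∫ div(A v ∇v) = 0`. -/
lemma integral_div_mul_grad (hn : n ≠ 0) (hK : IsCompact K) (h0 : (0 : E n) ∉ K)
    (hv : ContDiff ℝ 2 v) (hz : ∀ x ∉ K, v x = 0)
    {A a : E n → ℝ} (hA : ContDiffOn ℝ 1 A {0}ᶜ) (ha : ∀ x, x ≠ 0 → ∀ j, pd j A x = a x * x j) :
    Integrable (fun x => A x * v x * (∑ j, pd j (pd j v) x) + A x * (∑ j, pd j v x ^ 2)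
      + a x * (∑ j, x j * pd j v x) * v x) ∧
    ∫ x, (A x * v x * (∑ j, pd j (pd j v) x) + A x * (∑ j, pd j v x ^ 2)
      + a x * (∑ j, x j * pd j v x) * v x) = 0 := by
  have hp : ∀ j, ContDiff ℝ 1 (pd j v) := fun j => contDiff_pd hv (by norm_num) j
  have hv1 : ContDiff ℝ 1 v := hv.of_le (by norm_num)
  refine integral_div_eq_zero hn hK h0 (F := fun j x => (A x * v x) * pd j v x)
    (fun j => ?_) (fun j x hx => by simp [hz x hx]) fun x hx => ?_
  · exact (hA.mul hv1.contDiffOn).mul (hp j).contDiffOn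
  · have hAx : DifferentiableAt ℝ A x :=
      (hA.contDiffAt (isOpen_compl_singleton.mem_nhds hx)).differentiableAt (by norm_num)
    have hvx : DifferentiableAt ℝ v x := hv.differentiable (by norm_num) x
    have : ∀ j, pd j (fun y => (A y * v y) * pd j v y) x =
        A x * v x * pd j (pd j v) x + A x * pd j v x ^ 2 + a x * (x j * pd j v x) * v x := fun j => by
      rw [pd_mul (hAx.fun_mul hvx) ((hp j).differentiable (by norm_num) x), pd_mul hAx hvx, ha x hx]
      ring
    simp only [this, Finset.sum_add_distrib, ← Finset.sum_mul, ← Finset.mul_sum]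

/-- `∫ div(2 A (x·∇v) ∇v - A |∇v|² x) = 0`. -/
lemma integral_pohozaev (hn : n ≠ 0) (hK : IsCompact K) (h0 : (0 : E n) ∉ K)
    (hv : ContDiff ℝ 2 v) (hz : ∀ x ∉ K, v x = 0)
    {A a : E n → ℝ} (hA : ContDiffOn ℝ 1 A {0}ᶜ) (ha : ∀ x, x ≠ 0 → ∀ j, pd j A x = a x * x j) :
    Integrable (fun x => 2 * A x * (∑ j, x j * pd j v x) * (∑ j, pd j (pd j v) x)
      + (2 * A x - n * A x - a x * ‖x‖ ^ 2) * (∑ j, pd j v x ^ 2)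
      + 2 * a x * (∑ j, x j * pd j v x) ^ 2) ∧
    ∫ x, (2 * A x * (∑ j, x j * pd j v x) * (∑ j, pd j (pd j v) x)
      + (2 * A x - n * A x - a x * ‖x‖ ^ 2) * (∑ j, pd j v x ^ 2)
      + 2 * a x * (∑ j, x j * pd j v x) ^ 2) = 0 := by
  have hp : ∀ j, ContDiff ℝ 1 (pd j v) := fun j => contDiff_pd hv (by norm_num) j
  have hpz : ∀ j, ∀ x ∉ K, pd j v x = 0 := fun j x hx => pd_eq_zero_of_notMem hK.isClosed hz hx
  have hx1 : ∀ j : Fin n, ContDiff ℝ 1 (fun x : E n => x j) := fun j =>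
    (EuclideanSpace.proj j : E n →L[ℝ] ℝ).contDiff
  have hy : ContDiff ℝ 1 (fun x : E n => ∑ k, x k * pd k v x) :=
    ContDiff.sum fun k _ => (hx1 k).mul (hp k)
  have hg : ContDiff ℝ 1 (fun x : E n => ∑ k, pd k v x * pd k v x) :=
    ContDiff.sum fun k _ => (hp k).mul (hp k)
  refine integral_div_eq_zero hn hK h0
    (F := fun j x => (2 * A x) * ((∑ k, x k * pd k v x) * pd j v x)
      - (A x * ∑ k, pd k v x * pd k v x) * x j)
    (fun j => ?_) (fun j x hx => by simp [hpz _ x hx]) fun x hx => ?_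
  · exact ((contDiffOn_const.mul hA).mul (hy.mul (hp j)).contDiffOn).sub
      ((hA.mul hg.contDiffOn).mul (hx1 j).contDiffOn)
  · have hAx : DifferentiableAt ℝ A x :=
      (hA.contDiffAt (isOpen_compl_singleton.mem_nhds hx)).differentiableAt (by norm_num)
    have hpx : ∀ j, DifferentiableAt ℝ (pd j v) x := fun j => (hp j).differentiable (by norm_num) x
    have hyx : DifferentiableAt ℝ (fun x : E n => ∑ k, x k * pd k v x) x :=
      hy.differentiable (by norm_num) x
    have hgx : DifferentiableAt ℝ (fun x : E n => ∑ k, pd k v x * pd k v x) x :=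
      hg.differentiable (by norm_num) x
    have hxx : ∀ j : Fin n, DifferentiableAt ℝ (fun y : E n => y j) x := fun j =>
      (hx1 j).differentiable (by norm_num) x
    have h1 : ∀ j, pd j (fun x : E n => ∑ k, x k * pd k v x) x =
        pd j v x + ∑ k, x k * pd j (pd k v) x := fun j => by
      rw [pd_sum fun k _ => (hxx k).fun_mul (hpx k)]
      simp [pd_mul (hxx _) (hpx _), pd_coord, Finset.sum_add_distrib]
    have h2 : ∀ j, pd j (fun x : E n => ∑ k, pd k v x * pd k v x) x =
        2 * ∑ k, pd k v x * pd j (pd k v) x := fun j => by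
      rw [pd_sum fun k _ => (hpx k).fun_mul (hpx k), Finset.mul_sum]
      refine Finset.sum_congr rfl fun k _ => ?_
      rw [pd_mul (hpx k) (hpx k)]; ring
    have h3 : ∀ j, pd j (fun x => (2 * A x) * ((∑ k, x k * pd k v x) * pd j v x)
        - (A x * ∑ k, pd k v x * pd k v x) * x j) x =
        2 * a x * (∑ k, x k * pd k v x) * (x j * pd j v x)
        + 2 * A x * pd j v x ^ 2 + 2 * A x * (∑ k, x k * (pd j v x * pd j (pd k v) x))
        + 2 * A x * (∑ k, x k * pd k v x) * pd j (pd j v) x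
        - a x * x j ^ 2 * (∑ k, pd k v x * pd k v x)
        - 2 * A x * (∑ k, x j * (pd k v x * pd k (pd j v) x))
        - A x * (∑ k, pd k v x * pd k v x) := fun j => by
      rw [pd_sub ((hAx.const_mul 2).fun_mul (hyx.fun_mul (hpx j))) ((hAx.fun_mul hgx).fun_mul (hxx j)),
        pd_mul (hAx.const_mul 2) (hyx.fun_mul (hpx j)), pd_const_mul 2 hAx, pd_mul hyx (hpx j), h1,
        pd_mul (hAx.fun_mul hgx) (hxx j), pd_mul hAx hgx, h2, pd_coord, if_pos rfl, ha x hx]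
      have e1 : ∑ k, x k * (pd j v x * pd j (pd k v) x) = pd j v x * ∑ k, x k * pd j (pd k v) x := by
        rw [Finset.mul_sum]; exact Finset.sum_congr rfl fun k _ => by ring
      have e2 : ∑ k, x j * (pd k v x * pd k (pd j v) x) = x j * ∑ k, pd k v x * pd j (pd k v) x := by
        rw [Finset.mul_sum]
        exact Finset.sum_congr rfl fun k _ => by rw [pd_comm hv.contDiffAt j k]
      rw [e1, e2]; ring
    -- The Hessian terms from differentiating `x·∇v` and `|∇v|²` cancel once the order of summation
    -- is exchanged; the symmetry of the Hessian was used for `e2`.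
    have e3 : ∑ j, ∑ k, x k * (pd j v x * pd j (pd k v) x)
        = ∑ j, ∑ k, x j * (pd k v x * pd k (pd j v) x) := Finset.sum_comm
    have e4 : ∑ k, pd k v x * pd k v x = ∑ k, pd k v x ^ 2 :=
      Finset.sum_congr rfl fun k _ => (sq _).symm
    -- The inner sums are made opaque, so that the simplification of the outer sums leaves them
    -- alone.
    obtain ⟨P, hP⟩ : ∃ P : Fin n → ℝ, ∀ j, ∑ k, x k * (pd j v x * pd j (pd k v) x) = P j :=
      ⟨_, fun _ => rfl⟩
    obtain ⟨Q, hQ⟩ : ∃ Q : Fin n → ℝ, ∀ j, ∑ k, x j * (pd k v x * pd k (pd j v) x) = Q j :=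
      ⟨_, fun _ => rfl⟩
    simp only [hP, hQ, e4] at h3 e3
    simp only [h3, Finset.sum_add_distrib, Finset.sum_sub_distrib, ← Finset.sum_mul,
      ← Finset.mul_sum, norm_sq_eq_sum, Finset.sum_const, Finset.card_univ, Fintype.card_fin, e3,
      nsmul_eq_mul]
    ring

end Multiplier

end CriticalDecay

namespace CriticalDecay

/-! ### Radial weights and the function `Ṽ`. -/

section RadialWeights

variable {n : ℕ} {x : E n}

lemma contDiffOn_norm_compl {m : WithTop ℕ∞} : ContDiffOn ℝ m (fun x : E n => ‖x‖) {0}ᶜ :=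
  fun _ hx => (contDiffAt_norm ℝ hx).contDiffWithinAt

lemma contDiffOn_radial {G : Type*} [NormedAddCommGroup G] [NormedSpace ℝ G]
    {m : WithTop ℕ∞} {g : ℝ → G} (hg : ContDiffOn ℝ m g (Ioi 0)) :
    ContDiffOn ℝ m (fun x : E n => g ‖x‖) {0}ᶜ :=
  hg.comp contDiffOn_norm_compl fun _ hx => norm_pos_iff.2 hx

lemma pd_radial {G : Type*} [NormedAddCommGroup G] [NormedSpace ℝ G] {g : ℝ → G} {g' : G}
    (hx : x ≠ 0) (hg : HasDerivAt g g' ‖x‖) (j : Fin n) :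
    pd j (fun y => g ‖y‖) x = (x j / ‖x‖) • g' := by
  rw [pd_comp_real hg ((contDiffAt_norm ℝ hx (n := 1)).differentiableAt (by norm_num)), pd_norm hx]

lemma sum_coord_mul_pd_radial {g : ℝ → ℝ} {g' : ℝ} (hx : x ≠ 0) (hg : HasDerivAt g g' ‖x‖) :
    ∑ j, x j * pd j (fun y => g ‖y‖) x = ‖x‖ * g' := by
  have h := norm_pos_iff.2 hx
  have : ∀ j, x j * pd j (fun y => g ‖y‖) x = x j ^ 2 * (g' / ‖x‖) := fun j => by
    rw [pd_radial hx hg, smul_eq_mul]; ring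
  rw [Finset.sum_congr rfl fun j _ => this j, ← Finset.sum_mul, ← norm_sq_eq_sum]
  field_simp

lemma tildeV_eq {V : E n → ℝ} (hV : ContDiffOn ℝ 1 V {0}ᶜ) (hx : x ≠ 0) :
    tildeV V x = -(V x + ∑ j, x j * pd j V x) := by
  have h := norm_pos_iff.2 hx
  have hx' : ‖x‖ • (‖x‖⁻¹ • x) = x := by rw [smul_smul, mul_inv_cancel₀ h.ne', one_smul]
  have hd : HasFDerivAt V (fderiv ℝ V x) (‖x‖ • (‖x‖⁻¹ • x)) := by
    rw [hx']
    exact ((hV.contDiffAt (isOpen_compl_singleton.mem_nhds hx)).differentiableAt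
      (by norm_num)).hasFDerivAt
  have h1 : HasDerivAt (fun s : ℝ => s • (‖x‖⁻¹ • x)) (‖x‖⁻¹ • x) ‖x‖ := by
    simpa using (hasDerivAt_id ‖x‖).smul_const (‖x‖⁻¹ • x)
  have h2 := (hasDerivAt_id ‖x‖).mul (hd.comp_hasDerivAt _ h1)
  have h3 : deriv (fun s : ℝ => s * V (s • (‖x‖⁻¹ • x))) ‖x‖ = V x + fderiv ℝ V x x := by
    have := h2.deriv
    simp only [id, Function.comp_apply, hx', map_smul, smul_eq_mul, one_mul,
      mul_inv_cancel_left₀ h.ne'] at this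
    exact this
  rw [tildeV, h3, ← sum_coord_mul_pd]
  simp

lemma continuousOn_tildeV {V : E n → ℝ} (hV : ContDiffOn ℝ 1 V {0}ᶜ) :
    ContinuousOn (tildeV V) {0}ᶜ := by
  have : ContinuousOn (fun x => -(V x + ∑ j, x j * pd j V x)) {0}ᶜ := by
    refine (hV.continuousOn.add (continuousOn_finsetSum _ fun j _ => ?_)).neg
    exact (EuclideanSpace.proj j : E n →L[ℝ] ℝ).continuous.continuousOn.mul
      (contDiffOn_pd (m := 0) hV (by norm_num) j).continuousOn
  exact this.congr fun x hx => tildeV_eq hV hx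

end RadialWeights

/-! ### Hardy and Morawetz identities for real functions. -/

section RealIdentities

variable {n : ℕ} {K : Set (E n)} {v : E n → ℝ}

/-- `f` is integrable with integral zero. -/
def HasZeroIntegral (f : E n → ℝ) : Prop := Integrable f ∧ ∫ x, f x = 0

lemma HasZeroIntegral.sub {f g : E n → ℝ} (hf : HasZeroIntegral f) (hg : HasZeroIntegral g) :
    HasZeroIntegral fun x => f x - g x :=
  ⟨hf.1.sub hg.1, by rw [integral_sub hf.1 hg.1, hf.2, hg.2, sub_zero]⟩

lemma HasZeroIntegral.add {f g : E n → ℝ} (hf : HasZeroIntegral f) (hg : HasZeroIntegral g) :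
    HasZeroIntegral fun x => f x + g x :=
  ⟨hf.1.add hg.1, by rw [integral_add hf.1 hg.1, hf.2, hg.2, add_zero]⟩

lemma HasZeroIntegral.const_mul {f : E n → ℝ} (hf : HasZeroIntegral f) (c : ℝ) :
    HasZeroIntegral fun x => c * f x :=
  ⟨hf.1.const_mul c, by rw [integral_const_mul, hf.2, mul_zero]⟩

lemma HasZeroIntegral.congr {f g : E n → ℝ} (hf : HasZeroIntegral f) (h : f =ᵐ[volume] g) :
    HasZeroIntegral g :=
  ⟨hf.1.congr h, by rw [← integral_congr_ae h, hf.2]⟩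

/-- Hardy's identity. -/
lemma integral_hardy_identity (hn : n ≠ 0) (hK : IsCompact K) (h0 : (0 : E n) ∉ K)
    (hv : ContDiff ℝ 1 v) (hz : ∀ x ∉ K, v x = 0) :
    HasZeroIntegral (fun x => ((∑ j, x j * pd j v x) ^ 2 - lam n ^ 2 * v x ^ 2
      - ((∑ j, x j * pd j v x) + lam n * v x) ^ 2) / ‖x‖ ^ 2) := by
  -- With the weight `-λ/r²` and `n = 2λ + 2` the virial identity becomes the expansion of `(x·∇v +
  -- λv)²/r²`.
  have hW : ContDiffOn ℝ 1 (fun x : E n => -lam n / ‖x‖ ^ 2) {0}ᶜ :=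
    contDiffOn_radial (g := fun r => -lam n / r ^ 2)
      (contDiffOn_const.div (contDiffOn_id.pow 2) fun r hr => pow_ne_zero 2 (ne_of_gt hr))
  have hD : ∀ x : E n, x ≠ 0 → ∑ j, x j * pd j (fun x : E n => -lam n / ‖x‖ ^ 2) x
      = 2 * lam n / ‖x‖ ^ 2 := fun x hx => by
    have h := (norm_pos_iff.2 hx).ne'
    have hg : HasDerivAt (fun r : ℝ => -lam n / r ^ 2) (2 * lam n / ‖x‖ ^ 3) ‖x‖ := by
      refine ((hasDerivAt_const ‖x‖ (-lam n)).div (hasDerivAt_pow 2 ‖x‖) (by positivity)).congr_deriv ?_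
      field_simp; ring
    rw [sum_coord_mul_pd_radial hx hg]
    field_simp
  have := integral_virial hn hK h0 hv hz hW hD
  have hae : (fun x => 2 * (-lam n / ‖x‖ ^ 2) * v x * (∑ j, x j * pd j v x) +
      (n * (-lam n / ‖x‖ ^ 2) + 2 * lam n / ‖x‖ ^ 2) * v x ^ 2)
      = fun x => ((∑ j, x j * pd j v x) ^ 2 - lam n ^ 2 * v x ^ 2
      - ((∑ j, x j * pd j v x) + lam n * v x) ^ 2) / ‖x‖ ^ 2 := by
    ext x
    have : (n : ℝ) = 2 * lam n + 2 := by unfold lam; ring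
    rw [this]
    by_cases hx : ‖x‖ = 0
    · simp [hx]
    · field_simp
      ring
  rwa [hae] at this

/-- The weight `e^{-2εr}`. -/
noncomputable def wA (ε r : ℝ) : ℝ := Real.exp (-(2 * ε * r))

/-- The weight `(1 + 2εr) e^{-2εr}`. -/
noncomputable def wB (ε r : ℝ) : ℝ := (1 + 2 * ε * r) * wA ε r

lemma wA_pos (ε r : ℝ) : 0 < wA ε r := Real.exp_pos _

lemma wA_le_wB {ε r : ℝ} (hε : 0 ≤ ε) (hr : 0 ≤ r) : wA ε r ≤ wB ε r :=
  le_mul_of_one_le_left (wA_pos _ _).le (by nlinarith [mul_nonneg hε hr])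

lemma hasDerivAt_wA (ε r : ℝ) : HasDerivAt (wA ε) (-(2 * ε) * wA ε r) r := by
  have : HasDerivAt (fun r => -(2 * ε * r)) (-(2 * ε)) r := by
    simpa using ((hasDerivAt_id r).const_mul (2 * ε)).fun_neg
  exact this.exp.congr_deriv (mul_comm _ _)

lemma contDiff_wA (ε : ℝ) {m : WithTop ℕ∞} : ContDiff ℝ m (wA ε) := by
  unfold wA; fun_prop

lemma hasDerivAt_wB (ε r : ℝ) : HasDerivAt (wB ε) (-(4 * ε ^ 2 * r) * wA ε r) r := by
  have : HasDerivAt (fun r => 1 + 2 * ε * r) (2 * ε) r := by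
    simpa using ((hasDerivAt_id r).const_mul (2 * ε)).const_add 1
  refine (this.mul (hasDerivAt_wA ε r)).congr_deriv ?_
  ring

lemma contDiff_wB (ε : ℝ) {m : WithTop ℕ∞} : ContDiff ℝ m (wB ε) := by
  unfold wB; exact ContDiff.mul (by fun_prop) (contDiff_wA ε)

/-- The weighted Hardy identity. -/
lemma integral_weighted_hardy (hn : n ≠ 0) (hK : IsCompact K) (h0 : (0 : E n) ∉ K)
    (hv : ContDiff ℝ 1 v) (hz : ∀ x ∉ K, v x = 0) (ε : ℝ) :
    HasZeroIntegral (fun x => wB ε ‖x‖ * (((∑ j, x j * pd j v x) + ((n : ℝ) - 1) / 2 * v x) ^ 2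
        - v x ^ 2 / 4 - ((∑ j, x j * pd j v x) + ((n : ℝ) - 2) / 2 * v x) ^ 2) / ‖x‖ ^ 2
        - 2 * ε ^ 2 * wA ε ‖x‖ * v x ^ 2) := by
  -- Since `wB' = -4ε² r wA`, differentiating `wB/(2r²)` along `x` yields, besides `-wB/r²`, only
  -- the term `-2ε² wA`, whose sign is favourable.
  have hW : ContDiffOn ℝ 1 (fun x : E n => wB ε ‖x‖ / (2 * ‖x‖ ^ 2)) {0}ᶜ :=
    contDiffOn_radial (g := fun r => wB ε r / (2 * r ^ 2))
      ((contDiff_wB ε).contDiffOn.div (contDiffOn_const.mul (contDiffOn_id.pow 2))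
        fun r hr => mul_ne_zero two_ne_zero (pow_ne_zero 2 (ne_of_gt hr)))
  have hD : ∀ x : E n, x ≠ 0 → ∑ j, x j * pd j (fun x : E n => wB ε ‖x‖ / (2 * ‖x‖ ^ 2)) x
      = -(2 * ε ^ 2 * wA ε ‖x‖) - wB ε ‖x‖ / ‖x‖ ^ 2 := fun x hx => by
    have h := (norm_pos_iff.2 hx).ne'
    have hg := (hasDerivAt_wB ε ‖x‖).fun_div ((hasDerivAt_pow 2 ‖x‖).const_mul 2) (by positivity)
    refine (sum_coord_mul_pd_radial hx hg).trans ?_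
    simp only [Nat.cast_ofNat, Nat.add_one_sub_one, pow_one]
    field_simp
    ring
  have := integral_virial hn hK h0 hv hz hW hD
  have hae : (fun x => 2 * (wB ε ‖x‖ / (2 * ‖x‖ ^ 2)) * v x * (∑ j, x j * pd j v x) +
      (n * (wB ε ‖x‖ / (2 * ‖x‖ ^ 2)) + (-(2 * ε ^ 2 * wA ε ‖x‖) - wB ε ‖x‖ / ‖x‖ ^ 2)) * v x ^ 2)
      = fun x => wB ε ‖x‖ * (((∑ j, x j * pd j v x) + ((n : ℝ) - 1) / 2 * v x) ^ 2
        - v x ^ 2 / 4 - ((∑ j, x j * pd j v x) + ((n : ℝ) - 2) / 2 * v x) ^ 2) / ‖x‖ ^ 2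
        - 2 * ε ^ 2 * wA ε ‖x‖ * v x ^ 2 := by
    ext x
    by_cases hx : ‖x‖ = 0
    · simp [hx]
    · field_simp
      ring
  rwa [hae] at this

/-- The multiplier identity for `-Δ + V` with the multiplier `2 e^{-2εr} (x·∇v + (n-1)/2 v)`. -/
lemma integral_morawetz (hn : n ≠ 0) (hK : IsCompact K) (h0 : (0 : E n) ∉ K)
    (hv : ContDiff ℝ 2 v) (hz : ∀ x ∉ K, v x = 0)
    {V : E n → ℝ} (hV : ContDiffOn ℝ 1 V {0}ᶜ) (ε : ℝ) :
    HasZeroIntegral (fun x => 2 * wA ε ‖x‖ * ((∑ j, x j * pd j v x) + ((n : ℝ) - 1) / 2 * v x) *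
          (-(∑ j, pd j (pd j v) x) + V x * v x)
        - (wA ε ‖x‖ * (1 - 2 * ε * ‖x‖) *
            ((∑ j, x j * pd j v x) + ((n : ℝ) - 1) / 2 * v x) ^ 2 / ‖x‖ ^ 2
          + wB ε ‖x‖ * ((∑ j, pd j v x ^ 2) - (∑ j, x j * pd j v x) ^ 2 / ‖x‖ ^ 2
            + (lam n ^ 2 - 1 / 4) * v x ^ 2 / ‖x‖ ^ 2)
          + wA ε ‖x‖ * (tildeV V x + 2 * ε * ‖x‖ * V x) * v x ^ 2)) := by
  have hv1 : ContDiff ℝ 1 v := hv.of_le (by norm_num)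
  have hA : ContDiffOn ℝ 1 (fun x : E n => wA ε ‖x‖) {0}ᶜ := contDiffOn_radial (contDiff_wA ε).contDiffOn
  have ha : ∀ x : E n, x ≠ 0 → ∀ j, pd j (fun x : E n => wA ε ‖x‖) x
      = (-(2 * ε) * wA ε ‖x‖ / ‖x‖) * x j := fun x hx j => by
    rw [pd_radial hx (hasDerivAt_wA ε ‖x‖), smul_eq_mul]; ring
  -- The virial identity with this weight supplies the part `(n-1) wA v (x·∇v)/r²` of the cross term
  -- in the square of `x·∇v + (n-1)/2 v`.
  have hW : ContDiffOn ℝ 1 (fun x : E n => ((n : ℝ) - 1) / 2 * wA ε ‖x‖ / ‖x‖ ^ 2) {0}ᶜ :=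
    contDiffOn_radial (g := fun r => ((n : ℝ) - 1) / 2 * wA ε r / r ^ 2)
      ((contDiffOn_const.mul (contDiff_wA ε).contDiffOn).div (contDiffOn_id.pow 2)
        fun r hr => (pow_ne_zero 2 (ne_of_gt hr)))
  have hWD : ∀ x : E n, x ≠ 0 →
      ∑ j, x j * pd j (fun x : E n => ((n : ℝ) - 1) / 2 * wA ε ‖x‖ / ‖x‖ ^ 2) x
      = ((n : ℝ) - 1) / 2 * wA ε ‖x‖ * (-(2 * ε * ‖x‖) - 2) / ‖x‖ ^ 2 := fun x hx => by
    have h := (norm_pos_iff.2 hx).ne'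
    have hg := ((hasDerivAt_wA ε ‖x‖).const_mul (((n : ℝ) - 1) / 2)).fun_div (hasDerivAt_pow 2 ‖x‖)
      (by positivity)
    refine (sum_coord_mul_pd_radial hx hg).trans ?_
    simp only [Nat.cast_ofNat, Nat.add_one_sub_one, pow_one]
    field_simp
  have hU : ContDiffOn ℝ 1 (fun x : E n => wA ε ‖x‖ * V x) {0}ᶜ := hA.mul hV
  have hUD : ∀ x : E n, x ≠ 0 → ∑ j, x j * pd j (fun x : E n => wA ε ‖x‖ * V x) x
      = wA ε ‖x‖ * (-tildeV V x - V x - 2 * ε * ‖x‖ * V x) := fun x hx => by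
    have hAx : DifferentiableAt ℝ (fun x : E n => wA ε ‖x‖) x :=
      (hA.contDiffAt (isOpen_compl_singleton.mem_nhds hx)).differentiableAt (by norm_num)
    have hVx : DifferentiableAt ℝ V x :=
      (hV.contDiffAt (isOpen_compl_singleton.mem_nhds hx)).differentiableAt (by norm_num)
    have e : ∀ j, x j * pd j (fun x : E n => wA ε ‖x‖ * V x) x =
        (x j * pd j (fun x : E n => wA ε ‖x‖) x) * V x + wA ε ‖x‖ * (x j * pd j V x) := fun j => by
      rw [pd_mul hAx hVx]; ring
    simp only [e, Finset.sum_add_distrib, ← Finset.sum_mul, ← Finset.mul_sum]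
    rw [sum_coord_mul_pd_radial hx (hasDerivAt_wA ε ‖x‖), tildeV_eq hV hx]
    ring
  obtain ⟨i1, e1⟩ := integral_pohozaev hn hK h0 hv hz hA ha
  obtain ⟨i2, e2⟩ := integral_div_mul_grad hn hK h0 hv hz hA ha
  obtain ⟨i3, e3⟩ := integral_virial hn hK h0 hv1 hz hW hWD
  obtain ⟨i4, e4⟩ := integral_virial hn hK h0 hv1 hz hU hUD
  -- The Pohozaev identity accounts for the part `x·∇v` of the multiplier, `n - 1` times the
  -- identity for `div(A v ∇v)` for the part `v`, the virial identity with weight `wA V` for the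
  -- potential, and the one with weight `W` completes the square.
  have key := HasZeroIntegral.sub (HasZeroIntegral.sub (HasZeroIntegral.sub ⟨i4, e4⟩ ⟨i3, e3⟩)
    (HasZeroIntegral.const_mul ⟨i2, e2⟩ ((n : ℝ) - 1))) ⟨i1, e1⟩
  refine key.congr ((volume_singleton_zero_compl hn).mono fun x hx => ?_)
  have h := (norm_pos_iff.2 hx).ne'
  have hl : (n : ℝ) = 2 * lam n + 2 := by unfold lam; ring
  simp only [hl, wB]
  generalize (∑ j, x j * pd j v x) = Y
  generalize (∑ j, pd j v x ^ 2) = N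
  generalize (∑ j, pd j (pd j v) x) = Lv
  field_simp
  ring

end RealIdentities

end CriticalDecay

namespace CriticalDecay

/-! ### Polar coordinates, and the positivity assumptions integrated over the radius. -/

section Polar

variable {n : ℕ}

/-- Polar coordinates: off the origin, which is a null set, the volume is the product of the surface
measure of the unit sphere and a measure in the radius. -/
lemma integral_nonneg_of_sphere (hn : n ≠ 0) {F : E n → ℝ} (hF : Integrable F)
    (h : ∀ r : ℝ, 0 < r →
      0 ≤ ∫ θ : Metric.sphere (0 : E n) 1, F (r • (θ : E n)) ∂((volume : Measure (E n)).toSphere)) :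
    0 ≤ ∫ x, F x := by
  have : NeZero n := ⟨hn⟩
  have : Nontrivial (E n) := inferInstance
  have hmp := (volume : Measure (E n)).measurePreserving_homeomorphUnitSphereProd
  have hme := (homeomorphUnitSphereProd (E n)).measurableEmbedding
  set g : Metric.sphere (0 : E n) 1 × Ioi (0 : ℝ) → ℝ := fun p => F (p.2.1 • (p.1 : E n)) with hg
  have hcomp : ∀ x : ({0}ᶜ : Set (E n)), g (homeomorphUnitSphereProd (E n) x) = F x := fun x => by
    have hx : ‖(x : E n)‖ ≠ 0 := norm_ne_zero_iff.2 x.2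
    simp [hg, smul_smul, hx]
  have hgi : Integrable g ((volume : Measure (E n)).toSphere.prod
      (Measure.volumeIoiPow (Module.finrank ℝ (E n) - 1))) := by
    rw [← hmp.integrable_comp_emb hme]
    have : g ∘ (homeomorphUnitSphereProd (E n)) = F ∘ (↑) := funext hcomp
    rw [this, ← integrableOn_iff_comap_subtypeVal (measurableSet_singleton _).compl]
    exact hF.integrableOn
  have h1 : ∫ x, F x = ∫ p, g p ∂((volume : Measure (E n)).toSphere.prod
      (Measure.volumeIoiPow (Module.finrank ℝ (E n) - 1))) := by
    have h2 : ∫ x, F x = ∫ x in {0}ᶜ, F x := by rw [restrict_compl_singleton]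
    rw [← hmp.integral_comp hme, h2, ← integral_subtype_comap (measurableSet_singleton _).compl]
    exact integral_congr_ae (ae_of_all _ fun x => (hcomp x).symm)
  rw [h1, integral_prod_symm _ hgi]
  exact integral_nonneg fun r => h r.1 r.2

lemma continuous_gradSq {φ : E n → ℂ} (hφ : ContDiff ℝ 1 φ) : Continuous (gradSq φ) := by
  have : ∀ j, Continuous (pd j φ) := fun j => (contDiff_pd (m := 0) hφ (by norm_num) j).continuous
  unfold gradSq
  exact continuous_finsetSum _ fun j _ => ((this j).norm.pow 2)

lemma continuousOn_inv_norm : ContinuousOn (fun x : E n => ‖x‖⁻¹) {0}ᶜ :=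
  continuous_norm.continuousOn.inv₀ fun _ hx => norm_ne_zero_iff.2 hx

lemma continuousOn_radialDeriv {φ : E n → ℂ} (hφ : ContDiff ℝ 1 φ) :
    ContinuousOn (radialDeriv φ) {0}ᶜ :=
  (hφ.continuous_fderiv (by norm_num)).continuousOn.clm_apply
    (continuousOn_inv_norm.smul continuousOn_id)

lemma continuousOn_sphGradSq {φ : E n → ℂ} (hφ : ContDiff ℝ 1 φ) :
    ContinuousOn (sphGradSq φ) {0}ᶜ :=
  (continuous_norm.pow 2).continuousOn.mul
    ((continuous_gradSq hφ).continuousOn.sub ((continuousOn_radialDeriv hφ).norm.pow 2))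

lemma integrable_on_sphere {f : E n → ℝ} (hf : ContinuousOn f {0}ᶜ) {r : ℝ} (hr : 0 < r) :
    Integrable (fun θ : Metric.sphere (0 : E n) 1 => f (r • (θ : E n)))
      ((volume : Measure (E n)).toSphere) := by
  have : Continuous fun θ : Metric.sphere (0 : E n) 1 => f (r • (θ : E n)) := by
    refine hf.comp_continuous (by fun_prop) fun θ => ?_
    have hθ : ‖(θ : E n)‖ = 1 := by simp
    simp only [mem_compl_iff, mem_singleton_iff, smul_eq_zero, not_or]
    exact ⟨hr.ne', fun h => by simp [h] at hθ⟩
  exact this.integrable_of_hasCompactSupport (HasCompactSupport.of_compactSpace _)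

/-- The positivity assumption, integrated against a radial weight. -/
lemma PositiveOnSpheres.integral_nonneg (hn : n ≠ 0) {W : E n → ℝ} {δ : ℝ}
    (hW : ContinuousOn W {0}ᶜ) (h : PositiveOnSpheres W δ) {φ : E n → ℂ} (hφ : ContDiff ℝ ∞ φ)
    {β : ℝ → ℝ} (hβ : ∀ r, 0 < r → 0 ≤ β r)
    (hi : Integrable fun x => β ‖x‖ *
      (sphGradSq φ x + (lam n ^ 2 + ‖x‖ ^ 2 * W x - δ ^ 2) * ‖φ x‖ ^ 2)) :
    0 ≤ ∫ x, β ‖x‖ * (sphGradSq φ x + (lam n ^ 2 + ‖x‖ ^ 2 * W x - δ ^ 2) * ‖φ x‖ ^ 2) := by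
  have hφ1 : ContDiff ℝ 1 φ := hφ.of_le (by exact_mod_cast le_top)
  have hc1 : ContinuousOn (fun x => ‖φ x‖ ^ 2) {0}ᶜ := (hφ.continuous.norm.pow 2).continuousOn
  have hc2 : ContinuousOn (fun x => sphGradSq φ x + (lam n ^ 2 + ‖x‖ ^ 2 * W x) * ‖φ x‖ ^ 2) {0}ᶜ :=
    (continuousOn_sphGradSq hφ1).add ((continuousOn_const.add
      ((continuous_norm.pow 2).continuousOn.mul hW)).mul hc1)
  refine integral_nonneg_of_sphere hn hi fun r hr => ?_
  have i1 := integrable_on_sphere hc1 hr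
  have i2 := integrable_on_sphere hc2 hr
  have key : ∀ θ : Metric.sphere (0 : E n) 1, β ‖r • (θ : E n)‖ *
      (sphGradSq φ (r • (θ : E n)) + (lam n ^ 2 + ‖r • (θ : E n)‖ ^ 2 * W (r • (θ : E n)) - δ ^ 2)
        * ‖φ (r • (θ : E n))‖ ^ 2) =
      β r * ((sphGradSq φ (r • (θ : E n)) + (lam n ^ 2 + ‖r • (θ : E n)‖ ^ 2 * W (r • (θ : E n)))
        * ‖φ (r • (θ : E n))‖ ^ 2) - δ ^ 2 * ‖φ (r • (θ : E n))‖ ^ 2) := fun θ => by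
    have hθ : ‖(θ : E n)‖ = 1 := by simp
    rw [norm_smul, hθ, mul_one, Real.norm_of_nonneg hr.le]; ring
  simp only [key]
  rw [integral_const_mul, integral_sub i2 (i1.const_mul _), integral_const_mul]
  refine mul_nonneg (hβ r hr) (sub_nonneg.2 ?_)
  have h3 := h r hr φ hφ
  unfold sphereIntegral at h3
  have hp : 0 < r ^ (n - 1) := by positivity
  refine le_of_mul_le_mul_left ?_ hp
  linarith

end Polar

end CriticalDecay

namespace CriticalDecay

/-! ### The identities for complex functions. -/

section ComplexIdentities

variable {n : ℕ} {K : Set (E n)} {φ : E n → ℂ} {x : E n}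

/-- The Euler vector field `x·∇φ`. -/
noncomputable def euler (φ : E n → ℂ) (x : E n) : ℂ := fderiv ℝ φ x x

/-- `∑ⱼ ∂ⱼ²φ`. -/
noncomputable def lap (φ : E n → ℂ) (x : E n) : ℂ := ∑ j, pd j (pd j φ) x

lemma gradSq_eq (φ : E n → ℂ) (x : E n) : gradSq φ x = ∑ j, ‖pd j φ x‖ ^ 2 := rfl

lemma gradSq_nonneg (φ : E n → ℂ) (x : E n) : 0 ≤ gradSq φ x :=
  Finset.sum_nonneg fun _ _ => by positivity

lemma norm_euler_sq (hx : x ≠ 0) : ‖euler φ x‖ ^ 2 = ‖x‖ ^ 2 * ‖radialDeriv φ x‖ ^ 2 := by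
  have := (norm_pos_iff.2 hx).ne'
  rw [radialDeriv, map_smul, norm_smul, norm_inv, norm_norm, euler]
  field_simp

lemma complex_norm_sq (z : ℂ) : ‖z‖ ^ 2 = z.re ^ 2 + z.im ^ 2 := by
  rw [← Complex.normSq_eq_norm_sq, Complex.normSq_apply]; ring

lemma pd_re (hφ : DifferentiableAt ℝ φ x) (j : Fin n) :
    pd j (fun y => (φ y).re) x = (pd j φ x).re := pd_clm Complex.reCLM hφ

lemma pd_im (hφ : DifferentiableAt ℝ φ x) (j : Fin n) :
    pd j (fun y => (φ y).im) x = (pd j φ x).im := pd_clm Complex.imCLM hφ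

lemma euler_re (φ : E n → ℂ) (hφ : DifferentiableAt ℝ φ x) :
    ∑ j, x j * pd j (fun y => (φ y).re) x = (euler φ x).re := by
  simp [euler, ← sum_coord_mul_pd, pd_re hφ]

lemma euler_im (φ : E n → ℂ) (hφ : DifferentiableAt ℝ φ x) :
    ∑ j, x j * pd j (fun y => (φ y).im) x = (euler φ x).im := by
  simp [euler, ← sum_coord_mul_pd, pd_im hφ]

lemma lap_re (hφ : ContDiff ℝ 2 φ) (x : E n) :
    ∑ j, pd j (pd j (fun y => (φ y).re)) x = (lap φ x).re := by
  have h : ∀ j, pd j (fun y => (φ y).re) = fun y => (pd j φ y).re := fun j =>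
    funext fun y => pd_re (hφ.differentiable (by norm_num) y) j
  have h2 : ∀ j, DifferentiableAt ℝ (pd j φ) x := fun j =>
    (contDiff_pd (m := 1) hφ (by norm_num) j).differentiable (by norm_num) x
  simp [h, lap, pd_re (h2 _)]

lemma lap_im (hφ : ContDiff ℝ 2 φ) (x : E n) :
    ∑ j, pd j (pd j (fun y => (φ y).im)) x = (lap φ x).im := by
  have h : ∀ j, pd j (fun y => (φ y).im) = fun y => (pd j φ y).im := fun j =>
    funext fun y => pd_im (hφ.differentiable (by norm_num) y) j
  have h2 : ∀ j, DifferentiableAt ℝ (pd j φ) x := fun j =>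
    (contDiff_pd (m := 1) hφ (by norm_num) j).differentiable (by norm_num) x
  simp [h, lap, pd_im (h2 _)]

lemma gradSq_re_im (hφ : DifferentiableAt ℝ φ x) :
    gradSq φ x = ∑ j, pd j (fun y => (φ y).re) x ^ 2 + ∑ j, pd j (fun y => (φ y).im) x ^ 2 := by
  simp [gradSq_eq, complex_norm_sq, Finset.sum_add_distrib, pd_re hφ, pd_im hφ]

lemma contDiff_re {m : WithTop ℕ∞} (hφ : ContDiff ℝ m φ) : ContDiff ℝ m fun y => (φ y).re :=
  Complex.reCLM.contDiff.comp hφ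

lemma contDiff_im {m : WithTop ℕ∞} (hφ : ContDiff ℝ m φ) : ContDiff ℝ m fun y => (φ y).im :=
  Complex.imCLM.contDiff.comp hφ

/-- The identity is quadratic with real coefficients, so the real versions for the real and the
imaginary part add up to it. -/
lemma hasZeroIntegral_hardy (hn : n ≠ 0) (hK : IsCompact K) (h0 : (0 : E n) ∉ K)
    (hφ : ContDiff ℝ 1 φ) (hz : ∀ x ∉ K, φ x = 0) :
    HasZeroIntegral (fun x => (‖euler φ x‖ ^ 2 - lam n ^ 2 * ‖φ x‖ ^ 2
      - ‖euler φ x + lam n * φ x‖ ^ 2) / ‖x‖ ^ 2) := by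
  have h1 := integral_hardy_identity hn hK h0 (contDiff_re hφ) fun x hx => by simp [hz x hx]
  have h2 := integral_hardy_identity hn hK h0 (contDiff_im hφ) fun x hx => by simp [hz x hx]
  refine (h1.add h2).congr (ae_of_all _ fun x => ?_)
  have hd := hφ.differentiable (by norm_num) x
  simp only [euler_re φ hd, euler_im φ hd, complex_norm_sq, Complex.add_re, Complex.add_im,
    Complex.re_ofReal_mul, Complex.im_ofReal_mul]
  ring

lemma hasZeroIntegral_weighted_hardy (hn : n ≠ 0) (hK : IsCompact K) (h0 : (0 : E n) ∉ K)
    (hφ : ContDiff ℝ 1 φ) (hz : ∀ x ∉ K, φ x = 0) (ε : ℝ) :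
    HasZeroIntegral (fun x => wB ε ‖x‖ * (‖euler φ x + (((n : ℝ) - 1) / 2 : ℝ) * φ x‖ ^ 2
        - ‖φ x‖ ^ 2 / 4 - ‖euler φ x + (((n : ℝ) - 2) / 2 : ℝ) * φ x‖ ^ 2) / ‖x‖ ^ 2
        - 2 * ε ^ 2 * wA ε ‖x‖ * ‖φ x‖ ^ 2) := by
  have h1 := integral_weighted_hardy hn hK h0 (contDiff_re hφ) (fun x hx => by simp [hz x hx]) ε
  have h2 := integral_weighted_hardy hn hK h0 (contDiff_im hφ) (fun x hx => by simp [hz x hx]) ε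
  refine (h1.add h2).congr (ae_of_all _ fun x => ?_)
  have hd := hφ.differentiable (by norm_num) x
  simp only [euler_re φ hd, euler_im φ hd, complex_norm_sq, Complex.add_re, Complex.add_im,
    Complex.re_ofReal_mul, Complex.im_ofReal_mul]
  ring

lemma hasZeroIntegral_morawetz (hn : n ≠ 0) (hK : IsCompact K) (h0 : (0 : E n) ∉ K)
    (hφ : ContDiff ℝ 2 φ) (hz : ∀ x ∉ K, φ x = 0)
    {V : E n → ℝ} (hV : ContDiffOn ℝ 1 V {0}ᶜ) (ε : ℝ) :
    HasZeroIntegral (fun x => 2 * wA ε ‖x‖ *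
          ((starRingEnd ℂ) (euler φ x + (((n : ℝ) - 1) / 2 : ℝ) * φ x) *
            (-lap φ x + V x * φ x)).re
        - (wA ε ‖x‖ * (1 - 2 * ε * ‖x‖) *
            ‖euler φ x + (((n : ℝ) - 1) / 2 : ℝ) * φ x‖ ^ 2 / ‖x‖ ^ 2
          + wB ε ‖x‖ * (gradSq φ x - ‖euler φ x‖ ^ 2 / ‖x‖ ^ 2
            + (lam n ^ 2 - 1 / 4) * ‖φ x‖ ^ 2 / ‖x‖ ^ 2)
          + wA ε ‖x‖ * (tildeV V x + 2 * ε * ‖x‖ * V x) * ‖φ x‖ ^ 2)) := by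
  have h1 := integral_morawetz hn hK h0 (contDiff_re hφ) (fun x hx => by simp [hz x hx]) hV ε
  have h2 := integral_morawetz hn hK h0 (contDiff_im hφ) (fun x hx => by simp [hz x hx]) hV ε
  refine (h1.add h2).congr (ae_of_all _ fun x => ?_)
  have hd := hφ.differentiable (by norm_num) x
  simp only [euler_re φ hd, euler_im φ hd, lap_re hφ, lap_im hφ, complex_norm_sq, Complex.add_re,
    Complex.add_im, Complex.im_ofReal_mul, gradSq_re_im hd, Complex.ofReal_re, Complex.ofReal_im,
    Complex.mul_re, Complex.conj_re, Complex.conj_im, Complex.neg_re, Complex.neg_im]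
  ring

end ComplexIdentities

/-! ### The conjugated a priori estimate. -/

section Apriori

variable {n : ℕ} {K : Set (E n)} {φ : E n → ℂ} {x : E n}

lemma continuous_euler (hφ : ContDiff ℝ 1 φ) : Continuous (euler φ) :=
  (hφ.continuous_fderiv (by norm_num)).clm_apply continuous_id

lemma continuous_lap (hφ : ContDiff ℝ 2 φ) : Continuous (lap φ) :=
  continuous_finsetSum _ fun j _ =>
    (contDiff_pd (m := 0) (contDiff_pd (m := 1) hφ (by norm_num) j) (by norm_num) j).continuous

lemma euler_eq_zero (hK : IsClosed K) (hz : ∀ x ∉ K, φ x = 0) (hx : x ∉ K) : euler φ x = 0 := by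
  simp [euler, ← sum_coord_mul_pd, pd_eq_zero_of_notMem hK hz hx]

lemma lap_eq_zero (hK : IsClosed K) (hz : ∀ x ∉ K, φ x = 0) (hx : x ∉ K) : lap φ x = 0 :=
  Finset.sum_eq_zero fun _ _ =>
    pd_eq_zero_of_notMem hK (fun _ hy => pd_eq_zero_of_notMem hK hz hy) hx

lemma gradSq_eq_zero (hK : IsClosed K) (hz : ∀ x ∉ K, φ x = 0) (hx : x ∉ K) : gradSq φ x = 0 := by
  simp [gradSq_eq, pd_eq_zero_of_notMem hK hz hx]

lemma sphGradSq_eq_zero (hK : IsClosed K) (hz : ∀ x ∉ K, φ x = 0) (hx : x ∉ K) :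
    sphGradSq φ x = 0 := by
  have : radialDeriv φ x = 0 := by
    have := euler_eq_zero hK hz hx
    rw [euler] at this
    rw [radialDeriv, map_smul, this, smul_zero]
  simp [sphGradSq, gradSq_eq_zero hK hz hx, this]

lemma sphGradSq_eq (hx : x ≠ 0) :
    sphGradSq φ x = ‖x‖ ^ 2 * gradSq φ x - ‖euler φ x‖ ^ 2 := by
  rw [norm_euler_sq hx, sphGradSq]; ring

/-- The square of the constant in the a priori estimate. -/
noncomputable def aprioriSq (δ : ℝ) : ℝ :=
  if δ ^ 2 ≤ 1 / 2 then 1 / δ ^ 4 else 1 / (δ ^ 2 - 1 / 4)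

lemma aprioriSq_pos {δ : ℝ} (hδ : 0 < δ) : 0 < aprioriSq δ := by
  unfold aprioriSq
  split_ifs with h
  · positivity
  · exact one_div_pos.2 (by linarith)

/-- The a priori estimate after conjugation with `e^{-izr}`. -/
lemma apriori_conjugated (hn : n ≠ 0) (hK : IsCompact K) (h0 : (0 : E n) ∉ K)
    (hφ : ContDiff ℝ ∞ φ) (hz : ∀ x ∉ K, φ x = 0)
    {V : E n → ℝ} (hV : ContDiffOn ℝ 1 V {0}ᶜ) {δ : ℝ} (hδ : 0 < δ)
    (hA2 : PositiveOnSpheres V δ) (hA3 : PositiveOnSpheres (tildeV V) δ)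
    {z : ℂ} (hε : 0 ≤ z.im) {D : E n → ℂ} (hDc : ContinuousOn D {0}ᶜ) (hDz : ∀ x ∉ K, D x = 0)
    (hD : ∀ x, x ≠ 0 → D x = -lap φ x + V x * φ x
      - 2 * Complex.I * z * (euler φ x + (((n : ℝ) - 1) / 2 : ℝ) * φ x) / ‖x‖) :
    ∫ x, wA z.im ‖x‖ * ‖φ x‖ ^ 2 / ‖x‖ ^ 2 ≤
      aprioriSq δ * ∫ x, wA z.im ‖x‖ * (‖x‖ ^ 2 * ‖D x‖ ^ 2) := by
  have hφ2 : ContDiff ℝ 2 φ := by exact_mod_cast contDiff_infty.1 hφ 2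
  have hφ1 : ContDiff ℝ 1 φ := hφ.of_le (by exact_mod_cast le_top)
  set ε := z.im with hεd
  set Z : E n → ℂ := fun x => euler φ x + (((n : ℝ) - 1) / 2 : ℝ) * φ x with hZ
  have hKc := hK.isClosed
  have cA : ContinuousOn (fun x : E n => wA ε ‖x‖) {0}ᶜ :=
    ((contDiff_wA ε (m := 0)).continuous.comp continuous_norm).continuousOn
  have cB : ContinuousOn (fun x : E n => wB ε ‖x‖) {0}ᶜ :=
    ((contDiff_wB ε (m := 0)).continuous.comp continuous_norm).continuousOn
  have cr : ContinuousOn (fun x : E n => ‖x‖ ^ 2) {0}ᶜ := (continuous_norm.pow 2).continuousOn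
  have cr0 : ∀ x ∈ ({0}ᶜ : Set (E n)), ‖x‖ ^ 2 ≠ 0 := fun x hx => pow_ne_zero 2 (norm_ne_zero_iff.2 hx)
  have cZ : ContinuousOn (fun x => ‖Z x‖ ^ 2) {0}ᶜ :=
    (((continuous_euler hφ1).add (continuous_const.mul hφ.continuous)).norm.pow 2).continuousOn
  have cφ : ContinuousOn (fun x => ‖φ x‖ ^ 2) {0}ᶜ := (hφ.continuous.norm.pow 2).continuousOn
  have zZ : ∀ x ∉ K, Z x = 0 := fun x hx => by simp [hZ, hz x hx, euler_eq_zero hKc hz hx]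
  have cV : ContinuousOn V {0}ᶜ := hV.continuousOn
  have cV' := continuousOn_tildeV hV
  have i1 : Integrable fun x => wB ε ‖x‖ * ‖Z x‖ ^ 2 / ‖x‖ ^ 2 :=
    integrable_of_continuousOn_compl hK h0 ((cB.mul cZ).div cr cr0) fun x hx => by simp [zZ x hx]
  have i2 : Integrable fun x => wB ε ‖x‖ * ‖φ x‖ ^ 2 / ‖x‖ ^ 2 :=
    integrable_of_continuousOn_compl hK h0 ((cB.mul cφ).div cr cr0) fun x hx => by simp [hz x hx]
  have i2' : Integrable fun x => wA ε ‖x‖ * ‖φ x‖ ^ 2 / ‖x‖ ^ 2 :=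
    integrable_of_continuousOn_compl hK h0 ((cA.mul cφ).div cr cr0) fun x hx => by simp [hz x hx]
  have i3 : Integrable fun x => wA ε ‖x‖ * (‖x‖ ^ 2 * ‖D x‖ ^ 2) :=
    integrable_of_continuousOn_compl hK h0 (cA.mul (cr.mul (hDc.norm.pow 2)))
      fun x hx => by simp [hDz x hx]
  have cP : ∀ (β : ℝ → ℝ) (W : E n → ℝ), ContinuousOn β (Ioi 0) → ContinuousOn W {0}ᶜ →
      Integrable fun x => β ‖x‖ *
        (sphGradSq φ x + (lam n ^ 2 + ‖x‖ ^ 2 * W x - δ ^ 2) * ‖φ x‖ ^ 2) := fun β W hβ hW =>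
    integrable_of_continuousOn_compl hK h0
      ((hβ.comp continuous_norm.continuousOn fun x hx => norm_pos_iff.2 hx).mul
        ((continuousOn_sphGradSq hφ1).add
          (((continuousOn_const.add (cr.mul hW)).sub continuousOn_const).mul cφ)))
      fun x hx => by simp [hz x hx, sphGradSq_eq_zero hKc hz hx]
  -- In the Morawetz identity `Ṽ` carries the weight `wA` and `V` the weight `2εr wA`. The
  -- corresponding weights `wA/r²` and `2ε wA/r` of the two positivity assumptions add up to
  -- `wB/r²`, the weight of the spherical gradient.
  have i4 := cP (fun r => wA ε r / r ^ 2) (tildeV V)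
    ((contDiff_wA ε (m := 0)).continuous.continuousOn.div (by fun_prop)
      fun r hr => pow_ne_zero 2 (ne_of_gt hr)) cV'
  have i5 := cP (fun r => 2 * ε * wA ε r / r) V
    ((continuousOn_const.mul (contDiff_wA ε (m := 0)).continuous.continuousOn).div (by fun_prop)
      fun r hr => ne_of_gt hr) cV
  have p4 := hA3.integral_nonneg hn cV' hφ (β := fun r => wA ε r / r ^ 2)
    (fun r _ => div_nonneg (wA_pos _ _).le (by positivity)) i4
  have p5 := hA2.integral_nonneg hn cV hφ (β := fun r => 2 * ε * wA ε r / r)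
    (fun r hr => div_nonneg (mul_nonneg (by positivity) (wA_pos _ _).le) hr.le) i5
  have hM := hasZeroIntegral_morawetz hn hK h0 hφ2 hz hV ε
  have hH := hasZeroIntegral_weighted_hardy hn hK h0 hφ1 hz ε
  -- Hardy's inequality with constant `1/4`: the last square and the `ε²` term of the weighted
  -- identity have a sign and are dropped.
  have key1 : ∫ x, wB ε ‖x‖ * ‖φ x‖ ^ 2 / ‖x‖ ^ 2 ≤ 4 * ∫ x, wB ε ‖x‖ * ‖Z x‖ ^ 2 / ‖x‖ ^ 2 := by
    have h1 : 0 ≤ ∫ x, (wB ε ‖x‖ * ‖Z x‖ ^ 2 / ‖x‖ ^ 2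
        - (1 / 4) * (wB ε ‖x‖ * ‖φ x‖ ^ 2 / ‖x‖ ^ 2)) := by
      rw [← hH.2]
      refine integral_mono hH.1 (i1.sub (i2.const_mul _)) fun x => ?_
      have hB : 0 ≤ wB ε ‖x‖ := (wA_pos _ _).le.trans (wA_le_wB hε (norm_nonneg _))
      have e1 : 0 ≤ wB ε ‖x‖ * ‖euler φ x + (((n : ℝ) - 2) / 2 : ℝ) * φ x‖ ^ 2 / ‖x‖ ^ 2 := by
        positivity
      have e2 : 0 ≤ 2 * ε ^ 2 * wA ε ‖x‖ * ‖φ x‖ ^ 2 := by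
        have := (wA_pos ε ‖x‖).le
        positivity
      have e3 : wB ε ‖x‖ * (‖euler φ x + (((n : ℝ) - 1) / 2 : ℝ) * φ x‖ ^ 2
        - ‖φ x‖ ^ 2 / 4 - ‖euler φ x + (((n : ℝ) - 2) / 2 : ℝ) * φ x‖ ^ 2) / ‖x‖ ^ 2 =
        (wB ε ‖x‖ * ‖Z x‖ ^ 2 / ‖x‖ ^ 2 - (1 / 4) * (wB ε ‖x‖ * ‖φ x‖ ^ 2 / ‖x‖ ^ 2)) -
        wB ε ‖x‖ * ‖euler φ x + (((n : ℝ) - 2) / 2 : ℝ) * φ x‖ ^ 2 / ‖x‖ ^ 2 := by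
        simp only [hZ]; ring
      simp only
      rw [e3]
      linarith
    rw [integral_sub i1 (i2.const_mul _), integral_const_mul] at h1
    linarith
  -- `a` is the parameter in `2 Re(Z̄D) ≤ a|Z|²/r² + a⁻¹r²|D|²`; it is chosen at the end.
  have key2 : ∀ a : ℝ, 0 < a → (1 - a) * (∫ x, wB ε ‖x‖ * ‖Z x‖ ^ 2 / ‖x‖ ^ 2)
      + (δ ^ 2 - 1 / 4) * (∫ x, wB ε ‖x‖ * ‖φ x‖ ^ 2 / ‖x‖ ^ 2) ≤
      a⁻¹ * ∫ x, wA ε ‖x‖ * (‖x‖ ^ 2 * ‖D x‖ ^ 2) := fun a ha => by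
    have h1 := integral_mono_ae hM.1 ((((i3.const_mul a⁻¹).sub (i1.const_mul (1 - a))).sub
      (i2.const_mul (δ ^ 2 - 1 / 4))).sub (i4.add i5))
      ((volume_singleton_zero_compl hn).mono fun x hx => ?_)
    · rw [hM.2, integral_sub' (((i3.const_mul a⁻¹).sub (i1.const_mul (1 - a))).sub
        (i2.const_mul (δ ^ 2 - 1 / 4))) (i4.add i5), integral_sub' ((i3.const_mul a⁻¹).sub
        (i1.const_mul (1 - a))) (i2.const_mul (δ ^ 2 - 1 / 4)), integral_sub' (i3.const_mul a⁻¹)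
        (i1.const_mul (1 - a)), integral_const_mul, integral_const_mul, integral_const_mul,
        integral_add' i4 i5] at h1
      linarith
    · have hr := norm_pos_iff.2 hx
      have hD' : -lap φ x + V x * φ x = D x + 2 * Complex.I * z * Z x / ‖x‖ := by
        rw [hD x hx]; ring
      -- Since `Re(2iz|Z|²) = -2ε|Z|²`, the real part of `z` has no effect. The term that remains
      -- changes the coefficient `wA (1 - 2εr)` of the square into `wA (1 + 2εr) = wB`.
      have e1 : ((starRingEnd ℂ) (Z x) * (-lap φ x + V x * φ x)).re =
          ((starRingEnd ℂ) (Z x) * D x).re - 2 * ε * ‖Z x‖ ^ 2 / ‖x‖ := by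
        have e2 : (starRingEnd ℂ) (Z x) * (D x + 2 * Complex.I * z * Z x / ‖x‖) =
            (starRingEnd ℂ) (Z x) * D x + ((‖Z x‖ ^ 2 / ‖x‖ * 2 : ℝ) : ℂ) * (Complex.I * z) := by
          have : (starRingEnd ℂ) (Z x) * Z x = ((‖Z x‖ ^ 2 : ℝ) : ℂ) := by
            rw [Complex.conj_mul']; norm_cast
          push_cast at this ⊢
          linear_combination (2 * Complex.I * z / ‖x‖) * this
        rw [hD', e2, Complex.add_re, Complex.re_ofReal_mul]
        simp [hεd]
        ring
      have e3 : 2 * ((starRingEnd ℂ) (Z x) * D x).re ≤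
          a * (‖Z x‖ ^ 2 / ‖x‖ ^ 2) + a⁻¹ * (‖x‖ ^ 2 * ‖D x‖ ^ 2) := by
        have : ((starRingEnd ℂ) (Z x) * D x).re ≤ ‖Z x‖ * ‖D x‖ := by
          refine (Complex.re_le_norm _).trans ?_
          rw [norm_mul, RCLike.norm_conj]
        have h2 : a * (‖Z x‖ ^ 2 / ‖x‖ ^ 2) + a⁻¹ * (‖x‖ ^ 2 * ‖D x‖ ^ 2) - 2 * (‖Z x‖ * ‖D x‖)
            = (a * (‖Z x‖ / ‖x‖) - ‖x‖ * ‖D x‖) ^ 2 / a := by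
          field_simp
          ring
        have h3 : 0 ≤ (a * (‖Z x‖ / ‖x‖) - ‖x‖ * ‖D x‖) ^ 2 / a := by positivity
        linarith
      have hAB := wA_le_wB hε hr.le
      have e4 : wA ε ‖x‖ * (2 * ((starRingEnd ℂ) (Z x) * D x).re) ≤
          a * (wB ε ‖x‖ * ‖Z x‖ ^ 2 / ‖x‖ ^ 2) + a⁻¹ * (wA ε ‖x‖ * (‖x‖ ^ 2 * ‖D x‖ ^ 2)) := by
        refine (mul_le_mul_of_nonneg_left e3 (wA_pos ε ‖x‖).le).trans ?_
        have : wA ε ‖x‖ * (a * (‖Z x‖ ^ 2 / ‖x‖ ^ 2)) ≤ wB ε ‖x‖ * (a * (‖Z x‖ ^ 2 / ‖x‖ ^ 2)) :=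
          mul_le_mul_of_nonneg_right hAB (by positivity)
        calc _ = wA ε ‖x‖ * (a * (‖Z x‖ ^ 2 / ‖x‖ ^ 2)) + a⁻¹ * (wA ε ‖x‖ * (‖x‖ ^ 2 * ‖D x‖ ^ 2)) := by
              ring
          _ ≤ _ := by
              refine add_le_add (this.trans (le_of_eq ?_)) le_rfl
              ring
      simp only [Pi.sub_apply, Pi.add_apply]
      change 2 * wA ε ‖x‖ * ((starRingEnd ℂ) (Z x) * (-lap φ x + V x * φ x)).re -
        (wA ε ‖x‖ * (1 - 2 * ε * ‖x‖) * ‖Z x‖ ^ 2 / ‖x‖ ^ 2 + _ + _) ≤ _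
      rw [e1]
      refine le_trans (le_of_eq ?_) (sub_le_sub_right e4 (wB ε ‖x‖ * ‖Z x‖ ^ 2 / ‖x‖ ^ 2 +
        (δ ^ 2 - 1 / 4) * (wB ε ‖x‖ * ‖φ x‖ ^ 2 / ‖x‖ ^ 2) + (wA ε ‖x‖ / ‖x‖ ^ 2 *
        (sphGradSq φ x + (lam n ^ 2 + ‖x‖ ^ 2 * tildeV V x - δ ^ 2) * ‖φ x‖ ^ 2) +
        2 * ε * wA ε ‖x‖ / ‖x‖ * (sphGradSq φ x +
          (lam n ^ 2 + ‖x‖ ^ 2 * V x - δ ^ 2) * ‖φ x‖ ^ 2)))) |>.trans (le_of_eq ?_)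
      · rw [sphGradSq_eq hx]
        unfold wB
        field_simp
        ring
      · ring
  have hX : 0 ≤ ∫ x, wA ε ‖x‖ * (‖x‖ ^ 2 * ‖D x‖ ^ 2) :=
    integral_nonneg fun x => mul_nonneg (wA_pos _ _).le (by positivity)
  have hAB : ∫ x, wA ε ‖x‖ * ‖φ x‖ ^ 2 / ‖x‖ ^ 2 ≤ ∫ x, wB ε ‖x‖ * ‖φ x‖ ^ 2 / ‖x‖ ^ 2 :=
    integral_mono i2' i2 fun x => by
      have := wA_le_wB hε (norm_nonneg x)
      simp only
      gcongr
  refine hAB.trans ?_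
  unfold aprioriSq
  split_ifs with h
  -- For `a ≤ 1`, `key1` turns the left side of `key2` into `δ² - a/4` times the integral. The
  -- product `a(δ² - a/4)` is largest, equal to `δ⁴`, at `a = 2δ²`, which is admissible when `δ² ≤
  -- 1/2`; otherwise `a = 1` is taken.
  · have h1 := key2 (2 * δ ^ 2) (by positivity)
    have h2 : δ ^ 2 / 2 * (∫ x, wB ε ‖x‖ * ‖φ x‖ ^ 2 / ‖x‖ ^ 2) ≤
        (2 * δ ^ 2)⁻¹ * ∫ x, wA ε ‖x‖ * (‖x‖ ^ 2 * ‖D x‖ ^ 2) := by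
      nlinarith [mul_nonneg (show 0 ≤ 1 - 2 * δ ^ 2 by linarith) (sub_nonneg.2 key1)]
    have h3 : 0 < δ ^ 2 := by positivity
    have h4 := mul_le_mul_of_nonneg_left h2 (show 0 ≤ 2 / δ ^ 2 by positivity)
    calc _ = 2 / δ ^ 2 * (δ ^ 2 / 2 * (∫ x, wB ε ‖x‖ * ‖φ x‖ ^ 2 / ‖x‖ ^ 2)) := by field_simp
      _ ≤ _ := h4
      _ = _ := by field_simp
  · have h1 := key2 1 one_pos
    have h3 : 0 < δ ^ 2 - 1 / 4 := by linarith
    rw [div_mul_eq_mul_div, le_div_iff₀ h3]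
    linarith

end Apriori

end CriticalDecay

namespace CriticalDecay

/-! ### Derivatives of products with radial functions. -/

section RadialProducts

variable {n : ℕ} {φ : E n → ℂ} {x : E n}

lemma differentiableAt_radial {G : Type*} [NormedAddCommGroup G] [NormedSpace ℝ G] {g : ℝ → G}
    {g' : G} (hx : x ≠ 0) (hg : HasDerivAt g g' ‖x‖) :
    DifferentiableAt ℝ (fun y : E n => g ‖y‖) x :=
  hg.differentiableAt.comp x ((contDiffAt_norm ℝ hx (n := 1)).differentiableAt (by norm_num))

lemma pd_radial_mul {g : ℝ → ℂ} {g' : ℂ} (hx : x ≠ 0) (hg : HasDerivAt g g' ‖x‖)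
    (hφ : DifferentiableAt ℝ φ x) (j : Fin n) :
    pd j (fun y => g ‖y‖ * φ y) x = (x j : ℂ) * (g' / ‖x‖ * φ x) + g ‖x‖ * pd j φ x := by
  rw [pd_mul (differentiableAt_radial hx hg) hφ, pd_radial hx hg, Complex.real_smul]
  push_cast; ring

lemma euler_eq_sum (φ : E n → ℂ) (x : E n) : euler φ x = ∑ j, (x j : ℂ) * pd j φ x := by
  simp [euler, ← sum_coord_mul_pd]

lemma sum_coord_sq_complex (x : E n) : ∑ j, (x j : ℂ) * (x j : ℂ) = (‖x‖ : ℂ) ^ 2 := by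
  have := norm_sq_eq_sum x
  rw [← Complex.ofReal_pow, this]
  push_cast
  exact Finset.sum_congr rfl fun j _ => by ring

lemma euler_radial_mul {g : ℝ → ℂ} {g' : ℂ} (hx : x ≠ 0) (hg : HasDerivAt g g' ‖x‖)
    (hφ : DifferentiableAt ℝ φ x) :
    euler (fun y => g ‖y‖ * φ y) x = ‖x‖ * g' * φ x + g ‖x‖ * euler φ x := by
  have h : (‖x‖ : ℂ) ≠ 0 := by exact_mod_cast (norm_pos_iff.2 hx).ne'
  simp only [euler_eq_sum, pd_radial_mul hx hg hφ, mul_add, Finset.sum_add_distrib]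
  have e1 : ∀ j, (x j : ℂ) * ((x j : ℂ) * (g' / ‖x‖ * φ x)) = (x j : ℂ) * (x j : ℂ) * (g' / ‖x‖ * φ x) :=
    fun j => by ring
  have e2 : ∀ j, (x j : ℂ) * (g ‖x‖ * pd j φ x) = g ‖x‖ * ((x j : ℂ) * pd j φ x) := fun j => by ring
  simp only [e1, e2, ← Finset.sum_mul, ← Finset.mul_sum, sum_coord_sq_complex]
  field_simp

/-- Leibniz rule with the radial Laplacian `g'' + (n-1)/r g'`. It serves both the factor `e^{-izr}`
and the radial cutoffs. -/
lemma lap_radial_mul {g g' : ℝ → ℂ} {g'' : ℂ} (hx : x ≠ 0)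
    (hg : ∀ r, 0 < r → HasDerivAt g (g' r) r) (hg' : HasDerivAt g' g'' ‖x‖)
    (hφ : ContDiff ℝ 2 φ) :
    lap (fun y => g ‖y‖ * φ y) x = (g'' + ((n : ℂ) - 1) / ‖x‖ * g' ‖x‖) * φ x
      + 2 * (g' ‖x‖ / ‖x‖) * euler φ x + g ‖x‖ * lap φ x := by
  have hr := norm_pos_iff.2 hx
  have h : (‖x‖ : ℂ) ≠ 0 := by exact_mod_cast hr.ne'
  have hd : ∀ y, DifferentiableAt ℝ φ y := hφ.differentiable (by norm_num)
  have hpd : ∀ j, DifferentiableAt ℝ (pd j φ) x := fun j =>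
    (contDiff_pd (m := 1) hφ (by norm_num) j).differentiable (by norm_num) x
  have hh : HasDerivAt (fun r : ℝ => g' r / (r : ℂ)) (g'' / ‖x‖ - g' ‖x‖ / ‖x‖ ^ 2) ‖x‖ := by
    refine (hg'.fun_div (HasDerivAt.ofReal_comp (hasDerivAt_id ‖x‖)) h).congr_deriv ?_
    simp only [id, Complex.ofReal_one]
    field_simp
  have hc : ∀ j : Fin n, DifferentiableAt ℝ (fun y : E n => ((y j : ℝ) : ℂ)) x := fun j =>
    (Complex.ofRealCLM.comp (EuclideanSpace.proj j : E n →L[ℝ] ℝ)).differentiableAt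
  have hpc : ∀ j : Fin n, pd j (fun y : E n => ((y j : ℝ) : ℂ)) x = 1 := fun j => by
    have := pd_clm (j := j) (x := x) Complex.ofRealCLM (f := fun y : E n => y j) (by fun_prop)
    rw [pd_coord, if_pos rfl] at this
    simpa using this
  have hφh := (differentiableAt_radial hx hh).fun_mul (hd x)
  have e : ∀ j, pd j (pd j (fun y => g ‖y‖ * φ y)) x =
      g' ‖x‖ / ‖x‖ * φ x + (x j : ℂ) * (x j : ℂ) * ((g'' / ‖x‖ - g' ‖x‖ / ‖x‖ ^ 2) / ‖x‖ * φ x)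
      + 2 * (g' ‖x‖ / ‖x‖) * ((x j : ℂ) * pd j φ x) + g ‖x‖ * pd j (pd j φ) x := fun j => by
    have h1 : pd j (fun y => g ‖y‖ * φ y) =ᶠ[𝓝 x] fun y =>
        ((y j : ℝ) : ℂ) * (g' ‖y‖ / (‖y‖ : ℝ) * φ y) + g ‖y‖ * pd j φ y := by
      filter_upwards [isOpen_compl_singleton.mem_nhds hx] with y hy
      exact pd_radial_mul hy (hg _ (norm_pos_iff.2 hy)) (hd y) j
    rw [pd_congr h1, pd_add ((hc j).fun_mul hφh)
      ((differentiableAt_radial hx (hg _ hr)).fun_mul (hpd j)), pd_mul (hc j) hφh, hpc,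
      pd_radial_mul (g := fun r => g' r / (r : ℂ)) hx hh (hd x), pd_radial_mul hx (hg _ hr) (hpd j)]
    ring
  unfold lap
  simp only [e, Finset.sum_add_distrib, ← Finset.sum_mul, ← Finset.mul_sum, sum_coord_sq_complex,
    ← euler_eq_sum, Finset.sum_const, Finset.card_univ, Fintype.card_fin, nsmul_eq_mul]
  field_simp
  ring

end RadialProducts

/-! ### The a priori estimate for test functions. -/

section AprioriTest

variable {n : ℕ} {u : E n → ℂ}

lemma IsTest.compact (hu : IsTest u) : IsCompact (tsupport u) := hu.2.1
lemma IsTest.zero_off (_hu : IsTest u) : ∀ x ∉ tsupport u, u x = 0 := fun _ hx =>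
  image_eq_zero_of_notMem_tsupport hx
lemma IsTest.contDiff2 (hu : IsTest u) : ContDiff ℝ 2 u := by exact_mod_cast contDiff_infty.1 hu.1 2
lemma IsTest.contDiff1 (hu : IsTest u) : ContDiff ℝ 1 u := by exact_mod_cast contDiff_infty.1 hu.1 1

lemma IsTest.lap_eq (hu : IsTest u) (x : E n) : (Δ u) x = lap u x :=
  laplacian_eq_sum_pd hu.contDiff2.contDiffAt

/-- A function vanishing off a compact subset of `ℝⁿ ∖ {0}` and smooth off the origin is a test
function. -/
lemma isTest_of {K : Set (E n)} (hK : IsCompact K) (h0 : (0 : E n) ∉ K)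
    (hu : ContDiffOn ℝ ∞ u {0}ᶜ) (hz : ∀ x ∉ K, u x = 0) : IsTest u := by
  have hs : tsupport u ⊆ K := closure_minimal
    (fun x hx => by by_contra h; exact hx (hz x h)) hK.isClosed
  exact ⟨contDiff_of_contDiffOn_compl hK.isClosed h0 hu hz,
    hK.of_isClosed_subset (isClosed_tsupport _) hs, fun h => h0 (hs h)⟩

/-- The a priori estimate for test functions. -/
theorem apriori (hn : n ≠ 0) (hu : IsTest u)
    {V : E n → ℝ} (hV : ContDiffOn ℝ 1 V {0}ᶜ) {δ : ℝ} (hδ : 0 < δ)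
    (hA2 : PositiveOnSpheres V δ) (hA3 : PositiveOnSpheres (tildeV V) δ)
    {z : ℂ} (hε : 0 ≤ z.im) :
    ∫ x, ‖u x‖ ^ 2 / ‖x‖ ^ 2 ≤
      aprioriSq δ * ∫ x, ‖x‖ ^ 2 * ‖-lap u x + V x * u x - z ^ 2 * u x‖ ^ 2 := by
  set g : ℝ → ℂ := fun r => Complex.exp (-Complex.I * z * r) with hg
  have hgd : ∀ r : ℝ, HasDerivAt g (-Complex.I * z * g r) r := fun r => by
    have h1 : HasDerivAt (fun r : ℝ => -Complex.I * z * (r : ℂ)) (-Complex.I * z) r := by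
      simpa using (HasDerivAt.ofReal_comp (hasDerivAt_id r)).const_mul (-Complex.I * z)
    exact h1.cexp.congr_deriv (by ring)
  have hgd2 : ∀ r : ℝ, HasDerivAt (fun r => -Complex.I * z * g r)
      (-Complex.I * z * (-Complex.I * z * g r)) r := fun r => (hgd r).const_mul _
  have hgs : ContDiff ℝ ∞ g := by
    have : ContDiff ℝ ∞ fun r : ℝ => (r : ℂ) := Complex.ofRealCLM.contDiff
    exact (contDiff_const.mul this).cexp
  set v : E n → ℂ := fun x => g ‖x‖ * u x with hv
  have hK := hu.compact
  have h0 : (0 : E n) ∉ tsupport u := hu.2.2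
  have hvz : ∀ x ∉ tsupport u, v x = 0 := fun x hx => by simp [hv, hu.zero_off x hx]
  have hvs : ContDiff ℝ ∞ v := contDiff_of_contDiffOn_compl hK.isClosed h0
    ((contDiffOn_radial hgs.contDiffOn).mul hu.1.contDiffOn) hvz
  have hv2 : ContDiff ℝ 2 v := by exact_mod_cast contDiff_infty.1 hvs 2
  have hv1 : ContDiff ℝ 1 v := by exact_mod_cast contDiff_infty.1 hvs 1
  -- `|e^{-izr}|² = e^{2r Im z}` is the inverse of the weight `wA`, so weighted integrals of `v` are
  -- unweighted integrals of `u`.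
  have hwg : ∀ r : ℝ, wA z.im r * ‖g r‖ ^ 2 = 1 := fun r => by
    rw [hg, wA]
    simp only [Complex.norm_exp]
    rw [← Real.exp_nat_mul, ← Real.exp_add]
    simp
    ring
  set D : E n → ℂ := fun x => -lap v x + V x * v x
      - 2 * Complex.I * z * (euler v x + (((n : ℝ) - 1) / 2 : ℝ) * v x) / ‖x‖ with hD
  have hDc : ContinuousOn D {0}ᶜ := by
    have hVc : ContinuousOn (fun x => (V x : ℂ)) {0}ᶜ :=
      Complex.continuous_ofReal.comp_continuousOn hV.continuousOn
    refine ((continuous_lap hv2).neg.continuousOn.add (hVc.mul hvs.continuous.continuousOn)).sub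
      (ContinuousOn.div (continuous_const.mul ((continuous_euler hv1).add
        (continuous_const.mul hvs.continuous))).continuousOn ?_ fun x hx => ?_)
    · fun_prop
    · exact_mod_cast norm_ne_zero_iff.2 hx
  have key := apriori_conjugated hn hK h0 hvs hvz hV hδ hA2 hA3 hε hDc (fun x hx => by
    simp [hD, hvz x hx, lap_eq_zero hK.isClosed hvz hx, euler_eq_zero hK.isClosed hvz hx])
    fun x _ => rfl
  have hL : ∀ x, wA z.im ‖x‖ * ‖v x‖ ^ 2 / ‖x‖ ^ 2 = ‖u x‖ ^ 2 / ‖x‖ ^ 2 := fun x => by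
    rw [hv]
    simp only [norm_mul, mul_pow]
    rw [← mul_assoc, hwg, one_mul]
  have hR : ∀ x, x ≠ 0 → wA z.im ‖x‖ * (‖x‖ ^ 2 * ‖D x‖ ^ 2) =
      ‖x‖ ^ 2 * ‖-lap u x + V x * u x - z ^ 2 * u x‖ ^ 2 := fun x hx => by
    have h : (‖x‖ : ℂ) ≠ 0 := by exact_mod_cast (norm_pos_iff.2 hx).ne'
    -- `g''` contributes `z²` and the Euler field in the first order term contributes `-2z²`, so `D`
    -- is `e^{-izr}(-Δ + V - z²)u`.
    have e : D x = g ‖x‖ * (-lap u x + V x * u x - z ^ 2 * u x) := by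
      rw [hD]
      simp only
      rw [hv, lap_radial_mul hx (fun r _ => hgd r) (hgd2 ‖x‖) hu.contDiff2,
        euler_radial_mul hx (hgd ‖x‖) (hu.contDiff1.differentiable (by norm_num) x)]
      push_cast
      field_simp
      linear_combination (g ‖x‖ * ‖x‖ * z ^ 2 * u x) * Complex.I_sq
    rw [e, norm_mul, mul_pow]
    linear_combination (‖x‖ ^ 2 * ‖-lap u x + V x * u x - z ^ 2 * u x‖ ^ 2) * hwg ‖x‖
  rw [integral_congr_ae (ae_of_all _ hL),
    integral_congr_ae ((volume_singleton_zero_compl hn).mono hR)] at key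
  exact key

end AprioriTest

end CriticalDecay

namespace CriticalDecay

/-! ### Bounded multiplication operators on `L²`. -/

section Multiplication

variable {n : ℕ} {a b : E n → ℂ}

/-- `a` is measurable and bounded. -/
def IsMult (a : E n → ℂ) : Prop := Measurable a ∧ ∃ C : ℝ, ∀ x, ‖a x‖ ≤ C

lemma IsMult.memLp (ha : IsMult a) (f : L2 n) : MemLp (fun x => a x * f x) 2 := by
  obtain ⟨hm, C, hC⟩ := ha
  exact (Lp.memLp f).of_le_mul (hm.aestronglyMeasurable.mul (Lp.aestronglyMeasurable f))
    (ae_of_all _ fun x => by rw [norm_mul]; exact mul_le_mul_of_nonneg_right (hC x) (norm_nonneg _))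

open Classical in
/-- Multiplication by a bounded measurable function, on `L²`. -/
noncomputable def mulL2 (a : E n → ℂ) : L2 n →L[ℂ] L2 n :=
  if ha : IsMult a then
    LinearMap.mkContinuousOfExistsBound
      { toFun := fun f => (ha.memLp f).toLp
        map_add' := fun f g => by
          rw [← MemLp.toLp_add]
          refine MemLp.toLp_congr _ _ ?_
          filter_upwards [Lp.coeFn_add f g] with x hx
          change a x * (f + g : L2 n) x = a x * f x + a x * g x
          rw [hx, Pi.add_apply, mul_add]
        map_smul' := fun c f => by
          rw [RingHom.id_apply, ← MemLp.toLp_const_smul]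
          refine MemLp.toLp_congr _ _ ?_
          filter_upwards [Lp.coeFn_smul c f] with x hx
          simp [hx]
          ring }
      (by
        obtain ⟨hm, C, hC⟩ := id ha
        refine ⟨C, fun f => ?_⟩
        have hC0 : 0 ≤ C := (norm_nonneg _).trans (hC 0)
        simp only [LinearMap.coe_mk, AddHom.coe_mk]
        refine Lp.norm_le_mul_norm_of_ae_le_mul ?_
        filter_upwards [(ha.memLp f).coeFn_toLp] with x hx
        rw [hx, norm_mul]
        exact mul_le_mul_of_nonneg_right (hC x) (norm_nonneg _))
  else 0

lemma mulL2_ae (ha : IsMult a) (f : L2 n) : mulL2 a f =ᵐ[volume] fun x => a x * f x := by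
  rw [mulL2, dif_pos ha]
  exact (ha.memLp f).coeFn_toLp

lemma IsMult.conj (ha : IsMult a) : IsMult fun x => (starRingEnd ℂ) (a x) :=
  ⟨Complex.continuous_conj.measurable.comp ha.1, ha.2.imp fun C hC x => by
    simpa only [RCLike.norm_conj] using hC x⟩

lemma inner_mulL2_left (ha : IsMult a) (f g : L2 n) :
    ⟪mulL2 a f, g⟫_ℂ = ⟪f, mulL2 (fun x => (starRingEnd ℂ) (a x)) g⟫_ℂ := by
  rw [L2.inner_def, L2.inner_def]
  refine integral_congr_ae ?_
  filter_upwards [mulL2_ae ha f, mulL2_ae ha.conj g] with x h1 h2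
  rw [h1, h2]
  simp only [RCLike.inner_apply, map_mul]
  ring

lemma isMult_of_continuousOn {K : Set (E n)} (hK : IsCompact K) (h0 : (0 : E n) ∉ K)
    (ha : ContinuousOn a {0}ᶜ) (hz : ∀ x ∉ K, a x = 0) : IsMult a := by
  have hKs : K ⊆ {0}ᶜ := fun x hx h => h0 (by rw [← mem_singleton_iff.1 h]; exact hx)
  have hc : Continuous a := by
    rw [continuous_iff_continuousAt]
    intro x
    by_cases hx : x = 0
    · have : a =ᶠ[𝓝 x] fun _ => 0 := by
        filter_upwards [hK.isClosed.isOpen_compl.mem_nhds (by rw [hx]; exact h0)] with y hy using hz y hy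
      exact continuousAt_const.congr this.symm
    · exact ha.continuousAt (isOpen_compl_singleton.mem_nhds hx)
  obtain ⟨C, hC⟩ := hK.exists_bound_of_continuousOn hc.continuousOn
  refine ⟨hc.measurable, max C 0, fun x => ?_⟩
  by_cases hx : x ∈ K
  · exact (hC x hx).trans (le_max_left _ _)
  · simp [hz x hx]

/-- The bounded approximation `min (1/|x|) N` of `1/|x|`. -/
noncomputable def invN (N : ℕ) (x : E n) : ℂ := ((min ‖x‖⁻¹ N : ℝ) : ℂ)

lemma isMult_invN (N : ℕ) : IsMult (invN N : E n → ℂ) := by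
  refine ⟨Complex.measurable_ofReal.comp ((measurable_norm.inv).min measurable_const), N, fun x => ?_⟩
  rw [invN, Complex.norm_real, Real.norm_of_nonneg (le_min (by positivity) (by positivity))]
  exact min_le_right _ _

lemma norm_invN (N : ℕ) (x : E n) : ‖invN N x‖ = min ‖x‖⁻¹ N := by
  rw [invN, Complex.norm_real, Real.norm_of_nonneg (le_min (by positivity) (by positivity))]

lemma conj_invN (N : ℕ) : (fun x : E n => (starRingEnd ℂ) (invN N x)) = invN N := by
  ext x; simp [invN]

lemma memLp_of_continuousOn_compl {K : Set (E n)} (hK : IsCompact K) (h0 : (0 : E n) ∉ K)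
    {f : E n → ℂ} (hf : ContinuousOn f {0}ᶜ) (hz : ∀ x ∉ K, f x = 0) : MemLp f 2 := by
  refine (memLp_two_iff_integrable_sq_norm
    (integrable_of_continuousOn_compl hK h0 hf hz).aestronglyMeasurable).2 ?_
  exact integrable_of_continuousOn_compl hK h0 (hf.norm.pow 2) fun x hx => by simp [hz x hx]

lemma norm_toLp_sq {f : E n → ℂ} (hf : MemLp f 2) : ‖hf.toLp f‖ ^ 2 = ∫ x, ‖f x‖ ^ 2 := by
  rw [@norm_sq_eq_re_inner ℂ, L2.inner_def, ← integral_re (L2.integrable_inner _ _)]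
  refine integral_congr_ae ?_
  filter_upwards [hf.coeFn_toLp] with x hx
  rw [hx, ← norm_sq_eq_re_inner]

lemma inner_toLp {f g : E n → ℂ} (hf : MemLp f 2) (hg : MemLp g 2) :
    ⟪hf.toLp f, hg.toLp g⟫_ℂ = ∫ x, (starRingEnd ℂ) (f x) * g x := by
  rw [L2.inner_def]
  refine integral_congr_ae ?_
  filter_upwards [hf.coeFn_toLp, hg.coeFn_toLp] with x h1 h2
  rw [h1, h2, RCLike.inner_apply, mul_comm]

lemma inner_toLp_left {f : E n → ℂ} (hf : MemLp f 2) (g : L2 n) :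
    ⟪hf.toLp f, g⟫_ℂ = ∫ x, (starRingEnd ℂ) (f x) * g x := by
  rw [L2.inner_def]
  refine integral_congr_ae ?_
  filter_upwards [hf.coeFn_toLp] with x h1
  rw [h1, RCLike.inner_apply, mul_comm]

end Multiplication

/-! ### The quadratic form: positivity and comparison with the Dirichlet integral. -/

section Form

variable {n : ℕ} {V : E n → ℝ} {φ ψ : E n → ℂ} {δ : ℝ}

lemma CriticalBound.exists_bound (h : CriticalBound V) :
    ∃ M : ℝ, 0 ≤ M ∧ ∀ x : E n, x ≠ 0 → |V x| ≤ M / ‖x‖ ^ 2 := by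
  obtain ⟨⟨C, hC⟩, ⟨D, hD⟩⟩ := h
  refine ⟨max (max C D) 0, le_max_right _ _, fun x hx => ?_⟩
  have h1 := hC ⟨x, rfl⟩
  have h2 := hD ⟨x, rfl⟩
  have hr : 0 < ‖x‖ ^ 2 := by have := norm_pos_iff.2 hx; positivity
  rw [le_div_iff₀ hr]
  have h3 : max C D ≤ max (max C D) 0 := le_max_left _ _
  simp only at h1 h2
  rcases abs_cases (V x) with ⟨h, _⟩ | ⟨h, _⟩ <;> rw [h]
  · nlinarith [mul_le_mul_of_nonneg_left (le_max_left (V x) 0) hr.le, le_max_left C D]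
  · nlinarith [mul_le_mul_of_nonneg_left (le_max_left (-V x) 0) hr.le, le_max_right C D]

lemma norm_euler_sq_le (φ : E n → ℂ) (x : E n) : ‖euler φ x‖ ^ 2 ≤ ‖x‖ ^ 2 * gradSq φ x := by
  have h1 : ‖euler φ x‖ ≤ ∑ j, |x j| * ‖pd j φ x‖ := by
    rw [euler_eq_sum]
    refine (norm_sum_le _ _).trans (le_of_eq (Finset.sum_congr rfl fun j _ => ?_))
    rw [norm_mul, Complex.norm_real, Real.norm_eq_abs]
  refine (pow_le_pow_left₀ (norm_nonneg _) h1 2).trans ?_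
  refine (Finset.sum_mul_sq_le_sq_mul_sq _ _ _).trans (le_of_eq ?_)
  rw [norm_sq_eq_sum, gradSq_eq]
  simp

lemma IsTest.integrable {G : Type*} [NormedAddCommGroup G] (hφ : IsTest φ) {f : E n → G}
    (hf : ContinuousOn f {0}ᶜ) (hz : ∀ x ∉ tsupport φ, f x = 0) : Integrable f :=
  integrable_of_continuousOn_compl hφ.compact hφ.2.2 hf hz

lemma IsTest.integrable_gradSq (hφ : IsTest φ) : Integrable (gradSq φ) :=
  hφ.integrable (continuous_gradSq hφ.contDiff1).continuousOn fun _ hx =>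
    gradSq_eq_zero (isClosed_tsupport _) hφ.zero_off hx

lemma continuousOn_norm_sq_div (hφ : Continuous φ) :
    ContinuousOn (fun x => ‖φ x‖ ^ 2 / ‖x‖ ^ 2) {0}ᶜ :=
  (hφ.norm.pow 2).continuousOn.div (continuous_norm.pow 2).continuousOn
    fun _ hx => pow_ne_zero 2 (norm_ne_zero_iff.2 hx)

lemma IsTest.integrable_div (hφ : IsTest φ) : Integrable fun x => ‖φ x‖ ^ 2 / ‖x‖ ^ 2 :=
  hφ.integrable (continuousOn_norm_sq_div hφ.1.continuous) fun x hx => by simp [hφ.zero_off x hx]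

lemma IsTest.integrable_euler_div (hφ : IsTest φ) : Integrable fun x => ‖euler φ x‖ ^ 2 / ‖x‖ ^ 2 :=
  hφ.integrable (continuousOn_norm_sq_div (continuous_euler hφ.contDiff1)) fun x hx => by
    simp [euler_eq_zero (isClosed_tsupport _) hφ.zero_off hx]

lemma IsTest.integrable_pot (hφ : IsTest φ) (hV : ContinuousOn V {0}ᶜ) :
    Integrable fun x => V x * ‖φ x‖ ^ 2 :=
  hφ.integrable (hV.mul (hφ.1.continuous.norm.pow 2).continuousOn) fun x hx => by
    simp [hφ.zero_off x hx]

/-- Hardy's inequality for the radial derivative. -/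
lemma IsTest.hardy_radial (hn : n ≠ 0) (hφ : IsTest φ) :
    lam n ^ 2 * ∫ x, ‖φ x‖ ^ 2 / ‖x‖ ^ 2 ≤ ∫ x, ‖euler φ x‖ ^ 2 / ‖x‖ ^ 2 := by
  have h := hasZeroIntegral_hardy hn hφ.compact hφ.2.2 hφ.contDiff1 hφ.zero_off
  have h1 : 0 ≤ ∫ x, (‖euler φ x‖ ^ 2 / ‖x‖ ^ 2 - lam n ^ 2 * (‖φ x‖ ^ 2 / ‖x‖ ^ 2)) := by
    rw [← h.2]
    refine integral_mono h.1 (hφ.integrable_euler_div.sub (hφ.integrable_div.const_mul _)) fun x => ?_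
    have : 0 ≤ ‖euler φ x + lam n * φ x‖ ^ 2 / ‖x‖ ^ 2 := by positivity
    simp only [sub_div, mul_div_assoc]
    linarith
  rw [integral_sub hφ.integrable_euler_div (hφ.integrable_div.const_mul _), integral_const_mul] at h1
  linarith

/-- Hardy's inequality. -/
lemma IsTest.hardy (hn : n ≠ 0) (hφ : IsTest φ) :
    lam n ^ 2 * ∫ x, ‖φ x‖ ^ 2 / ‖x‖ ^ 2 ≤ ∫ x, gradSq φ x := by
  refine (hφ.hardy_radial hn).trans (integral_mono hφ.integrable_euler_div hφ.integrable_gradSq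
    fun x => ?_)
  by_cases hx : ‖x‖ = 0
  · simp [hx, gradSq_nonneg]
  · have := norm_euler_sq_le φ x
    have h2 : 0 < ‖x‖ ^ 2 := by positivity
    simp only
    rw [div_le_iff₀ h2]; linarith

lemma IsTest.formQ_eq (hφ : IsTest φ) (hV : ContinuousOn V {0}ᶜ) :
    formQ V φ = (∫ x, gradSq φ x) + ∫ x, V x * ‖φ x‖ ^ 2 :=
  integral_add hφ.integrable_gradSq (hφ.integrable_pot hV)

/-- The form is positive. -/
lemma IsTest.le_formQ (hn : n ≠ 0) (hφ : IsTest φ) (hV : ContinuousOn V {0}ᶜ)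
    (hA2 : PositiveOnSpheres V δ) :
    δ ^ 2 * ∫ x, ‖φ x‖ ^ 2 / ‖x‖ ^ 2 ≤ formQ V φ := by
  have hi : Integrable fun x => (‖x‖ ^ 2)⁻¹ *
      (sphGradSq φ x + (lam n ^ 2 + ‖x‖ ^ 2 * V x - δ ^ 2) * ‖φ x‖ ^ 2) := by
    refine hφ.integrable (ContinuousOn.mul ((continuous_norm.pow 2).continuousOn.inv₀
      fun x hx => pow_ne_zero 2 (norm_ne_zero_iff.2 hx)) ((continuousOn_sphGradSq hφ.contDiff1).add
        (((continuousOn_const.add ((continuous_norm.pow 2).continuousOn.mul hV)).sub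
          continuousOn_const).mul (hφ.1.continuous.norm.pow 2).continuousOn))) fun x hx => ?_
    simp [hφ.zero_off x hx, sphGradSq_eq_zero (isClosed_tsupport _) hφ.zero_off hx]
  -- The sphere inequality with radial weight `r⁻²` handles the angular part. Its constant `λ²` is
  -- exactly what the radial Hardy inequality pays for, and `δ²` is left over.
  have h1 := hA2.integral_nonneg hn hV hφ.1 (β := fun r => (r ^ 2)⁻¹) (fun r _ => by positivity) hi
  have h2 := hφ.hardy_radial hn
  have h3 : ∫ x, (‖x‖ ^ 2)⁻¹ * (sphGradSq φ x + (lam n ^ 2 + ‖x‖ ^ 2 * V x - δ ^ 2) * ‖φ x‖ ^ 2) =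
      ∫ x, (((gradSq φ x + V x * ‖φ x‖ ^ 2) - ‖euler φ x‖ ^ 2 / ‖x‖ ^ 2)
        + (lam n ^ 2 - δ ^ 2) * (‖φ x‖ ^ 2 / ‖x‖ ^ 2)) := by
    refine integral_congr_ae ((volume_singleton_zero_compl hn).mono fun x hx => ?_)
    have := (norm_pos_iff.2 hx).ne'
    simp only
    rw [sphGradSq_eq hx]
    field_simp
    ring
  have i1 : Integrable fun x => gradSq φ x + V x * ‖φ x‖ ^ 2 :=
    hφ.integrable_gradSq.add (hφ.integrable_pot hV)
  have i2 : Integrable fun x => (gradSq φ x + V x * ‖φ x‖ ^ 2) - ‖euler φ x‖ ^ 2 / ‖x‖ ^ 2 :=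
    i1.sub hφ.integrable_euler_div
  rw [h3, integral_add i2 (hφ.integrable_div.const_mul _),
    integral_sub i1 hφ.integrable_euler_div, integral_const_mul] at h1
  unfold formQ
  linarith

lemma IsTest.abs_pot_le (hn : n ≠ 0) (hφ : IsTest φ) (hV : ContinuousOn V {0}ᶜ) {M : ℝ}
    (hM : ∀ x : E n, x ≠ 0 → |V x| ≤ M / ‖x‖ ^ 2) :
    |∫ x, V x * ‖φ x‖ ^ 2| ≤ M * ∫ x, ‖φ x‖ ^ 2 / ‖x‖ ^ 2 := by
  rw [← integral_const_mul]
  refine abs_integral_le_integral_abs.trans (integral_mono_ae (hφ.integrable_pot hV).abs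
    (hφ.integrable_div.const_mul _) ((volume_singleton_zero_compl hn).mono fun x hx => ?_))
  simp only [abs_mul, abs_of_nonneg (sq_nonneg ‖φ x‖)]
  calc |V x| * ‖φ x‖ ^ 2 ≤ M / ‖x‖ ^ 2 * ‖φ x‖ ^ 2 :=
        mul_le_mul_of_nonneg_right (hM x hx) (by positivity)
    _ = _ := by ring

/-- The potential is at most `M/|x|²` in size, and the form itself controls `∫ |φ|²/|x|²` by
`IsTest.le_formQ`. -/
lemma IsTest.grad_le_formQ (hn : n ≠ 0) (hφ : IsTest φ) (hV : ContinuousOn V {0}ᶜ) (hδ : 0 < δ)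
    (hA2 : PositiveOnSpheres V δ) {M : ℝ} (hM0 : 0 ≤ M)
    (hM : ∀ x : E n, x ≠ 0 → |V x| ≤ M / ‖x‖ ^ 2) :
    ∫ x, gradSq φ x ≤ (1 + M / δ ^ 2) * formQ V φ := by
  have h1 := (abs_le.1 (hφ.abs_pot_le hn hV hM)).1
  have h2 := hφ.le_formQ hn hV hA2
  have h3 := hφ.formQ_eq hV
  have hδ2 : 0 < δ ^ 2 := by positivity
  have h4 : M * (∫ x, ‖φ x‖ ^ 2 / ‖x‖ ^ 2) ≤ M / δ ^ 2 * formQ V φ := by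
    rw [div_mul_eq_mul_div, le_div_iff₀ hδ2]
    nlinarith
  linarith

/-- The potential term is absorbed by Hardy's inequality, whose constant `λ⁻²` is at most `4`
because `n ≥ 3`. -/
lemma IsTest.formQ_le_grad (hn : 3 ≤ n) (hφ : IsTest φ) (hV : ContinuousOn V {0}ᶜ)
    {M : ℝ} (hM0 : 0 ≤ M) (hM : ∀ x : E n, x ≠ 0 → |V x| ≤ M / ‖x‖ ^ 2) :
    formQ V φ ≤ (1 + 4 * M) * ∫ x, gradSq φ x := by
  have hn0 : n ≠ 0 := by omega
  have h1 := (abs_le.1 (hφ.abs_pot_le hn0 hV hM)).2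
  have h2 := hφ.hardy hn0
  have h3 := hφ.formQ_eq hV
  have hl : 1 / 2 ≤ lam n := by
    have : (3 : ℝ) ≤ n := by exact_mod_cast hn
    unfold lam; linarith
  have h5 : 0 ≤ ∫ x, ‖φ x‖ ^ 2 / ‖x‖ ^ 2 := integral_nonneg fun x => by positivity
  have h6 : (1 / 4) * (∫ x, ‖φ x‖ ^ 2 / ‖x‖ ^ 2) ≤ ∫ x, gradSq φ x :=
    (mul_le_mul_of_nonneg_right (by nlinarith) h5).trans h2
  nlinarith [mul_le_mul_of_nonneg_left h6 hM0]

end Form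

end CriticalDecay

namespace CriticalDecay

/-! ### Test functions, and the inverse `T = (P + 1)⁻¹`. -/

section TestFunctions

variable {n : ℕ} {V : E n → ℝ} {φ ψ : E n → ℂ}

lemma IsTest.add (hφ : IsTest φ) (hψ : IsTest ψ) : IsTest fun x => φ x + ψ x :=
  isTest_of (hφ.compact.union hψ.compact) (fun h => h.elim hφ.2.2 hψ.2.2)
    (hφ.1.add hψ.1).contDiffOn fun x hx => by
      rw [hφ.zero_off x fun h => hx (Or.inl h), hψ.zero_off x fun h => hx (Or.inr h), add_zero]

lemma IsTest.const_mul (hφ : IsTest φ) (c : ℂ) : IsTest fun x => c * φ x :=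
  isTest_of hφ.compact hφ.2.2 (contDiff_const.mul hφ.1).contDiffOn fun x hx => by
    rw [hφ.zero_off x hx, mul_zero]

lemma isTest_zero : IsTest (fun _ : E n => (0 : ℂ)) :=
  isTest_of isCompact_empty (notMem_empty _) contDiffOn_const fun _ _ => rfl

lemma IsTest.memLp (hφ : IsTest φ) : MemLp φ 2 :=
  memLp_of_continuousOn_compl hφ.compact hφ.2.2 hφ.1.continuous.continuousOn hφ.zero_off

lemma IsTest.continuousOn_op (hφ : IsTest φ) (hV : ContinuousOn V {0}ᶜ) :
    ContinuousOn (fun x => -lap φ x + V x * φ x) {0}ᶜ :=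
  (continuous_lap hφ.contDiff2).neg.continuousOn.add
    ((Complex.continuous_ofReal.comp_continuousOn hV).mul hφ.1.continuous.continuousOn)

lemma IsTest.op_zero_off (hφ : IsTest φ) : ∀ x ∉ tsupport φ, -lap φ x + V x * φ x = 0 := fun x hx => by
  simp [lap_eq_zero (isClosed_tsupport _) hφ.zero_off hx, hφ.zero_off x hx]

lemma IsTest.memLp_op (hφ : IsTest φ) (hV : ContinuousOn V {0}ᶜ) :
    MemLp (fun x => -lap φ x + V x * φ x) 2 :=
  memLp_of_continuousOn_compl hφ.compact hφ.2.2 (hφ.continuousOn_op hV) hφ.op_zero_off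

lemma IsTest.contDiff_pd (hφ : IsTest φ) (j : Fin n) : ContDiff ℝ 1 (pd j φ) :=
  CriticalDecay.contDiff_pd hφ.contDiff2 (by norm_num) j

lemma IsTest.pd_zero_off (hφ : IsTest φ) (j : Fin n) : ∀ x ∉ tsupport φ, pd j φ x = 0 := fun _ hx =>
  pd_eq_zero_of_notMem (isClosed_tsupport _) hφ.zero_off hx

lemma IsTest.memLp_pd (hφ : IsTest φ) (j : Fin n) : MemLp (pd j φ) 2 :=
  memLp_of_continuousOn_compl hφ.compact hφ.2.2 (hφ.contDiff_pd j).continuous.continuousOn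
    (hφ.pd_zero_off j)

lemma pd_conj {f : E n → ℂ} {x : E n} (hf : DifferentiableAt ℝ f x) (j : Fin n) :
    pd j (fun y => (starRingEnd ℂ) (f y)) x = (starRingEnd ℂ) (pd j f x) :=
  pd_clm (Complex.conjCLE : ℂ →L[ℝ] ℂ) hf

lemma contDiff_conj {f : E n → ℂ} {m : WithTop ℕ∞} (hf : ContDiff ℝ m f) :
    ContDiff ℝ m fun y => (starRingEnd ℂ) (f y) :=
  (Complex.conjCLE : ℂ →L[ℝ] ℂ).contDiff.comp hf

lemma integral_conj_mul_lap (hψ : IsTest ψ) (hφ : ContDiff ℝ 1 φ) :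
    ∫ x, (starRingEnd ℂ) (φ x) * lap ψ x = -∑ j, ∫ x, (starRingEnd ℂ) (pd j φ x) * pd j ψ x := by
  unfold lap
  simp only [Finset.mul_sum]
  have hc := contDiff_conj hφ
  rw [integral_finsetSum _ fun j _ => ?_, ← Finset.sum_neg_distrib]
  · refine Finset.sum_congr rfl fun j _ => ?_
    rw [integral_mul_pd_eq_neg hψ.compact hψ.2.2 hc (hψ.contDiff_pd j) (hψ.pd_zero_off j)]
    simp only [pd_conj (hφ.differentiable (by norm_num) _)]
  · refine hψ.integrable (hc.continuous.mul
      (contDiff_pd (m := 0) (hψ.contDiff_pd j) (by norm_num) j).continuous).continuousOn fun x hx => ?_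
    rw [pd_eq_zero_of_notMem (isClosed_tsupport _) (hψ.pd_zero_off j) hx, mul_zero]

lemma integral_conj_lap_mul (hφ : IsTest φ) (hψ : IsTest ψ) :
    ∫ x, (starRingEnd ℂ) (lap φ x) * ψ x = ∫ x, (starRingEnd ℂ) (φ x) * lap ψ x := by
  rw [integral_conj_mul_lap hψ hφ.contDiff1]
  have h := integral_conj_mul_lap hφ hψ.contDiff1
  have h2 := congrArg (starRingEnd ℂ) h
  rw [← integral_conj, map_neg, map_sum] at h2
  simp only [← integral_conj, map_mul, Complex.conj_conj] at h2
  simp only [mul_comm] at h2 ⊢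
  exact h2

lemma IsTest.formQ_eq_integral (hφ : IsTest φ) (hV : ContinuousOn V {0}ᶜ) :
    (∫ x, (starRingEnd ℂ) (φ x) * (-lap φ x + V x * φ x)) = (formQ V φ : ℂ) := by
  have i1 : Integrable fun x => (starRingEnd ℂ) (φ x) * lap φ x :=
    hφ.integrable ((contDiff_conj hφ.contDiff1).continuous.mul
      (continuous_lap hφ.contDiff2)).continuousOn fun x hx => by simp [hφ.zero_off x hx]
  have i2 : Integrable fun x => ((V x * ‖φ x‖ ^ 2 : ℝ) : ℂ) := (hφ.integrable_pot hV).ofReal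
  have e1 : ∀ x, (starRingEnd ℂ) (φ x) * (-lap φ x + V x * φ x) =
      -((starRingEnd ℂ) (φ x) * lap φ x) + ((V x * ‖φ x‖ ^ 2 : ℝ) : ℂ) := fun x => by
    push_cast
    rw [← Complex.conj_mul']; ring
  simp only [e1]
  rw [integral_add i1.fun_neg i2, integral_neg, integral_conj_mul_lap hφ hφ.contDiff1, neg_neg,
    hφ.formQ_eq hV, integral_complex_ofReal, Complex.ofReal_add]
  congr 1
  rw [← integral_complex_ofReal, ← integral_finsetSum _ fun j _ => ?_]
  · refine integral_congr_ae (ae_of_all _ fun x => ?_)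
    simp only [gradSq_eq]
    push_cast
    exact Finset.sum_congr rfl fun j _ => Complex.conj_mul' _
  · exact hφ.integrable ((contDiff_conj (hφ.contDiff_pd j)).continuous.mul
      (hφ.contDiff_pd j).continuous).continuousOn fun x hx => by simp [hφ.pd_zero_off j x hx]

lemma lap_add (hφ : ContDiff ℝ 2 φ) (hψ : ContDiff ℝ 2 ψ) (x : E n) :
    lap (fun y => φ y + ψ y) x = lap φ x + lap ψ x := by
  have h : ∀ j, pd j (fun y => φ y + ψ y) = fun y => pd j φ y + pd j ψ y := fun j => funext fun y =>
    pd_add (hφ.differentiable (by norm_num) y) (hψ.differentiable (by norm_num) y)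
  unfold lap
  rw [← Finset.sum_add_distrib]
  refine Finset.sum_congr rfl fun j _ => ?_
  rw [h, pd_add ((contDiff_pd (m := 1) hφ (by norm_num) j).differentiable (by norm_num) x)
    ((contDiff_pd (m := 1) hψ (by norm_num) j).differentiable (by norm_num) x)]

lemma lap_const_mul (hφ : ContDiff ℝ 2 φ) (c : ℂ) (x : E n) :
    lap (fun y => c * φ y) x = c * lap φ x := by
  have h : ∀ j, pd j (fun y => c * φ y) = fun y => c * pd j φ y := fun j => funext fun y =>
    pd_const_mul c (hφ.differentiable (by norm_num) y)
  unfold lap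
  rw [Finset.mul_sum]
  refine Finset.sum_congr rfl fun j _ => ?_
  rw [h, pd_const_mul c ((contDiff_pd (m := 1) hφ (by norm_num) j).differentiable (by norm_num) x)]

/-- The space `C_c^∞(ℝⁿ ∖ {0})`. -/
def testSpace (n : ℕ) : Submodule ℂ (E n → ℂ) where
  carrier := {φ | IsTest φ}
  add_mem' := fun h1 h2 => IsTest.add h1 h2
  zero_mem' := isTest_zero
  smul_mem' := fun c _ h => IsTest.const_mul h c

/-- The inclusion of the test functions in `L²`. -/
noncomputable def testIncl (n : ℕ) : testSpace n →ₗ[ℂ] L2 n where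
  toFun φ := (IsTest.memLp φ.2).toLp
  map_add' φ ψ := MemLp.toLp_add (IsTest.memLp φ.2) (IsTest.memLp ψ.2)
  map_smul' c φ := MemLp.toLp_const_smul c (IsTest.memLp φ.2)

/-- The operator `-Δ + V + 1` on the test functions. -/
noncomputable def testOp (hV : ContinuousOn V {0}ᶜ) : testSpace n →ₗ[ℂ] L2 n where
  toFun φ := (IsTest.memLp_op φ.2 hV).toLp + testIncl n φ
  map_add' φ ψ := by
    rw [map_add, add_add_add_comm, ← MemLp.toLp_add]
    congr 1
    refine MemLp.toLp_congr _ _ (ae_of_all _ fun x => ?_)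
    have := lap_add (IsTest.contDiff2 φ.2) (IsTest.contDiff2 ψ.2) x
    change -lap (fun y => φ.1 y + ψ.1 y) x + V x * (φ.1 x + ψ.1 x) = (_ + _) + (_ + _)
    rw [this]; ring
  map_smul' c φ := by
    rw [map_smul, RingHom.id_apply, smul_add, ← MemLp.toLp_const_smul]
    congr 1
    refine MemLp.toLp_congr _ _ (ae_of_all _ fun x => ?_)
    have := lap_const_mul (IsTest.contDiff2 φ.2) c x
    change -lap (fun y => c * φ.1 y) x + V x * (c * φ.1 x) = c * (_ + _)
    rw [this]; ring

lemma inner_testIncl_testOp (hV : ContinuousOn V {0}ᶜ) (φ ψ : testSpace n) :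
    ⟪testIncl n φ, testOp hV ψ⟫_ℂ =
      (∫ x, (starRingEnd ℂ) (φ.1 x) * (-lap ψ.1 x + V x * ψ.1 x)) + ⟪testIncl n φ, testIncl n ψ⟫_ℂ := by
  change ⟪_, _ + testIncl n ψ⟫_ℂ = _
  rw [inner_add_right]
  congr 1
  exact inner_toLp (IsTest.memLp φ.2) (IsTest.memLp_op ψ.2 hV)

lemma inner_testOp_testIncl (hV : ContinuousOn V {0}ᶜ) (φ ψ : testSpace n) :
    ⟪testOp hV φ, testIncl n ψ⟫_ℂ =
      (∫ x, (starRingEnd ℂ) (-lap φ.1 x + V x * φ.1 x) * ψ.1 x) + ⟪testIncl n φ, testIncl n ψ⟫_ℂ := by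
  change ⟪_ + testIncl n φ, _⟫_ℂ = _
  rw [inner_add_left]
  congr 1
  exact inner_toLp (IsTest.memLp_op φ.2 hV) (IsTest.memLp ψ.2)

lemma integral_conj_op (hV : ContinuousOn V {0}ᶜ) (hφ : IsTest φ) (hψ : IsTest ψ) :
    ∫ x, (starRingEnd ℂ) (φ x) * (-lap ψ x + V x * ψ x) =
      ∫ x, (starRingEnd ℂ) (-lap φ x + V x * φ x) * ψ x := by
  have i1 : Integrable fun x => (starRingEnd ℂ) (φ x) * lap ψ x :=
    hφ.integrable ((contDiff_conj hφ.contDiff1).continuous.mul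
      (continuous_lap hψ.contDiff2)).continuousOn fun x hx => by simp [hφ.zero_off x hx]
  have i2 : Integrable fun x => (V x : ℂ) * ((starRingEnd ℂ) (φ x) * ψ x) :=
    hφ.integrable ((Complex.continuous_ofReal.comp_continuousOn hV).mul
      ((contDiff_conj hφ.contDiff1).continuous.mul hψ.1.continuous).continuousOn)
      fun x hx => by simp [hφ.zero_off x hx]
  have i3 : Integrable fun x => (starRingEnd ℂ) (lap φ x) * ψ x :=
    hψ.integrable ((Complex.continuous_conj.comp (continuous_lap hφ.contDiff2)).mul
      hψ.1.continuous).continuousOn fun x hx => by simp [hψ.zero_off x hx]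
  have e1 : ∀ x, (starRingEnd ℂ) (φ x) * (-lap ψ x + V x * ψ x) =
    -((starRingEnd ℂ) (φ x) * lap ψ x) + V x * ((starRingEnd ℂ) (φ x) * ψ x) := fun x => by ring
  have e2 : ∀ x, (starRingEnd ℂ) (-lap φ x + V x * φ x) * ψ x =
    -((starRingEnd ℂ) (lap φ x) * ψ x) + V x * ((starRingEnd ℂ) (φ x) * ψ x) := fun x => by
      simp only [map_add, map_neg, map_mul, Complex.conj_ofReal]; ring
  simp only [e1, e2]
  rw [integral_add i1.fun_neg i2, integral_add i3.fun_neg i2, integral_neg, integral_neg,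
    integral_conj_lap_mul hφ hψ]

/-- `T = (P + 1)⁻¹`, where `P` is the Friedrichs extension of `-Δ + V`. -/
structure IsFriedrichsInverse (V : E n → ℝ) (T : L2 n →L[ℂ] L2 n) : Prop where
  pos : IsPosContraction T
  apply_test : ∀ (hV : ContinuousOn V {0}ᶜ) (φ : testSpace n), T (testOp hV φ) = testIncl n φ
  weak : ∀ (hV : ContinuousOn V {0}ᶜ) (φ : testSpace n) (h : L2 n),
    ⟪testOp hV φ, T h⟫_ℂ = ⟪testIncl n φ, h⟫_ℂ
  approx : ∀ h : L2 n, ∃ φ : ℕ → testSpace n,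
    Tendsto (fun k => testIncl n (φ k)) atTop (𝓝 (T h)) ∧
    Tendsto (fun k => formQ V (φ k).1) atTop (𝓝 ((⟪T h, h⟫_ℂ).re - ‖T h‖ ^ 2)) ∧
    ∀ ε : ℝ, 0 < ε → ∃ N : ℕ, ∀ k ≥ N, ∀ l ≥ N, formQ V (φ k - φ l).1 < ε

lemma re_inner_testIncl_testOp (hV : ContinuousOn V {0}ᶜ) (φ : testSpace n) :
    (⟪testIncl n φ, testOp hV φ⟫_ℂ).re = formQ V φ.1 + ‖testIncl n φ‖ ^ 2 := by
  rw [inner_testIncl_testOp, IsTest.formQ_eq_integral φ.2 hV, inner_self_eq_norm_sq_to_K,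
    Complex.add_re, Complex.ofReal_re]
  norm_cast

lemma exists_isFriedrichsInverse {δ : ℝ} (hn : n ≠ 0) (hV : ContinuousOn V {0}ᶜ)
    (hA2 : PositiveOnSpheres V δ) : ∃ T, IsFriedrichsInverse V T := by
  have hpos : ∀ φ : testSpace n, 0 ≤ formQ V φ.1 := fun φ =>
    le_trans (mul_nonneg (sq_nonneg δ) (integral_nonneg fun x => by positivity))
      (IsTest.le_formQ hn φ.2 hV hA2)
  obtain ⟨T, h1, h2, h3, h4⟩ := exists_friedrichs_inverse (testIncl n) (testOp hV)
    (fun φ ψ => by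
      rw [inner_testIncl_testOp, inner_testOp_testIncl, integral_conj_op hV φ.2 ψ.2])
    (fun φ => by
      rw [re_inner_testIncl_testOp]
      linarith [hpos φ])
  refine ⟨T, h1, fun _ => h2, fun _ => h3, fun h => ?_⟩
  obtain ⟨φ, a1, a2, a3⟩ := h4 h
  refine ⟨φ, a1, ?_, fun ε hε => ?_⟩
  · have := a2.sub (a1.norm.pow 2)
    simpa only [re_inner_testIncl_testOp, add_sub_cancel_right] using this
  · obtain ⟨N, hN⟩ := a3 ε hε
    refine ⟨N, fun k hk l hl => lt_of_le_of_lt ?_ (hN k hk l hl)⟩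
    rw [re_inner_testIncl_testOp]
    exact le_add_of_nonneg_right (by positivity)

variable {T : L2 n →L[ℂ] L2 n}

/-- This is `P T h = h - T h`. It makes every `T h` an admissible test vector in the definitions of
the solutions, and those definitions are used with no other vectors. -/
lemma IsFriedrichsInverse.graph (hT : IsFriedrichsInverse V T) (hV : ContinuousOn V {0}ᶜ) (h : L2 n) :
    FriedrichsGraph V (T h) (h - T h) := by
  constructor
  · obtain ⟨φ, a1, -, a3⟩ := hT.approx h
    refine ⟨fun k => (φ k).1, fun k => (φ k).2, ?_, a3⟩
    have h1 : ∀ k, eLpNorm (fun x => (φ k).1 x - T h x) 2 volume = ‖testIncl n (φ k) - T h‖ₑ := fun k => by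
      rw [Lp.enorm_def]
      refine eLpNorm_congr_ae ?_
      filter_upwards [Lp.coeFn_sub (testIncl n (φ k)) (T h), (IsTest.memLp (φ k).2).coeFn_toLp] with x e1 e2
      rw [e1, Pi.sub_apply]
      exact congrArg (· - T h x) e2.symm
    simp only [h1]
    have := (tendsto_iff_norm_sub_tendsto_zero.1 a1)
    simpa [ofReal_norm] using ENNReal.tendsto_ofReal this
  · intro φ hφ
    have h1 := hT.weak hV ⟨φ, hφ⟩ h
    have h2 : ⟪testOp hV ⟨φ, hφ⟩, T h⟫_ℂ =
        (∫ x, (starRingEnd ℂ) (-lap φ x + V x * φ x) * T h x) + ⟪testIncl n ⟨φ, hφ⟩, T h⟫_ℂ := by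
      change ⟪_ + testIncl n ⟨φ, hφ⟩, _⟫_ℂ = _
      rw [inner_add_left]
      congr 1
      exact inner_toLp_left (hφ.memLp_op hV) _
    have h3 : ∫ x, (starRingEnd ℂ) (φ x) * (h - T h : L2 n) x = ⟪testIncl n ⟨φ, hφ⟩, h - T h⟫_ℂ :=
      (inner_toLp_left hφ.memLp _).symm
    rw [h3, inner_sub_right, ← h1, h2, add_sub_cancel_right]
    simp only [hφ.lap_eq]

/-- The origin is a null set, so testing against functions supported away from it still determines
an element of `L²`. -/
lemma eq_zero_of_inner_test_eq_zero (hn : n ≠ 0) {h : L2 n}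
    (hh : ∀ φ : testSpace n, ⟪testIncl n φ, h⟫_ℂ = 0) : h = 0 := by
  have hl : LocallyIntegrableOn (h : E n → ℂ) {0}ᶜ := fun x _ =>
    ((Lp.memLp h).locallyIntegrable (by norm_num) x).filter_mono nhdsWithin_le_nhds
  have h1 := isOpen_compl_singleton.ae_eq_zero_of_integral_contDiff_smul_eq_zero (U := ({0}ᶜ : Set (E n)))
    hl fun g hg hgc hgs => ?_
  · refine Lp.ext ?_
    filter_upwards [h1, volume_singleton_zero_compl hn, Lp.coeFn_zero ℂ 2 volume] with x a b c
    rw [a b, c, Pi.zero_apply]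
  · have ht : IsTest fun x => (g x : ℂ) := by
      refine isTest_of hgc (fun h => hgs h rfl) (Complex.ofRealCLM.contDiff.comp hg).contDiffOn ?_
      intro x hx
      simp [image_eq_zero_of_notMem_tsupport hx]
    have := hh ⟨_, ht⟩
    rw [testIncl] at this
    have h2 := inner_toLp_left ht.memLp h
    rw [← h2.symm.trans (this)] 
    refine integral_congr_ae (ae_of_all _ fun x => ?_)
    simp

lemma IsFriedrichsInverse.injective (hT : IsFriedrichsInverse V T) (hn : n ≠ 0)
    (hV : ContinuousOn V {0}ᶜ) (h : L2 n) (h0 : T h = 0) : h = 0 :=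
  eq_zero_of_inner_test_eq_zero hn fun φ => by rw [← hT.weak hV φ h, h0, inner_zero_right]

lemma norm_mulL2_invN_le (N : ℕ) (φ : testSpace n) :
    ‖mulL2 (invN N) (testIncl n φ)‖ ^ 2 ≤ ∫ x, ‖φ.1 x‖ ^ 2 / ‖x‖ ^ 2 := by
  have hφ : IsTest φ.1 := φ.2
  rw [@norm_sq_eq_re_inner ℂ, L2.inner_def, ← integral_re (L2.integrable_inner _ _)]
  refine integral_mono_ae (L2.integrable_inner _ _).re hφ.integrable_div ?_
  filter_upwards [mulL2_ae (isMult_invN N) (testIncl n φ), hφ.memLp.coeFn_toLp] with x h1 h2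
  rw [← norm_sq_eq_re_inner, h1, norm_mul, mul_pow, norm_invN]
  have h3 : (testIncl n φ : E n → ℂ) x = φ.1 x := h2
  rw [h3, div_eq_inv_mul, ← inv_pow]
  have : min ‖x‖⁻¹ (N : ℝ) ≤ ‖x‖⁻¹ := min_le_left _ _
  have h0 : 0 ≤ min ‖x‖⁻¹ (N : ℝ) := le_min (by positivity) (by positivity)
  gcongr

lemma eq_zero_of_mulL2_invN {N : ℕ} (hN : N ≠ 0) (hn : n ≠ 0) {f : L2 n} (h : mulL2 (invN N) f = 0) :
    f = 0 := by
  refine Lp.ext ?_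
  have h1 := mulL2_ae (isMult_invN N) f
  rw [h] at h1
  filter_upwards [h1, volume_singleton_zero_compl hn, Lp.coeFn_zero ℂ 2 volume] with x a b c
  rw [c] at a ⊢
  refine (mul_eq_zero.1 a.symm).resolve_left ?_
  refine norm_ne_zero_iff.1 ?_
  rw [norm_invN]
  have := norm_pos_iff.2 b
  have h2 : (0 : ℝ) < N := by exact_mod_cast Nat.pos_of_ne_zero hN
  exact (lt_min (by positivity) h2).ne'

/-- `T x = x` means `P x = 0`. The form then tends to `0` along the approximating test functions,
and by `IsTest.le_formQ` so does their weighted norm. -/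
lemma IsFriedrichsInverse.injective_one_sub (hT : IsFriedrichsInverse V T) (hn : n ≠ 0)
    (hV : ContinuousOn V {0}ᶜ) {δ : ℝ} (hδ : 0 < δ) (hA2 : PositiveOnSpheres V δ)
    (x : L2 n) (hx : T x = x) : x = 0 := by
  obtain ⟨φ, a1, a2, -⟩ := hT.approx x
  rw [hx] at a1 a2
  have e : (⟪x, x⟫_ℂ).re - ‖x‖ ^ 2 = 0 := by
    rw [inner_self_eq_norm_sq_to_K]; simp [← Complex.ofReal_pow]
  rw [e] at a2
  have h1 : Tendsto (fun k => ‖mulL2 (invN 1) (testIncl n (φ k))‖ ^ 2) atTop (𝓝 0) := by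
    have h2 : Tendsto (fun k => formQ V (φ k).1 / δ ^ 2) atTop (𝓝 0) := by
      simpa using a2.div_const (δ ^ 2)
    refine squeeze_zero (fun k => by positivity) (fun k => ?_) h2
    refine (norm_mulL2_invN_le 1 (φ k)).trans ?_
    rw [le_div_iff₀ (by positivity), mul_comm]
    exact IsTest.le_formQ hn (φ k).2 hV hA2
  have h3 := (((mulL2 (invN 1)).continuous.tendsto x).comp a1).norm.pow 2
  have h4 := tendsto_nhds_unique h3 h1
  exact eq_zero_of_mulL2_invN one_ne_zero hn (norm_eq_zero.1 (pow_eq_zero_iff two_ne_zero |>.1 h4))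

end TestFunctions

end CriticalDecay

namespace CriticalDecay

/-! ### Mollification in `L²`. -/

section Mollification

variable {n : ℕ}

open scoped Convolution in
/-- The convolution `ρ * F`. -/
noncomputable def moll (ρ : E n → ℝ) (F : E n → ℂ) : E n → ℂ :=
  ρ ⋆[ContinuousLinearMap.lsmul ℝ ℝ, volume] F

lemma moll_apply (ρ : E n → ℝ) (F : E n → ℂ) (x : E n) :
    moll ρ F x = ∫ t, ρ t • F (x - t) := rfl

lemma moll_apply_swap (ρ : E n → ℝ) (F : E n → ℂ) (x : E n) :
    moll ρ F x = ∫ y, (ρ (x - y) : ℂ) * F y :=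
  (convolution_lsmul_swap (μ := volume)).trans (by simp [Complex.real_smul])

lemma contDiff_moll {ρ : E n → ℝ} (hρ : ContDiff ℝ ∞ ρ) (hc : HasCompactSupport ρ) {F : E n → ℂ}
    (hF : LocallyIntegrable F) : ContDiff ℝ ∞ (moll ρ F) :=
  hc.contDiff_convolution_left _ hρ hF

lemma pd_moll {ρ : E n → ℝ} (hρ : ContDiff ℝ 1 ρ) (hc : HasCompactSupport ρ) {F : E n → ℂ}
    (hF : LocallyIntegrable F) (j : Fin n) : pd j (moll ρ F) = moll (pd j ρ) F := by
  ext x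
  have h := (hc.hasFDerivAt_convolution_left (ContinuousLinearMap.lsmul ℝ ℝ) hρ hF x).fderiv
  unfold pd moll
  rw [h]
  have hex := (hc.fderiv (𝕜 := ℝ)).convolutionExists_left
    ((ContinuousLinearMap.lsmul ℝ ℝ : ℝ →L[ℝ] ℂ →L[ℝ] ℂ).precompL (E n))
    (hρ.continuous_fderiv (by norm_num)) hF x
  rw [convolution_def, ContinuousLinearMap.integral_apply hex]
  rfl

lemma contDiff_pd_real {ρ : E n → ℝ} (hρ : ContDiff ℝ ∞ ρ) (j : Fin n) : ContDiff ℝ ∞ (pd j ρ) :=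
  contDiff_pd hρ (by exact_mod_cast le_refl _) j

lemma hasCompactSupport_pd {ρ : E n → ℝ} (hc : HasCompactSupport ρ) (j : Fin n) :
    HasCompactSupport (pd j ρ) :=
  HasCompactSupport.intro hc.isCompact fun _ hx =>
    pd_eq_zero_of_notMem hc.isClosed (fun _ hy => image_eq_zero_of_notMem_tsupport hy) hx

lemma L2.locallyIntegrable (F : L2 n) : LocallyIntegrable (F : E n → ℂ) :=
  (Lp.memLp F).locallyIntegrable (by norm_num)

/-- Translation. -/
noncomputable def shiftMap (t : E n) : C(E n, E n) := ⟨fun x => x - t, by fun_prop⟩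

lemma measurePreserving_shiftMap (t : E n) : MeasurePreserving (shiftMap t) := by
  have := measurePreserving_sub_right (volume : Measure (E n)) t
  exact this

lemma tendsto_shift (F : L2 n) :
    Tendsto (fun t : E n => ∫⁻ x, ‖F (x - t) - F x‖ₑ ^ 2) (𝓝 0) (𝓝 0) := by
  have hcont : Continuous (shiftMap : E n → C(E n, E n)) :=
    ContinuousMap.continuous_of_continuous_uncurry _ (by
      change Continuous fun p : E n × E n => p.2 - p.1
      fun_prop)
  have h1 : Tendsto (fun t : E n => Lp.compMeasurePreserving (shiftMap t)
      (measurePreserving_shiftMap t) F) (𝓝 0)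
      (𝓝 (Lp.compMeasurePreserving (shiftMap 0) (measurePreserving_shiftMap 0) F)) :=
    Filter.Tendsto.compMeasurePreservingLp tendsto_const_nhds (hcont.tendsto 0) _ _ (by norm_num)
  have h0 : Lp.compMeasurePreserving (shiftMap 0) (measurePreserving_shiftMap 0) F = F := by
    refine Lp.ext ((Lp.coeFn_compMeasurePreserving F _).trans (ae_of_all _ fun x => ?_))
    simp [shiftMap]
  rw [h0, tendsto_iff_edist_tendsto_0] at h1
  have h2 : ∀ t : E n, ∫⁻ x, ‖F (x - t) - F x‖ₑ ^ 2 =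
      edist (Lp.compMeasurePreserving (shiftMap t) (measurePreserving_shiftMap t) F) F ^ 2 := fun t => by
    rw [edist_eq_enorm_sub, enorm_sq_eq_lintegral]
    refine lintegral_congr_ae ?_
    filter_upwards [Lp.coeFn_sub (Lp.compMeasurePreserving (shiftMap t)
      (measurePreserving_shiftMap t) F) F, Lp.coeFn_compMeasurePreserving F
      (measurePreserving_shiftMap t)] with x e1 e2
    rw [e1, Pi.sub_apply, e2]
    rfl
  simp only [h2]
  simpa using ENNReal.Tendsto.pow (n := 2) h1

/-- Jensen's inequality for the probability measure with density `ρ`. -/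
lemma lintegral_mul_sq_le {ρ h : E n → ℝ≥0∞} (hρ : Measurable ρ) (h1 : ∫⁻ t, ρ t = 1)
    (hh : Measurable h) : (∫⁻ t, ρ t * h t) ^ 2 ≤ ∫⁻ t, ρ t * h t ^ 2 := by
  have : IsProbabilityMeasure ((volume : Measure (E n)).withDensity ρ) :=
    ⟨by rw [withDensity_apply _ MeasurableSet.univ, Measure.restrict_univ, h1]⟩
  have key := eLpNorm_le_eLpNorm_of_exponent_le (μ := (volume : Measure (E n)).withDensity ρ)
    (p := 1) (q := 2) (f := h) (by norm_num) hh.aestronglyMeasurable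
  rw [eLpNorm_one_eq_lintegral_enorm] at key
  have k2 := pow_le_pow_left' key 2
  rw [eLpNorm_eq_lintegral_rpow_enorm_toReal (by norm_num) (by norm_num), ← ENNReal.rpow_natCast,
    ← ENNReal.rpow_natCast, ← ENNReal.rpow_mul] at k2
  simp only [enorm_eq_self, ENNReal.toReal_ofNat, Nat.cast_ofNat, one_div, ne_eq, OfNat.ofNat_ne_zero,
    not_false_eq_true, inv_mul_cancel₀, ENNReal.rpow_one] at k2
  rw [lintegral_withDensity_eq_lintegral_mul _ hρ hh,
    lintegral_withDensity_eq_lintegral_mul _ hρ (hh.pow_const _)] at k2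
  simpa using k2

/-- `ρ * F - F` is the average of `F(· - t) - F` against `ρ`. Jensen's inequality and Tonelli's
theorem bound it by the largest translation error on the support of `ρ`. -/
lemma lintegral_moll_sub_sq_le {ρ : E n → ℝ} (hρ : Continuous ρ) (hc : HasCompactSupport ρ)
    (h0 : ∀ t, 0 ≤ ρ t) (h1 : ∫ t, ρ t = 1) {δ : ℝ} (hδ : ∀ t, ρ t ≠ 0 → ‖t‖ < δ) (F : L2 n)
    {ε : ℝ≥0∞} (hε : ∀ t : E n, ‖t‖ < δ → ∫⁻ x, ‖F (x - t) - F x‖ₑ ^ 2 ≤ ε) :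
    ∫⁻ x, ‖moll ρ F x - F x‖ₑ ^ 2 ≤ ε := by
  have hi : Integrable ρ := hρ.integrable_of_hasCompactSupport hc
  have hm : Measurable fun t => ‖ρ t‖ₑ := hρ.measurable.enorm
  have hmass : ∫⁻ t, ‖ρ t‖ₑ = 1 := by
    have := ofReal_integral_eq_lintegral_ofReal hi (ae_of_all _ h0)
    rw [h1] at this
    simp only [Real.enorm_eq_ofReal (h0 _), ← this, ENNReal.ofReal_one]
  have hF := (Lp.stronglyMeasurable F).measurable
  have hpt : ∀ x, ‖moll ρ F x - F x‖ₑ ^ 2 ≤ ∫⁻ t, ‖ρ t‖ₑ * ‖F (x - t) - F x‖ₑ ^ 2 := fun x => by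
    have hex : Integrable fun t => ρ t • F (x - t) :=
      hc.convolutionExists_left (ContinuousLinearMap.lsmul ℝ ℝ) hρ (L2.locallyIntegrable F) x
    have e1 : moll ρ F x - F x = ∫ t, ρ t • (F (x - t) - F x) := by
      simp only [smul_sub]
      rw [integral_sub hex (hi.smul_const _), integral_smul_const, h1, one_smul, moll_apply]
    have e2 : ‖moll ρ F x - F x‖ₑ ≤ ∫⁻ t, ‖ρ t‖ₑ * ‖F (x - t) - F x‖ₑ := by
      rw [e1]
      refine (enorm_integral_le_lintegral_enorm _).trans (le_of_eq ?_)
      simp only [enorm_smul]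
    refine (pow_le_pow_left' e2 2).trans (lintegral_mul_sq_le hm hmass ?_)
    exact ((hF.comp (measurable_const.sub measurable_id)).sub_const _).enorm
  have hmeas : Measurable fun p : E n × E n => ‖ρ p.2‖ₑ * ‖F (p.1 - p.2) - F p.1‖ₑ ^ 2 :=
    (hm.comp measurable_snd).mul (((hF.comp (measurable_fst.sub measurable_snd)).sub
      (hF.comp measurable_fst)).enorm.pow_const 2)
  calc ∫⁻ x, ‖moll ρ F x - F x‖ₑ ^ 2 ≤ ∫⁻ x, ∫⁻ t, ‖ρ t‖ₑ * ‖F (x - t) - F x‖ₑ ^ 2 :=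
        lintegral_mono hpt
    _ = ∫⁻ t, ∫⁻ x, ‖ρ t‖ₑ * ‖F (x - t) - F x‖ₑ ^ 2 := lintegral_lintegral_swap hmeas.aemeasurable
    _ = ∫⁻ t, ‖ρ t‖ₑ * ∫⁻ x, ‖F (x - t) - F x‖ₑ ^ 2 :=
        lintegral_congr fun t => lintegral_const_mul' _ _ enorm_ne_top
    _ ≤ ∫⁻ t, ‖ρ t‖ₑ * ε := lintegral_mono fun t => by
        by_cases ht : ρ t = 0
        · simp [ht]
        · exact mul_le_mul_right (hε t (hδ t ht)) _
    _ = ε := by rw [lintegral_mul_const _ hm, hmass, one_mul]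

/-- A standard mollifier, supported in the ball of radius `1/(k+1)`. -/
noncomputable def bumpK (n k : ℕ) : ContDiffBump (0 : E n) where
  rIn := 1 / (2 * (k + 1))
  rOut := 1 / (k + 1)
  rIn_pos := by positivity
  rIn_lt_rOut := by
    rw [div_lt_div_iff₀ (by positivity) (by positivity)]
    nlinarith [Nat.cast_nonneg (α := ℝ) k]

/-- The normalised mollifier. -/
noncomputable def rho (n k : ℕ) : E n → ℝ := (bumpK n k).normed volume

lemma contDiff_rho (k : ℕ) : ContDiff ℝ ∞ (rho n k) := (bumpK n k).contDiff_normed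

lemma hasCompactSupport_rho (k : ℕ) : HasCompactSupport (rho n k) := (bumpK n k).hasCompactSupport_normed

lemma rho_nonneg (k : ℕ) (x : E n) : 0 ≤ rho n k x := (bumpK n k).nonneg_normed x

lemma integral_rho (k : ℕ) : ∫ x, rho n k x = 1 := (bumpK n k).integral_normed

lemma norm_lt_of_rho_ne {k : ℕ} {x : E n} (h : rho n k x ≠ 0) : ‖x‖ < 1 / ((k : ℝ) + 1) := by
  have h1 : x ∈ Function.support (rho n k) := h
  rw [rho, (bumpK n k).support_normed_eq] at h1
  simpa [bumpK] using h1

lemma tendsto_lintegral_moll (F : L2 n) :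
    Tendsto (fun k => ∫⁻ x, ‖moll (rho n k) F x - F x‖ₑ ^ 2) atTop (𝓝 0) := by
  rw [ENNReal.tendsto_nhds_zero]
  intro ε hε
  have h1 := (ENNReal.tendsto_nhds_zero.1 (tendsto_shift F)) ε hε
  obtain ⟨δ, hδ, h2⟩ := Metric.eventually_nhds_iff.1 h1
  have h3 : Tendsto (fun k : ℕ => 1 / ((k : ℝ) + 1)) atTop (𝓝 0) := tendsto_one_div_add_atTop_nhds_zero_nat
  filter_upwards [h3.eventually_lt_const hδ] with k hk
  refine lintegral_moll_sub_sq_le (contDiff_rho k).continuous (hasCompactSupport_rho k) (rho_nonneg k)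
    (integral_rho k) (δ := δ) (fun t ht => (norm_lt_of_rho_ne ht).trans hk) F fun t ht => h2 ?_
  simpa using ht

lemma memLp_moll (k : ℕ) (F : L2 n) : MemLp (moll (rho n k) F) 2 := by
  have h1 : Continuous (moll (rho n k) F) :=
    (contDiff_moll (contDiff_rho k) (hasCompactSupport_rho k) (L2.locallyIntegrable F)).continuous
  have h2 : ∀ t : E n, ∫⁻ x, ‖F (x - t) - F x‖ₑ ^ 2 ≤ (2 * ‖F‖ₑ) ^ 2 := fun t => by
    have := enorm_sq_eq_lintegral (Lp.compMeasurePreserving (shiftMap t)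
      (measurePreserving_shiftMap t) F - F)
    have e : ∫⁻ x, ‖F (x - t) - F x‖ₑ ^ 2 = ‖Lp.compMeasurePreserving (shiftMap t)
      (measurePreserving_shiftMap t) F - F‖ₑ ^ 2 := by
      rw [this]
      refine lintegral_congr_ae ?_
      filter_upwards [Lp.coeFn_sub (Lp.compMeasurePreserving (shiftMap t)
        (measurePreserving_shiftMap t) F) F, Lp.coeFn_compMeasurePreserving F
        (measurePreserving_shiftMap t)] with x e1 e2
      rw [e1, Pi.sub_apply, e2]
      rfl
    rw [e]
    refine pow_le_pow_left' ((enorm_sub_le).trans ?_) 2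
    rw [two_mul]
    gcongr
    rw [← ofReal_norm, ← ofReal_norm, Lp.norm_compMeasurePreserving]
  have h3 := lintegral_moll_sub_sq_le (contDiff_rho k).continuous (hasCompactSupport_rho k) (rho_nonneg k)
    (integral_rho k) (fun t ht => norm_lt_of_rho_ne ht) F fun t _ => h2 t
  have h4 : MemLp (fun x => moll (rho n k) F x - F x) 2 := by
    refine ⟨h1.aestronglyMeasurable.sub (Lp.aestronglyMeasurable F), ?_⟩
    rw [eLpNorm_lt_top_iff_lintegral_rpow_enorm_lt_top (by norm_num) (by norm_num)]
    simp only [ENNReal.toReal_ofNat, ENNReal.rpow_ofNat]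
    exact h3.trans_lt (ENNReal.pow_lt_top (ENNReal.mul_lt_top (by norm_num) enorm_lt_top))
  have h5 := h4.add (Lp.memLp F)
  refine h5.ae_eq (ae_of_all _ fun x => ?_)
  simp

/-- The mollification as an element of `L²`. -/
noncomputable def mollL2 (k : ℕ) (F : L2 n) : L2 n := (memLp_moll k F).toLp

lemma mollL2_ae (k : ℕ) (F : L2 n) : mollL2 k F =ᵐ[volume] moll (rho n k) F :=
  (memLp_moll k F).coeFn_toLp

lemma tendsto_mollL2 (F : L2 n) : Tendsto (fun k => mollL2 k F) atTop (𝓝 F) := by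
  rw [tendsto_iff_edist_tendsto_0]
  have h : ∀ k, edist (mollL2 k F) F ^ 2 = ∫⁻ x, ‖moll (rho n k) F x - F x‖ₑ ^ 2 := fun k => by
    rw [edist_eq_enorm_sub, enorm_sq_eq_lintegral]
    refine lintegral_congr_ae ?_
    filter_upwards [Lp.coeFn_sub (mollL2 k F) F, mollL2_ae k F] with x e1 e2
    rw [e1, Pi.sub_apply, e2]
  have h1 := tendsto_lintegral_moll F
  simp only [← h] at h1
  have h2 := (ENNReal.continuous_rpow_const (y := 1 / 2)).tendsto _ |>.comp h1
  simp only [Function.comp_def] at h2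
  have h3 : ∀ a : ℝ≥0∞, (a ^ 2) ^ (2⁻¹ : ℝ) = a := fun a => by
    rw [← ENNReal.rpow_natCast, ← ENNReal.rpow_mul]; norm_num
  simpa [h3] using h2

end Mollification

end CriticalDecay

namespace CriticalDecay

/-! ### Derivatives of mollified elements of the domain. -/

section LocalEquation

variable {n : ℕ} {V : E n → ℝ} {T : L2 n →L[ℂ] L2 n} {δ : ℝ}

lemma IsFriedrichsInverse.weak_eq (hT : IsFriedrichsInverse V T) (hV : ContinuousOn V {0}ᶜ)
    {φ : E n → ℂ} (hφ : IsTest φ) (h : L2 n) :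
    ∫ x, (starRingEnd ℂ) (-lap φ x + V x * φ x) * T h x =
      ∫ x, (starRingEnd ℂ) (φ x) * (h - T h : L2 n) x := by
  have := (hT.graph hV h).2 φ hφ
  simpa only [hφ.lap_eq] using this

/-- Elements of the form domain have a gradient in `L²`. -/
lemma IsFriedrichsInverse.exists_gradient (hT : IsFriedrichsInverse V T) (hn : n ≠ 0)
    (hV : ContinuousOn V {0}ᶜ) (hδ : 0 < δ) (hA1 : CriticalBound V) (hA2 : PositiveOnSpheres V δ)
    (h : L2 n) :
    ∃ (φ : ℕ → testSpace n) (W : Fin n → L2 n),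
      Tendsto (fun k => testIncl n (φ k)) atTop (𝓝 (T h)) ∧
      Tendsto (fun k => formQ V (φ k).1) atTop (𝓝 ((⟪T h, h⟫_ℂ).re - ‖T h‖ ^ 2)) ∧
      ∀ j, Tendsto (fun k => (IsTest.memLp_pd (φ k).2 j).toLp) atTop (𝓝 (W j)) := by
  obtain ⟨φ, a1, a2, a3⟩ := hT.approx h
  obtain ⟨M, hM0, hM⟩ := hA1.exists_bound
  set C := 1 + M / δ ^ 2 with hC
  have hCpos : 0 < C := by positivity
  -- Sequences that are Cauchy for the form have Cauchy gradients, because `IsTest.grad_le_formQ`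
  -- bounds the Dirichlet integral by the form.
  have hcauchy : ∀ j, CauchySeq fun k => (IsTest.memLp_pd (φ k).2 j).toLp := fun j => by
    rw [Metric.cauchySeq_iff]
    intro ε hε
    obtain ⟨N, hN⟩ := a3 (ε ^ 2 / C) (by positivity)
    refine ⟨N, fun k hk l hl => ?_⟩
    have ht : IsTest (φ k - φ l).1 := (φ k - φ l).2
    have h1 : ‖(IsTest.memLp_pd (φ k).2 j).toLp - (IsTest.memLp_pd (φ l).2 j).toLp‖ ^ 2 =
        ∫ x, ‖pd j (φ k - φ l).1 x‖ ^ 2 := by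
      rw [← norm_toLp_sq (ht.memLp_pd j), ← MemLp.toLp_sub]
      congr 2
      refine MemLp.toLp_congr _ _ (ae_of_all _ fun x => ?_)
      exact (pd_sub ((IsTest.contDiff1 (φ k).2).differentiable (by norm_num) x)
        ((IsTest.contDiff1 (φ l).2).differentiable (by norm_num) x)).symm
    have h2 : ∫ x, ‖pd j (φ k - φ l).1 x‖ ^ 2 ≤ ∫ x, gradSq (φ k - φ l).1 x := by
      refine integral_mono ((ht.memLp_pd j).integrable_norm_pow (by norm_num)) ht.integrable_gradSq
        fun x => ?_
      exact Finset.single_le_sum (f := fun i => ‖pd i (φ k - φ l).1 x‖ ^ 2)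
        (fun i _ => by positivity) (Finset.mem_univ j)
    have h3 := ht.grad_le_formQ hn hV hδ hA2 hM0 hM
    have h4 := hN k hk l hl
    rw [dist_eq_norm]
    refine lt_of_pow_lt_pow_left₀ 2 hε.le ?_
    rw [h1]
    rw [lt_div_iff₀ hCpos] at h4
    linarith
  choose W hW using fun j => cauchySeq_tendsto_of_complete (hcauchy j)
  exact ⟨φ, W, a1, a2, hW⟩

/-- `y ↦ ρ(x - y)`. -/
lemma memLp_reflect {ρ : E n → ℝ} (hρ : Continuous ρ) (hc : HasCompactSupport ρ) (x : E n) :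
    MemLp (fun y => (ρ (x - y) : ℂ)) 2 := by
  have h1 : Continuous fun y => (ρ (x - y) : ℂ) := by fun_prop
  refine h1.memLp_of_hasCompactSupport ?_
  have h2 : HasCompactSupport fun y => ρ (x - y) := hc.comp_homeomorph (Homeomorph.subLeft x)
  exact h2.comp_left (g := fun r : ℝ => (r : ℂ)) Complex.ofReal_zero

lemma moll_eq_inner {ρ : E n → ℝ} (hρ : Continuous ρ) (hc : HasCompactSupport ρ) (F : L2 n) (x : E n) :
    moll ρ F x = ⟪(memLp_reflect hρ hc x).toLp, F⟫_ℂ := by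
  rw [moll_apply_swap, inner_toLp_left]
  simp

lemma moll_toLp (ρ : E n → ℝ) {f : E n → ℂ} (hf : MemLp f 2) (x : E n) :
    moll ρ (hf.toLp f) x = moll ρ f x := by
  rw [moll_apply_swap, moll_apply_swap]
  refine integral_congr_ae ?_
  filter_upwards [hf.coeFn_toLp] with y hy
  rw [hy]

lemma moll_pd_test {ρ : E n → ℝ} (hρ : ContDiff ℝ 1 ρ) (hc : HasCompactSupport ρ) {φ : E n → ℂ}
    (hφ : IsTest φ) (j : Fin n) : moll (pd j ρ) φ = moll ρ (pd j φ) := by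
  rw [← pd_moll hρ hc hφ.1.continuous.locallyIntegrable]
  ext x
  have hφ1 := hφ.contDiff1
  have h := (hφ.2.1.hasFDerivAt_convolution_right (ContinuousLinearMap.lsmul ℝ ℝ)
    hρ.continuous.locallyIntegrable hφ1 (μ := volume) x).fderiv
  unfold pd moll
  rw [h]
  have hex := (hφ.2.1.fderiv (𝕜 := ℝ)).convolutionExists_right
    ((ContinuousLinearMap.lsmul ℝ ℝ : ℝ →L[ℝ] ℂ →L[ℝ] ℂ).precompR (E n))
    hρ.continuous.locallyIntegrable (hφ1.continuous_fderiv (by norm_num)) (μ := volume) x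
  rw [convolution_def, ContinuousLinearMap.integral_apply hex]
  rfl

/-- `W` is the weak derivative of `w`. At a fixed point a mollification is an inner product with a
fixed `L²` function, so both sides are limits of their values for the `φ k`, where the derivative
may fall on either factor. -/
lemma pd_moll_eq {ρ : E n → ℝ} (hρ : ContDiff ℝ ∞ ρ) (hc : HasCompactSupport ρ)
    {φ : ℕ → testSpace n} {w : L2 n} {j : Fin n} {W : L2 n}
    (h1 : Tendsto (fun k => testIncl n (φ k)) atTop (𝓝 w))
    (h2 : Tendsto (fun k => (IsTest.memLp_pd (φ k).2 j).toLp) atTop (𝓝 W)) (x : E n) :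
    pd j (moll ρ w) x = moll ρ W x := by
  have hρ1 : ContDiff ℝ 1 ρ := by exact_mod_cast contDiff_infty.1 hρ 1
  have hρ' := (contDiff_pd_real hρ j).continuous
  have hc' := hasCompactSupport_pd hc j
  rw [pd_moll hρ1 hc (L2.locallyIntegrable w)]
  have e1 : Tendsto (fun k => moll (pd j ρ) (testIncl n (φ k)) x) atTop (𝓝 (moll (pd j ρ) w x)) := by
    simp only [moll_eq_inner hρ' hc']
    exact tendsto_const_nhds.inner h1
  have e2 : Tendsto (fun k => moll ρ ((IsTest.memLp_pd (φ k).2 j).toLp) x) atTop (𝓝 (moll ρ W x)) := by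
    simp only [moll_eq_inner hρ.continuous hc]
    exact tendsto_const_nhds.inner h2
  refine tendsto_nhds_unique e1 (e2.congr fun k => ?_)
  rw [moll_toLp, ← moll_pd_test hρ1 hc (φ k).2]
  exact (moll_toLp _ (IsTest.memLp (φ k).2) x).symm

lemma pd_reflect {f : E n → ℝ} (hf : ContDiff ℝ 1 f) (x y : E n) (j : Fin n) :
    pd j (fun y => (f (x - y) : ℂ)) y = -((pd j f (x - y) : ℝ) : ℂ) := by
  have h1 : DifferentiableAt ℝ f (x - y) := hf.differentiable (by norm_num) _
  have h2 : HasFDerivAt (fun y => f (x - y)) (-fderiv ℝ f (x - y)) y := by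
    have := h1.hasFDerivAt.comp y ((hasFDerivAt_id y).const_sub x)
    refine this.congr_fderiv ?_
    ext v; simp
  have h3 := pd_clm (j := j) Complex.ofRealCLM h2.differentiableAt
  have h4 : pd j (fun y => f (x - y)) y = -pd j f (x - y) := by
    rw [pd, h2.fderiv]; rfl
  rw [h4] at h3
  simpa using h3

lemma isTest_reflect {ρ : E n → ℝ} (hρ : ContDiff ℝ ∞ ρ) {x : E n}
    {b : ℝ} (hb : b < ‖x‖) (hs : ∀ t, ρ t ≠ 0 → ‖t‖ ≤ b) : IsTest fun y => (ρ (x - y) : ℂ) := by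
  refine isTest_of (K := Metric.closedBall x b) (isCompact_closedBall x b) ?_ ?_ fun y hy => ?_
  · simpa using hb
  · exact (Complex.ofRealCLM.contDiff.comp (hρ.comp (contDiff_const.sub contDiff_id))).contDiffOn
  · have : ρ (x - y) = 0 := by
      by_contra h
      exact hy (by rw [Metric.mem_closedBall, dist_comm, dist_eq_norm]; exact hs _ h)
    simp [this]

/-- The potential, cut off near the origin. -/
noncomputable def cutV (V : E n → ℝ) (a : ℝ) : E n → ℂ :=
  Set.indicator {x | a ≤ ‖x‖} fun x => (V x : ℂ)

lemma isMult_cutV (hV : ContinuousOn V {0}ᶜ) (hA1 : CriticalBound V) {a : ℝ} (ha : 0 < a) :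
    IsMult (cutV V a) := by
  obtain ⟨M, hM0, hM⟩ := hA1.exists_bound
  have hm : MeasurableSet {x : E n | a ≤ ‖x‖} := measurableSet_le measurable_const measurable_norm
  have h0 : ∀ x ∈ {x : E n | a ≤ ‖x‖}, x ≠ 0 := fun x hx h => by
    rw [h] at hx
    simp only [mem_ofPred_eq, norm_zero] at hx
    linarith
  constructor
  · rw [cutV, ← Set.piecewise_eq_indicator]
    exact ((Complex.continuous_ofReal.comp_continuousOn (hV.mono h0))).measurable_piecewise
      continuousOn_const hm
  · refine ⟨M / a ^ 2, fun x => ?_⟩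
    by_cases hx : a ≤ ‖x‖
    · rw [cutV, Set.indicator_of_mem (by exact hx), Complex.norm_real, Real.norm_eq_abs]
      exact (hM x (h0 x hx)).trans (by gcongr)
    · rw [cutV, Set.indicator_of_notMem (by exact hx), norm_zero]
      positivity

/-- The Laplacian of a mollified element of the domain. -/
lemma IsFriedrichsInverse.lap_moll (hT : IsFriedrichsInverse V T) (hV : ContinuousOn V {0}ᶜ)
    (hA1 : CriticalBound V) {ρ : E n → ℝ} (hρ : ContDiff ℝ ∞ ρ) (hc : HasCompactSupport ρ)
    {a b : ℝ} (ha : 0 < a) (hs : ∀ t, ρ t ≠ 0 → ‖t‖ ≤ b) {x : E n} (hx : a + b ≤ ‖x‖) (h : L2 n) :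
    lap (moll ρ (T h)) x = -moll ρ (h - T h - mulL2 (cutV V a) (T h) : L2 n) x := by
  have hρ1 : ContDiff ℝ 1 ρ := by exact_mod_cast contDiff_infty.1 hρ 1
  have hpρ : ∀ j, ContDiff ℝ ∞ (pd j ρ) := contDiff_pd_real hρ
  have hpρ1 : ∀ j, ContDiff ℝ 1 (pd j ρ) := fun j => by exact_mod_cast contDiff_infty.1 (hpρ j) 1
  have hpc : ∀ j, HasCompactSupport (pd j ρ) := hasCompactSupport_pd hc
  have hw := L2.locallyIntegrable (T h)
  have hbx : b < ‖x‖ := by linarith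
  -- `y ↦ ρ(x - y)` lives in `|y| ≥ a`, so it may be inserted in the weak equation, and `V` agrees
  -- with `cutV V a` on its support.
  have ht := isTest_reflect hρ hbx hs
  set φ : E n → ℂ := fun y => (ρ (x - y) : ℂ) with hφ
  have hcV := isMult_cutV hV hA1 ha
  have hlap : ∀ y, lap φ y = ∑ j, ((pd j (pd j ρ) (x - y) : ℝ) : ℂ) := fun y => by
    unfold lap
    refine Finset.sum_congr rfl fun j _ => ?_
    have e1 : pd j φ = fun y => -((pd j ρ (x - y) : ℝ) : ℂ) := funext fun y => pd_reflect hρ1 x y j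
    have e2 : pd j φ = fun y => (-1 : ℂ) * ((pd j ρ (x - y) : ℝ) : ℂ) := by rw [e1]; ext y; ring
    rw [e2, pd_const_mul, pd_reflect (hpρ1 j)]
    · ring
    · have : ContDiff ℝ 1 fun y => ((pd j ρ (x - y) : ℝ) : ℂ) :=
        Complex.ofRealCLM.contDiff.comp ((hpρ1 j).comp (contDiff_const.sub contDiff_id))
      exact this.differentiable (by norm_num) y
  have e1 : lap (moll ρ (T h)) x = ∫ y, lap φ y * T h y := by
    have i1 : ∀ j, Integrable fun y => ((pd j (pd j ρ) (x - y) : ℝ) : ℂ) * T h y := fun j =>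
      ((memLp_reflect (contDiff_pd_real (hpρ j) j).continuous (hasCompactSupport_pd (hpc j) j) x).integrable_mul
        (Lp.memLp (T h)))
    simp only [hlap, Finset.sum_mul]
    rw [integral_finsetSum _ fun j _ => i1 j]
    unfold lap
    refine Finset.sum_congr rfl fun j _ => ?_
    rw [pd_moll hρ1 hc hw, pd_moll (hpρ1 j) (hpc j) hw, moll_apply_swap]
  have e2 := hT.weak_eq hV ht h
  have hconj : ∀ y, (starRingEnd ℂ) (φ y) = φ y := fun y => Complex.conj_ofReal _
  have hconjl : ∀ y, (starRingEnd ℂ) (lap φ y) = lap φ y := fun y => by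
    rw [hlap, map_sum]; simp
  have hVφ : ∀ y, (V y : ℂ) * φ y * T h y = φ y * (cutV V a y * T h y) := fun y => by
    by_cases hy : φ y = 0
    · simp [hy]
    · have h1 : ρ (x - y) ≠ 0 := fun h0 => hy (by simp [hφ, h0])
      have h2 := hs _ h1
      have h3 : a ≤ ‖y‖ := by
        have := norm_sub_norm_le x (x - y)
        rw [sub_sub_cancel] at this
        linarith
      rw [cutV, Set.indicator_of_mem (by exact h3)]
      ring
  have ia : Integrable fun y => lap φ y * T h y := by
    have hm : MemLp (lap φ) 2 := memLp_of_continuousOn_compl ht.compact ht.2.2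
      (continuous_lap ht.contDiff2).continuousOn fun y hy => lap_eq_zero (isClosed_tsupport _) ht.zero_off hy
    exact hm.integrable_mul (Lp.memLp (T h))
  have ib : ∀ F : L2 n, Integrable fun y => φ y * F y := fun F => ht.memLp.integrable_mul (Lp.memLp F)
  have ec : ∀ᵐ y, φ y * (cutV V a y * T h y) = φ y * mulL2 (cutV V a) (T h) y := by
    filter_upwards [mulL2_ae hcV (T h)] with y hy
    rw [hy]
  have e3 : ∫ y, (starRingEnd ℂ) (-lap φ y + V y * φ y) * T h y =
      -(∫ y, lap φ y * T h y) + ∫ y, φ y * mulL2 (cutV V a) (T h) y := by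
    rw [← integral_neg, ← integral_add ia.fun_neg (ib _)]
    refine integral_congr_ae ?_
    filter_upwards [ec] with y hy
    rw [← hy, ← hVφ y]
    simp only [map_add, map_neg, map_mul, hconj, hconjl, Complex.conj_ofReal]
    ring
  simp only [hconj] at e2
  simp only [map_add, map_neg, map_mul, hconj] at e3
  rw [e1, moll_apply_swap]
  have e4 : ∫ y, φ y * (h - T h - mulL2 (cutV V a) (T h) : L2 n) y =
      (∫ y, φ y * (h - T h : L2 n) y) - ∫ y, φ y * mulL2 (cutV V a) (T h) y := by
    rw [← integral_sub (ib _) (ib _)]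
    refine integral_congr_ae ?_
    filter_upwards [Lp.coeFn_sub (h - T h) (mulL2 (cutV V a) (T h))] with y hy
    rw [hy, Pi.sub_apply]; ring
  change _ = -∫ y, φ y * _
  rw [e4, ← e2]
  simp only [map_add, map_neg, map_mul, hconj, e3]
  ring

end LocalEquation

end CriticalDecay

namespace CriticalDecay

/-! ### The a priori estimate for cut-off elements of the domain. -/

section Cutoff

variable {n : ℕ} {V : E n → ℝ} {T : L2 n →L[ℂ] L2 n} {δ : ℝ}

lemma norm_sq_eq_integral (f : L2 n) : ‖f‖ ^ 2 = ∫ x, ‖f x‖ ^ 2 := by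
  have := norm_toLp_sq (Lp.memLp f)
  rwa [Lp.toLp_coeFn] at this

lemma norm_mulL2_le {a : E n → ℂ} (ha : IsMult a) {C : ℝ} (hC : ∀ x, ‖a x‖ ≤ C) (f : L2 n) :
    ‖mulL2 a f‖ ≤ C * ‖f‖ := by
  refine Lp.norm_le_mul_norm_of_ae_le_mul ?_
  filter_upwards [mulL2_ae ha f] with x hx
  rw [hx, norm_mul]
  exact mul_le_mul_of_nonneg_right (hC x) (norm_nonneg _)

lemma norm_mulL2_le_mulL2 {a b : E n → ℂ} (ha : IsMult a) (hb : IsMult b) {C : ℝ}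
    (hC : ∀ x, x ≠ 0 → ‖a x‖ ≤ C * ‖b x‖) (hn : n ≠ 0) (f : L2 n) :
    ‖mulL2 a f‖ ≤ C * ‖mulL2 b f‖ := by
  refine Lp.norm_le_mul_norm_of_ae_le_mul ?_
  filter_upwards [mulL2_ae ha f, mulL2_ae hb f, volume_singleton_zero_compl hn] with x hx hy h0
  rw [hx, hy, norm_mul, norm_mul, ← mul_assoc]
  exact mul_le_mul_of_nonneg_right (hC x h0) (norm_nonneg _)

/-- `ϑ(|x|)` cuts off to the annulus `a ≤ |x| ≤ b`; `ϑ₁` and `ϑ₂` are the derivatives of `ϑ`. -/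
structure IsRadialCutoff (ϑ ϑ₁ ϑ₂ : ℝ → ℝ) (a b : ℝ) : Prop where
  pos : 0 < a
  smooth : ContDiffOn ℝ ∞ ϑ (Ioi 0)
  deriv1 : ∀ r, 0 < r → HasDerivAt ϑ (ϑ₁ r) r
  deriv2 : ∀ r, 0 < r → HasDerivAt ϑ₁ (ϑ₂ r) r
  cont2 : ContinuousOn ϑ₂ (Ioi 0)
  zero : ∀ r, 0 < r → r ∉ Icc a b → ϑ r = 0 ∧ ϑ₁ r = 0 ∧ ϑ₂ r = 0

lemma IsRadialCutoff.cont1 {ϑ ϑ₁ ϑ₂ : ℝ → ℝ} {a b : ℝ} (h : IsRadialCutoff ϑ ϑ₁ ϑ₂ a b) :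
    ContinuousOn ϑ₁ (Ioi 0) := fun r hr => (h.deriv2 r hr).continuousAt.continuousWithinAt

lemma IsRadialCutoff.cont {ϑ ϑ₁ ϑ₂ : ℝ → ℝ} {a b : ℝ} (h : IsRadialCutoff ϑ ϑ₁ ϑ₂ a b) :
    ContinuousOn ϑ (Ioi 0) := fun r hr => (h.deriv1 r hr).continuousAt.continuousWithinAt

/-- The closed annulus `a ≤ |x| ≤ b`. -/
def annulus (n : ℕ) (a b : ℝ) : Set (E n) := {x | ‖x‖ ∈ Icc a b}

lemma isCompact_annulus (a b : ℝ) : IsCompact (annulus n a b) := by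
  refine (isCompact_closedBall (0 : E n) b).of_isClosed_subset (isClosed_Icc.preimage continuous_norm)
    fun x hx => ?_
  simpa using hx.2

lemma zero_notMem_annulus {a b : ℝ} (ha : 0 < a) : (0 : E n) ∉ annulus n a b := fun h => by
  have := h.1
  rw [norm_zero] at this
  linarith

/-- Multipliers supported in an annulus. A value at the origin is irrelevant but must vanish. -/
lemma isMult_annulus {m : E n → ℂ} {a b : ℝ} (ha : 0 < a) (hm : ContinuousOn m {0}ᶜ)
    (h0 : m 0 = 0) (hz : ∀ x, x ≠ 0 → ‖x‖ ∉ Icc a b → m x = 0) : IsMult m :=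
  isMult_of_continuousOn (isCompact_annulus a b) (zero_notMem_annulus ha) hm fun x hx => by
    by_cases h : x = 0
    · rw [h, h0]
    · exact hz x h hx

lemma continuousOn_radial_complex {g : ℝ → ℝ} (hg : ContinuousOn g (Ioi 0)) :
    ContinuousOn (fun x : E n => (g ‖x‖ : ℂ)) {0}ᶜ :=
  Complex.continuous_ofReal.comp_continuousOn
    (hg.comp continuous_norm.continuousOn fun _ hx => norm_pos_iff.2 hx)

variable {ϑ ϑ₁ ϑ₂ : ℝ → ℝ} {a b : ℝ}

lemma IsRadialCutoff.isMult_div (h : IsRadialCutoff ϑ ϑ₁ ϑ₂ a b) :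
    IsMult fun x : E n => ((ϑ ‖x‖ / ‖x‖ : ℝ) : ℂ) :=
  isMult_annulus (b := b) h.pos (continuousOn_radial_complex (g := fun r => ϑ r / r)
    (h.cont.div continuousOn_id fun _ hr => ne_of_gt hr)) (by simp) fun x hx hxa => by
      simp [(h.zero _ (norm_pos_iff.2 hx) hxa).1]

lemma IsRadialCutoff.isMult_mul (h : IsRadialCutoff ϑ ϑ₁ ϑ₂ a b) :
    IsMult fun x : E n => ((‖x‖ * ϑ ‖x‖ : ℝ) : ℂ) :=
  isMult_annulus (b := b) h.pos (continuousOn_radial_complex (g := fun r => r * ϑ r)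
    (continuousOn_id.mul h.cont)) (by simp) fun x hx hxa => by
      simp [(h.zero _ (norm_pos_iff.2 hx) hxa).1]

lemma IsRadialCutoff.isMult_lap (h : IsRadialCutoff ϑ ϑ₁ ϑ₂ a b) :
    IsMult fun x : E n => ((‖x‖ * (ϑ₂ ‖x‖ + ((n : ℝ) - 1) / ‖x‖ * ϑ₁ ‖x‖) : ℝ) : ℂ) :=
  isMult_annulus (b := b) h.pos (continuousOn_radial_complex
    (g := fun r => r * (ϑ₂ r + ((n : ℝ) - 1) / r * ϑ₁ r))
    (continuousOn_id.mul (h.cont2.add ((continuousOn_const.div continuousOn_id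
      fun _ hr => ne_of_gt hr).mul h.cont1)))) (by simp) fun x hx hxa => by
      simp [(h.zero _ (norm_pos_iff.2 hx) hxa).2]

lemma IsRadialCutoff.isMult_grad (h : IsRadialCutoff ϑ ϑ₁ ϑ₂ a b) (j : Fin n) :
    IsMult fun x : E n => ((2 * ϑ₁ ‖x‖ * x j : ℝ) : ℂ) := by
  refine isMult_annulus (b := b) h.pos (Complex.continuous_ofReal.comp_continuousOn
    ((continuousOn_const.mul (h.cont1.comp continuous_norm.continuousOn
      fun _ hx => norm_pos_iff.2 hx)).mul (by fun_prop))) (by simp) fun x hx hxa => by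
      simp [(h.zero _ (norm_pos_iff.2 hx) hxa).2]

lemma IsRadialCutoff.isMult_pot (h : IsRadialCutoff ϑ ϑ₁ ϑ₂ a b) (hV : ContinuousOn V {0}ᶜ) (z : ℂ) :
    IsMult fun x : E n => ((‖x‖ * ϑ ‖x‖ : ℝ) : ℂ) * (V x - z ^ 2) :=
  isMult_annulus (b := b) h.pos ((continuousOn_radial_complex (g := fun r => r * ϑ r)
    (continuousOn_id.mul h.cont)).mul ((Complex.continuous_ofReal.comp_continuousOn hV).sub
      continuousOn_const)) (by simp) fun x hx hxa => by
      simp [(h.zero _ (norm_pos_iff.2 hx) hxa).1]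

/-- The a priori estimate for a cut-off element of the domain. -/
lemma apriori_cutoff (hn : n ≠ 0) (hT : IsFriedrichsInverse V T)
    (hV : ContDiffOn ℝ 1 V {0}ᶜ) (hδ : 0 < δ) (hA1 : CriticalBound V)
    (hA2 : PositiveOnSpheres V δ) (hA3 : PositiveOnSpheres (tildeV V) δ)
    {z : ℂ} (hz : 0 ≤ z.im) (hϑ : IsRadialCutoff ϑ ϑ₁ ϑ₂ a b) {h : L2 n}
    {φ : ℕ → testSpace n} {W : Fin n → L2 n}
    (h1 : Tendsto (fun k => testIncl n (φ k)) atTop (𝓝 (T h)))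
    (h2 : ∀ j, Tendsto (fun k => (IsTest.memLp_pd (φ k).2 j).toLp) atTop (𝓝 (W j))) :
    ‖mulL2 (fun x : E n => ((ϑ ‖x‖ / ‖x‖ : ℝ) : ℂ)) (T h)‖ ^ 2 ≤ aprioriSq δ *
      ‖mulL2 (fun x : E n => ((‖x‖ * ϑ ‖x‖ : ℝ) : ℂ)) (h - T h - z ^ 2 • T h)
        - mulL2 (fun x : E n => ((‖x‖ * (ϑ₂ ‖x‖ + ((n : ℝ) - 1) / ‖x‖ * ϑ₁ ‖x‖) : ℝ) : ℂ)) (T h)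
        - ∑ j, mulL2 (fun x : E n => ((2 * ϑ₁ ‖x‖ * x j : ℝ) : ℂ)) (W j)‖ ^ 2 := by
  have hVc := hV.continuousOn
  set w := T h with hw
  have m1 := hϑ.isMult_div (n := n)
  have m2 := hϑ.isMult_mul (n := n)
  have m3 := hϑ.isMult_lap (n := n)
  have m4 := hϑ.isMult_grad (n := n)
  have m5 := hϑ.isMult_pot hVc z
  have ha2 : 0 < a / 2 := half_pos hϑ.pos
  have m6 := isMult_cutV hVc hA1 ha2
  set H : L2 n := h - w - mulL2 (cutV V (a / 2)) w with hH
  -- `B w W H` is `|x|(-Δ + V - z²)(ϑw)` with `∇w` and `Δw` replaced by `W` and `-H`. Its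
  -- coefficients are bounded multipliers supported in the annulus, so it is continuous on `L²` and
  -- passes to the limit when the mollifier is removed.
  set B : L2 n → (Fin n → L2 n) → L2 n → L2 n := fun w' W' H' =>
    mulL2 (fun x : E n => ((‖x‖ * ϑ ‖x‖ : ℝ) : ℂ)) H'
      + mulL2 (fun x : E n => ((‖x‖ * ϑ ‖x‖ : ℝ) : ℂ) * (V x - z ^ 2)) w'
      - mulL2 (fun x : E n => ((‖x‖ * (ϑ₂ ‖x‖ + ((n : ℝ) - 1) / ‖x‖ * ϑ₁ ‖x‖) : ℝ) : ℂ)) w'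
      - ∑ j, mulL2 (fun x : E n => ((2 * ϑ₁ ‖x‖ * x j : ℝ) : ℂ)) (W' j) with hB
  have hBae : ∀ w' W' H', (B w' W' H' : E n → ℂ) =ᵐ[volume] fun x =>
      ((‖x‖ * ϑ ‖x‖ : ℝ) : ℂ) * H' x + ((‖x‖ * ϑ ‖x‖ : ℝ) : ℂ) * (V x - z ^ 2) * w' x
      - ((‖x‖ * (ϑ₂ ‖x‖ + ((n : ℝ) - 1) / ‖x‖ * ϑ₁ ‖x‖) : ℝ) : ℂ) * w' x
      - ∑ j, ((2 * ϑ₁ ‖x‖ * x j : ℝ) : ℂ) * W' j x := fun w' W' H' => by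
    have hs : ∀ᵐ x, ∀ j, mulL2 (fun x : E n => ((2 * ϑ₁ ‖x‖ * x j : ℝ) : ℂ)) (W' j) x =
        ((2 * ϑ₁ ‖x‖ * x j : ℝ) : ℂ) * W' j x := ae_all_iff.2 fun j => mulL2_ae (m4 j) (W' j)
    simp only [hB]
    filter_upwards [Lp.coeFn_sub (mulL2 (fun x : E n => ((‖x‖ * ϑ ‖x‖ : ℝ) : ℂ)) H'
      + mulL2 (fun x : E n => ((‖x‖ * ϑ ‖x‖ : ℝ) : ℂ) * (V x - z ^ 2)) w'
      - mulL2 (fun x : E n => ((‖x‖ * (ϑ₂ ‖x‖ + ((n : ℝ) - 1) / ‖x‖ * ϑ₁ ‖x‖) : ℝ) : ℂ)) w')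
      (∑ j, mulL2 (fun x : E n => ((2 * ϑ₁ ‖x‖ * x j : ℝ) : ℂ)) (W' j)),
      Lp.coeFn_sub (mulL2 (fun x : E n => ((‖x‖ * ϑ ‖x‖ : ℝ) : ℂ)) H'
      + mulL2 (fun x : E n => ((‖x‖ * ϑ ‖x‖ : ℝ) : ℂ) * (V x - z ^ 2)) w')
      (mulL2 (fun x : E n => ((‖x‖ * (ϑ₂ ‖x‖ + ((n : ℝ) - 1) / ‖x‖ * ϑ₁ ‖x‖) : ℝ) : ℂ)) w'),
      Lp.coeFn_add (mulL2 (fun x : E n => ((‖x‖ * ϑ ‖x‖ : ℝ) : ℂ)) H')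
      (mulL2 (fun x : E n => ((‖x‖ * ϑ ‖x‖ : ℝ) : ℂ) * (V x - z ^ 2)) w'),
      Lp.coeFn_finsetSum Finset.univ fun j => mulL2 (fun x : E n => ((2 * ϑ₁ ‖x‖ * x j : ℝ) : ℂ)) (W' j),
      hs, mulL2_ae m2 H', mulL2_ae m5 w', mulL2_ae m3 w'] with x e1 e2 e3 e4 e5 e6 e7 e8
    rw [e1, Pi.sub_apply, e2, Pi.sub_apply, e3, Pi.add_apply, e4, e6, e7, e8, Finset.sum_apply]
    simp only [e5]
  have hBc : Tendsto (fun k => B (mollL2 k w) (fun j => mollL2 k (W j)) (mollL2 k H)) atTop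
      (𝓝 (B w W H)) := by
    have c : ∀ (A : L2 n →L[ℂ] L2 n) (F : L2 n), Tendsto (fun k => A (mollL2 k F)) atTop (𝓝 (A F)) :=
      fun A F => (A.continuous.tendsto F).comp (tendsto_mollL2 F)
    exact (((c _ H).add (c _ w)).sub (c _ w)).sub (tendsto_finsetSum _ fun j _ => c _ (W j))
  have hlim1 : Tendsto (fun k => ‖mulL2 (fun x : E n => ((ϑ ‖x‖ / ‖x‖ : ℝ) : ℂ)) (mollL2 k w)‖ ^ 2)
      atTop (𝓝 (‖mulL2 (fun x : E n => ((ϑ ‖x‖ / ‖x‖ : ℝ) : ℂ)) w‖ ^ 2)) :=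
    ((((mulL2 _).continuous.tendsto w).comp (tendsto_mollL2 w)).norm).pow 2
  have hlim2 := ((hBc.norm).pow 2).const_mul (aprioriSq δ)
  have hstep : ∀ᶠ k : ℕ in atTop,
      ‖mulL2 (fun x : E n => ((ϑ ‖x‖ / ‖x‖ : ℝ) : ℂ)) (mollL2 k w)‖ ^ 2 ≤
        aprioriSq δ * ‖B (mollL2 k w) (fun j => mollL2 k (W j)) (mollL2 k H)‖ ^ 2 := by
    have h3 : Tendsto (fun k : ℕ => 1 / ((k : ℝ) + 1)) atTop (𝓝 0) := tendsto_one_div_add_atTop_nhds_zero_nat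
    -- With mollifier radius below `a/2` the mollified equation holds on the whole annulus, for the
    -- potential cut at `a/2`.
    filter_upwards [h3.eventually_lt_const ha2] with k hk
    set f := moll (rho n k) w with hf
    have hfs : ContDiff ℝ ∞ f := contDiff_moll (contDiff_rho k) (hasCompactSupport_rho k)
      (L2.locallyIntegrable w)
    have hf2 : ContDiff ℝ 2 f := by exact_mod_cast contDiff_infty.1 hfs 2
    set u : E n → ℂ := fun x => (ϑ ‖x‖ : ℂ) * f x with hu
    -- `ϑ` is controlled only for `r > 0` and may be nonzero at `0`: `logCut m 0 = 1`, because
    -- `Real.log 0 = 0`. The value at the origin is therefore set to `0`.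
    have ht : IsTest (fun x => if x = 0 then 0 else u x) := by
      refine isTest_of (isCompact_annulus a b) (zero_notMem_annulus hϑ.pos) ?_ fun x hx => ?_
      · have : ContDiffOn ℝ ∞ u {0}ᶜ := by
          refine ContDiffOn.mul ?_ hfs.contDiffOn
          exact Complex.ofRealCLM.contDiff.comp_contDiffOn (contDiffOn_radial hϑ.smooth)
        exact this.congr fun x hx => if_neg hx
      · by_cases h0 : x = 0
        · simp [h0]
        · rw [if_neg h0, hu]
          simp [(hϑ.zero _ (norm_pos_iff.2 h0) hx).1]
    have heq : ∀ x, x ≠ 0 → (fun x => if x = 0 then 0 else u x) =ᶠ[𝓝 x] u := fun x hx => by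
      filter_upwards [isOpen_compl_singleton.mem_nhds hx] with y hy using if_neg hy
    have hlapeq : ∀ x, x ≠ 0 → lap (fun x => if x = 0 then 0 else u x) x = lap u x := fun x hx => by
      unfold lap
      refine Finset.sum_congr rfl fun j _ => pd_congr ?_
      filter_upwards [(heq x hx).eventually_nhds] with y hy using pd_congr hy
    have key := apriori hn ht hV hδ hA2 hA3 hz
    refine (le_of_eq ?_).trans (key.trans (le_of_eq ?_))
    · rw [norm_sq_eq_integral]
      refine integral_congr_ae ?_
      filter_upwards [mulL2_ae m1 (mollL2 k w), mollL2_ae k w, volume_singleton_zero_compl hn] with x e1 e2 hx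
      rw [e1, e2, if_neg hx, hu]
      simp only [norm_mul, mul_pow, Complex.norm_real, Real.norm_eq_abs, sq_abs, div_pow]
      ring
    · congr 1
      rw [norm_sq_eq_integral]
      refine integral_congr_ae ?_
      have hs : ∀ᵐ x, ∀ j, mollL2 k (W j) x = moll (rho n k) (W j) x :=
        ae_all_iff.2 fun j => mollL2_ae k (W j)
      filter_upwards [hBae (mollL2 k w) (fun j => mollL2 k (W j)) (mollL2 k H), mollL2_ae k w,
        mollL2_ae k H, hs, volume_singleton_zero_compl hn] with x e1 e2 e3 e4 hx
      have hr := norm_pos_iff.2 hx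
      have hr' : (‖x‖ : ℂ) ≠ 0 := by exact_mod_cast hr.ne'
      rw [e1, e2, e3, hlapeq x hx, if_neg hx]
      simp only [e4]
      have hl := lap_radial_mul (g := fun r => (ϑ r : ℂ)) (g' := fun r => (ϑ₁ r : ℂ)) hx
        (fun r hr => (hϑ.deriv1 r hr).ofReal_comp) (hϑ.deriv2 _ hr).ofReal_comp hf2
      have he : euler f x = ∑ j, (x j : ℂ) * moll (rho n k) (W j) x := by
        rw [euler_eq_sum]
        refine Finset.sum_congr rfl fun j _ => ?_
        rw [hf, pd_moll_eq (contDiff_rho k) (hasCompactSupport_rho k) h1 (h2 j)]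
      have hlf : (ϑ ‖x‖ : ℂ) * lap f x = -((ϑ ‖x‖ : ℂ) * moll (rho n k) H x) := by
        by_cases hxa : ‖x‖ ∈ Icc a b
        · rw [hf, hH, hT.lap_moll hVc hA1 (contDiff_rho k) (hasCompactSupport_rho k) ha2
            (b := a / 2) (fun t ht => ((norm_lt_of_rho_ne ht).trans hk).le) (by linarith [hxa.1]) h]
          ring
        · simp [(hϑ.zero _ hr hxa).1]
      have hs2 : ∑ j, ((2 * ϑ₁ ‖x‖ * x j : ℝ) : ℂ) * moll (rho n k) (W j) x
          = 2 * ϑ₁ ‖x‖ * euler f x := by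
        rw [he, Finset.mul_sum]
        refine Finset.sum_congr rfl fun j _ => ?_
        push_cast; ring
      have e5 : ((‖x‖ * ϑ ‖x‖ : ℝ) : ℂ) * moll (rho n k) H x
          + ((‖x‖ * ϑ ‖x‖ : ℝ) : ℂ) * (V x - z ^ 2) * f x
          - ((‖x‖ * (ϑ₂ ‖x‖ + ((n : ℝ) - 1) / ‖x‖ * ϑ₁ ‖x‖) : ℝ) : ℂ) * f x
          - ∑ j, ((2 * ϑ₁ ‖x‖ * x j : ℝ) : ℂ) * moll (rho n k) (W j) x =
          ‖x‖ * (-lap u x + V x * u x - z ^ 2 * u x) := by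
        rw [hs2, hu, hl, hlf]
        push_cast
        field_simp
        ring
      rw [e5, norm_mul, mul_pow, Complex.norm_real, norm_norm]
  have hfin := le_of_tendsto_of_tendsto hlim1 hlim2 hstep
  -- On the annulus the potential contained in `H` cancels the one in the second multiplier.
  have hBeq : B w W H = mulL2 (fun x : E n => ((‖x‖ * ϑ ‖x‖ : ℝ) : ℂ)) (h - w - z ^ 2 • w)
        - mulL2 (fun x : E n => ((‖x‖ * (ϑ₂ ‖x‖ + ((n : ℝ) - 1) / ‖x‖ * ϑ₁ ‖x‖) : ℝ) : ℂ)) w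
        - ∑ j, mulL2 (fun x : E n => ((2 * ϑ₁ ‖x‖ * x j : ℝ) : ℂ)) (W j) := by
    simp only [hB]
    congr 2
    rw [hH, map_sub _ (h - w), map_sub _ (h - w), sub_add]
    congr 1
    refine Lp.ext ?_
    filter_upwards [Lp.coeFn_sub (mulL2 (fun x : E n => ((‖x‖ * ϑ ‖x‖ : ℝ) : ℂ))
        (mulL2 (cutV V (a / 2)) w))
      (mulL2 (fun x : E n => ((‖x‖ * ϑ ‖x‖ : ℝ) : ℂ) * (V x - z ^ 2)) w),
      mulL2_ae m2 (mulL2 (cutV V (a / 2)) w), mulL2_ae m6 w, mulL2_ae m5 w,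
      mulL2_ae m2 (z ^ 2 • w), Lp.coeFn_smul (z ^ 2) w, volume_singleton_zero_compl hn]
      with x e1 e2 e3 e4 e5 e6 hx
    rw [e1, Pi.sub_apply, e2, e3, e4, e5, e6, Pi.smul_apply, smul_eq_mul]
    by_cases hxa : ‖x‖ ∈ Icc a b
    · have : a / 2 ≤ ‖x‖ := by linarith [hxa.1, hϑ.pos]
      rw [cutV, Set.indicator_of_mem (by exact this)]
      ring
    · simp [(hϑ.zero _ (norm_pos_iff.2 hx) hxa).1]
  rwa [hBeq] at hfin

end Cutoff

end CriticalDecay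

namespace CriticalDecay

/-! ### Logarithmic cutoffs. -/

section LogCutoff

/-- A smooth bump on the line. -/
noncomputable def lineBump : ContDiffBump (0 : ℝ) := ⟨1, 2, one_pos, one_lt_two⟩

lemma contDiff_lineBump {m : ℕ∞} : ContDiff ℝ m lineBump := lineBump.contDiff

lemma contDiff_deriv_lineBump : ContDiff ℝ ∞ (deriv lineBump) :=
  (contDiff_infty_iff_deriv.1 contDiff_lineBump).2

lemma contDiff_deriv_deriv_lineBump : ContDiff ℝ ∞ (deriv (deriv lineBump)) :=
  (contDiff_infty_iff_deriv.1 contDiff_deriv_lineBump).2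

lemma lineBump_eq_zero {y : ℝ} (h : 2 < |y|) :
    lineBump y = 0 ∧ deriv lineBump y = 0 ∧ deriv (deriv lineBump) y = 0 := by
  have hE : {y : ℝ | 2 < |y|} ∈ 𝓝 y := (isOpen_lt continuous_const continuous_abs).mem_nhds h
  have h0 : lineBump =ᶠ[𝓝 y] fun _ => 0 := by
    filter_upwards [hE] with x hx
    refine lineBump.zero_of_le_dist ?_
    rw [Real.dist_eq, sub_zero]
    exact le_of_lt hx
  have h1 : deriv lineBump =ᶠ[𝓝 y] fun _ => 0 := by
    filter_upwards [h0.eventually_nhds] with x hx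
    rw [(show lineBump =ᶠ[𝓝 x] fun _ => 0 from hx).deriv_eq]; simp
  refine ⟨h0.eq_of_nhds, h1.eq_of_nhds, ?_⟩
  rw [h1.deriv_eq]; simp

lemma exists_lineBump_bound : ∃ C : ℝ, 0 ≤ C ∧
    ∀ y, |deriv lineBump y| ≤ C ∧ |deriv (deriv lineBump) y| ≤ C := by
  have hK : IsCompact (Icc (-2 : ℝ) 2) := isCompact_Icc
  obtain ⟨C, hC⟩ := hK.exists_bound_of_continuousOn contDiff_deriv_lineBump.continuous.continuousOn
  obtain ⟨D, hD⟩ := hK.exists_bound_of_continuousOn contDiff_deriv_deriv_lineBump.continuous.continuousOn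
  refine ⟨max (max C D) 0, le_max_right _ _, fun y => ?_⟩
  by_cases hy : |y| ≤ 2
  · have := abs_le.1 hy
    exact ⟨(hC y this).trans ((le_max_left _ _).trans (le_max_left _ _)),
      (hD y this).trans ((le_max_right _ _).trans (le_max_left _ _))⟩
  · have h := lineBump_eq_zero (not_le.1 hy)
    rw [h.2.1, h.2.2, abs_zero]
    exact ⟨le_max_right _ _, le_max_right _ _⟩

/-- A cutoff to `e^{-2m} ≤ r ≤ e^{2m}`, for which `r ϑ'` is of size `1/m`. -/
noncomputable def logCut (m : ℕ) (r : ℝ) : ℝ := lineBump (Real.log r / (m + 1))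

/-- The derivative of `logCut`. -/
noncomputable def logCut₁ (m : ℕ) (r : ℝ) : ℝ :=
  deriv lineBump (Real.log r / (m + 1)) / (m + 1) / r

/-- The second derivative of `logCut`. -/
noncomputable def logCut₂ (m : ℕ) (r : ℝ) : ℝ :=
  deriv (deriv lineBump) (Real.log r / (m + 1)) / (m + 1) ^ 2 / r ^ 2
    - deriv lineBump (Real.log r / (m + 1)) / (m + 1) / r ^ 2

lemma isRadialCutoff_logCut (m : ℕ) : IsRadialCutoff (logCut m) (logCut₁ m) (logCut₂ m)
    (Real.exp (-(2 * (m + 1)))) (Real.exp (2 * (m + 1))) := by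
  have hm : (0 : ℝ) < m + 1 := by positivity
  have hl : ∀ r : ℝ, 0 < r → HasDerivAt (fun r => Real.log r / ((m : ℝ) + 1)) (r⁻¹ / (m + 1)) r := fun r hr =>
    (Real.hasDerivAt_log hr.ne').div_const _
  have hd1 : ∀ y, HasDerivAt lineBump (deriv lineBump y) y := fun y =>
    (contDiff_lineBump (m := 1) |>.differentiable (by norm_num) y).hasDerivAt
  have hd2 : ∀ y, HasDerivAt (deriv lineBump) (deriv (deriv lineBump) y) y := fun y =>
    (contDiff_deriv_lineBump.differentiable (by norm_num) y).hasDerivAt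
  have hlog : ContinuousOn Real.log (Ioi 0) := Real.continuousOn_log.mono fun r hr => ne_of_gt hr
  refine ⟨Real.exp_pos _, ?_, fun r hr => ?_, fun r hr => ?_, ?_, fun r hr hrm => ?_⟩
  · exact (contDiff_lineBump (m := ⊤)).comp_contDiffOn ((Real.contDiffOn_log.mono fun r hr => ne_of_gt hr).div_const _)
  · refine ((hd1 _).comp r (hl r hr)).congr_deriv ?_
    unfold logCut₁
    field_simp
  · refine ((((hd2 _).comp r (hl r hr)).div_const ((m : ℝ) + 1)).fun_div (hasDerivAt_id r) hr.ne').congr_deriv ?_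
    simp only [Function.comp_apply, id, logCut₂]
    field_simp
  · unfold logCut₂
    have c1 : ContinuousOn (fun r => Real.log r / ((m : ℝ) + 1)) (Ioi 0) := hlog.div_const _
    exact (((contDiff_deriv_deriv_lineBump.continuous.comp_continuousOn c1).div_const _).div (by fun_prop)
      fun r hr => pow_ne_zero 2 (ne_of_gt hr)).sub (((contDiff_deriv_lineBump.continuous.comp_continuousOn c1).div_const _).div
      (by fun_prop) fun r hr => pow_ne_zero 2 (ne_of_gt hr))
  · have h2 : 2 < |Real.log r / ((m : ℝ) + 1)| := by
      rw [abs_div, abs_of_pos hm, lt_div_iff₀ hm]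
      by_contra! h
      refine hrm ⟨?_, ?_⟩
      · rw [← Real.le_log_iff_exp_le hr]; linarith [(abs_le.1 h).1]
      · rw [← Real.log_le_iff_le_exp hr]; linarith [(abs_le.1 h).2]
    obtain ⟨e1, e2, e3⟩ := lineBump_eq_zero h2
    simp [logCut, logCut₁, logCut₂, e1, e2, e3]

lemma logCut_mem (m : ℕ) (r : ℝ) : 0 ≤ logCut m r ∧ logCut m r ≤ 1 :=
  ⟨lineBump.nonneg, lineBump.le_one⟩

lemma tendsto_logCut (r : ℝ) : Tendsto (fun m => logCut m r) atTop (𝓝 1) := by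
  have h : Tendsto (fun m : ℕ => Real.log r / ((m : ℝ) + 1)) atTop (𝓝 0) := by
    simpa [div_eq_mul_inv] using (tendsto_one_div_add_atTop_nhds_zero_nat (𝕜 := ℝ)).const_mul (Real.log r)
  have h1 : lineBump 0 = 1 := lineBump.one_of_mem_closedBall (by simp [lineBump])
  have := ((contDiff_lineBump (m := 0)).continuous.tendsto 0).comp h
  rwa [h1] at this

end LogCutoff

/-! ### The weighted resolvent estimate and the Kato bound. -/

section Resolvent

variable {n : ℕ} {V : E n → ℝ} {T : L2 n →L[ℂ] L2 n} {δ : ℝ}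

/-- Dominated convergence for multiplication operators. -/
lemma tendsto_mulL2 (hn : n ≠ 0) {a : ℕ → E n → ℂ} (ha : ∀ m, IsMult (a m)) (h1 : ∀ m x, ‖a m x‖ ≤ 1)
    (ht : ∀ x, x ≠ 0 → Tendsto (fun m => a m x) atTop (𝓝 1)) (f : L2 n) :
    Tendsto (fun m => mulL2 (a m) f) atTop (𝓝 f) := by
  rw [tendsto_iff_norm_sub_tendsto_zero]
  have h2 : ∀ m, ‖mulL2 (a m) f - f‖ ^ 2 = ∫ x, ‖(a m x - 1) * f x‖ ^ 2 := fun m => by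
    rw [norm_sq_eq_integral]
    refine integral_congr_ae ?_
    filter_upwards [Lp.coeFn_sub (mulL2 (a m) f) f, mulL2_ae (ha m) f] with x e1 e2
    rw [e1, Pi.sub_apply, e2, sub_mul, one_mul]
  have h3 : Tendsto (fun m => ∫ x, ‖(a m x - 1) * f x‖ ^ 2) atTop (𝓝 (∫ _ : E n, (0 : ℝ))) := by
    refine tendsto_integral_of_dominated_convergence (fun x => 4 * ‖f x‖ ^ 2) (fun m => ?_) ?_
      (fun m => ae_of_all _ fun x => ?_) ((volume_singleton_zero_compl hn).mono fun x hx => ?_)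
    · exact ((((ha m).1.sub_const 1).aestronglyMeasurable.mul (Lp.aestronglyMeasurable f)).norm.pow 2)
    · exact ((Lp.memLp f).integrable_norm_pow (by norm_num)).const_mul 4
    · rw [norm_pow, norm_norm, norm_mul, mul_pow]
      have : ‖a m x - 1‖ ≤ 2 := (norm_sub_le _ _).trans (by rw [norm_one]; linarith [h1 m x])
      have h4 : ‖a m x - 1‖ ^ 2 ≤ 4 := (pow_le_pow_left₀ (norm_nonneg _) this 2).trans (by norm_num)
      exact mul_le_mul_of_nonneg_right h4 (sq_nonneg _)
    · have := (((ht x hx).sub_const 1).mul_const (f x)).norm.pow 2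
      simpa using this
  rw [integral_zero] at h3
  simp only [← h2] at h3
  have h4 := (Real.continuous_sqrt.tendsto 0).comp h3
  simp only [Function.comp_def, Real.sqrt_zero] at h4
  simpa [Real.sqrt_sq (norm_nonneg _)] using h4

lemma isMult_logCut (m : ℕ) : IsMult fun x : E n => (logCut m ‖x‖ : ℂ) := by
  refine ⟨?_, 1, fun x => ?_⟩
  · refine Complex.measurable_ofReal.comp ?_
    exact (contDiff_lineBump (m := 0)).continuous.measurable.comp
      ((Real.measurable_log.comp measurable_norm).div_const _)
  · rw [Complex.norm_real, Real.norm_of_nonneg (logCut_mem m _).1]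
    exact (logCut_mem m _).2

/-- The uniform bound of the weighted norm of an element of the form domain. -/
lemma IsFriedrichsInverse.exists_weighted_bound (hT : IsFriedrichsInverse V T) (hn : n ≠ 0)
    (hV : ContinuousOn V {0}ᶜ) (hδ : 0 < δ) (hA2 : PositiveOnSpheres V δ) (h : L2 n) :
    ∃ B : ℝ, 0 ≤ B ∧ ∀ N, ‖mulL2 (invN N) (T h)‖ ≤ B := by
  obtain ⟨φ, a1, a2, -⟩ := hT.approx h
  refine ⟨√(((⟪T h, h⟫_ℂ).re - ‖T h‖ ^ 2) / δ ^ 2), Real.sqrt_nonneg _, fun N => ?_⟩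
  refine Real.le_sqrt_of_sq_le ?_
  refine le_of_tendsto_of_tendsto ((((mulL2 (invN N)).continuous.tendsto _).comp a1).norm.pow 2)
    (a2.div_const (δ ^ 2)) (Eventually.of_forall fun k => ?_)
  refine (norm_mulL2_invN_le N (φ k)).trans ?_
  rw [le_div_iff₀ (by positivity), mul_comm]
  exact IsTest.le_formQ hn (φ k).2 hV hA2

/-- The a priori estimate for the resolvent. -/
lemma IsFriedrichsInverse.norm_invN_le (hT : IsFriedrichsInverse V T) (hn : n ≠ 0)
    (hV : ContDiffOn ℝ 1 V {0}ᶜ) (hδ : 0 < δ) (hA1 : CriticalBound V)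
    (hA2 : PositiveOnSpheres V δ) (hA3 : PositiveOnSpheres (tildeV V) δ)
    {z : ℂ} (hz : 0 ≤ z.im) {h y : L2 n} (N : ℕ)
    (hh : h - T h - z ^ 2 • T h = mulL2 (invN N) y) :
    ‖mulL2 (invN N) (T h)‖ ≤ √(aprioriSq δ) * ‖y‖ := by
  obtain ⟨φ, W, h1, -, h2⟩ := hT.exists_gradient hn hV.continuousOn hδ hA1 hA2 h
  obtain ⟨B, hB0, hB⟩ := hT.exists_weighted_bound hn hV.continuousOn hδ hA2 h
  obtain ⟨C, hC0, hC⟩ := exists_lineBump_bound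
  have hn1 : (1 : ℝ) ≤ n := by exact_mod_cast Nat.one_le_iff_ne_zero.2 hn
  -- For logarithmic cutoffs `rϑ'` and `r²ϑ''` are `O(1/m)`, so the commutator terms are at most
  -- `D/(m+1)`; here `B` bounds `|x|⁻¹ T h`, and the `W j` are the partial derivatives of `T h`.
  set D : ℝ := C * (n + 1) * B + ∑ j, 2 * C * ‖W j‖ with hD
  have key : ∀ m : ℕ, ‖mulL2 (invN N) (mulL2 (fun x : E n => (logCut m ‖x‖ : ℂ)) (T h))‖ ≤
      √(aprioriSq δ) * (‖y‖ + D / (m + 1)) := fun m => by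
    have hm : (0 : ℝ) < m + 1 := by positivity
    have hm1 : (1 : ℝ) ≤ m + 1 := by linarith [Nat.cast_nonneg (α := ℝ) m]
    have hϑ := isRadialCutoff_logCut m
    have h3 := apriori_cutoff hn hT hV hδ hA1 hA2 hA3 hz hϑ h1 h2
    rw [hh] at h3
    have h4 : ‖mulL2 (invN N) (mulL2 (fun x : E n => (logCut m ‖x‖ : ℂ)) (T h))‖ ≤
        ‖mulL2 (fun x : E n => ((logCut m ‖x‖ / ‖x‖ : ℝ) : ℂ)) (T h)‖ := by
      refine Lp.norm_le_norm_of_ae_le ?_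
      filter_upwards [mulL2_ae (isMult_invN N) (mulL2 (fun x : E n => (logCut m ‖x‖ : ℂ)) (T h)),
        mulL2_ae (isMult_logCut m) (T h), mulL2_ae hϑ.isMult_div (T h)] with x e1 e2 e3
      rw [e1, e2, e3, ← mul_assoc, norm_mul, norm_mul, norm_mul, norm_invN, Complex.norm_real,
        Complex.norm_real, norm_div, norm_norm, div_eq_inv_mul]
      have : min ‖x‖⁻¹ (N : ℝ) ≤ ‖x‖⁻¹ := min_le_left _ _
      gcongr
    -- The factor `|x|` on the right of the a priori estimate is compensated by the weight on the
    -- data.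
    have h5 : ‖mulL2 (fun x : E n => ((‖x‖ * logCut m ‖x‖ : ℝ) : ℂ)) (mulL2 (invN N) y)‖ ≤ ‖y‖ := by
      refine Lp.norm_le_norm_of_ae_le ?_
      filter_upwards [mulL2_ae hϑ.isMult_mul (mulL2 (invN N) y), mulL2_ae (isMult_invN N) y,
        volume_singleton_zero_compl hn] with x e1 e2 hx
      have hr := norm_pos_iff.2 hx
      rw [e1, e2, norm_mul, norm_mul, norm_invN, Complex.norm_real, norm_mul, norm_norm,
        Real.norm_of_nonneg (logCut_mem m _).1, ← mul_assoc]
      refine mul_le_of_le_one_left (norm_nonneg _) ?_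
      have e3 : min ‖x‖⁻¹ (N : ℝ) ≤ ‖x‖⁻¹ := min_le_left _ _
      have e4 : 0 ≤ min ‖x‖⁻¹ (N : ℝ) := le_min (by positivity) (by positivity)
      calc ‖x‖ * logCut m ‖x‖ * min ‖x‖⁻¹ (N : ℝ) ≤ ‖x‖ * 1 * ‖x‖⁻¹ := by
            gcongr
            exact (logCut_mem m _).2
        _ = 1 := by field_simp
    have h6 : ‖mulL2 (fun x : E n => ((‖x‖ * (logCut₂ m ‖x‖ + ((n : ℝ) - 1) / ‖x‖ * logCut₁ m ‖x‖) : ℝ) : ℂ)) (T h)‖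
        ≤ C * (n + 1) / (m + 1) * B := by
      -- `N'` exceeds `1/|x|` on the annulus, so that `invN N'` is `1/|x|` there; the bound `B` does
      -- not depend on it.
      obtain ⟨N', hN'⟩ := exists_nat_ge (Real.exp (2 * (m + 1)))
      refine (norm_mulL2_le_mulL2 hϑ.isMult_lap (isMult_invN N') (C := C * (n + 1) / (m + 1))
        (fun x hx => ?_) hn (T h)).trans (mul_le_mul_of_nonneg_left (hB N') (by positivity))
      have hr := norm_pos_iff.2 hx
      rw [Complex.norm_real, Real.norm_eq_abs, norm_invN]
      by_cases hxa : ‖x‖ ∈ Icc (Real.exp (-(2 * ((m : ℝ) + 1)))) (Real.exp (2 * (m + 1)))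
      · have e1 : min ‖x‖⁻¹ (N' : ℝ) = ‖x‖⁻¹ := by
          refine min_eq_left (le_trans ?_ hN')
          rw [inv_le_comm₀ hr (Real.exp_pos _), ← Real.exp_neg]
          exact hxa.1
        have e2 : ‖x‖ * (logCut₂ m ‖x‖ + ((n : ℝ) - 1) / ‖x‖ * logCut₁ m ‖x‖) =
            (deriv (deriv lineBump) (Real.log ‖x‖ / (m + 1)) / (m + 1)
              + (n - 2) * deriv lineBump (Real.log ‖x‖ / (m + 1))) / (m + 1) * ‖x‖⁻¹ := by
          unfold logCut₂ logCut₁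
          field_simp
          ring
        rw [e1, e2, abs_mul, abs_inv, abs_norm, abs_div, abs_of_pos hm]
        refine mul_le_mul_of_nonneg_right (div_le_div_of_nonneg_right ?_ hm.le) (by positivity)
        refine (abs_add_le _ _).trans ?_
        rw [abs_div, abs_of_pos hm, abs_mul]
        have e3 := (hC (Real.log ‖x‖ / (m + 1))).2
        have e4 := (hC (Real.log ‖x‖ / (m + 1))).1
        have e5 : |deriv (deriv lineBump) (Real.log ‖x‖ / (m + 1))| / ((m : ℝ) + 1) ≤ C :=
          (div_le_self (abs_nonneg _) hm1).trans e3
        have e6 : |(n : ℝ) - 2| ≤ n := abs_le.2 ⟨by linarith, by linarith⟩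
        have e7 := mul_le_mul e6 e4 (abs_nonneg _) (by linarith)
        linarith
      · obtain ⟨-, e2, e3⟩ := hϑ.zero _ hr hxa
        rw [e2, e3]
        simp only [mul_zero, add_zero, abs_zero]
        have : 0 ≤ min ‖x‖⁻¹ (N' : ℝ) := le_min (by positivity) (by positivity)
        positivity
    have h7 : ∀ j, ‖mulL2 (fun x : E n => ((2 * logCut₁ m ‖x‖ * x j : ℝ) : ℂ)) (W j)‖
        ≤ 2 * C / (m + 1) * ‖W j‖ := fun j => by
      refine norm_mulL2_le (hϑ.isMult_grad j) (fun x => ?_) _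
      rw [Complex.norm_real, Real.norm_eq_abs]
      by_cases hx : x = 0
      · simp only [hx, PiLp.zero_apply, mul_zero, abs_zero]; positivity
      have hr := norm_pos_iff.2 hx
      rw [abs_mul, abs_mul, abs_two, logCut₁, abs_div, abs_div, abs_norm, abs_of_pos hm]
      have e1 := (hC (Real.log ‖x‖ / (m + 1))).1
      have e2 : |x j| ≤ ‖x‖ := by simpa using PiLp.norm_apply_le x j
      calc 2 * (|deriv lineBump (Real.log ‖x‖ / (m + 1))| / ((m : ℝ) + 1) / ‖x‖) * |x j|
          ≤ 2 * (C / (m + 1) / ‖x‖) * ‖x‖ := by gcongr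
        _ = 2 * C / (m + 1) := by field_simp
    have h8 := Real.sqrt_le_sqrt h3
    rw [Real.sqrt_sq (norm_nonneg _), Real.sqrt_mul (aprioriSq_pos hδ).le,
      Real.sqrt_sq (norm_nonneg _)] at h8
    refine h4.trans (h8.trans (mul_le_mul_of_nonneg_left ?_ (Real.sqrt_nonneg _)))
    refine (norm_sub_le _ _).trans ((add_le_add ((norm_sub_le _ _).trans (add_le_add h5 h6))
      ((norm_sum_le _ _).trans (Finset.sum_le_sum fun j _ => h7 j))).trans (le_of_eq ?_))
    rw [hD, add_div, Finset.sum_div, ← add_assoc]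
    congr 1
    · ring
    · exact Finset.sum_congr rfl fun j _ => by ring
  have hl : Tendsto (fun m : ℕ => √(aprioriSq δ) * (‖y‖ + D / ((m : ℝ) + 1))) atTop
      (𝓝 (√(aprioriSq δ) * (‖y‖ + D * 0))) := by
    refine (tendsto_const_nhds.add ?_).const_mul _
    simpa [div_eq_mul_inv] using (tendsto_one_div_add_atTop_nhds_zero_nat (𝕜 := ℝ)).const_mul D
  rw [mul_zero, add_zero] at hl
  have ht := tendsto_mulL2 hn (fun m => isMult_logCut (n := n) m) (fun m x => by
    rw [Complex.norm_real, Real.norm_of_nonneg (logCut_mem m _).1]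
    exact (logCut_mem m _).2) (fun x _ => by
      have := (Complex.continuous_ofReal.tendsto 1).comp (tendsto_logCut ‖x‖)
      rw [Complex.ofReal_one] at this
      exact this) (T h)
  exact le_of_tendsto_of_tendsto (((mulL2 (invN N)).continuous.tendsto _).comp ht).norm hl
    (Eventually.of_forall key)

lemma resf_conj (ζ : ℂ) (s : ℝ) : (starRingEnd ℂ) (resf ζ s) = resf ((starRingEnd ℂ) ζ) s := by
  simp [resf]

/-- With `R(ζ) = (P - ζ)⁻¹`, the a priori estimate gives `‖A R(ζ) A‖ ≤ c` for all non-real `ζ`. Then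
`R(ζ)*R(ζ) = (R(ζ̄) - R(ζ))/(ζ̄ - ζ)` bounds `‖R(ζ)A y‖²` by `2c‖y‖²/(2|Im ζ|)`, and `A R(ζ)` is the
adjoint of `R(ζ̄)A`. -/
theorem IsFriedrichsInverse.katoBound (hT : IsFriedrichsInverse V T) (hn : n ≠ 0)
    (hV : ContDiffOn ℝ 1 V {0}ᶜ) (hδ : 0 < δ) (hA1 : CriticalBound V)
    (hA2 : PositiveOnSpheres V δ) (hA3 : PositiveOnSpheres (tildeV V) δ) (N : ℕ) :
    KatoBound T (mulL2 (invN N)) √(aprioriSq δ) := by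
  set A : L2 n →L[ℂ] L2 n := mulL2 (invN N) with hA
  set c := √(aprioriSq δ) with hc
  have hAs : ∀ f g, ⟪A f, g⟫_ℂ = ⟪f, A g⟫_ℂ := fun f g => by
    rw [hA, inner_mulL2_left (isMult_invN N), conj_invN]
  have hP := hT.pos
  have hAR : ∀ ζ : ℂ, ζ.im ≠ 0 → ∀ y, ‖A (fc T (resf ζ) (A y))‖ ≤ c * ‖y‖ := fun ζ hζ y => by
    -- One of the two square roots of `ζ` lies in the closed upper half plane, as the a priori
    -- estimate demands.
    obtain ⟨z, hz2, hz⟩ : ∃ z : ℂ, z ^ 2 = ζ ∧ 0 ≤ z.im := by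
      obtain ⟨z, hz⟩ := IsSquare.exists_sq (a := ζ) (IsAlgClosed.exists_eq_mul_self ζ)
      rcases le_total 0 z.im with h | h
      · exact ⟨z, hz.symm, h⟩
      · exact ⟨-z, by rw [neg_sq, hz], by simpa using h⟩
    have hcr : ContinuousOn (resf ζ) (Icc 0 1) := (continuous_resf hζ).continuousOn
    have h1c : ContinuousOn (fun s : ℝ => (1 + ζ) * resf ζ s) (Icc 0 1) :=
      continuousOn_const.mul hcr
    set w := fc T (resf ζ) (A y) with hw
    -- `h = (P + 1)w`, computed from `(P - ζ)w = A y`; hence `T h = w`.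
    set h := A y + (1 + ζ) • w with hh
    have hw' : T h = w := by
      have e1 : h = fc T (fun s => 1 + (1 + ζ) * resf ζ s) (A y) := by
        rw [fc_add hP continuousOn_const h1c, fc_one hP, fc_const_mul hP _ hcr]
        rfl
      have e2 : T h = fc T (fun s => (s : ℂ)) h := by rw [fc_id hP]
      have h1d : ContinuousOn (fun s : ℝ => 1 + (1 + ζ) * resf ζ s) (Icc 0 1) :=
        continuousOn_const.add h1c
      have hid : ContinuousOn (fun s : ℝ => (s : ℂ)) (Icc 0 1) :=
        Complex.continuous_ofReal.continuousOn
      rw [e2, e1, fc_mul_apply hP hid h1d, hw]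
      congr 1
      refine fc_congr hP fun s _ => ?_
      have hq := mul_inv_cancel₀ (resf_denom_ne hζ s)
      simp only [resf, div_eq_mul_inv]
      linear_combination (-(s : ℂ)) * hq
    have := hT.norm_invN_le hn hV hδ hA1 hA2 hA3 hz (h := h) (y := y) N (by
      rw [hw', hz2, hh, add_smul, one_smul]; abel)
    rwa [hw'] at this
  have hRA : ∀ ζ : ℂ, ζ.im ≠ 0 → ∀ y, ‖fc T (resf ζ) (A y)‖ ^ 2 ≤ c / |ζ.im| * ‖y‖ ^ 2 := fun ζ hζ y => by
    have hζ' : ((starRingEnd ℂ) ζ).im ≠ 0 := by simpa using hζ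
    have hcr : ContinuousOn (resf ζ) (Icc 0 1) := (continuous_resf hζ).continuousOn
    have hcr' : ContinuousOn (resf ((starRingEnd ℂ) ζ)) (Icc 0 1) := (continuous_resf hζ').continuousOn
    have e1 : ((‖fc T (resf ζ) (A y)‖ ^ 2 : ℝ) : ℂ) =
        ⟪A y, fc T (fun s => resf ((starRingEnd ℂ) ζ) s * resf ζ s) (A y)⟫_ℂ := by
      have := inner_self_eq_norm_sq_to_K (𝕜 := ℂ) (fc T (resf ζ) (A y))
      rw [inner_fc_left] at this
      simp only [resf_conj] at this
      rw [fc_mul_apply hP hcr' hcr] at this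
      rw [this]; norm_cast
    have hcc : (((starRingEnd ℂ) ζ) - ζ) ≠ 0 := by
      intro h
      have := congrArg Complex.im h
      simp at this
      exact hζ (by linarith)
    have e2 : fc T (fun s => resf ((starRingEnd ℂ) ζ) s * resf ζ s) =
        fc T (fun s => (((starRingEnd ℂ) ζ) - ζ)⁻¹ * (resf ((starRingEnd ℂ) ζ) s - resf ζ s)) := by
      refine fc_congr hP fun s _ => ?_
      have d1 := mul_inv_cancel₀ (resf_denom_ne hζ s)
      have d2 := mul_inv_cancel₀ (resf_denom_ne hζ' s)
      rw [eq_inv_mul_iff_mul_eq₀ hcc]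
      simp only [resf, div_eq_mul_inv]
      set i := (1 - (s : ℂ) - ζ * s)⁻¹
      set j := (1 - (s : ℂ) - (starRingEnd ℂ) ζ * s)⁻¹
      linear_combination (s : ℂ) * j * d1 - (s : ℂ) * i * d2
    have hsub : ContinuousOn (fun s => resf ((starRingEnd ℂ) ζ) s - resf ζ s) (Icc 0 1) := hcr'.sub hcr
    rw [e2, fc_const_mul hP _ hsub, fc_sub hP hcr' hcr] at e1
    have e3 : ‖fc T (resf ζ) (A y)‖ ^ 2 = ‖((‖fc T (resf ζ) (A y)‖ ^ 2 : ℝ) : ℂ)‖ := by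
      rw [Complex.norm_real, Real.norm_of_nonneg (by positivity)]
    have e4 : ‖((starRingEnd ℂ) ζ) - ζ‖ = 2 * |ζ.im| := by
      have : ((starRingEnd ℂ) ζ) - ζ = ((-2 * ζ.im : ℝ) : ℂ) * Complex.I := by
        apply Complex.ext
        · simp
        · simp; ring
      rw [this, norm_mul, Complex.norm_I, mul_one, Complex.norm_real, Real.norm_eq_abs, abs_mul]
      norm_num
    rw [e3, e1, smul_apply, inner_smul_right, norm_mul, norm_inv, e4, hAs]
    have h5 : ‖A ((fc T (resf ((starRingEnd ℂ) ζ)) - fc T (resf ζ)) (A y))‖ ≤ 2 * c * ‖y‖ := by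
      rw [sub_apply, map_sub]
      refine (norm_sub_le _ _).trans ?_
      linarith [hAR _ hζ' y, hAR _ hζ y]
    have hi : 0 < |ζ.im| := abs_pos.2 hζ
    calc (2 * |ζ.im|)⁻¹ * ‖⟪y, A ((fc T (resf ((starRingEnd ℂ) ζ)) - fc T (resf ζ)) (A y))⟫_ℂ‖
        ≤ (2 * |ζ.im|)⁻¹ * (‖y‖ * (2 * c * ‖y‖)) := by
          gcongr
          exact (norm_inner_le_norm _ _).trans (mul_le_mul_of_nonneg_left h5 (norm_nonneg _))
      _ = c / |ζ.im| * ‖y‖ ^ 2 := by field_simp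
  intro ζ hζ h
  have hζ' : ((starRingEnd ℂ) ζ).im ≠ 0 := by simpa using hζ
  set x := A (fc T (resf ζ) h) with hx
  have h1 : ‖x‖ ^ 2 ≤ ‖fc T (resf ((starRingEnd ℂ) ζ)) (A x)‖ * ‖h‖ := by
    have e1 : ⟪h, fc T (resf ((starRingEnd ℂ) ζ)) (A x)⟫_ℂ = ((‖x‖ ^ 2 : ℝ) : ℂ) := by
      have := inner_fc_left (T := T) (resf ζ) h (A x)
      simp only [resf_conj] at this
      rw [← this, ← hAs, ← hx, inner_self_eq_norm_sq_to_K]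
      norm_cast
    have e2 := norm_inner_le_norm (𝕜 := ℂ) h (fc T (resf ((starRingEnd ℂ) ζ)) (A x))
    rw [e1, Complex.norm_real, Real.norm_of_nonneg (by positivity)] at e2
    linarith
  have h2 := hRA _ hζ' x
  have hic : |((starRingEnd ℂ) ζ).im| = |ζ.im| := by simp
  rw [hic] at h2
  by_cases hx0 : ‖x‖ = 0
  · rw [hx0]
    rw [zero_pow two_ne_zero]
    exact mul_nonneg (div_nonneg (Real.sqrt_nonneg _) (abs_nonneg _)) (sq_nonneg _)
  · have hxp : 0 < ‖x‖ ^ 2 := by positivity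
    have h3 := pow_le_pow_left₀ (by positivity) h1 2
    rw [mul_pow] at h3
    have h4 : (‖x‖ ^ 2) * ‖x‖ ^ 2 ≤ (c / |ζ.im| * ‖h‖ ^ 2) * ‖x‖ ^ 2 := by
      nlinarith [mul_le_mul_of_nonneg_right h2 (sq_nonneg ‖h‖)]
    exact le_of_mul_le_mul_right h4 hxp

end Resolvent

end CriticalDecay
namespace CriticalDecay

/-! ### From the bounded weights to `|x|⁻¹`. -/

section Weighted

variable {n : ℕ}

/-- `∫ |v|² / |x|²`, as an extended nonnegative number. -/
noncomputable def weightSq (v : E n → ℂ) : ℝ≥0∞ := ∫⁻ x, (‖v x‖ₑ / ‖x‖ₑ) ^ 2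

lemma enorm_invN_mul (N : ℕ) (x : E n) (z : ℂ) (hx : x ≠ 0) :
    ‖invN N x * z‖ₑ = min (‖x‖ₑ⁻¹) N * ‖z‖ₑ := by
  rw [enorm_mul, ← ofReal_norm (invN N x), norm_invN, ENNReal.ofReal_min, ENNReal.ofReal_natCast,
    ENNReal.ofReal_inv_of_pos (norm_pos_iff.2 hx), ofReal_norm]

lemma weightSq_le_liminf (hn : n ≠ 0) (w : L2 n) :
    weightSq w ≤ liminf (fun N : ℕ => ‖mulL2 (invN N) w‖ₑ ^ 2) atTop := by
  have e : ∀ N : ℕ, ‖mulL2 (invN N) w‖ₑ ^ 2 = ∫⁻ x, (min (‖x‖ₑ⁻¹) N * ‖w x‖ₑ) ^ 2 := fun N => by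
    rw [enorm_sq_eq_lintegral]
    refine lintegral_congr_ae ?_
    filter_upwards [mulL2_ae (isMult_invN N) w, volume_singleton_zero_compl hn] with x e1 hx
    rw [e1, enorm_invN_mul N x _ hx]
  simp only [e]
  refine le_trans (lintegral_mono fun x => ?_) (lintegral_liminf_le' fun N => ?_)
  · have ht : Tendsto (fun N : ℕ => (min (‖x‖ₑ⁻¹) (N : ℝ≥0∞) * ‖w x‖ₑ) ^ 2) atTop
        (𝓝 ((min (‖x‖ₑ⁻¹) ⊤ * ‖w x‖ₑ) ^ 2)) := by
      refine ENNReal.Tendsto.pow ?_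
      by_cases hw : ‖w x‖ₑ = 0
      · simp [hw]
      · exact ENNReal.Tendsto.mul_const
          (tendsto_const_nhds.min ENNReal.tendsto_nat_nhds_top) (Or.inr enorm_ne_top)
    rw [ht.liminf_eq, min_eq_left le_top, div_eq_mul_inv, mul_comm]
  · exact (((measurable_enorm.inv.min measurable_const).aemeasurable).mul
      (Lp.aestronglyMeasurable w).enorm).pow_const 2

/-- Estimates uniform in `N` suffice: Fatou's lemma is applied in `x` by `weightSq_le_liminf`, and
once more in `t`. -/
lemma weightedNorm_le_of_forall (hn : n ≠ 0) {u : ℝ → L2 n} (hu : Continuous u) {K : ℝ≥0∞}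
    (h : ∀ N : ℕ, ∫⁻ t, ‖mulL2 (invN N) (u t)‖ₑ ^ 2 ≤ K) : ∫⁻ t, weightSq (u t) ≤ K := by
  refine (lintegral_mono fun t => weightSq_le_liminf hn (u t)).trans ?_
  refine (lintegral_liminf_le fun N => ?_).trans ?_
  · exact (((mulL2 (invN N)).continuous.comp hu).enorm.measurable).pow_const 2
  · exact liminf_le_of_le (by isBoundedDefault) fun b hb => by
      obtain ⟨N, hN⟩ := hb.exists
      exact hN.trans (h N)

end Weighted

/-! ### The Schrödinger estimate. -/

section Schrodinger

variable {n : ℕ} {V : E n → ℝ} {δ : ℝ}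

lemma smoothingConst_nonneg (hδ : 0 < δ) : 0 ≤ smoothingConst δ := by
  unfold smoothingConst
  split_ifs with h
  · positivity
  · exact div_nonneg (Real.sqrt_nonneg _) (Real.rpow_nonneg (by linarith) _)

/-- This matches the constant `2c` of `lintegral_schrodinger_le`, with `c = √(aprioriSq δ)`. -/
lemma smoothingConst_sq (hδ : 0 < δ) : smoothingConst δ ^ 2 = 2 * √(aprioriSq δ) := by
  unfold smoothingConst aprioriSq
  split_ifs with h
  · rw [div_pow, Real.sq_sqrt zero_le_two, Real.sqrt_div' _ (by positivity), Real.sqrt_one,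
      show δ ^ 4 = (δ ^ 2) ^ 2 by ring, Real.sqrt_sq (by positivity)]
    ring
  · have hp : 0 < δ ^ 2 - 1 / 4 := by linarith
    rw [div_pow, Real.sq_sqrt zero_le_two, Real.sqrt_div' _ hp.le, Real.sqrt_one,
      ← Real.rpow_natCast, ← Real.rpow_mul hp.le, Real.sqrt_eq_rpow]
    norm_num
    ring

theorem IsSchrodingerSolution.weightedNorm_le (hn : 3 ≤ n) (hV : ContDiffOn ℝ 1 V {0}ᶜ)
    (hA1 : CriticalBound V) (hδ : 0 < δ) (hA2 : PositiveOnSpheres V δ)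
    (hA3 : PositiveOnSpheres (tildeV V) δ) {f : L2 n} {u : ℝ → L2 n}
    (hu : IsSchrodingerSolution V f u) :
    weightedNorm (fun t => (u t : E n → ℂ)) ≤ ENNReal.ofReal (smoothingConst δ) * ‖f‖ₑ := by
  have hn0 : n ≠ 0 := by omega
  obtain ⟨T, hT⟩ := exists_isFriedrichsInverse hn0 hV.continuousOn hA2
  have key := weightedNorm_le_of_forall hn0 hu.cont fun N =>
    lintegral_schrodinger_le hT.pos (hT.injective hn0 hV.continuousOn)
      (hT.injective_one_sub hn0 hV.continuousOn hδ hA2) (Real.sqrt_nonneg _)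
      (hT.katoBound hn0 hV hδ hA1 hA2 hA3 N) hu.cont fun η t => hu.eqn _ _ (hT.graph hV.continuousOn η) t
  rw [hu.init] at key
  have e : ENNReal.ofReal (2 * √(aprioriSq δ)) * ‖f‖ₑ ^ 2 =
      (ENNReal.ofReal (smoothingConst δ) * ‖f‖ₑ) ^ (2 : ℝ) := by
    rw [← smoothingConst_sq hδ, ENNReal.ofReal_pow (smoothingConst_nonneg hδ), ← mul_pow,
      ENNReal.rpow_two]
  rw [e] at key
  have := ENNReal.rpow_le_rpow key (z := 1 / 2) (by norm_num)
  rwa [← ENNReal.rpow_mul, mul_one_div_cancel two_ne_zero, ENNReal.rpow_one] at this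

end Schrodinger

end CriticalDecay
namespace CriticalDecay

/-! ### Resolvents at `-τ²` and their variational characterisation. -/

section Resolvents

variable {H : Type*} [NormedAddCommGroup H] [InnerProductSpace ℂ H] [CompleteSpace H]
variable {T : H →L[ℂ] H}

/-- The denominator of `resM` and `resL`. -/
noncomputable def resD (τ s : ℝ) : ℝ := 1 - s + τ ^ 2 * s

/-- `(p + τ²)⁻¹` as a function of `s = (1 + p)⁻¹`. -/
noncomputable def resM (τ s : ℝ) : ℝ := s / resD τ s

/-- `p (p + τ²)⁻¹` as a function of `s = (1 + p)⁻¹`. -/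
noncomputable def resL (τ s : ℝ) : ℝ := (1 - s) / resD τ s

lemma resD_pos {τ s : ℝ} (hτ : τ ≠ 0) (hs : s ∈ Icc (0 : ℝ) 1) : 0 < resD τ s := by
  have : 0 < τ ^ 2 := by positivity
  unfold resD
  rcases hs.1.eq_or_lt with h | h
  · rw [← h]; norm_num
  · have := hs.2
    have := mul_pos ‹0 < τ ^ 2› h
    linarith

lemma resM_nonneg {τ s : ℝ} (hτ : τ ≠ 0) (hs : s ∈ Icc (0 : ℝ) 1) : 0 ≤ resM τ s :=
  div_nonneg hs.1 (resD_pos hτ hs).le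

lemma resL_nonneg {τ s : ℝ} (hτ : τ ≠ 0) (hs : s ∈ Icc (0 : ℝ) 1) : 0 ≤ resL τ s :=
  div_nonneg (by linarith [hs.2]) (resD_pos hτ hs).le

lemma resL_add_mul_resM {τ s : ℝ} (hτ : τ ≠ 0) (hs : s ∈ Icc (0 : ℝ) 1) :
    resL τ s + τ ^ 2 * resM τ s = 1 := by
  have := (resD_pos hτ hs).ne'
  unfold resL resM
  rw [mul_div_assoc', ← add_div, div_eq_one_iff_eq this, resD]

lemma continuous_resD (τ : ℝ) : Continuous (resD τ) := by unfold resD; fun_prop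

lemma continuousOn_resM {τ : ℝ} (hτ : τ ≠ 0) : ContinuousOn (resM τ) (Icc 0 1) :=
  continuousOn_id.div (continuous_resD τ).continuousOn fun _ hs => (resD_pos hτ hs).ne'

lemma continuousOn_resL {τ : ℝ} (hτ : τ ≠ 0) : ContinuousOn (resL τ) (Icc 0 1) :=
  (continuousOn_const.sub continuousOn_id).div (continuous_resD τ).continuousOn
    fun _ hs => (resD_pos hτ hs).ne'

lemma continuousOn_ofReal_sqrt {f : ℝ → ℝ} (hf : ContinuousOn f (Icc 0 1)) :
    ContinuousOn (fun s => ((√(f s) : ℝ) : ℂ)) (Icc 0 1) :=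
  Complex.continuous_ofReal.comp_continuousOn hf.sqrt

/-- `⟨f, (P + τ²)⁻¹ f⟩` and `⟨f, P (P + τ²)⁻¹ f⟩` add up. -/
lemma norm_sq_resL_add (hT : IsPosContraction T) {τ : ℝ} (hτ : τ ≠ 0) (f : H) :
    ‖fc T (fun s => ((√(resL τ s) : ℝ) : ℂ)) f‖ ^ 2 +
      τ ^ 2 * ‖fc T (fun s => ((√(resM τ s) : ℝ) : ℂ)) f‖ ^ 2 = ‖f‖ ^ 2 := by
  have hL := continuousOn_ofReal_sqrt (continuousOn_resL hτ)
  have hM := continuousOn_ofReal_sqrt (continuousOn_resM hτ)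
  have hL' : ContinuousOn (fun s => (((‖((√(resL τ s) : ℝ) : ℂ)‖ ^ 2 : ℝ)) : ℂ)) (Icc 0 1) :=
    Complex.continuous_ofReal.comp_continuousOn (hL.norm.pow 2)
  have hM' : ContinuousOn (fun s => (((‖((√(resM τ s) : ℝ) : ℂ)‖ ^ 2 : ℝ)) : ℂ)) (Icc 0 1) :=
    Complex.continuous_ofReal.comp_continuousOn (hM.norm.pow 2)
  have hM'' : ContinuousOn (fun s => ((τ ^ 2 : ℝ) : ℂ) * (((‖((√(resM τ s) : ℝ) : ℂ)‖ ^ 2 : ℝ)) : ℂ))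
    (Icc 0 1) := continuousOn_const.mul hM'
  have e : fc T (fun s => (((‖((√(resL τ s) : ℝ) : ℂ)‖ ^ 2 : ℝ)) : ℂ) +
      ((τ ^ 2 : ℝ) : ℂ) * (((‖((√(resM τ s) : ℝ) : ℂ)‖ ^ 2 : ℝ)) : ℂ)) = 1 := by
    rw [← fc_one hT]
    refine fc_congr hT fun s hs => ?_
    simp only [Complex.norm_real, Real.norm_eq_abs, sq_abs]
    rw [Real.sq_sqrt (resL_nonneg hτ hs), Real.sq_sqrt (resM_nonneg hτ hs)]
    exact_mod_cast resL_add_mul_resM hτ hs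
  rw [norm_fc_sq hT f hL, norm_fc_sq hT f hM]
  have h2 := congrArg (fun A : H →L[ℂ] H => (⟪f, A f⟫_ℂ).re) e
  rw [fc_add hT hL' hM'', fc_const_mul hT _ hM', add_apply, smul_apply,
    inner_add_right, inner_smul_right, Complex.add_re, Complex.re_ofReal_mul, one_apply_eq_self,
    inner_self_eq_norm_sq_to_K] at h2
  rw [h2]
  norm_cast

/-- The variational characterization of `⟨f, (P + τ²)⁻¹ f⟩`. -/
lemma norm_sub_sq_resM (hT : IsPosContraction T) {τ : ℝ} (hτ : τ ≠ 0) (f h : H) :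
    ‖fc T (fun s => ((√(resM τ s) : ℝ) : ℂ)) f - fc T (fun s => ((√(s * resD τ s) : ℝ) : ℂ)) h‖ ^ 2 =
      ‖fc T (fun s => ((√(resM τ s) : ℝ) : ℂ)) f‖ ^ 2 -
      (2 * (⟪f, T h⟫_ℂ).re - ((⟪T h, h⟫_ℂ).re - ‖T h‖ ^ 2) - τ ^ 2 * ‖T h‖ ^ 2) := by
  have hM := continuousOn_ofReal_sqrt (continuousOn_resM hτ)
  have hk : ContinuousOn (fun s => ((√(s * resD τ s) : ℝ) : ℂ)) (Icc 0 1) :=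
    continuousOn_ofReal_sqrt (continuousOn_id.mul (continuous_resD τ).continuousOn)
  have hid : ContinuousOn (fun s : ℝ => (s : ℂ)) (Icc 0 1) := Complex.continuous_ofReal.continuousOn
  have e1 : ⟪fc T (fun s => ((√(resM τ s) : ℝ) : ℂ)) f, fc T (fun s => ((√(s * resD τ s) : ℝ) : ℂ)) h⟫_ℂ
      = ⟪f, T h⟫_ℂ := by
    rw [inner_fc_left]
    simp only [Complex.conj_ofReal]
    rw [fc_mul_apply hT hM hk]
    have : fc T (fun s => ((√(resM τ s) : ℝ) : ℂ) * ((√(s * resD τ s) : ℝ) : ℂ)) = T := by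
      conv_rhs => rw [← fc_id hT]
      refine fc_congr hT fun s hs => ?_
      have hd := (resD_pos hτ hs).ne'
      rw [← Complex.ofReal_mul, ← Real.sqrt_mul (resM_nonneg hτ hs), resM,
        show s / resD τ s * (s * resD τ s) = s ^ 2 by field_simp, Real.sqrt_sq hs.1]
    rw [this]
  -- `s(1 - s + τ²s) = s + (τ² - 1)s²`; with `⟨T h, h⟩ - ‖T h‖²` as the value of the form at `T h`,
  -- this is the form plus `τ²‖T h‖²`.
  have e2 : ‖fc T (fun s => ((√(s * resD τ s) : ℝ) : ℂ)) h‖ ^ 2 =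
      (⟪T h, h⟫_ℂ).re - ‖T h‖ ^ 2 + τ ^ 2 * ‖T h‖ ^ 2 := by
    have h1 : ContinuousOn (fun s : ℝ => ((τ ^ 2 - 1 : ℝ) : ℂ) * ((s : ℂ) * s)) (Icc 0 1) := by fun_prop
    have h2 : ContinuousOn (fun s : ℝ => (s : ℂ) * s) (Icc 0 1) := by fun_prop
    have e3 : fc T (fun s => ((‖((√(s * resD τ s) : ℝ) : ℂ)‖ ^ 2 : ℝ) : ℂ)) =
        fc T (fun s => (s : ℂ) + ((τ ^ 2 - 1 : ℝ) : ℂ) * ((s : ℂ) * s)) := by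
      refine fc_congr hT fun s hs => ?_
      simp only [Complex.norm_real, Real.norm_eq_abs, sq_abs]
      rw [Real.sq_sqrt (mul_nonneg hs.1 (resD_pos hτ hs).le), resD]
      push_cast; ring
    rw [norm_fc_sq hT h hk, e3, fc_add hT hid h1, fc_const_mul hT _ h2, fc_mul hT hid hid, fc_id hT]
    have e4 : ⟪h, T (T h)⟫_ℂ = ((‖T h‖ ^ 2 : ℝ) : ℂ) := by
      have := inner_fc_left (T := T) (fun s => (s : ℂ)) h (T h)
      simp only [Complex.conj_ofReal] at this
      rw [fc_id hT, inner_self_eq_norm_sq_to_K] at this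
      rw [← this]; norm_cast
    have e5 : (⟪h, T h⟫_ℂ).re = (⟪T h, h⟫_ℂ).re := by
      rw [← inner_conj_symm, Complex.conj_re]
    rw [add_apply, smul_apply, inner_add_right, inner_smul_right, Complex.add_re,
      Complex.re_ofReal_mul, show (T * T) h = T (T h) from rfl, e4, e5, Complex.ofReal_re]
    ring
  rw [@norm_sub_sq ℂ, e1, e2]
  simp only [RCLike.re_eq_complex_re]
  ring

/-- The supremum in the variational characterization is attained. -/
lemma exists_resM_eq (hT : IsPosContraction T) {τ : ℝ} (hτ : τ ≠ 0) (f : H) : ∃ h,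
    ‖fc T (fun s => ((√(resM τ s) : ℝ) : ℂ)) f‖ ^ 2 =
      2 * (⟪f, T h⟫_ℂ).re - ((⟪T h, h⟫_ℂ).re - ‖T h‖ ^ 2) - τ ^ 2 * ‖T h‖ ^ 2 := by
  have hk : ContinuousOn (fun s => ((√(s * resD τ s) : ℝ) : ℂ)) (Icc 0 1) :=
    continuousOn_ofReal_sqrt (continuousOn_id.mul (continuous_resD τ).continuousOn)
  have hd : ContinuousOn (fun s => (((resD τ s)⁻¹ : ℝ) : ℂ)) (Icc 0 1) :=
    Complex.continuous_ofReal.comp_continuousOn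
      ((continuous_resD τ).continuousOn.inv₀ fun s hs => (resD_pos hτ hs).ne')
  -- The maximiser is `T h = (P + τ²)⁻¹ f`.
  refine ⟨fc T (fun s => (((resD τ s)⁻¹ : ℝ) : ℂ)) f, ?_⟩
  have h0 : fc T (fun s => ((√(s * resD τ s) : ℝ) : ℂ)) (fc T (fun s => (((resD τ s)⁻¹ : ℝ) : ℂ)) f) =
      fc T (fun s => ((√(resM τ s) : ℝ) : ℂ)) f := by
    rw [fc_mul_apply hT hk hd]
    refine congrArg (fun L : H →L[ℂ] H => L f) (fc_congr hT fun s hs => ?_)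
    have hp := resD_pos hτ hs
    rw [← Complex.ofReal_mul, resM, Real.sqrt_mul hs.1, Real.sqrt_div hs.1, mul_assoc,
      ← div_eq_mul_inv, Real.sqrt_div_self, div_eq_mul_inv]
  have := norm_sub_sq_resM hT hτ f (fc T (fun s => (((resD τ s)⁻¹ : ℝ) : ℂ)) f)
  rw [h0, sub_self, norm_zero] at this
  linarith

end Resolvents

end CriticalDecay
namespace CriticalDecay

/-! ### Square roots as integrals of resolvents. -/

section SquareRoots

variable {H : Type*} [NormedAddCommGroup H] [InnerProductSpace ℂ H] [CompleteSpace H]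
variable {T : H →L[ℂ] H}

/-- With `a = √p` this writes `π/√p` as an integral of `(p + τ²)⁻¹`. It reduces square roots to
resolvents, for which a comparison of forms is available. -/
lemma lintegral_inv_sq_add_sq {a : ℝ} (ha : 0 < a) :
    ∫⁻ τ : ℝ, ENNReal.ofReal (a ^ 2 + τ ^ 2)⁻¹ = ENNReal.ofReal (Real.pi / a) := by
  have e : ∀ τ : ℝ, (a ^ 2 + τ ^ 2)⁻¹ = (a ^ 2)⁻¹ * (1 + (a⁻¹ * τ) ^ 2)⁻¹ := fun τ => by
    rw [← mul_inv]
    congr 1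
    field_simp
  have hint : Integrable fun τ : ℝ => (a ^ 2)⁻¹ * (1 + (a⁻¹ * τ) ^ 2)⁻¹ :=
    (integrable_inv_one_add_sq.comp_mul_left' (inv_pos.2 ha).ne').const_mul _
  simp_rw [e]
  rw [← ofReal_integral_eq_lintegral_ofReal hint (Eventually.of_forall fun τ => by positivity),
    integral_const_mul, Measure.integral_comp_mul_left (fun y : ℝ => (1 + y ^ 2)⁻¹),
    integral_univ_inv_one_add_sq, inv_inv, abs_of_pos ha, smul_eq_mul]
  congr 1
  field_simp

/-- The inequality between symbols is integrated against the spectral measure, and Tonelli's theorem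
exchanges this with the integral over `τ`. The single value `τ = 0`, where the resolvent may be
singular, does not matter. -/
lemma enorm_fc_sq_le_lintegral (hT : IsPosContraction T) {R : ℝ → ℝ → ℝ}
    (hR : Measurable (Function.uncurry R)) (hRc : ∀ τ, τ ≠ 0 → ContinuousOn (R τ) (Icc 0 1))
    (hR0 : ∀ τ, τ ≠ 0 → ∀ s ∈ Icc (0 : ℝ) 1, 0 ≤ R τ s) {k : ℝ → ℂ} (hk : ContinuousOn k (Icc 0 1))
    {c : ℝ≥0∞} (hc : c ≠ ⊤)
    (h : ∀ s ∈ Icc (0 : ℝ) 1, ‖k s‖ₑ ^ 2 ≤ c * ∫⁻ τ, ENNReal.ofReal (R τ s)) (f : H) :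
    ‖fc T k f‖ₑ ^ 2 ≤ c * ∫⁻ τ, ‖fc T (fun s => ((√(R τ s) : ℝ) : ℂ)) f‖ₑ ^ 2 := by
  have e : ∫⁻ τ, ‖fc T (fun s => ((√(R τ s) : ℝ) : ℂ)) f‖ₑ ^ 2 =
      ∫⁻ τ, ∫⁻ s : Icc (0 : ℝ) 1, ENNReal.ofReal (R τ s) ∂(specMeas hT f) := by
    refine lintegral_congr_ae ?_
    have h0 : ∀ᵐ τ : ℝ, τ ≠ 0 := by
      simp [ae_iff]
    filter_upwards [h0] with τ hτ
    rw [enorm_fc_sq hT f (continuousOn_ofReal_sqrt (hRc τ hτ))]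
    refine lintegral_congr fun s => ?_
    rw [← ofReal_norm, Complex.norm_real, Real.norm_of_nonneg (Real.sqrt_nonneg _),
      ← ENNReal.ofReal_pow (Real.sqrt_nonneg _), Real.sq_sqrt (hR0 τ hτ s s.2)]
  have hm : Measurable (Function.uncurry fun (τ : ℝ) (s : Icc (0 : ℝ) 1) => ENNReal.ofReal (R τ s)) :=
    (hR.comp (measurable_fst.prodMk (measurable_subtype_coe.comp measurable_snd))).ennreal_ofReal
  rw [e, lintegral_lintegral_swap hm.aemeasurable, enorm_fc_sq hT f hk, ← lintegral_const_mul' _ _ hc]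
  exact lintegral_mono fun s => h s s.2

lemma measurable_resD : Measurable (Function.uncurry resD) := by
  unfold resD Function.uncurry; fun_prop

lemma pm_of_chi_ne {m : ℕ} {s : ℝ} (h : chi m s ≠ 0) : 0 < s ∧ pm m s = (1 - s) / s := by
  have h1 := clampC_of_chi_ne h
  have h2 := clampC_pos m s
  rw [h1] at h2
  refine ⟨h2, ?_⟩
  rw [pm, h1]
  field_simp

lemma lintegral_resM {m : ℕ} {s : ℝ} (h : chi m s ≠ 0) :
    ∫⁻ τ, ENNReal.ofReal (resM τ s) = ENNReal.ofReal (Real.pi / √(pm m s)) := by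
  obtain ⟨hs, hp⟩ := pm_of_chi_ne h
  have hp0 := pm_pos m s
  rw [← lintegral_inv_sq_add_sq (Real.sqrt_pos.2 hp0), Real.sq_sqrt hp0.le]
  refine lintegral_congr fun τ => ?_
  rw [hp, resM, resD]
  congr 1
  rw [div_add' _ _ _ hs.ne', inv_div]

lemma lintegral_resL {m : ℕ} {s : ℝ} (h : chi m s ≠ 0) :
    ∫⁻ τ, ENNReal.ofReal (resL τ s) = ENNReal.ofReal (Real.pi * √(pm m s)) := by
  obtain ⟨hs, hp⟩ := pm_of_chi_ne h
  have hp0 := pm_pos m s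
  have e : ∀ τ, ENNReal.ofReal (resL τ s) = ENNReal.ofReal (pm m s) * ENNReal.ofReal (resM τ s) := fun τ => by
    rw [← ENNReal.ofReal_mul hp0.le, hp, resL, resM]
    congr 1
    field_simp
  simp only [e]
  rw [lintegral_const_mul' _ _ ENNReal.ofReal_ne_top, lintegral_resM h, ← ENNReal.ofReal_mul hp0.le]
  congr 1
  nth_rw 1 [← Real.mul_self_sqrt hp0.le]
  have := Real.sqrt_pos.2 hp0
  field_simp

lemma continuousOn_chi_mul (m : ℕ) : ContinuousOn
    (fun s => ((chi m s * √√(pm m s) : ℝ) : ℂ)) (Icc 0 1) :=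
  ofReal_continuousOn ((continuous_chi m).mul (continuous_pm m).sqrt.sqrt)

lemma continuousOn_chi_div (m : ℕ) : ContinuousOn
    (fun s => ((chi m s * (1 / √√(pm m s)) : ℝ) : ℂ)) (Icc 0 1) :=
  ofReal_continuousOn ((continuous_chi m).mul (continuous_const.div (continuous_pm m).sqrt.sqrt
    fun s => (Real.sqrt_pos.2 (Real.sqrt_pos.2 (pm_pos m s))).ne'))

lemma enorm_chi_mul_sq_le (m : ℕ) (s : ℝ) {b : ℝ} (hb : 0 ≤ b) :
    ‖((chi m s * √b : ℝ) : ℂ)‖ₑ ^ 2 ≤ ENNReal.ofReal b := by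
  rw [← ofReal_norm, ← ENNReal.ofReal_pow (norm_nonneg _), Complex.norm_real, Real.norm_eq_abs, sq_abs,
    mul_pow, Real.sq_sqrt hb]
  refine ENNReal.ofReal_le_ofReal (mul_le_of_le_one_left hb ?_)
  exact pow_le_one₀ (chi_nonneg m s) (chi_le_one m s)

lemma enorm_fc_chi_mul_sq_le (hT : IsPosContraction T) (m : ℕ) (f : H) :
    ‖fc T (fun s => ((chi m s * √√(pm m s) : ℝ) : ℂ)) f‖ₑ ^ 2 ≤
      ENNReal.ofReal (1 / Real.pi) * ∫⁻ τ, ‖fc T (fun s => ((√(resL τ s) : ℝ) : ℂ)) f‖ₑ ^ 2 := by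
  refine enorm_fc_sq_le_lintegral hT (R := resL) ?_ (fun τ hτ => continuousOn_resL hτ)
    (fun τ hτ s hs => resL_nonneg hτ hs) (continuousOn_chi_mul m) ENNReal.ofReal_ne_top
    (fun s _ => ?_) f
  · exact (measurable_const.sub measurable_snd).div measurable_resD
  · by_cases h : chi m s = 0
    · simp [h]
    · rw [lintegral_resL h, ← ENNReal.ofReal_mul (by positivity), one_div,
        inv_mul_cancel_left₀ Real.pi_ne_zero]
      exact enorm_chi_mul_sq_le m s (Real.sqrt_nonneg _)

lemma enorm_fc_chi_div_sq_le (hT : IsPosContraction T) (m : ℕ) (f : H) :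
    ‖fc T (fun s => ((chi m s * (1 / √√(pm m s)) : ℝ) : ℂ)) f‖ₑ ^ 2 ≤
      ENNReal.ofReal (1 / Real.pi) * ∫⁻ τ, ‖fc T (fun s => ((√(resM τ s) : ℝ) : ℂ)) f‖ₑ ^ 2 := by
  refine enorm_fc_sq_le_lintegral hT (R := resM) ?_ (fun τ hτ => continuousOn_resM hτ)
    (fun τ hτ s hs => resM_nonneg hτ hs) (continuousOn_chi_div m) ENNReal.ofReal_ne_top
    (fun s _ => ?_) f
  · exact measurable_snd.div measurable_resD
  · by_cases h : chi m s = 0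
    · simp [h]
    · rw [lintegral_resM h, ← ENNReal.ofReal_mul (by positivity),
        show 1 / Real.pi * (Real.pi / √(pm m s)) = 1 / √(pm m s) by
          have := Real.pi_ne_zero
          field_simp,
        show 1 / √√(pm m s) = √(1 / √(pm m s)) by rw [Real.sqrt_div zero_le_one, Real.sqrt_one]]
      exact enorm_chi_mul_sq_le m s (by positivity)

end SquareRoots

end CriticalDecay
namespace CriticalDecay

/-! ### Density of the test functions in `H¹`. -/

section SchwartzApproximation

variable {n : ℕ}

lemma schwartz_exists_norm_le (φ : 𝓢(E n, ℂ)) : ∃ C : ℝ, 0 ≤ C ∧ ∀ x, ‖φ x‖ ≤ C := by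
  obtain ⟨C, hC0, hC⟩ := φ.decay 0 0
  exact ⟨C, hC0.le, fun x => by simpa using hC x⟩

/-- Hardy's weight is integrable against Schwartz functions. -/
lemma schwartz_integrable_norm_sq_div (hn : 3 ≤ n) (φ : 𝓢(E n, ℂ)) :
    Integrable fun x => ‖φ x‖ ^ 2 / ‖x‖ ^ 2 := by
  obtain ⟨C, hC0, hC⟩ := schwartz_exists_norm_le φ
  have hfr : Module.finrank ℝ (E n) = n := by simp
  have hm : AEStronglyMeasurable (fun x : E n => ‖φ x‖ ^ 2 / ‖x‖ ^ 2) :=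
    (φ.continuous.measurable.norm.pow_const 2 |>.div (measurable_norm.pow_const 2)).aestronglyMeasurable
  rw [← integrableOn_univ, ← union_compl_self (Metric.ball (0 : E n) 1), integrableOn_union]
  constructor
  · refine integrableOn_ball_of_norm_le_rpow (C := C ^ 2) (α := 2) (by rw [hfr]; omega) ?_ ?_ hm
    · rw [hfr]
      have : (3 : ℝ) ≤ n := by exact_mod_cast hn
      linarith
    · refine ae_of_all _ fun x => ?_
      rw [norm_div, norm_pow, norm_pow, norm_norm, norm_norm, Real.rpow_neg (norm_nonneg _),
        Real.rpow_two, ← div_eq_mul_inv]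
      gcongr
      exact hC x
  · have hi : Integrable fun x : E n => ‖φ x‖ ^ 2 := (φ.memLp 2 volume).integrable_norm_pow (by norm_num)
    refine Integrable.mono' hi.integrableOn hm.restrict ?_
    filter_upwards [ae_restrict_mem measurableSet_ball.compl] with x hx
    have hx1 : 1 ≤ ‖x‖ := by simpa using hx
    rw [Real.norm_of_nonneg (by positivity)]
    exact div_le_self (by positivity) (one_le_pow₀ hx1)

lemma schwartz_memLp_div_norm (hn : 3 ≤ n) (φ : 𝓢(E n, ℂ)) :
    MemLp (fun x => ((‖x‖⁻¹ : ℝ) : ℂ) * φ x) 2 := by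
  have hm : AEStronglyMeasurable (fun x : E n => ((‖x‖⁻¹ : ℝ) : ℂ) * φ x) :=
    ((Complex.measurable_ofReal.comp measurable_norm.inv).mul φ.continuous.measurable).aestronglyMeasurable
  rw [memLp_two_iff_integrable_sq_norm hm]
  refine (schwartz_integrable_norm_sq_div hn φ).congr (ae_of_all _ fun x => ?_)
  change ‖φ x‖ ^ 2 / ‖x‖ ^ 2 = ‖((‖x‖⁻¹ : ℝ) : ℂ) * φ x‖ ^ 2
  rw [norm_mul, Complex.norm_real, norm_inv, norm_norm, mul_pow, inv_pow, div_eq_inv_mul]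

open scoped LineDeriv in
/-- Test functions are dense in the Schwartz functions for the `H¹` norm. -/
lemma exists_tendsto_test (hn : 3 ≤ n) (φ : 𝓢(E n, ℂ)) : ∃ ψ : ℕ → testSpace n,
    Tendsto (fun m => testIncl n (ψ m)) atTop (𝓝 (φ.toLp 2)) ∧
    ∀ j, Tendsto (fun m => (IsTest.memLp_pd (ψ m).2 j).toLp) atTop
      (𝓝 ((∂_{(EuclideanSpace.single j 1 : E n)} φ).toLp 2)) := by
  have hn0 : n ≠ 0 := by omega
  obtain ⟨C, hC0, hC⟩ := exists_lineBump_bound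
  set u : ℕ → E n → ℂ := fun m x => (logCut m ‖x‖ : ℂ) * φ x with hu
  have ht : ∀ m, IsTest (fun x => if x = 0 then 0 else u m x) := fun m => by
    have hϑ := isRadialCutoff_logCut m
    refine isTest_of (isCompact_annulus _ (Real.exp (2 * (m + 1)))) (zero_notMem_annulus hϑ.pos) ?_ fun x hx => ?_
    · have : ContDiffOn ℝ ∞ (u m) {0}ᶜ := by
        refine ContDiffOn.mul ?_ (φ.smooth _).contDiffOn
        exact Complex.ofRealCLM.contDiff.comp_contDiffOn (contDiffOn_radial hϑ.smooth)
      exact this.congr fun x hx => if_neg hx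
    · by_cases h0 : x = 0
      · simp [h0]
      · rw [if_neg h0, hu]
        simp [(hϑ.zero _ (norm_pos_iff.2 h0) hx).1]
  have h1 : ∀ f : L2 n, Tendsto (fun m => mulL2 (fun x : E n => (logCut m ‖x‖ : ℂ)) f) atTop (𝓝 f) :=
    fun f => tendsto_mulL2 hn0 (fun m => isMult_logCut (n := n) m) (fun m x => by
      rw [Complex.norm_real, Real.norm_of_nonneg (logCut_mem m _).1]
      exact (logCut_mem m _).2) (fun x _ => by
        have := (Complex.continuous_ofReal.tendsto 1).comp (tendsto_logCut ‖x‖)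
        rw [Complex.ofReal_one] at this
        exact this) f
  refine ⟨fun m => ⟨_, ht m⟩, ?_, fun j => ?_⟩
  · refine (h1 (φ.toLp 2)).congr fun m => Lp.ext ?_
    filter_upwards [mulL2_ae (isMult_logCut m) (φ.toLp 2), (ht m).memLp.coeFn_toLp, φ.coeFn_toLp 2,
      volume_singleton_zero_compl hn0] with x e1 e2 e3 hx
    refine e1.trans (Eq.trans ?_ e2.symm)
    rw [e3, if_neg hx]
  -- The derivative of the cutoff contributes `(ϑ' xⱼ)(φ/|x|)`, which is `O(1/m)` times `φ/|x|`, a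
  -- square integrable function as `n ≥ 3`.
  · set W : L2 n := (schwartz_memLp_div_norm hn φ).toLp with hW
    set a : ℕ → E n → ℂ := fun m x => ((2 * logCut₁ m ‖x‖ * x j : ℝ) : ℂ) with ha
    have ham : ∀ m, IsMult (a m) := fun m => (isRadialCutoff_logCut m).isMult_grad j
    have h2 : Tendsto (fun m => mulL2 (a m) W) atTop (𝓝 0) := by
      have hl : Tendsto (fun m : ℕ => 2 * C / ((m : ℝ) + 1) * ‖W‖) atTop (𝓝 0) := by
        have := ((tendsto_one_div_add_atTop_nhds_zero_nat (𝕜 := ℝ)).const_mul (2 * C)).mul_const ‖W‖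
        simpa [div_eq_mul_inv] using this
      refine squeeze_zero_norm (fun m => ?_) hl
      have hm : (0 : ℝ) < m + 1 := by positivity
      refine norm_mulL2_le (ham m) (fun x => ?_) _
      rw [ha, Complex.norm_real, Real.norm_eq_abs]
      by_cases hx : x = 0
      · simp only [hx, PiLp.zero_apply, mul_zero, abs_zero]; positivity
      have hr := norm_pos_iff.2 hx
      rw [abs_mul, abs_mul, abs_two, logCut₁, abs_div, abs_div, abs_norm, abs_of_pos hm]
      have e1 := (hC (Real.log ‖x‖ / (m + 1))).1
      have e2 : |x j| ≤ ‖x‖ := by simpa using PiLp.norm_apply_le x j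
      calc 2 * (|deriv lineBump (Real.log ‖x‖ / (m + 1))| / ((m : ℝ) + 1) / ‖x‖) * |x j|
          ≤ 2 * (C / (m + 1) / ‖x‖) * ‖x‖ := by gcongr
        _ = 2 * C / (m + 1) := by field_simp
    -- The `1/2` undoes the `2` in the multiplier borrowed from `IsRadialCutoff.isMult_grad`.
    have h3 := (h2.const_smul ((1 : ℂ) / 2)).add (h1 ((∂_{(EuclideanSpace.single j 1 : E n)} φ).toLp 2))
    rw [smul_zero, zero_add] at h3
    refine h3.congr fun m => Lp.ext ?_
    filter_upwards [mulL2_ae (ham m) W, mulL2_ae (isMult_logCut m) ((∂_{(EuclideanSpace.single j 1 : E n)} φ).toLp 2),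
      (schwartz_memLp_div_norm hn φ).coeFn_toLp, SchwartzMap.coeFn_toLp (∂_{(EuclideanSpace.single j 1 : E n)} φ) 2,
      ((ht m).memLp_pd j).coeFn_toLp, volume_singleton_zero_compl hn0,
      Lp.coeFn_add (((1 : ℂ) / 2) • mulL2 (a m) W) (mulL2 (fun x : E n => (logCut m ‖x‖ : ℂ))
        ((∂_{(EuclideanSpace.single j 1 : E n)} φ).toLp 2)),
      Lp.coeFn_smul ((1 : ℂ) / 2) (mulL2 (a m) W)] with x e1 e2 e3 e4 e5 hx e6 e7
    refine e6.trans (Eq.trans ?_ e5.symm)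
    have hr := norm_pos_iff.2 hx
    have hϑ := isRadialCutoff_logCut m
    have hd1 : DifferentiableAt ℝ (fun y : E n => (logCut m ‖y‖ : ℂ)) x :=
      Complex.ofRealCLM.differentiableAt.comp x
        ((hϑ.deriv1 _ hr).differentiableAt.comp x ((contDiffAt_norm ℝ hx (n := 1)).differentiableAt (by norm_num)))
    have hpd : pd j (fun y : E n => (logCut m ‖y‖ : ℂ)) x = ((x j / ‖x‖ * logCut₁ m ‖x‖ : ℝ) : ℂ) := by
      rw [pd_comp_real (f := fun r => (logCut m r : ℂ)) ((hϑ.deriv1 _ hr).ofReal_comp)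
        ((contDiffAt_norm ℝ hx (n := 1)).differentiableAt (by norm_num)), pd_norm hx,
        Complex.real_smul]
      push_cast; ring
    have e8 : pd j (fun y => if y = 0 then 0 else u m y) x = pd j (u m) x := by
      refine pd_congr ?_
      filter_upwards [isOpen_compl_singleton.mem_nhds hx] with y hy using if_neg hy
    rw [e8, hu, pd_mul hd1 φ.differentiableAt, hpd, Pi.add_apply, e7, Pi.smul_apply, e1, e2, e4,
      hW, e3, SchwartzMap.lineDerivOp_apply_eq_fderiv, ha, smul_eq_mul]
    unfold pd
    have hrc : (‖x‖ : ℂ) ≠ 0 := by exact_mod_cast hr.ne'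
    push_cast
    field_simp

end SchwartzApproximation

end CriticalDecay
namespace CriticalDecay

/-! ### The variational characterisation for the Laplacian, on the Fourier side. -/

section FourierSide

open scoped LineDeriv

variable {n : ℕ}

/-- The Fourier symbol of `c|∇|² + τ²`. -/
noncomputable def symD (c τ : ℝ) (ξ : E n) : ℝ := c * (2 * Real.pi * ‖ξ‖) ^ 2 + τ ^ 2

lemma symD_pos {c τ : ℝ} (hc : 0 < c) (hτ : τ ≠ 0) (ξ : E n) : 0 < symD c τ ξ := by
  unfold symD; positivity

lemma contDiff_symD (c τ : ℝ) : ContDiff ℝ ∞ (symD c τ : E n → ℝ) := by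
  unfold symD
  simp only [mul_pow]
  exact (contDiff_const.mul (contDiff_const.mul (contDiff_norm_sq ℝ))).add contDiff_const

/-- The Fourier symbol of `(c|∇|² + τ²)^{-1/2}`. -/
noncomputable def symR (c τ : ℝ) (ξ : E n) : ℂ := (((√(symD c τ ξ))⁻¹ : ℝ) : ℂ)

lemma isMult_symR {c τ : ℝ} (hc : 0 < c) (hτ : τ ≠ 0) : IsMult (symR c τ : E n → ℂ) := by
  refine ⟨Complex.measurable_ofReal.comp ((contDiff_symD c τ).continuous.sqrt.measurable.inv),
    (√(τ ^ 2))⁻¹, fun ξ => ?_⟩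
  rw [symR, Complex.norm_real, norm_inv, Real.norm_of_nonneg (Real.sqrt_nonneg _)]
  have : 0 < √(τ ^ 2) := Real.sqrt_pos.2 (by positivity)
  gcongr
  unfold symD
  have : 0 ≤ c * (2 * Real.pi * ‖ξ‖) ^ 2 := by positivity
  linarith

lemma conj_symR (c τ : ℝ) : (fun ξ : E n => (starRingEnd ℂ) (symR c τ ξ)) = symR c τ := by
  ext x; simp [symR]

/-- The `j`-th partial derivative of a Schwartz function. -/
noncomputable def schwartzPd (j : Fin n) (φ : 𝓢(E n, ℂ)) : 𝓢(E n, ℂ) :=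
  ∂_{(EuclideanSpace.single j 1 : E n)} φ

lemma norm_toL2_sq (φ : 𝓢(E n, ℂ)) : ‖φ.toLp 2‖ ^ 2 = ∫ x, ‖φ x‖ ^ 2 := norm_toLp_sq (φ.memLp 2)

lemma integrable_schwartz_sq (φ : 𝓢(E n, ℂ)) : Integrable fun x => ‖φ x‖ ^ 2 :=
  (φ.memLp 2 volume).integrable_norm_pow (by norm_num)

lemma norm_fourier_schwartzPd (j : Fin n) (φ : 𝓢(E n, ℂ)) (ξ : E n) :
    ‖𝓕 (schwartzPd j φ) ξ‖ ^ 2 = (2 * Real.pi * ξ j) ^ 2 * ‖𝓕 φ ξ‖ ^ 2 := by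
  have ht : (fun x : E n => inner ℝ x (EuclideanSpace.single j 1 : E n)).HasTemperateGrowth :=
    ((innerSL ℝ).flip (EuclideanSpace.single j 1 : E n)).hasTemperateGrowth
  have e : 𝓕 (schwartzPd j φ) ξ = (2 * Real.pi * Complex.I) * ((ξ j : ℂ) * 𝓕 φ ξ) := by
    rw [schwartzPd, SchwartzMap.fourier_lineDerivOp_eq, smul_apply,
      SchwartzMap.smulLeftCLM_apply_apply ht, EuclideanSpace.inner_single_right]
    simp
  rw [e, norm_mul, norm_mul, norm_mul, Complex.norm_I, Complex.norm_real]
  simp only [norm_mul, Complex.norm_real, Complex.norm_ofNat, Real.norm_eq_abs, mul_one]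
  rw [← mul_assoc, mul_pow, mul_pow, mul_pow, mul_pow, mul_pow, sq_abs, sq_abs]

lemma integrable_fourier_weight (φ : 𝓢(E n, ℂ)) :
    Integrable fun ξ : E n => (2 * Real.pi * ‖ξ‖) ^ 2 * ‖𝓕 φ ξ‖ ^ 2 := by
  have h : ∀ ξ : E n, (2 * Real.pi * ‖ξ‖) ^ 2 * ‖𝓕 φ ξ‖ ^ 2 = ∑ j, ‖𝓕 (schwartzPd j φ) ξ‖ ^ 2 := fun ξ => by
    simp only [norm_fourier_schwartzPd, mul_pow _ _ 2, norm_sq_eq_sum ξ, Finset.mul_sum, Finset.sum_mul]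
  simp only [h]
  exact integrable_finsetSum _ fun j _ => integrable_schwartz_sq _

lemma sum_norm_schwartzPd (φ : 𝓢(E n, ℂ)) : ∑ j, ‖(schwartzPd j φ).toLp 2‖ ^ 2 =
    ∫ ξ : E n, (2 * Real.pi * ‖ξ‖) ^ 2 * ‖𝓕 φ ξ‖ ^ 2 := by
  have h : ∀ ξ : E n, (2 * Real.pi * ‖ξ‖) ^ 2 * ‖𝓕 φ ξ‖ ^ 2 = ∑ j, ‖𝓕 (schwartzPd j φ) ξ‖ ^ 2 := fun ξ => by
    simp only [norm_fourier_schwartzPd, mul_pow _ _ 2, norm_sq_eq_sum ξ, Finset.mul_sum, Finset.sum_mul]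
  simp only [h]
  rw [integral_finsetSum _ fun j _ => integrable_schwartz_sq _]
  refine Finset.sum_congr rfl fun j _ => ?_
  rw [← norm_toL2_sq, ← SchwartzMap.toLp_fourier_eq, Lp.norm_fourier_eq]

/-- `(c|∇|² + τ²)^{1/2} φ`, on the Fourier side. -/
lemma memLp_symD {c τ : ℝ} (hc : 0 < c) (hτ : τ ≠ 0) (φ : 𝓢(E n, ℂ)) :
    MemLp (fun ξ => ((√(symD c τ ξ) : ℝ) : ℂ) * 𝓕 φ ξ) 2 := by
  have hm : AEStronglyMeasurable (fun ξ => ((√(symD c τ ξ) : ℝ) : ℂ) * 𝓕 φ ξ) :=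
    ((Complex.continuous_ofReal.comp (contDiff_symD c τ).continuous.sqrt).mul
      (𝓕 φ).continuous).aestronglyMeasurable
  rw [memLp_two_iff_integrable_sq_norm hm]
  refine (((integrable_fourier_weight φ).const_mul c).add
    ((integrable_schwartz_sq (𝓕 φ)).const_mul (τ ^ 2))).congr (ae_of_all _ fun ξ => ?_)
  change c * ((2 * Real.pi * ‖ξ‖) ^ 2 * ‖𝓕 φ ξ‖ ^ 2) + τ ^ 2 * ‖𝓕 φ ξ‖ ^ 2 =
    ‖((√(symD c τ ξ) : ℝ) : ℂ) * 𝓕 φ ξ‖ ^ 2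
  rw [norm_mul, Complex.norm_real, Real.norm_of_nonneg (Real.sqrt_nonneg _),
    mul_pow (√(symD c τ ξ)),
    Real.sq_sqrt (symD_pos hc hτ ξ).le, symD]
  ring

/-- `‖(c|∇|² + τ²)^{-1/2} f - (c|∇|² + τ²)^{1/2} φ‖²`, expanded. -/
lemma norm_sub_sq_symR {c τ : ℝ} (hc : 0 < c) (hτ : τ ≠ 0) (f : L2 n) (φ : 𝓢(E n, ℂ)) :
    ‖mulL2 (symR c τ) (𝓕 f) - (memLp_symD hc hτ φ).toLp‖ ^ 2 =
      ‖mulL2 (symR c τ) (𝓕 f)‖ ^ 2 - (2 * (⟪f, φ.toLp 2⟫_ℂ).re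
        - c * ∑ j, ‖(schwartzPd j φ).toLp 2‖ ^ 2 - τ ^ 2 * ‖φ.toLp 2‖ ^ 2) := by
  have e1 : ⟪mulL2 (symR c τ) (𝓕 f), (memLp_symD hc hτ φ).toLp⟫_ℂ = ⟪f, φ.toLp 2⟫_ℂ := by
    rw [inner_mulL2_left (isMult_symR hc hτ), conj_symR, ← Lp.inner_fourier_eq f,
      SchwartzMap.toLp_fourier_eq]
    congr 1
    refine Lp.ext ?_
    filter_upwards [mulL2_ae (isMult_symR hc hτ) (memLp_symD hc hτ φ).toLp,
      (memLp_symD hc hτ φ).coeFn_toLp, (𝓕 φ).coeFn_toLp 2] with ξ e1 e2 e3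
    have := (Real.sqrt_pos.2 (symD_pos hc hτ ξ)).ne'
    rw [e1, e2, e3, symR, ← mul_assoc, ← Complex.ofReal_mul, inv_mul_cancel₀ this, Complex.ofReal_one,
      one_mul]
  have e2 : ‖(memLp_symD hc hτ φ).toLp‖ ^ 2 =
      c * ∑ j, ‖(schwartzPd j φ).toLp 2‖ ^ 2 + τ ^ 2 * ‖φ.toLp 2‖ ^ 2 := by
    rw [norm_toLp_sq, sum_norm_schwartzPd, ← Lp.norm_fourier_eq (φ.toLp 2 volume), SchwartzMap.toLp_fourier_eq,
      norm_toL2_sq, ← integral_const_mul, ← integral_const_mul,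
      ← integral_add ((integrable_fourier_weight φ).const_mul c)
        ((integrable_schwartz_sq (𝓕 φ)).const_mul (τ ^ 2))]
    refine integral_congr_ae (ae_of_all _ fun ξ => ?_)
    change ‖((√(symD c τ ξ) : ℝ) : ℂ) * 𝓕 φ ξ‖ ^ 2 =
      c * ((2 * Real.pi * ‖ξ‖) ^ 2 * ‖𝓕 φ ξ‖ ^ 2) + τ ^ 2 * ‖𝓕 φ ξ‖ ^ 2
    rw [norm_mul, Complex.norm_real, Real.norm_of_nonneg (Real.sqrt_nonneg _),
    mul_pow (√(symD c τ ξ)),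
      Real.sq_sqrt (symD_pos hc hτ ξ).le, symD]
    ring
  rw [@norm_sub_sq ℂ, e1, e2]
  simp only [RCLike.re_eq_complex_re]
  ring

lemma integral_gradSq_eq (ψ : testSpace n) :
    ∫ x, gradSq ψ.1 x = ∑ j, ‖(IsTest.memLp_pd ψ.2 j).toLp‖ ^ 2 := by
  simp only [norm_toLp_sq]
  rw [← integral_finsetSum _ fun j _ => (IsTest.memLp_pd ψ.2 j).integrable_norm_pow (by norm_num)]
  exact integral_congr_ae (ae_of_all _ fun x => gradSq_eq ..)

lemma IsTest.hasCompactSupport {φ : E n → ℂ} (h : IsTest φ) : HasCompactSupport φ := h.2.1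

/-- The test functions on the variational characterization of `⟨f, (c|∇|² + τ²)⁻¹ f⟩`. -/
lemma le_norm_sq_symR {c τ : ℝ} (hc : 0 < c) (hτ : τ ≠ 0) (f : L2 n) (ψ : testSpace n) :
    2 * (⟪f, testIncl n ψ⟫_ℂ).re - c * (∫ x, gradSq ψ.1 x) - τ ^ 2 * ‖testIncl n ψ‖ ^ 2 ≤
      ‖mulL2 (symR c τ) (𝓕 f)‖ ^ 2 := by
  have h := norm_sub_sq_symR hc hτ f (HasCompactSupport.toSchwartzMap (IsTest.hasCompactSupport ψ.2) ψ.2.1)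
  have h2 := sq_nonneg ‖mulL2 (symR c τ) (𝓕 f) -
    (memLp_symD hc hτ (HasCompactSupport.toSchwartzMap (IsTest.hasCompactSupport ψ.2) ψ.2.1)).toLp‖
  rw [h, sub_nonneg] at h2
  rw [integral_gradSq_eq]
  exact h2

lemma norm_sq_symR_le (hn : 3 ≤ n) {c τ : ℝ} (hc : 0 < c) (hτ : τ ≠ 0) (f : L2 n) {K : ℝ}
    (h : ∀ ψ : testSpace n, 2 * (⟪f, testIncl n ψ⟫_ℂ).re - c * (∫ x, gradSq ψ.1 x)
      - τ ^ 2 * ‖testIncl n ψ‖ ^ 2 ≤ K) :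
    ‖mulL2 (symR c τ) (𝓕 f)‖ ^ 2 ≤ K := by
  have h1 : ∀ φ : 𝓢(E n, ℂ), 2 * (⟪f, φ.toLp 2⟫_ℂ).re
      - c * ∑ j, ‖(schwartzPd j φ).toLp 2‖ ^ 2 - τ ^ 2 * ‖φ.toLp 2‖ ^ 2 ≤ K := fun φ => by
    obtain ⟨ψ, a1, a2⟩ := exists_tendsto_test hn φ
    have b1 : Tendsto (fun m => (⟪f, testIncl n (ψ m)⟫_ℂ).re) atTop (𝓝 (⟪f, φ.toLp 2⟫_ℂ).re) :=
      (Complex.continuous_re.tendsto _).comp (tendsto_const_nhds.inner a1)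
    have b2 := tendsto_finsetSum Finset.univ fun j _ => (a2 j).norm.pow 2
    refine le_of_tendsto (((b1.const_mul 2).sub (b2.const_mul c)).sub ((a1.norm.pow 2).const_mul (τ ^ 2)))
      (Eventually.of_forall fun m => ?_)
    have := h (ψ m)
    rwa [integral_gradSq_eq] at this
  -- The maximum is nearly attained: a smooth compactly supported `g` close to `symR c τ * 𝓕 f` is
  -- multiplied by `symR c τ`, and the result is the Fourier transform of a Schwartz function `φ`.
  refine le_of_forall_pos_le_add fun ε hε => ?_
  obtain ⟨g, hg1, hg2, hg3⟩ := MemLp.exist_eLpNorm_sub_le (p := 2) (by norm_num) (by norm_num)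
    (Lp.memLp (mulL2 (symR c τ) (𝓕 f))) (Real.sqrt_pos.2 hε)
  have hs : ContDiff ℝ ∞ fun ξ => symR c τ ξ * g ξ := by
    refine ContDiff.mul (Complex.ofRealCLM.contDiff.comp ?_) hg2
    exact ((contDiff_symD c τ).sqrt fun ξ => (symD_pos hc hτ ξ).ne').inv fun ξ =>
      (Real.sqrt_pos.2 (symD_pos hc hτ ξ)).ne'
  set φ : 𝓢(E n, ℂ) := 𝓕⁻ (HasCompactSupport.toSchwartzMap (hg1.mul_left (f := symR c τ)) hs) with hφ
  have hF : 𝓕 φ = HasCompactSupport.toSchwartzMap (hg1.mul_left (f := symR c τ)) hs := by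
    rw [hφ, FourierTransform.fourier_fourierInv_eq]
  have h2 := norm_sub_sq_symR hc hτ f φ
  have h3 : ‖mulL2 (symR c τ) (𝓕 f) - (memLp_symD hc hτ φ).toLp‖ ≤ √ε := by
    rw [Lp.norm_def]
    refine ENNReal.toReal_le_of_le_ofReal (Real.sqrt_nonneg _) (le_trans (le_of_eq ?_) hg3)
    refine eLpNorm_congr_ae ?_
    filter_upwards [Lp.coeFn_sub (mulL2 (symR c τ) (𝓕 f)) (memLp_symD hc hτ φ).toLp,
      (memLp_symD hc hτ φ).coeFn_toLp] with ξ e1 e2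
    have := (Real.sqrt_pos.2 (symD_pos hc hτ ξ)).ne'
    rw [e1, Pi.sub_apply, Pi.sub_apply, e2, hF]
    have e3 : ((√(symD c τ ξ) : ℝ) : ℂ) * (symR c τ ξ * g ξ) = g ξ := by
      rw [symR, ← mul_assoc, ← Complex.ofReal_mul, mul_inv_cancel₀ this, Complex.ofReal_one, one_mul]
    exact congrArg (fun z => (mulL2 (symR c τ) (𝓕 f) : E n → ℂ) ξ - z) e3
  have h4 := pow_le_pow_left₀ (norm_nonneg _) h3 2
  rw [Real.sq_sqrt hε.le, h2] at h4
  linarith [h1 φ]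

end FourierSide

end CriticalDecay
namespace CriticalDecay

/-! ### Comparison of `P^{±1/2}` with powers of the Laplacian. -/

section FormComparison

variable {n : ℕ} {V : E n → ℝ} {T : L2 n →L[ℂ] L2 n} {c : ℝ}

/-- `q ≤ c ‖∇·‖²` implies `(c|∇|² + τ²)⁻¹ ≤ (P + τ²)⁻¹`. -/
lemma norm_sq_symR_le_resM (hT : IsFriedrichsInverse V T) (hn : 3 ≤ n) (hV : ContinuousOn V {0}ᶜ)
    (hc : 0 < c) (hq : ∀ ψ : testSpace n, formQ V ψ.1 ≤ c * ∫ x, gradSq ψ.1 x)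
    {τ : ℝ} (hτ : τ ≠ 0) (f : L2 n) :
    ‖mulL2 (symR c τ) (𝓕 f)‖ ^ 2 ≤ ‖fc T (fun s => ((√(resM τ s) : ℝ) : ℂ)) f‖ ^ 2 := by
  refine norm_sq_symR_le hn hc hτ f fun ψ => ?_
  have h := norm_sub_sq_resM hT.pos hτ f (testOp hV ψ)
  have h2 := sq_nonneg ‖fc T (fun s => ((√(resM τ s) : ℝ) : ℂ)) f
    - fc T (fun s => ((√(s * resD τ s) : ℝ) : ℂ)) (testOp hV ψ)‖
  rw [h, hT.apply_test hV ψ, re_inner_testIncl_testOp] at h2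
  linarith [hq ψ]

/-- `c ‖∇·‖² ≤ q` implies `(P + τ²)⁻¹ ≤ (c|∇|² + τ²)⁻¹`. -/
lemma resM_le_norm_sq_symR (hT : IsFriedrichsInverse V T)
    (hc : 0 < c) (hq : ∀ ψ : testSpace n, c * ∫ x, gradSq ψ.1 x ≤ formQ V ψ.1)
    {τ : ℝ} (hτ : τ ≠ 0) (f : L2 n) :
    ‖fc T (fun s => ((√(resM τ s) : ℝ) : ℂ)) f‖ ^ 2 ≤ ‖mulL2 (symR c τ) (𝓕 f)‖ ^ 2 := by
  obtain ⟨h, e⟩ := exists_resM_eq hT.pos hτ f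
  obtain ⟨ψ, a1, a2, -⟩ := hT.approx h
  rw [e]
  have b1 : Tendsto (fun m => (⟪f, testIncl n (ψ m)⟫_ℂ).re) atTop (𝓝 (⟪f, T h⟫_ℂ).re) :=
    (Complex.continuous_re.tendsto _).comp (tendsto_const_nhds.inner a1)
  refine le_of_tendsto (((b1.const_mul 2).sub a2).sub ((a1.norm.pow 2).const_mul (τ ^ 2)))
    (Eventually.of_forall fun m => ?_)
  linarith [le_norm_sq_symR hc hτ f (ψ m), hq (ψ m)]

lemma enorm_sq_symR {τ : ℝ} (hc : 0 < c) (hτ : τ ≠ 0) (f : L2 n) :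
    ‖mulL2 (symR c τ) f‖ₑ ^ 2 = ∫⁻ ξ, ENNReal.ofReal (symD c τ ξ)⁻¹ * ‖f ξ‖ₑ ^ 2 := by
  rw [enorm_sq_eq_lintegral]
  refine lintegral_congr_ae ?_
  filter_upwards [mulL2_ae (isMult_symR hc hτ) f] with ξ e
  rw [e, enorm_mul, mul_pow, symR, ← ofReal_norm, Complex.norm_real,
    Real.norm_of_nonneg (inv_nonneg.2 (Real.sqrt_nonneg _)), ← ENNReal.ofReal_pow
      (inv_nonneg.2 (Real.sqrt_nonneg _)), inv_pow, Real.sq_sqrt (symD_pos hc hτ ξ).le]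

lemma measurable_symD (c : ℝ) : Measurable (Function.uncurry fun (τ : ℝ) (ξ : E n) => symD c τ ξ) := by
  unfold symD Function.uncurry; fun_prop

/-- The measure of a function with respect to the symbol `|ξ|^(2s)`. -/
noncomputable def hsSq (s : ℝ) (f : L2 n) : ℝ≥0∞ :=
  ∫⁻ ξ, (ENNReal.ofReal ((2 * Real.pi * ‖ξ‖) ^ s) * ‖(𝓕 f : L2 n) ξ‖ₑ) ^ 2

lemma ae_ne_zero_real : ∀ᵐ τ : ℝ, τ ≠ 0 := by simp [ae_iff]

lemma sq_rpow_half {a : ℝ} (ha : 0 ≤ a) : (a ^ (1 / 2 : ℝ)) ^ 2 = a := by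
  rw [← Real.sqrt_eq_rpow, Real.sq_sqrt ha]

lemma sq_rpow_neg_half {a : ℝ} (ha : 0 ≤ a) : (a ^ (-1 / 2 : ℝ)) ^ 2 = a⁻¹ := by
  rw [neg_div, Real.rpow_neg ha, inv_pow, sq_rpow_half ha]

/-- The inequality `(P + τ²)⁻¹ ≤ (c|∇|² + τ²)⁻¹` is integrated over `τ`. One side gives `π
P^{-1/2}`, the other `π/(√c · 2π|ξ|)` on the Fourier side. -/
theorem enorm_fc_chi_div_sq_le_hsSq (hT : IsFriedrichsInverse V T) (hn : n ≠ 0)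
    (hc : 0 < c) (hq : ∀ ψ : testSpace n, c * ∫ x, gradSq ψ.1 x ≤ formQ V ψ.1) (m : ℕ) (g : L2 n) :
    ‖fc T (fun s => ((chi m s * (1 / √√(pm m s)) : ℝ) : ℂ)) g‖ₑ ^ 2 ≤
      ENNReal.ofReal (√c)⁻¹ * hsSq (-1 / 2) g := by
  have hsc : 0 < √c := Real.sqrt_pos.2 hc
  refine (enorm_fc_chi_div_sq_le hT.pos m g).trans ?_
  have h1 : ∫⁻ τ, ‖fc T (fun s => ((√(resM τ s) : ℝ) : ℂ)) g‖ₑ ^ 2 ≤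
      ∫⁻ τ, ∫⁻ ξ : E n, ENNReal.ofReal (symD c τ ξ)⁻¹ * ‖(𝓕 g : L2 n) ξ‖ₑ ^ 2 := by
    refine lintegral_mono_ae ?_
    filter_upwards [ae_ne_zero_real] with τ hτ
    rw [← enorm_sq_symR hc hτ, ← ofReal_norm, ← ofReal_norm, ← ENNReal.ofReal_pow (norm_nonneg _),
      ← ENNReal.ofReal_pow (norm_nonneg _)]
    exact ENNReal.ofReal_le_ofReal (resM_le_norm_sq_symR hT hc hq hτ g)
  refine (mul_le_mul_right h1 _).trans ?_
  rw [lintegral_lintegral_swap ((((measurable_symD c).inv.ennreal_ofReal).aemeasurable).mul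
    ((Lp.aestronglyMeasurable (𝓕 g : L2 n)).enorm.pow_const 2).comp_snd), hsSq,
    ← lintegral_const_mul' _ _ ENNReal.ofReal_ne_top, ← lintegral_const_mul' _ _ ENNReal.ofReal_ne_top]
  refine lintegral_mono_ae ?_
  filter_upwards [volume_singleton_zero_compl hn] with ξ hξ
  have hr : 0 < 2 * Real.pi * ‖ξ‖ := by have := norm_pos_iff.2 hξ; positivity
  have hp : 0 < √c * (2 * Real.pi * ‖ξ‖) := by positivity
  have e : ∀ τ : ℝ, ENNReal.ofReal (symD c τ ξ)⁻¹ =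
      ENNReal.ofReal ((√c * (2 * Real.pi * ‖ξ‖)) ^ 2 + τ ^ 2)⁻¹ := fun τ => by
    rw [symD, mul_pow (√c), Real.sq_sqrt hc.le]
  rw [lintegral_mul_const' _ _ (by finiteness), mul_pow (ENNReal.ofReal _), ← ENNReal.ofReal_pow (Real.rpow_nonneg hr.le _),
    sq_rpow_neg_half hr.le, ← mul_assoc, ← mul_assoc, ← ENNReal.ofReal_mul (by positivity)]
  simp only [e]
  rw [lintegral_inv_sq_add_sq hp, ← ENNReal.ofReal_mul (by positivity)]
  refine mul_le_mul_left (ENNReal.ofReal_le_ofReal (le_of_eq ?_)) _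
  have := Real.pi_pos
  field_simp

/-- Writing `p/(p + τ²) = 1 - τ²/(p + τ²)` reverses the comparison of resolvents, so that an upper
bound of the form bounds `P^{1/2}` from above. -/
theorem enorm_fc_chi_mul_sq_le_hsSq (hT : IsFriedrichsInverse V T) (hn : 3 ≤ n)
    (hV : ContinuousOn V {0}ᶜ)
    (hc : 0 < c) (hq : ∀ ψ : testSpace n, formQ V ψ.1 ≤ c * ∫ x, gradSq ψ.1 x) (m : ℕ) (f : L2 n) :
    ‖fc T (fun s => ((chi m s * √√(pm m s) : ℝ) : ℂ)) f‖ₑ ^ 2 ≤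
      ENNReal.ofReal (√c) * hsSq (1 / 2) f := by
  have hn0 : n ≠ 0 := by omega
  have hsc : 0 < √c := Real.sqrt_pos.2 hc
  refine (enorm_fc_chi_mul_sq_le hT.pos m f).trans ?_
  set F : L2 n := 𝓕 f with hF
  have h1 : ∫⁻ τ, ‖fc T (fun s => ((√(resL τ s) : ℝ) : ℂ)) f‖ₑ ^ 2 ≤
      ∫⁻ τ, ∫⁻ ξ : E n, ENNReal.ofReal (c * (2 * Real.pi * ‖ξ‖) ^ 2) *
        (ENNReal.ofReal (symD c τ ξ)⁻¹ * ‖F ξ‖ₑ ^ 2) := by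
    refine lintegral_mono_ae ?_
    filter_upwards [ae_ne_zero_real] with τ hτ
    have e1 := norm_sq_resL_add hT.pos hτ f
    have e2 := norm_sq_symR_le_resM hT hn hV hc hq hτ f
    have e3 : ‖fc T (fun s => ((√(resL τ s) : ℝ) : ℂ)) f‖ ^ 2 ≤
        ‖F‖ ^ 2 - τ ^ 2 * ‖mulL2 (symR c τ) F‖ ^ 2 := by
      rw [hF, Lp.norm_fourier_eq]
      nlinarith [mul_le_mul_of_nonneg_left e2 (sq_nonneg τ)]
    have hi : Integrable fun ξ => ‖F ξ‖ ^ 2 := (Lp.memLp F).integrable_norm_pow (by norm_num)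
    have hi2 : Integrable fun ξ => τ ^ 2 * ‖mulL2 (symR c τ) F ξ‖ ^ 2 :=
      ((Lp.memLp (mulL2 (symR c τ) F)).integrable_norm_pow (by norm_num)).const_mul _
    have e4 : (fun ξ => ‖F ξ‖ ^ 2 - τ ^ 2 * ‖mulL2 (symR c τ) F ξ‖ ^ 2) =ᵐ[volume]
        fun ξ => c * (2 * Real.pi * ‖ξ‖) ^ 2 * ((symD c τ ξ)⁻¹ * ‖F ξ‖ ^ 2) := by
      filter_upwards [mulL2_ae (isMult_symR hc hτ) F] with ξ e
      have hD := symD_pos hc hτ ξ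
      rw [e, norm_mul, mul_pow, symR, Complex.norm_real,
        Real.norm_of_nonneg (inv_nonneg.2 (Real.sqrt_nonneg _)), inv_pow, Real.sq_sqrt hD.le]
      have : c * (2 * Real.pi * ‖ξ‖) ^ 2 = symD c τ ξ - τ ^ 2 := by unfold symD; ring
      rw [this]
      field_simp
    rw [norm_sq_eq_integral F, norm_sq_eq_integral (mulL2 (symR c τ) F), ← integral_const_mul,
      ← integral_sub hi hi2, integral_congr_ae e4] at e3
    rw [← ofReal_norm, ← ENNReal.ofReal_pow (norm_nonneg _)]
    refine (ENNReal.ofReal_le_ofReal e3).trans ?_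
    rw [ofReal_integral_eq_lintegral_ofReal ((hi.sub hi2).congr e4) (ae_of_all _ fun ξ => by
      have := symD_pos hc hτ ξ
      positivity)]
    refine le_of_eq (lintegral_congr fun ξ => ?_)
    have hD := symD_pos hc hτ ξ
    rw [ENNReal.ofReal_mul (p := c * (2 * Real.pi * ‖ξ‖) ^ 2) (by positivity),
      ENNReal.ofReal_mul (p := (symD c τ ξ)⁻¹) (by positivity), ENNReal.ofReal_pow (norm_nonneg _), ofReal_norm]
  refine (mul_le_mul_right h1 _).trans ?_
  have hw : Measurable fun z : ℝ × E n => ENNReal.ofReal (c * (2 * Real.pi * ‖z.2‖) ^ 2) := by fun_prop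
  rw [lintegral_lintegral_swap (hw.aemeasurable.mul
    ((((measurable_symD c).inv.ennreal_ofReal).aemeasurable).mul
    ((Lp.aestronglyMeasurable F).enorm.pow_const 2).comp_snd)), hsSq,
    ← lintegral_const_mul' _ _ ENNReal.ofReal_ne_top, ← lintegral_const_mul' _ _ ENNReal.ofReal_ne_top]
  refine lintegral_mono_ae ?_
  filter_upwards [volume_singleton_zero_compl hn0] with ξ hξ
  have hr : 0 < 2 * Real.pi * ‖ξ‖ := by have := norm_pos_iff.2 hξ; positivity
  have hp : 0 < √c * (2 * Real.pi * ‖ξ‖) := by positivity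
  have e : ∀ τ : ℝ, ENNReal.ofReal (symD c τ ξ)⁻¹ =
      ENNReal.ofReal ((√c * (2 * Real.pi * ‖ξ‖)) ^ 2 + τ ^ 2)⁻¹ := fun τ => by
    rw [symD, mul_pow (√c), Real.sq_sqrt hc.le]
  rw [lintegral_const_mul' _ _ ENNReal.ofReal_ne_top,
    lintegral_mul_const' _ _ (by finiteness), mul_pow (ENNReal.ofReal _), ← ENNReal.ofReal_pow (Real.rpow_nonneg hr.le _),
    sq_rpow_half hr.le, ← mul_assoc, ← mul_assoc, ← mul_assoc, ← ENNReal.ofReal_mul (by positivity),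
    ← ENNReal.ofReal_mul (by positivity)]
  simp only [e]
  rw [lintegral_inv_sq_add_sq hp, ← ENNReal.ofReal_mul (by positivity)]
  refine mul_le_mul_left (ENNReal.ofReal_le_ofReal (le_of_eq ?_)) _
  have := Real.pi_pos
  nth_rw 1 [← Real.mul_self_sqrt hc.le]
  field_simp

end FormComparison

end CriticalDecay
namespace CriticalDecay

/-! ### Homogeneous Sobolev norms of tempered distributions. -/

section SobolevNorm

variable {n : ℕ} {s : ℝ}

lemma continuousOn_weight (s : ℝ) :
    ContinuousOn (fun ξ : E n => (((2 * Real.pi * ‖ξ‖) ^ s : ℝ) : ℂ)) {0}ᶜ := by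
  refine Complex.continuous_ofReal.comp_continuousOn fun ξ hξ => ?_
  have : 2 * Real.pi * ‖ξ‖ ≠ 0 := mul_ne_zero (by positivity) (norm_ne_zero_iff.2 hξ)
  have hc : ContinuousAt (fun ξ : E n => 2 * Real.pi * ‖ξ‖) ξ := by fun_prop
  exact (hc.rpow_const (Or.inl this)).continuousWithinAt

lemma norm_weight (s : ℝ) (ξ : E n) :
    ‖(((2 * Real.pi * ‖ξ‖) ^ s : ℝ) : ℂ)‖ = (2 * Real.pi * ‖ξ‖) ^ s := by
  rw [Complex.norm_real, Real.norm_of_nonneg (Real.rpow_nonneg (by positivity) _)]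

/-- The Fourier transform of `f`, when `f` belongs to the homogeneous Sobolev space. -/
lemma fourier_ae_eq_of_hs (hn : n ≠ 0) {f F : L2 n}
    (h : ∀ φ : 𝓢(E n, ℂ), (𝓕 (f : 𝓢'(E n, ℂ))) φ =
      ∫ ξ : E n, φ ξ * ((((2 * Real.pi * ‖ξ‖) ^ (-s) : ℝ) : ℂ) * F ξ)) :
    (𝓕 f : L2 n) =ᵐ[volume] fun ξ => (((2 * Real.pi * ‖ξ‖) ^ (-s) : ℝ) : ℂ) * F ξ := by
  have hloc : ∀ G : L2 n, LocallyIntegrableOn (G : E n → ℂ) {0}ᶜ := fun G x _ =>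
    ((Lp.memLp G).locallyIntegrable (by norm_num) x).filter_mono nhdsWithin_le_nhds
  have hw : LocallyIntegrableOn (fun ξ : E n => (((2 * Real.pi * ‖ξ‖) ^ (-s) : ℝ) : ℂ) * F ξ) {0}ᶜ :=
    (hloc F).continuousOn_mul (continuousOn_weight (-s)) isOpen_compl_singleton.isLocallyClosed
  -- Test functions supported away from `0` avoid the possible singularity of the weight, and the
  -- origin is a null set.
  have h1 := isOpen_compl_singleton.ae_eq_zero_of_integral_contDiff_smul_eq_zero
    (U := ({0}ᶜ : Set (E n))) ((hloc (𝓕 f : L2 n)).sub hw) fun g hg hgc hgs => ?_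
  · filter_upwards [h1, volume_singleton_zero_compl hn] with ξ a b
    have := a b
    rwa [Pi.sub_apply, sub_eq_zero] at this
  · have hg' : ContDiff ℝ ∞ fun ξ => (g ξ : ℂ) := Complex.ofRealCLM.contDiff.comp hg
    have hgc' : HasCompactSupport fun ξ => (g ξ : ℂ) := hgc.comp_left Complex.ofReal_zero
    have h0 : (0 : E n) ∉ tsupport g := fun h => hgs h rfl
    have hz : ∀ x ∉ tsupport g, g x = 0 := fun x hx => image_eq_zero_of_notMem_tsupport hx
    have h2 := h (hgc'.toSchwartzMap hg')
    rw [Lp.fourier_toTemperedDistribution_eq, Lp.toTemperedDistribution_apply] at h2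
    have m1 : MemLp (fun ξ => (g ξ : ℂ)) 2 :=
      memLp_of_continuousOn_compl hgc h0 hg'.continuous.continuousOn fun x hx => by simp [hz x hx]
    have m2 : MemLp (fun ξ => (g ξ : ℂ) * (((2 * Real.pi * ‖ξ‖) ^ (-s) : ℝ) : ℂ)) 2 :=
      memLp_of_continuousOn_compl hgc h0 (hg'.continuous.continuousOn.mul (continuousOn_weight (-s)))
        fun x hx => by simp [hz x hx]
    have i1 : Integrable fun ξ => (g ξ : ℂ) * (𝓕 f : L2 n) ξ := m1.integrable_mul (Lp.memLp _)
    have i2 : Integrable fun ξ => (g ξ : ℂ) * (((2 * Real.pi * ‖ξ‖) ^ (-s) : ℝ) : ℂ) * F ξ :=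
      m2.integrable_mul (Lp.memLp _)
    have e : ∀ ξ, g ξ • ((𝓕 f : L2 n) - fun ξ => (((2 * Real.pi * ‖ξ‖) ^ (-s) : ℝ) : ℂ) * F ξ : E n → ℂ) ξ =
        (g ξ : ℂ) * (𝓕 f : L2 n) ξ - (g ξ : ℂ) * (((2 * Real.pi * ‖ξ‖) ^ (-s) : ℝ) : ℂ) * F ξ := fun ξ => by
      rw [Pi.sub_apply, Complex.real_smul]; ring
    simp only [e]
    rw [integral_sub i1 i2, sub_eq_zero]
    refine Eq.trans h2 (integral_congr_ae (ae_of_all _ fun ξ => ?_))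
    exact (mul_assoc (g ξ : ℂ) _ _).symm

/-- The norm of `hsNorm` is the one computed from the Fourier transform. -/
lemma hsSq_le_hsNorm_sq (hn : n ≠ 0) (f : L2 n) : hsSq s f ≤ hsNorm s (f : 𝓢'(E n, ℂ)) ^ 2 := by
  have h : hsSq s f ^ (1 / 2 : ℝ) ≤ hsNorm s (f : 𝓢'(E n, ℂ)) := by
    refine le_iInf₂ fun F hF => ?_
    have e : hsSq s f = ‖F‖ₑ ^ 2 := by
      rw [enorm_sq_eq_lintegral, hsSq]
      refine lintegral_congr_ae ?_
      filter_upwards [fourier_ae_eq_of_hs hn hF, volume_singleton_zero_compl hn] with ξ h1 hξ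
      have hr : 0 < 2 * Real.pi * ‖ξ‖ := by have := norm_pos_iff.2 hξ; positivity
      rw [h1, enorm_mul, ← mul_assoc, ← ofReal_norm (((2 * Real.pi * ‖ξ‖) ^ (-s) : ℝ) : ℂ), norm_weight,
        ← ENNReal.ofReal_mul (Real.rpow_nonneg hr.le _), ← Real.rpow_add hr, add_neg_cancel,
        Real.rpow_zero, ENNReal.ofReal_one, one_mul]
    rw [e, ← ENNReal.rpow_two, ← ENNReal.rpow_mul]
    norm_num
  calc hsSq s f = (hsSq s f ^ (1 / 2 : ℝ)) ^ 2 := by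
        rw [← ENNReal.rpow_two, ← ENNReal.rpow_mul]; norm_num
    _ ≤ _ := by gcongr

/-- Schwartz functions are square integrable against the weights `|ξ|^{∓1}`. -/
lemma memLp_weight_mul (hn : 3 ≤ n) (hs : s = 1 / 2 ∨ s = -1 / 2) (φ : 𝓢(E n, ℂ)) :
    MemLp (fun ξ => (((2 * Real.pi * ‖ξ‖) ^ (-s) : ℝ) : ℂ) * φ ξ) 2 := by
  have hn0 : n ≠ 0 := by omega
  have hm : AEStronglyMeasurable (fun ξ => (((2 * Real.pi * ‖ξ‖) ^ (-s) : ℝ) : ℂ) * φ ξ) :=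
    ((Complex.measurable_ofReal.comp ((measurable_norm.const_mul _).pow_const _)).mul
      φ.continuous.measurable).aestronglyMeasurable
  rw [memLp_two_iff_integrable_sq_norm hm]
  have h1 := integrable_fourier_weight (𝓕⁻ φ)
  rw [FourierTransform.fourier_fourierInv_eq] at h1
  have h2 := (schwartz_integrable_norm_sq_div hn φ).const_mul ((2 * Real.pi) ^ 2)⁻¹
  refine (h1.add h2).mono' (hm.norm.pow 2) ?_
  filter_upwards [volume_singleton_zero_compl hn0] with ξ hξ
  have hr : 0 < 2 * Real.pi * ‖ξ‖ := by have := norm_pos_iff.2 hξ; positivity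
  rw [norm_pow, norm_norm, norm_mul, norm_weight, mul_pow, Pi.add_apply]
  set r := 2 * Real.pi * ‖ξ‖ with hrd
  have e2 : ((2 * Real.pi) ^ 2)⁻¹ * (‖φ ξ‖ ^ 2 / ‖ξ‖ ^ 2) = (r⁻¹) ^ 2 * ‖φ ξ‖ ^ 2 := by
    rw [hrd]; have := norm_pos_iff.2 hξ; have := Real.pi_pos; field_simp
  rw [e2, ← add_mul]
  refine mul_le_mul_of_nonneg_right ?_ (sq_nonneg _)
  have hri : 0 < r⁻¹ := inv_pos.2 hr
  have hrr : r * r⁻¹ = 1 := mul_inv_cancel₀ hr.ne'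
  -- Both `r` and `r⁻¹` are at most `r² + r⁻²`.
  rcases hs with rfl | rfl
  · rw [← neg_div, sq_rpow_neg_half hr.le]
    nlinarith [sq_nonneg (r - 1), sq_nonneg (r⁻¹ - 1), sq_nonneg (r⁻¹ - r)]
  · rw [neg_div, neg_neg, sq_rpow_half hr.le]
    nlinarith [sq_nonneg (r - 1), sq_nonneg (r⁻¹ - 1), sq_nonneg (r⁻¹ - r)]

lemma integrable_weight_mul (hn : 3 ≤ n) (hs : s = 1 / 2 ∨ s = -1 / 2) (φ : 𝓢(E n, ℂ)) (F : L2 n) :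
    Integrable fun ξ => φ ξ * ((((2 * Real.pi * ‖ξ‖) ^ (-s) : ℝ) : ℂ) * F ξ) := by
  refine ((memLp_weight_mul hn hs φ).integrable_mul (Lp.memLp F)).congr (ae_of_all _ fun ξ => ?_)
  rw [Pi.mul_apply]; ring

/-- The functions representing `S - R` and `R` add up to one for `S`. Integrability is needed for
this, since the integral of a sum would not split otherwise. -/
lemma hsNorm_le_add (hn : 3 ≤ n) (hs : s = 1 / 2 ∨ s = -1 / 2) (S R : 𝓢'(E n, ℂ)) :
    hsNorm s S ≤ hsNorm s (S - R) + hsNorm s R := by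
  unfold hsNorm
  refine ENNReal.le_iInf₂_add_iInf₂ fun F hF G hG => ?_
  refine (iInf₂_le (F + G) fun φ => ?_).trans (enorm_add_le F G)
  have h1 : (𝓕 S) φ = (𝓕 (S - R)) φ + (𝓕 R) φ := by
    simp only [TemperedDistribution.fourier_apply]
    change S (𝓕 φ) = (S (𝓕 φ) - R (𝓕 φ)) + R (𝓕 φ)
    ring
  rw [h1, hF, hG, ← integral_add (integrable_weight_mul hn hs φ F) (integrable_weight_mul hn hs φ G)]
  refine integral_congr_ae ?_
  filter_upwards [Lp.coeFn_add F G] with ξ e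
  rw [e, Pi.add_apply]; ring

lemma exists_enorm_apply_le_hsNorm (hn : 3 ≤ n) (hs : s = 1 / 2 ∨ s = -1 / 2) (φ : 𝓢(E n, ℂ)) :
    ∃ C : ℝ≥0∞, C ≠ ⊤ ∧ ∀ S : 𝓢'(E n, ℂ), ‖S φ‖ₑ ≤ C * hsNorm s S := by
  set W : L2 n := (memLp_weight_mul hn hs (𝓕⁻ φ)).toLp with hW
  have hC : ‖W‖ₑ + 1 ≠ ⊤ := by finiteness
  -- The summand `1` makes the constant nonzero, so that it can be moved across an infimum that may
  -- equal `⊤`.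
  have hC0 : ‖W‖ₑ + 1 ≠ 0 := by simp
  refine ⟨‖W‖ₑ + 1, hC, fun S => ?_⟩
  unfold hsNorm
  rw [ENNReal.mul_iInf_of_ne hC0 hC]
  refine le_iInf fun F => ?_
  rw [ENNReal.mul_iInf_of_ne hC0 hC]
  refine le_iInf fun hF => ?_
  have h1 : S φ = (𝓕 S) (𝓕⁻ φ) := by
    rw [TemperedDistribution.fourier_apply, FourierTransform.fourier_fourierInv_eq]
  have h2 : ‖S φ‖ ≤ ∫ ξ, ‖W ξ‖ * ‖F ξ‖ := by
    rw [h1, hF]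
    refine (norm_integral_le_integral_norm _).trans (le_of_eq (integral_congr_ae ?_))
    filter_upwards [(memLp_weight_mul hn hs (𝓕⁻ φ)).coeFn_toLp] with ξ e
    rw [hW, e, ← norm_mul]
    congr 1; ring
  have h3 : ∫ ξ, ‖W ξ‖ * ‖F ξ‖ ≤ ‖W‖ * ‖F‖ := by
    have := integral_mul_le_Lp_mul_Lq_of_nonneg (p := 2) (q := 2) (μ := volume) (by norm_num [Real.holderConjugate_iff])
      (f := fun ξ => ‖W ξ‖) (g := fun ξ => ‖F ξ‖) (ae_of_all _ fun _ => norm_nonneg _)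
      (ae_of_all _ fun _ => norm_nonneg _) (by simpa using (Lp.memLp W).norm) (by simpa using (Lp.memLp F).norm)
    simp only [Real.rpow_two, ← norm_sq_eq_integral] at this
    rwa [← Real.sqrt_eq_rpow, ← Real.sqrt_eq_rpow, Real.sqrt_sq (norm_nonneg _),
      Real.sqrt_sq (norm_nonneg _)] at this
  calc ‖S φ‖ₑ = ENNReal.ofReal ‖S φ‖ := (ofReal_norm _).symm
    _ ≤ ENNReal.ofReal (‖W‖ * ‖F‖) := ENNReal.ofReal_le_ofReal (h2.trans h3)
    _ = ‖W‖ₑ * ‖F‖ₑ := by rw [ENNReal.ofReal_mul (norm_nonneg _), ofReal_norm, ofReal_norm]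
    _ ≤ (‖W‖ₑ + 1) * ‖F‖ₑ := mul_le_mul_left le_self_add _

lemma tendsto_apply_of_hsNorm (hn : 3 ≤ n) (hs : s = 1 / 2 ∨ s = -1 / 2) {S : ℕ → 𝓢'(E n, ℂ)} {R : 𝓢'(E n, ℂ)}
    (h : Tendsto (fun k => hsNorm s (S k - R)) atTop (𝓝 0)) (φ : 𝓢(E n, ℂ)) :
    Tendsto (fun k => S k φ) atTop (𝓝 (R φ)) := by
  obtain ⟨C, hC, hle⟩ := exists_enorm_apply_le_hsNorm hn hs φ
  rw [tendsto_iff_edist_tendsto_0]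
  have h1 := ENNReal.Tendsto.const_mul h (Or.inr hC)
  rw [mul_zero] at h1
  refine tendsto_of_tendsto_of_tendsto_of_le_of_le tendsto_const_nhds h1 (fun _ => zero_le) fun k => ?_
  change edist (S k φ) (R φ) ≤ _
  rw [edist_eq_enorm_sub]
  exact hle (S k - R)

end SobolevNorm

end CriticalDecay
namespace CriticalDecay

/-! ### Weak lower semicontinuity of the weighted norm. -/

section WeakLimits

variable {n : ℕ}

lemma denseRange_testIncl (hn : n ≠ 0) : DenseRange (testIncl n) := by
  have h : (LinearMap.range (testIncl n)).topologicalClosure = ⊤ := by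
    rw [Submodule.topologicalClosure_eq_top_iff, Submodule.eq_bot_iff]
    intro f hf
    refine eq_zero_of_inner_test_eq_zero hn fun φ => ?_
    exact (Submodule.mem_orthogonal _ _).1 hf _ ⟨φ, rfl⟩
  intro f
  have : f ∈ (LinearMap.range (testIncl n)).topologicalClosure := by rw [h]; trivial
  exact this

lemma IsTest.div_norm {φ : E n → ℂ} (hφ : IsTest φ) : IsTest fun x => ((‖x‖⁻¹ : ℝ) : ℂ) * φ x := by
  refine isTest_of hφ.compact hφ.2.2 ?_ fun x hx => by rw [hφ.zero_off x hx, mul_zero]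
  refine ContDiffOn.mul (Complex.ofRealCLM.contDiff.comp_contDiffOn ?_) hφ.1.contDiffOn
  have h1 : ContDiffOn ℝ ∞ (fun x : E n => ‖x‖) {0}ᶜ := fun x hx => (contDiffAt_norm ℝ hx).contDiffWithinAt
  exact h1.inv fun x hx => norm_ne_zero_iff.2 hx

/-- A function that is bounded as a functional on the test functions is square integrable. -/
lemma weightSq_le_of_forall (hn : n ≠ 0) {v : E n → ℂ} (hv : LocallyIntegrableOn v {0}ᶜ)
    {K : ℝ} (hK : 0 ≤ K) (h : ∀ χ : testSpace n,
      ‖∫ x, ((‖x‖⁻¹ : ℝ) : ℂ) * χ.1 x * v x‖ ≤ K * ‖testIncl n χ‖) :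
    weightSq v ≤ ENNReal.ofReal K ^ 2 := by
  have hint : ∀ {φ : E n → ℂ}, IsTest φ → Integrable fun x => φ x * v x := fun {φ} hφ => by
    have h1 : IntegrableOn v (tsupport φ) :=
      hv.integrableOn_compact_subset (fun x hx h0 => hφ.2.2 (by rwa [← mem_singleton_iff.1 h0])) hφ.compact
    have h2 := h1.continuousOn_mul hφ.1.continuous.continuousOn hφ.compact
    refine (integrableOn_iff_integrable_of_support_subset fun x hx => ?_).1 h2
    by_contra hn
    exact hx (by simp [hφ.zero_off x hn])
  have hT : ∀ χ : testSpace n, Integrable fun x => ((‖x‖⁻¹ : ℝ) : ℂ) * χ.1 x * v x := fun χ => by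
    exact hint (IsTest.div_norm χ.2)
  let l : testSpace n →ₗ[ℂ] ℂ :=
    { toFun := fun χ => ∫ x, ((‖x‖⁻¹ : ℝ) : ℂ) * χ.1 x * v x
      map_add' := fun χ ψ => by
        rw [← integral_add (hT χ) (hT ψ)]
        refine integral_congr_ae (ae_of_all _ fun x => ?_)
        change ((‖x‖⁻¹ : ℝ) : ℂ) * (χ.1 x + ψ.1 x) * v x = _
        ring
      map_smul' := fun c χ => by
        rw [RingHom.id_apply, smul_eq_mul, ← integral_const_mul]
        refine integral_congr_ae (ae_of_all _ fun x => ?_)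
        change ((‖x‖⁻¹ : ℝ) : ℂ) * (c * χ.1 x) * v x = _
        ring }
  have hl : ∀ χ, ‖l χ‖ ≤ K * ‖testIncl n χ‖ := h
  have hd := denseRange_testIncl hn
  -- Riesz representation: the functional `χ ↦ ∫ |x|⁻¹χ v` extends to `L²`, so `|x|⁻¹v` agrees
  -- almost everywhere with the conjugate of some `F` with `‖F‖ ≤ K`.
  set L : L2 n →L[ℂ] ℂ := l.extendOfNorm (testIncl n) with hL
  have hLχ : ∀ χ, L (testIncl n χ) = l χ := LinearMap.extendOfNorm_eq hd ⟨K, hl⟩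
  have hLn : ‖L‖ ≤ K := ContinuousLinearMap.opNorm_le_bound _ hK
    fun f => LinearMap.norm_extendOfNorm_apply_le hd K hl f
  set F : L2 n := (InnerProductSpace.toDual ℂ (L2 n)).symm L with hF
  have hFn : ‖F‖ ≤ K := by rw [hF, LinearIsometryEquiv.norm_map]; exact hLn
  have hFχ : ∀ χ : testSpace n, ∫ x, (starRingEnd ℂ) (F x) * χ.1 x =
      ∫ x, ((‖x‖⁻¹ : ℝ) : ℂ) * χ.1 x * v x := fun χ => by
    have h1 : ⟪F, testIncl n χ⟫_ℂ = l χ := by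
      rw [hF, InnerProductSpace.toDual_symm_apply, hLχ]
    have h2 : ⟪F, testIncl n χ⟫_ℂ = ∫ x, (starRingEnd ℂ) (F x) * χ.1 x := by
      rw [L2.inner_def]
      refine integral_congr_ae ?_
      filter_upwards [(IsTest.memLp χ.2).coeFn_toLp] with x e
      have e' : (testIncl n χ : E n → ℂ) x = χ.1 x := e
      rw [e', RCLike.inner_apply, mul_comm]
    rw [← h2, h1]
    rfl
  have hconj : MemLp (fun x => (starRingEnd ℂ) (F x)) 2 := (Lp.memLp F).star
  have hFl : LocallyIntegrableOn (fun x => (starRingEnd ℂ) (F x)) {0}ᶜ := fun x _ =>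
    (hconj.locallyIntegrable (by norm_num) x).filter_mono nhdsWithin_le_nhds
  have hwc : ContinuousOn (fun x : E n => ((‖x‖⁻¹ : ℝ) : ℂ)) {0}ᶜ :=
    Complex.continuous_ofReal.comp_continuousOn
      (continuous_norm.continuousOn.inv₀ fun x hx => norm_ne_zero_iff.2 hx)
  have hvl : LocallyIntegrableOn (fun x => ((‖x‖⁻¹ : ℝ) : ℂ) * v x) {0}ᶜ :=
    hv.continuousOn_mul hwc isOpen_compl_singleton.isLocallyClosed
  have key := isOpen_compl_singleton.ae_eq_zero_of_integral_contDiff_smul_eq_zero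
    (U := ({0}ᶜ : Set (E n))) (hFl.sub hvl) fun g hg hgc hgs => ?_
  · have e : ∀ᵐ x, (‖v x‖ₑ / ‖x‖ₑ) ^ 2 = ‖F x‖ₑ ^ 2 := by
      filter_upwards [key, volume_singleton_zero_compl hn] with x a b
      have h1 := a b
      rw [Pi.sub_apply, sub_eq_zero] at h1
      rw [← RCLike.enorm_conj (F x), h1, enorm_mul, ← ofReal_norm ((‖x‖⁻¹ : ℝ) : ℂ), Complex.norm_real, norm_inv, norm_norm,
        ENNReal.ofReal_inv_of_pos (norm_pos_iff.2 b), ofReal_norm, div_eq_mul_inv, mul_comm]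
    rw [weightSq, lintegral_congr_ae e, ← enorm_sq_eq_lintegral, ← ofReal_norm]
    gcongr
  · have ht : IsTest fun x => (g x : ℂ) := by
      refine isTest_of hgc (fun h => hgs h rfl) (Complex.ofRealCLM.contDiff.comp hg).contDiffOn ?_
      intro x hx
      simp [image_eq_zero_of_notMem_tsupport hx]
    have i1 : Integrable fun x => (starRingEnd ℂ) (F x) * (g x : ℂ) := hconj.integrable_mul ht.memLp
    have i2 := hT ⟨_, ht⟩
    have e : ∀ x, g x • ((fun x => (starRingEnd ℂ) (F x)) - fun x => ((‖x‖⁻¹ : ℝ) : ℂ) * v x : E n → ℂ) x =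
        (starRingEnd ℂ) (F x) * (g x : ℂ) - ((‖x‖⁻¹ : ℝ) : ℂ) * (g x : ℂ) * v x := fun x => by
      rw [Pi.sub_apply, Complex.real_smul]; ring
    simp only [e]
    rw [integral_sub i1 i2, sub_eq_zero]
    exact hFχ ⟨_, ht⟩

lemma enorm_integral_le_weightSq (hn : n ≠ 0) (w : L2 n) (χ : testSpace n) :
    ‖∫ x, ((‖x‖⁻¹ : ℝ) : ℂ) * χ.1 x * w x‖ₑ ≤ weightSq w ^ (1 / 2 : ℝ) * ‖testIncl n χ‖ₑ := by
  refine (enorm_integral_le_lintegral_enorm _).trans ?_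
  have h1 : ∫⁻ x, ‖((‖x‖⁻¹ : ℝ) : ℂ) * χ.1 x * w x‖ₑ = ∫⁻ x, (‖w x‖ₑ / ‖x‖ₑ) * ‖testIncl n χ x‖ₑ := by
    refine lintegral_congr_ae ?_
    filter_upwards [(IsTest.memLp χ.2).coeFn_toLp, volume_singleton_zero_compl hn] with x e b
    have e' : (testIncl n χ : E n → ℂ) x = χ.1 x := e
    rw [e', enorm_mul, enorm_mul, ← ofReal_norm ((‖x‖⁻¹ : ℝ) : ℂ), Complex.norm_real, norm_inv, norm_norm,
      ENNReal.ofReal_inv_of_pos (norm_pos_iff.2 b), ofReal_norm, div_eq_mul_inv]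
    ring
  have h2 := ENNReal.lintegral_mul_le_Lp_mul_Lq (volume : Measure (E n)) (p := 2) (q := 2)
    (by norm_num [Real.holderConjugate_iff]) (f := fun x => ‖w x‖ₑ / ‖x‖ₑ) (g := fun x => ‖testIncl n χ x‖ₑ)
    ((Lp.aestronglyMeasurable w).enorm.div measurable_enorm.aemeasurable)
    (Lp.aestronglyMeasurable (testIncl n χ)).enorm
  rw [h1]
  refine h2.trans (le_of_eq ?_)
  simp only [ENNReal.rpow_two]
  rw [← enorm_sq_eq_lintegral, weightSq]
  congr 1
  rw [← ENNReal.rpow_two, ← ENNReal.rpow_mul]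
  norm_num

/-- Weak lower semicontinuity of the weighted norm. -/
lemma weightSq_le_liminf_of_weak (hn : n ≠ 0) {v : E n → ℂ} (hv : LocallyIntegrableOn v {0}ᶜ)
    {w : ℕ → L2 n} (h : ∀ ψ : E n → ℂ, IsTest ψ →
      Tendsto (fun k => ∫ x, ψ x * w k x) atTop (𝓝 (∫ x, ψ x * v x))) :
    weightSq v ≤ liminf (fun k => weightSq (w k)) atTop := by
  set K := liminf (fun k => weightSq (w k)) atTop with hK
  by_cases hKt : K = ⊤
  · rw [hKt]; exact le_top
  have hKr : K ^ (1 / 2 : ℝ) ≠ ⊤ := ENNReal.rpow_ne_top_of_nonneg (by norm_num) hKt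
  have key : ∀ χ : testSpace n, ‖∫ x, ((‖x‖⁻¹ : ℝ) : ℂ) * χ.1 x * v x‖ ≤
      (K ^ (1 / 2 : ℝ)).toReal * ‖testIncl n χ‖ := fun χ => by
    have h1 := h _ (IsTest.div_norm χ.2)
    have h2 : ‖∫ x, ((‖x‖⁻¹ : ℝ) : ℂ) * χ.1 x * v x‖ₑ ≤ K ^ (1 / 2 : ℝ) * ‖testIncl n χ‖ₑ := by
      rw [← h1.enorm.liminf_eq]
      refine (liminf_le_liminf (Eventually.of_forall fun k => enorm_integral_le_weightSq hn (w k) χ)).trans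
        (le_of_eq ?_)
      -- A continuous monotone function commutes with `liminf`.
      have hmono : Monotone fun y : ℝ≥0∞ => y ^ (1 / 2 : ℝ) * ‖testIncl n χ‖ₑ := fun a b hab => by
        dsimp only
        gcongr
      have hcont : Continuous fun y : ℝ≥0∞ => y ^ (1 / 2 : ℝ) * ‖testIncl n χ‖ₑ :=
        (ENNReal.continuous_mul_const enorm_ne_top).comp ENNReal.continuous_rpow_const
      exact (hmono.map_liminf_of_continuousAt (fun k => weightSq (w k)) hcont.continuousAt).symm
    have h3 := ENNReal.toReal_mono (by finiteness) h2
    rwa [ENNReal.toReal_mul, toReal_enorm, toReal_enorm] at h3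
  have h4 := weightSq_le_of_forall hn hv ENNReal.toReal_nonneg key
  rwa [ENNReal.ofReal_toReal hKr, ← ENNReal.rpow_two, ← ENNReal.rpow_mul,
    show (1 / 2 : ℝ) * 2 = 1 by norm_num, ENNReal.rpow_one] at h4

/-- Each term on the right is continuous in `w`, which gives the measurability in time required for
Fatou's lemma. -/
lemma weightSq_eq_liminf (hn : n ≠ 0) (w : L2 n) :
    weightSq w = liminf (fun N : ℕ => ‖mulL2 (invN N) w‖ₑ ^ 2) atTop := by
  refine le_antisymm (weightSq_le_liminf hn w) (liminf_le_of_le (by isBoundedDefault) fun b hb => ?_)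
  obtain ⟨N, hN⟩ := hb.exists
  refine hN.trans ?_
  rw [enorm_sq_eq_lintegral]
  refine lintegral_mono_ae ?_
  filter_upwards [mulL2_ae (isMult_invN N) w, volume_singleton_zero_compl hn] with x e1 hx
  rw [e1, enorm_invN_mul N x _ hx, div_eq_mul_inv, mul_comm]
  gcongr
  exact min_le_left _ _

lemma measurable_weightSq (hn : n ≠ 0) {u : ℝ → L2 n} (hu : Continuous u) :
    Measurable fun t => weightSq (u t) := by
  simp only [weightSq_eq_liminf hn]
  exact Measurable.liminf fun N => (((mulL2 (invN N)).continuous.comp hu).enorm.measurable).pow_const 2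

end WeakLimits

end CriticalDecay
namespace CriticalDecay

/-! ### The wave estimate. -/

section Wave

variable {n : ℕ} {V : E n → ℝ} {δ : ℝ}

lemma Represents.locallyIntegrable {v : E n → ℂ} {S : 𝓢'(E n, ℂ)} (h : Represents v S) :
    LocallyIntegrable v := fun x => by
  let b : ContDiffBump x := ⟨1, 2, one_pos, one_lt_two⟩
  have hs : ContDiff ℝ ∞ fun y => ((b y : ℝ) : ℂ) := Complex.ofRealCLM.contDiff.comp b.contDiff
  have hc : HasCompactSupport fun y => ((b y : ℝ) : ℂ) := b.hasCompactSupport.comp_left Complex.ofReal_zero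
  have hi := (h (hc.toSchwartzMap hs)).1
  refine ⟨Metric.closedBall x 1, Metric.closedBall_mem_nhds x one_pos, ?_⟩
  refine hi.integrableOn.congr_fun (fun y hy => ?_) measurableSet_closedBall
  have : b y = 1 := b.one_of_mem_closedBall hy
  change ((b y : ℝ) : ℂ) * v y = v y
  rw [this, Complex.ofReal_one, one_mul]

lemma le_of_enorm_sq_le {a b d : ℝ≥0∞} {r : ℝ} (h : a ^ 2 ≤ ENNReal.ofReal r * b)
    (hb : b ≤ d ^ 2) : a ≤ ENNReal.ofReal √r * d := by
  have h1 : ENNReal.ofReal r ≤ ENNReal.ofReal √r ^ 2 := by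
    rw [← ENNReal.ofReal_pow (Real.sqrt_nonneg _)]
    refine ENNReal.ofReal_le_ofReal ?_
    rcases le_total 0 r with h | h
    · rw [Real.sq_sqrt h]
    · exact h.trans (sq_nonneg _)
  have h2 : a ^ 2 ≤ (ENNReal.ofReal √r * d) ^ 2 := by
    rw [mul_pow]
    exact h.trans (mul_le_mul' h1 hb)
  exact (ENNReal.pow_right_strictMono two_ne_zero).le_iff_le.1 h2

/-- The estimate for the wave equation with data in `L²`. -/
theorem exists_wave_bound (hn : 3 ≤ n) (hV : ContDiffOn ℝ 1 V {0}ᶜ)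
    (hA1 : CriticalBound V) (hδ : 0 < δ) (hA2 : PositiveOnSpheres V δ)
    (hA3 : PositiveOnSpheres (tildeV V) δ) :
    ∃ C : ℝ, 0 < C ∧ ∀ (f g : L2 n) (u : ℝ → L2 n), IsWaveSolutionL2 V f g u →
      ∫⁻ t, weightSq (u t) ≤ (ENNReal.ofReal C * (hsNorm (1 / 2) (f : 𝓢'(E n, ℂ)) +
        hsNorm (-1 / 2) (g : 𝓢'(E n, ℂ)))) ^ 2 := by
  have hn0 : n ≠ 0 := by omega
  have hVc := hV.continuousOn
  obtain ⟨T, hT⟩ := exists_isFriedrichsInverse hn0 hVc hA2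
  obtain ⟨M, hM0, hM⟩ := hA1.exists_bound
  have hc1 : 0 < 1 + 4 * M := by positivity
  have hk : 0 < 1 + M / δ ^ 2 := by positivity
  have hc0 : 0 < (1 + M / δ ^ 2)⁻¹ := inv_pos.2 hk
  -- The form is comparable with the Dirichlet integral: the upper bound serves the datum `f`, the
  -- lower bound the datum `g`.
  have hq1 : ∀ ψ : testSpace n, formQ V ψ.1 ≤ (1 + 4 * M) * ∫ x, gradSq ψ.1 x := fun ψ =>
    IsTest.formQ_le_grad hn ψ.2 hVc hM0 hM
  have hq0 : ∀ ψ : testSpace n, (1 + M / δ ^ 2)⁻¹ * ∫ x, gradSq ψ.1 x ≤ formQ V ψ.1 := fun ψ => by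
    rw [inv_mul_le_iff₀ hk]
    exact IsTest.grad_le_formQ hn0 ψ.2 hVc hδ hA2 hM0 hM
  set A : ℝ := √√(1 + 4 * M) with hA
  set B : ℝ := √(√(1 + M / δ ^ 2)⁻¹)⁻¹ with hB
  have hA0 : 0 < A := Real.sqrt_pos.2 (Real.sqrt_pos.2 hc1)
  have hB0 : 0 ≤ B := Real.sqrt_nonneg _
  set κ : ℝ := 64 * Real.pi * √(aprioriSq δ) with hκ
  have hκ0 : 0 < κ := by
    have := Real.sqrt_pos.2 (aprioriSq_pos hδ)
    have := Real.pi_pos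
    positivity
  refine ⟨√κ * (A + B), by have := Real.sqrt_pos.2 hκ0; positivity, fun f g u hu => ?_⟩
  have key := weightedNorm_le_of_forall hn0 hu.cont fun N =>
    lintegral_wave_le (α := ENNReal.ofReal A * hsNorm (1 / 2) (f : 𝓢'(E n, ℂ)))
      (β := ENNReal.ofReal B * hsNorm (-1 / 2) (g : 𝓢'(E n, ℂ))) hT.pos (hT.injective hn0 hVc)
      (hT.injective_one_sub hn0 hVc hδ hA2) (Real.sqrt_nonneg _)
      (hT.katoBound hn0 hV hδ hA1 hA2 hA3 N) hu.cont (fun η => hu.eqn _ _ (hT.graph hVc η))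
      (fun m => by
        rw [hu.init]
        exact le_of_enorm_sq_le (enorm_fc_chi_mul_sq_le_hsSq hT hn hVc hc1 hq1 m f)
          (hsSq_le_hsNorm_sq hn0 f))
      (fun m => le_of_enorm_sq_le (enorm_fc_chi_div_sq_le_hsSq hT hn0 hc0 hq0 m g)
          (hsSq_le_hsNorm_sq hn0 g))
  refine key.trans ?_
  rw [← hκ, ENNReal.ofReal_mul (Real.sqrt_nonneg _), mul_assoc, mul_pow (ENNReal.ofReal √κ),
    ← ENNReal.ofReal_pow (Real.sqrt_nonneg _), Real.sq_sqrt hκ0.le, mul_add]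
  gcongr
  · linarith
  · linarith

theorem exists_wave_weightedNorm_le (hn : 3 ≤ n) (hV : ContDiffOn ℝ 1 V {0}ᶜ)
    (hA1 : CriticalBound V) (hδ : 0 < δ) (hA2 : PositiveOnSpheres V δ)
    (hA3 : PositiveOnSpheres (tildeV V) δ) :
    ∃ C : ℝ, 0 < C ∧ ∀ (f g : 𝓢'(E n, ℂ)) (u : ℝ → E n → ℂ),
      hsNorm (1 / 2) f < ⊤ → hsNorm (-1 / 2) g < ⊤ → IsWaveSolution V f g u →
        weightedNorm u ≤ ENNReal.ofReal C * (hsNorm (1 / 2) f + hsNorm (-1 / 2) g) := by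
  have hn0 : n ≠ 0 := by omega
  obtain ⟨C, hC0, hC⟩ := exists_wave_bound hn hV hA1 hδ hA2 hA3
  refine ⟨C, hC0, fun f g u _ _ ⟨U, fk, gk, uk, hrep, hsol, hf, hg, hU⟩ => ?_⟩
  have h1 : ∀ t, weightSq (u t) ≤ liminf (fun k => weightSq (uk k t)) atTop := fun t => by
    refine weightSq_le_liminf_of_weak hn0 ((hrep t).locallyIntegrable.locallyIntegrableOn _) fun ψ hψ => ?_
    -- Convergence in `Ḣ^{1/2}` implies convergence of distributions, so `uk k t` tends to `u t`
    -- weakly against test functions for each `t`.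
    have h2 := tendsto_apply_of_hsNorm hn (Or.inl rfl) (hU t)
      (HasCompactSupport.toSchwartzMap (IsTest.hasCompactSupport hψ) hψ.1)
    rw [(hrep t _).2] at h2
    simp only [Lp.toTemperedDistribution_apply] at h2
    exact h2
  have h3 : ∫⁻ t, weightSq (u t) ≤
      (ENNReal.ofReal C * (hsNorm (1 / 2) f + hsNorm (-1 / 2) g)) ^ 2 := by
    refine (lintegral_mono h1).trans ((lintegral_liminf_le fun k =>
      measurable_weightSq hn0 (hsol k).cont).trans ?_)
    have h4 : ∀ k, ∫⁻ t, weightSq (uk k t) ≤ (ENNReal.ofReal C *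
        ((hsNorm (1 / 2) ((fk k : 𝓢'(E n, ℂ)) - f) + hsNorm (1 / 2) f) +
          (hsNorm (-1 / 2) ((gk k : 𝓢'(E n, ℂ)) - g) + hsNorm (-1 / 2) g))) ^ 2 := fun k => by
      refine (hC _ _ _ (hsol k)).trans ?_
      gcongr
      · exact hsNorm_le_add hn (Or.inl rfl) _ _
      · exact hsNorm_le_add hn (Or.inr rfl) _ _
    refine (liminf_le_liminf (Eventually.of_forall h4)).trans (le_of_eq (Tendsto.liminf_eq ?_))
    have h5 := (hf.add_const (hsNorm (1 / 2) f)).add (hg.add_const (hsNorm (-1 / 2) g))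
    rw [zero_add, zero_add] at h5
    exact ENNReal.Tendsto.pow (ENNReal.Tendsto.const_mul h5 (Or.inr ENNReal.ofReal_ne_top))
  have h6 := ENNReal.rpow_le_rpow h3 (z := 1 / 2) (by norm_num)
  rwa [← ENNReal.rpow_two, ← ENNReal.rpow_mul, mul_one_div_cancel two_ne_zero, ENNReal.rpow_one] at h6

end Wave

end CriticalDecay
theorem mainTheorem4 (n : ℕ) (hn : 3 ≤ n)
    (V : CriticalDecay.E n → ℝ) (hV : ContDiffOn ℝ 1 V {0}ᶜ)
    (hA1 : CriticalDecay.CriticalBound V)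
    (δ : ℝ) (hδ : 0 < δ)
    (hA2 : CriticalDecay.PositiveOnSpheres V δ)
    (hA3 : CriticalDecay.PositiveOnSpheres (CriticalDecay.tildeV V) δ) :
    (∀ (f : CriticalDecay.L2 n) (u : ℝ → CriticalDecay.L2 n),
      CriticalDecay.IsSchrodingerSolution V f u →
        CriticalDecay.weightedNorm (fun t => (u t : CriticalDecay.E n → ℂ)) ≤
          ENNReal.ofReal (CriticalDecay.smoothingConst δ) * ‖f‖ₑ) ∧
    ∃ C : ℝ, 0 < C ∧
      ∀ (f g : 𝓢'(CriticalDecay.E n, ℂ)) (u : ℝ → CriticalDecay.E n → ℂ),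
        CriticalDecay.hsNorm (1 / 2) f < ⊤ → CriticalDecay.hsNorm (-1 / 2) g < ⊤ →
        CriticalDecay.IsWaveSolution V f g u →
          CriticalDecay.weightedNorm u ≤
            ENNReal.ofReal C *
              (CriticalDecay.hsNorm (1 / 2) f + CriticalDecay.hsNorm (-1 / 2) g) := by
  exact ⟨fun f u hu => hu.weightedNorm_le hn hV hA1 hδ hA2 hA3,
    CriticalDecay.exists_wave_weightedNorm_le hn hV hA1 hδ hA2 hA3⟩
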